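/- \textbf{Conventions.} Let $K$ be a field of characteristic $0$ and $c,d\in\mathbb Z$. Properads are $\mathbb Z$-graded over $K$, differentials have degree $+1$, Koszul signs are used, and $P(m,n)$ denotes the operations with $m$ outputs and $n$ inputs. For a properad $P$ and $k\in\mathbb Z$ consider families $\eta=(\eta_{m,n})_{m,n\ge 0}$ with $\eta_{m,n}\in P(m,n)$ of degree $k+c(1-m)+d(1-n)$ and $(\sigma,\tau)\cdot\eta_{m,n}=\mathrm{sgn}(\sigma)^c\,\mathrm{sgn}(\tau)^d\,\eta_{m,n}$ for $(\sigma,\tau)\in S_m\times S_n$. For such families $\eta,\xi$ of degrees $k,l$ let $\eta\star\xi$ be the family of degree $k+l$ with $$(\eta\star\xi)_{m,n}=\sum_{m_1+m_2=m,\ n_1+n_2=n}\frac{(-1)^{(|\eta_{m_1,n_1+1}|+k)\,|\xi_{1+m_2,n_2}|+cd\,n_1m_2}}{m_1!\,m_2!\,n_1!\,n_2!}\sum_{\sigma\in S_m,\ \tau\in S_n}\mathrm{sgn}(\sigma)^c\,\mathrm{sgn}(\tau)^d\,(\sigma,\tau)\cdot\big(\eta_{m_1,n_1+1}\circ\xi_{1+m_2,n_2}\big),$$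 where $\circ$ glues the last input of the upper operation $\eta_{m_1,n_1+1}$ to the first output of the lower operation $\xi_{1+m_2,n_2}$ (a sum over graphs with two vertices and exactly one internal edge). $\mathcal{H}olieb_{c,d}$ is the free properad on generators $e_{m,n}$, $m,n\ge1$, $m+n\ge3$, of degree $1+c(1-m)+d(1-n)$, with $(\sigma,\tau)\cdot e_{m,n}=\mathrm{sgn}(\sigma)^c\mathrm{sgn}(\tau)^d e_{m,n}$, with the differential that is the derivation given by $\delta e=-e\star e$. Let $P$ be a dg properad, with differential $\partial$, under $\mathcal{H}olieb_{c,d}$, i.e. with a morphism of dg properads $i:\mathcal{H}olieb_{c,d}\to P$. Put $\pi_{m,n}=i(e_{m,n})$, and $\pi_{m,n}=0$ for the other $(m,n)$. \textbf{The deformation complex.} $\mathrm{Def}=\mathrm{Def}(\mathcal{H}olieb_{c,d}\xrightarrow{i}P)$ is the space $\prod_{m,n\ge1}\big(P(m,n)\otimes\mathrm{sgn}_m^{\otimes|c|}\otimes\mathrm{sgn}_n^{\otimes|d|}\big)^{S_m\times S_n}[c(1-m)+d(1-n)]$ of all families $\gamma$ as above that vanish for $m=0$ or $n=0$ (the $(1,1)$-component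 is included), with $$[\eta,\xi]=(-1)^{kl}\xi\star\eta-\eta\star\xi,\qquad \delta\eta=\partial\eta-[\pi,\eta]=\partial\eta+\pi\star\eta-(-1)^k\eta\star\pi .$$ \textbf{The twisted properad.} $\mathrm{Tw}P$ is generated freely by $P$ and Maurer--Cartan (MC) generators $\bullet_m$, $m\ge1$, with $m$ outputs and no inputs, of degree $c(1-m)+d$, with $\sigma\cdot\bullet_m=\mathrm{sgn}(\sigma)^c\bullet_m$, and is completed with respect to the number of MC generators. $\mathrm{Der}(\mathrm{Tw}P)$ consists of the continuous derivations. For a family $\gamma$ in $P$ put $$\widehat\gamma=\sum_{k\ge0}\frac1{k!}\,\big(\cdots\big((\gamma\star\bullet)\star\bullet\big)\cdots\big)\star\bullet\qquad(k\text{ factors }\bullet),$$ a family in $\mathrm{Tw}P$ ($\gamma$ with MC generators attached, each by one output, to its inputs). For $h\in(\mathrm{Tw}P)(1,1)$ put $D_h(a)=\sum_{o}h\circ_o a-(-1)^{|h||a|}\sum_{b}a\circ_b h$, where $h$ is attached to every output $o$, respectively to every input $b$, of $a$. \textbf{Theorem.} (i) $\mathrm{Def}$ is a dg Lie algebra. There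 is a unique $\partial_\centerdot\in\mathrm{Der}(\mathrm{Tw}P)$ of degree $1$ with $\partial_\centerdot a=\partial a+D_\blacklozenge(a)$ for $a\in P$ and $\partial_\centerdot\bullet_m=D_\blacklozenge(\bullet_m)-\widehat\pi_{m,0}$, where $\blacklozenge=\widehat\pi_{1,1}$; and $\partial_\centerdot^2=0$. Hence $\mathrm{Tw}P$ is a dg properad, and $\mathrm{Der}(\mathrm{Tw}P)$ is a dg Lie algebra with the graded commutator and the differential $[\partial_\centerdot,\cdot\,]$. (ii) There is a morphism of dg Lie algebras $\Phi:\mathrm{Def}(\mathcal{H}olieb_{c,d}\xrightarrow{i}P)\to\mathrm{Der}(\mathrm{Tw}P)$, $\gamma\mapsto\Phi_\gamma$, where $\Phi_\gamma$ is given on the generators by $$\Phi_\gamma(\bullet_m)=D_\lozenge(\bullet_m)+\widehat\gamma_{m,0}\quad(m\ge1),\qquad \Phi_\gamma(a)=D_\lozenge(a)\quad(a\in P),\qquad \lozenge=-\widehat\gamma_{1,1}.$$ Here $\widehat\gamma_{m,0}$ is the sum over $k\ge1$, $m=m_0+\dots+m_k$, $m_0\ge1$, $m_1,\dots,m_k\geq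 0$, of $\frac1{k!}$ times $\gamma_{m_0,k}$ with all its $k$ inputs closed by MC generators, and $\lozenge=-\sum_{k\ge0}\frac1{k!}\gamma_{1,k+1}(\bullet_1,\dots,\bullet_1,-)$, with (skew)symmetrized legs. (iii) Consequently $H^\bullet(\mathrm{Def})$ acts on the properad $H^\bullet(\mathrm{Tw}P,\partial_\centerdot)$ by derivations: $[\gamma]\cdot[x]=[\Phi_\gamma(x)]$ is a well-defined morphism of graded Lie algebras $H^\bullet(\mathrm{Def})\to\mathrm{Der}(H^\bullet(\mathrm{Tw}P))$. -/

import Mathlib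

universe u v w

open scoped Nat

noncomputable section

namespace Twisting

/-- The sign `(-1)^n`, for an integer `n`, in the field `K`. -/
def ksign (K : Type v) [Field K] (n : ℤ) : K := ((n.negOnePow : ℤ) : K)

/-- The sign `(-1)^{c|σ|}` of a permutation in the representation `sgn^{⊗|c|}`. -/
def psign (K : Type v) [Field K] {m : ℕ} (c : ℤ) (σ : Equiv.Perm (Fin m)) : K :=
  (((Equiv.Perm.sign σ) ^ c : ℤˣ) : ℤ)

/-- The data of a properad over `K` with components graded by `Γ`, in the coordinate-free form in
which outputs and inputs are labelled by arbitrary finite sets: `obj A B i` are the operations of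
degree `i` with outputs labelled by `A` and inputs labelled by `B`, so that `P(m,n)` is
`obj (Fin m) (Fin n)`; `relabel` is the (left) action of bijections; `comp x y` glues the inputs
`E` of the upper operation `x` to the outputs `E` of the lower operation `y`, along a nonempty set
`E` of edges. -/
structure ProperadData (K : Type v) [Field K] (Γ : Type) [AddCommMonoid Γ] where
  obj : (A B : Type) → [Finite A] → [Finite B] → Γ → Type u
  [grp : ∀ (A B : Type) [Finite A] [Finite B] (i : Γ), AddCommGroup (obj A B i)]
  [mod : ∀ (A B : Type) [Finite A] [Finite B] (i : Γ), Module K (obj A B i)]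
  one : obj (Fin 1) (Fin 1) 0
  relabel : ∀ {A A' B B' : Type} [Finite A] [Finite A'] [Finite B] [Finite B'] {i : Γ},
    A ≃ A' → B ≃ B' → (obj A B i →ₗ[K] obj A' B' i)
  comp : ∀ {A B C D E : Type} [Finite A] [Finite B] [Finite C] [Finite D] [Finite E] [Nonempty E]
    {i j k : Γ}, i + j = k →
      (obj A (B ⊕ E) i →ₗ[K] obj (E ⊕ C) D j →ₗ[K] obj (A ⊕ C) (B ⊕ D) k)

attribute [instance] ProperadData.grp ProperadData.mod

/-- Exchange of the first two summands. -/
def exchL (X Y Z : Type) : X ⊕ (Y ⊕ Z) ≃ Y ⊕ (X ⊕ Z) :=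
  ((Equiv.sumAssoc X Y Z).symm.trans (Equiv.sumCongr (Equiv.sumComm X Y) (Equiv.refl Z))).trans
    (Equiv.sumAssoc Y X Z)

/-- Exchange of the last two summands. -/
def exchR (X Y Z : Type) : (X ⊕ Y) ⊕ Z ≃ (X ⊕ Z) ⊕ Y :=
  ((Equiv.sumAssoc X Y Z).trans (Equiv.sumCongr (Equiv.refl X) (Equiv.sumComm Y Z))).trans
    (Equiv.sumAssoc X Z Y).symm

/-- The laws of a properad, with the Koszul sign rule for the parity `par`: functoriality and
equivariance, units, associativity for three vertices in which the middle one is attached to the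
upper one (`assoc`), and the exchange of two lower vertices (`assoc_below`) or two upper vertices
(`assoc_above`). -/
structure ProperadData.IsProperad {K : Type v} [Field K] {Γ : Type} [AddCommMonoid Γ]
    (par : Γ →+ ℤ) (Q : ProperadData.{u} K Γ) : Prop where
  relabel_refl : ∀ {A B : Type} [Finite A] [Finite B] {i : Γ} (x : Q.obj A B i),
    Q.relabel (Equiv.refl A) (Equiv.refl B) x = x
  relabel_trans : ∀ {A A' A'' B B' B'' : Type} [Finite A] [Finite A'] [Finite A'']
    [Finite B] [Finite B'] [Finite B''] {i : Γ} (e : A ≃ A') (e' : A' ≃ A'')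
    (f : B ≃ B') (f' : B' ≃ B'') (x : Q.obj A B i),
    Q.relabel (e.trans e') (f.trans f') x = Q.relabel e' f' (Q.relabel e f x)
  comp_relabel : ∀ {A A' B B' C C' D D' E E' : Type} [Finite A] [Finite A'] [Finite B]
    [Finite B'] [Finite C] [Finite C'] [Finite D] [Finite D'] [Finite E] [Finite E']
    [Nonempty E] [Nonempty E'] {i j k : Γ} (h : i + j = k) (a : A ≃ A') (b : B ≃ B')
    (c : C ≃ C') (d : D ≃ D') (e : E ≃ E') (x : Q.obj A (B ⊕ E) i) (y : Q.obj (E ⊕ C) D j),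
    Q.comp h (Q.relabel a (Equiv.sumCongr b e) x) (Q.relabel (Equiv.sumCongr e c) d y)
      = Q.relabel (Equiv.sumCongr a c) (Equiv.sumCongr b d) (Q.comp h x y)
  one_comp : ∀ {C D : Type} [Finite C] [Finite D] {i : Γ} (y : Q.obj (Fin 1 ⊕ C) D i),
    Q.comp (zero_add i) (Q.relabel (Equiv.refl (Fin 1)) (Equiv.emptySum Empty (Fin 1)).symm Q.one) y
      = Q.relabel (Equiv.refl (Fin 1 ⊕ C)) (Equiv.emptySum Empty D).symm y
  comp_one : ∀ {A B : Type} [Finite A] [Finite B] {i : Γ} (x : Q.obj A (B ⊕ Fin 1) i),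
    Q.comp (add_zero i) x (Q.relabel (Equiv.sumEmpty (Fin 1) Empty).symm (Equiv.refl (Fin 1)) Q.one)
      = Q.relabel (Equiv.sumEmpty A Empty).symm (Equiv.refl (B ⊕ Fin 1)) x
  assoc : ∀ {A B C D E₁ E₂ E₃ F G : Type} [Finite A] [Finite B] [Finite C] [Finite D]
    [Finite E₁] [Finite E₂] [Finite E₃] [Finite F] [Finite G] [Nonempty E₁] [Nonempty E₂]
    {i j k ij jk l : Γ} (h₁ : i + j = ij) (h₂ : ij + k = l) (h₃ : j + k = jk) (h₄ : i + jk = l)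
    (x : Q.obj A ((B ⊕ E₃) ⊕ E₁) i) (y : Q.obj (E₁ ⊕ C) (D ⊕ E₂) j)
    (z : Q.obj ((E₃ ⊕ E₂) ⊕ F) G k),
    Q.relabel (Equiv.sumAssoc A C F) (Equiv.sumAssoc B D G)
        (Q.comp h₂ (Q.relabel (Equiv.refl (A ⊕ C)) (Equiv.sumSumSumComm B E₃ D E₂)
          (Q.comp h₁ x y)) z)
      = Q.comp h₄ (Q.relabel (Equiv.refl A) ((exchR B E₃ E₁).trans (Equiv.sumAssoc B E₁ E₃)) x)
          (Q.relabel (Equiv.sumSumSumComm E₁ C E₃ F) (Equiv.refl (D ⊕ G))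
            (Q.comp h₃ y
              (Q.relabel ((Equiv.sumAssoc E₃ E₂ F).trans (exchL E₃ E₂ F)) (Equiv.refl G) z)))
  assoc_below : ∀ {A B C D E₁ E₂ F G : Type} [Finite A] [Finite B] [Finite C] [Finite D]
    [Finite E₁] [Finite E₂] [Finite F] [Finite G] [Nonempty E₁] [Nonempty E₂]
    {i j k ij ik l : Γ} (h₁ : i + k = ik) (h₂ : ik + j = l) (h₃ : i + j = ij) (h₄ : ij + k = l)
    (x : Q.obj A ((B ⊕ E₁) ⊕ E₂) i) (y : Q.obj (E₁ ⊕ C) D j) (z : Q.obj (E₂ ⊕ F) G k),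
    Q.comp h₂ (Q.relabel (Equiv.refl (A ⊕ F)) (exchR B E₁ G) (Q.comp h₁ x z)) y
      = ksign K (par j * par k) • Q.relabel (exchR A C F) (exchR B D G)
          (Q.comp h₄ (Q.relabel (Equiv.refl (A ⊕ C)) (exchR B E₂ D)
            (Q.comp h₃ (Q.relabel (Equiv.refl A) (exchR B E₁ E₂) x) y)) z)
  assoc_above : ∀ {A A' B B' C D E₁ E₂ : Type} [Finite A] [Finite A'] [Finite B] [Finite B']
    [Finite C] [Finite D] [Finite E₁] [Finite E₂] [Nonempty E₁] [Nonempty E₂]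
    {i j k ik jk l : Γ} (h₁ : i + k = ik) (h₂ : j + ik = l) (h₃ : j + k = jk) (h₄ : i + jk = l)
    (x : Q.obj A (B ⊕ E₁) i) (y : Q.obj A' (B' ⊕ E₂) j) (z : Q.obj (E₁ ⊕ (E₂ ⊕ C)) D k),
    Q.comp h₂ y (Q.relabel (exchL A E₂ C) (Equiv.refl (B ⊕ D)) (Q.comp h₁ x z))
      = ksign K (par i * par j) • Q.relabel (exchL A A' C) (exchL B B' D)
          (Q.comp h₄ x (Q.relabel (exchL A' E₁ C) (Equiv.refl (B' ⊕ D))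
            (Q.comp h₃ y (Q.relabel (exchL E₁ E₂ C) (Equiv.refl D) z))))


section Presentation

variable (K : Type v) [Field K] {Γ : Type} [AddCommMonoid Γ] (G : (A B : Type) → Γ → Type w)

/-- Formal expressions in generators `G` and the operations of a properad. -/
inductive Term : (A B : Type) → Γ → Type (max 1 v w)
  | gen {A B : Type} [Finite A] [Finite B] {i : Γ} (g : G A B i) : Term A B i
  | one : Term (Fin 1) (Fin 1) 0
  | relabel {A A' B B' : Type} [Finite A] [Finite A'] [Finite B] [Finite B'] {i : Γ}
      (e : A ≃ A') (f : B ≃ B') (x : Term A B i) : Term A' B' i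
  | comp {A B C D E : Type} [Finite A] [Finite B] [Finite C] [Finite D] [Finite E] [Nonempty E]
      {i j k : Γ} (h : i + j = k) (x : Term A (B ⊕ E) i) (y : Term (E ⊕ C) D j) :
      Term (A ⊕ C) (B ⊕ D) k
  | zero (A B : Type) [Finite A] [Finite B] (i : Γ) : Term A B i
  | add {A B : Type} [Finite A] [Finite B] {i : Γ} (x y : Term A B i) : Term A B i
  | smul {A B : Type} [Finite A] [Finite B] {i : Γ} (a : K) (x : Term A B i) : Term A B i

variable {K G}

/-- The smallest congruence that contains `R` and makes the formal expressions a properad. -/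
inductive Rel (par : Γ →+ ℤ) (R : ∀ (A B : Type) (i : Γ), Term K G A B i → Term K G A B i → Prop) :
    ∀ {A B : Type} {i : Γ}, Term K G A B i → Term K G A B i → Prop
  | of {A B : Type} {i : Γ} {x y : Term K G A B i} (h : R A B i x y) : Rel par R x y
  | refl {A B : Type} {i : Γ} (x : Term K G A B i) : Rel par R x x
  | symm {A B : Type} {i : Γ} {x y : Term K G A B i} : Rel par R x y → Rel par R y x
  | trans {A B : Type} {i : Γ} {x y z : Term K G A B i} :
      Rel par R x y → Rel par R y z → Rel par R x z
  | relabel_congr {A A' B B' : Type} [Finite A] [Finite A'] [Finite B] [Finite B'] {i : Γ}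
      (e : A ≃ A') (f : B ≃ B') {x x' : Term K G A B i} :
      Rel par R x x' → Rel par R (.relabel e f x) (.relabel e f x')
  | comp_congr {A B C D E : Type} [Finite A] [Finite B] [Finite C] [Finite D] [Finite E]
      [Nonempty E] {i j k : Γ} (h : i + j = k) {x x' : Term K G A (B ⊕ E) i}
      {y y' : Term K G (E ⊕ C) D j} :
      Rel par R x x' → Rel par R y y' → Rel par R (.comp h x y) (.comp h x' y')
  | add_congr {A B : Type} [Finite A] [Finite B] {i : Γ} {x x' y y' : Term K G A B i} :
      Rel par R x x' → Rel par R y y' → Rel par R (.add x y) (.add x' y')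
  | smul_congr {A B : Type} [Finite A] [Finite B] {i : Γ} (a : K) {x x' : Term K G A B i} :
      Rel par R x x' → Rel par R (.smul a x) (.smul a x')
  | add_comm {A B : Type} [Finite A] [Finite B] {i : Γ} (x y : Term K G A B i) :
      Rel par R (.add x y) (.add y x)
  | add_assoc {A B : Type} [Finite A] [Finite B] {i : Γ} (x y z : Term K G A B i) :
      Rel par R (.add (.add x y) z) (.add x (.add y z))
  | zero_add {A B : Type} [Finite A] [Finite B] {i : Γ} (x : Term K G A B i) :
      Rel par R (.add (.zero A B i) x) x
  | neg_add {A B : Type} [Finite A] [Finite B] {i : Γ} (x : Term K G A B i) :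
      Rel par R (.add (.smul (-1) x) x) (.zero A B i)
  | one_smul {A B : Type} [Finite A] [Finite B] {i : Γ} (x : Term K G A B i) :
      Rel par R (.smul 1 x) x
  | mul_smul {A B : Type} [Finite A] [Finite B] {i : Γ} (a b : K) (x : Term K G A B i) :
      Rel par R (.smul (a * b) x) (.smul a (.smul b x))
  | add_smul {A B : Type} [Finite A] [Finite B] {i : Γ} (a b : K) (x : Term K G A B i) :
      Rel par R (.smul (a + b) x) (.add (.smul a x) (.smul b x))
  | smul_add {A B : Type} [Finite A] [Finite B] {i : Γ} (a : K) (x y : Term K G A B i) :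
      Rel par R (.smul a (.add x y)) (.add (.smul a x) (.smul a y))
  | relabel_add {A A' B B' : Type} [Finite A] [Finite A'] [Finite B] [Finite B'] {i : Γ}
      (e : A ≃ A') (f : B ≃ B') (x y : Term K G A B i) :
      Rel par R (.relabel e f (.add x y)) (.add (.relabel e f x) (.relabel e f y))
  | relabel_smul {A A' B B' : Type} [Finite A] [Finite A'] [Finite B] [Finite B'] {i : Γ}
      (e : A ≃ A') (f : B ≃ B') (a : K) (x : Term K G A B i) :
      Rel par R (.relabel e f (.smul a x)) (.smul a (.relabel e f x))
  | comp_add_left {A B C D E : Type} [Finite A] [Finite B] [Finite C] [Finite D] [Finite E]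
      [Nonempty E] {i j k : Γ} (h : i + j = k) (x x' : Term K G A (B ⊕ E) i)
      (y : Term K G (E ⊕ C) D j) :
      Rel par R (.comp h (.add x x') y) (.add (.comp h x y) (.comp h x' y))
  | comp_add_right {A B C D E : Type} [Finite A] [Finite B] [Finite C] [Finite D] [Finite E]
      [Nonempty E] {i j k : Γ} (h : i + j = k) (x : Term K G A (B ⊕ E) i)
      (y y' : Term K G (E ⊕ C) D j) :
      Rel par R (.comp h x (.add y y')) (.add (.comp h x y) (.comp h x y'))
  | comp_smul_left {A B C D E : Type} [Finite A] [Finite B] [Finite C] [Finite D] [Finite E]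
      [Nonempty E] {i j k : Γ} (h : i + j = k) (a : K) (x : Term K G A (B ⊕ E) i)
      (y : Term K G (E ⊕ C) D j) :
      Rel par R (.comp h (.smul a x) y) (.smul a (.comp h x y))
  | comp_smul_right {A B C D E : Type} [Finite A] [Finite B] [Finite C] [Finite D] [Finite E]
      [Nonempty E] {i j k : Γ} (h : i + j = k) (a : K) (x : Term K G A (B ⊕ E) i)
      (y : Term K G (E ⊕ C) D j) :
      Rel par R (.comp h x (.smul a y)) (.smul a (.comp h x y))
  | relabel_refl {A B : Type} [Finite A] [Finite B] {i : Γ} (x : Term K G A B i) :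
      Rel par R (.relabel (Equiv.refl A) (Equiv.refl B) x) x
  | relabel_trans {A A' A'' B B' B'' : Type} [Finite A] [Finite A'] [Finite A'']
      [Finite B] [Finite B'] [Finite B''] {i : Γ} (e : A ≃ A') (e' : A' ≃ A'')
      (f : B ≃ B') (f' : B' ≃ B'') (x : Term K G A B i) :
      Rel par R (.relabel (e.trans e') (f.trans f') x) (.relabel e' f' (.relabel e f x))
  | comp_relabel {A A' B B' C C' D D' E E' : Type} [Finite A] [Finite A'] [Finite B]
      [Finite B'] [Finite C] [Finite C'] [Finite D] [Finite D'] [Finite E] [Finite E']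
      [Nonempty E] [Nonempty E'] {i j k : Γ} (h : i + j = k) (a : A ≃ A') (b : B ≃ B')
      (c : C ≃ C') (d : D ≃ D') (e : E ≃ E') (x : Term K G A (B ⊕ E) i)
      (y : Term K G (E ⊕ C) D j) :
      Rel par R
        (.comp h (.relabel a (Equiv.sumCongr b e) x) (.relabel (Equiv.sumCongr e c) d y))
        (.relabel (Equiv.sumCongr a c) (Equiv.sumCongr b d) (.comp h x y))
  | one_comp {C D : Type} [Finite C] [Finite D] {i : Γ} (y : Term K G (Fin 1 ⊕ C) D i) :
      Rel par R
        (.comp (_root_.zero_add i)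
          (.relabel (Equiv.refl (Fin 1)) (Equiv.emptySum Empty (Fin 1)).symm .one) y)
        (.relabel (Equiv.refl (Fin 1 ⊕ C)) (Equiv.emptySum Empty D).symm y)
  | comp_one {A B : Type} [Finite A] [Finite B] {i : Γ} (x : Term K G A (B ⊕ Fin 1) i) :
      Rel par R
        (.comp (add_zero i) x
          (.relabel (Equiv.sumEmpty (Fin 1) Empty).symm (Equiv.refl (Fin 1)) .one))
        (.relabel (Equiv.sumEmpty A Empty).symm (Equiv.refl (B ⊕ Fin 1)) x)
  | assoc {A B C D E₁ E₂ E₃ F H : Type} [Finite A] [Finite B] [Finite C] [Finite D]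
      [Finite E₁] [Finite E₂] [Finite E₃] [Finite F] [Finite H] [Nonempty E₁] [Nonempty E₂]
      {i j k ij jk l : Γ} (h₁ : i + j = ij) (h₂ : ij + k = l) (h₃ : j + k = jk) (h₄ : i + jk = l)
      (x : Term K G A ((B ⊕ E₃) ⊕ E₁) i) (y : Term K G (E₁ ⊕ C) (D ⊕ E₂) j)
      (z : Term K G ((E₃ ⊕ E₂) ⊕ F) H k) :
      Rel par R
        (.relabel (Equiv.sumAssoc A C F) (Equiv.sumAssoc B D H)
          (.comp h₂ (.relabel (Equiv.refl (A ⊕ C)) (Equiv.sumSumSumComm B E₃ D E₂)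
            (.comp h₁ x y)) z))
        (.comp h₄ (.relabel (Equiv.refl A) ((exchR B E₃ E₁).trans (Equiv.sumAssoc B E₁ E₃)) x)
          (.relabel (Equiv.sumSumSumComm E₁ C E₃ F) (Equiv.refl (D ⊕ H))
            (.comp h₃ y
              (.relabel ((Equiv.sumAssoc E₃ E₂ F).trans (exchL E₃ E₂ F)) (Equiv.refl H) z))))
  | assoc_below {A B C D E₁ E₂ F H : Type} [Finite A] [Finite B] [Finite C] [Finite D]
      [Finite E₁] [Finite E₂] [Finite F] [Finite H] [Nonempty E₁] [Nonempty E₂]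
      {i j k ij ik l : Γ} (h₁ : i + k = ik) (h₂ : ik + j = l) (h₃ : i + j = ij) (h₄ : ij + k = l)
      (x : Term K G A ((B ⊕ E₁) ⊕ E₂) i) (y : Term K G (E₁ ⊕ C) D j)
      (z : Term K G (E₂ ⊕ F) H k) :
      Rel par R
        (.comp h₂ (.relabel (Equiv.refl (A ⊕ F)) (exchR B E₁ H) (.comp h₁ x z)) y)
        (.smul (ksign K (par j * par k)) (.relabel (exchR A C F) (exchR B D H)
          (.comp h₄ (.relabel (Equiv.refl (A ⊕ C)) (exchR B E₂ D)
            (.comp h₃ (.relabel (Equiv.refl A) (exchR B E₁ E₂) x) y)) z)))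
  | assoc_above {A A' B B' C D E₁ E₂ : Type} [Finite A] [Finite A'] [Finite B] [Finite B']
      [Finite C] [Finite D] [Finite E₁] [Finite E₂] [Nonempty E₁] [Nonempty E₂]
      {i j k ik jk l : Γ} (h₁ : i + k = ik) (h₂ : j + ik = l) (h₃ : j + k = jk) (h₄ : i + jk = l)
      (x : Term K G A (B ⊕ E₁) i) (y : Term K G A' (B' ⊕ E₂) j)
      (z : Term K G (E₁ ⊕ (E₂ ⊕ C)) D k) :
      Rel par R
        (.comp h₂ y (.relabel (exchL A E₂ C) (Equiv.refl (B ⊕ D)) (.comp h₁ x z)))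
        (.smul (ksign K (par i * par j)) (.relabel (exchL A A' C) (exchL B B' D)
          (.comp h₄ x (.relabel (exchL A' E₁ C) (Equiv.refl (B' ⊕ D))
            (.comp h₃ y (.relabel (exchL E₁ E₂ C) (Equiv.refl D) z))))))

variable (par : Γ →+ ℤ) (R : ∀ (A B : Type) (i : Γ), Term K G A B i → Term K G A B i → Prop)

def Rel.setoid (A B : Type) (i : Γ) : Setoid (Term K G A B i) where
  r := Rel par R
  iseqv := ⟨Rel.refl, Rel.symm, Rel.trans⟩

def Presented.Obj (A B : Type) (i : Γ) : Type (max 1 v w) := Quotient (Rel.setoid par R A B i)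

variable {par R}

def Presented.mk {A B : Type} {i : Γ} (x : Term K G A B i) : Presented.Obj par R A B i :=
  Quotient.mk (Rel.setoid par R A B i) x

theorem Presented.ind {A B : Type} {i : Γ} {p : Presented.Obj par R A B i → Prop}
    (h : ∀ x, p (Presented.mk x)) (x : Presented.Obj par R A B i) : p x :=
  Quotient.ind h x

theorem Presented.sound {A B : Type} {i : Γ} {x y : Term K G A B i} (h : Rel par R x y) :
    (Presented.mk x : Presented.Obj par R A B i) = Presented.mk y :=
  Quotient.sound (s := Rel.setoid par R A B i) h

instance Presented.zeroInst (A B : Type) [Finite A] [Finite B] (i : Γ) :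
    Zero (Presented.Obj par R A B i) := ⟨Presented.mk (.zero A B i)⟩

instance Presented.addInst (A B : Type) [Finite A] [Finite B] (i : Γ) :
    Add (Presented.Obj par R A B i) :=
  ⟨Quotient.map₂ Term.add fun _ _ h _ _ h' => Rel.add_congr h h'⟩

instance Presented.negInst (A B : Type) [Finite A] [Finite B] (i : Γ) :
    Neg (Presented.Obj par R A B i) :=
  ⟨Quotient.map (Term.smul (-1)) fun _ _ h => Rel.smul_congr (-1) h⟩

instance Presented.addCommGroup (A B : Type) [Finite A] [Finite B] (i : Γ) :
    AddCommGroup (Presented.Obj par R A B i) where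
  nsmul := nsmulRec
  zsmul := zsmulRec
  add_assoc x y z := by
    induction x using Presented.ind; induction y using Presented.ind
    induction z using Presented.ind
    exact Presented.sound (Rel.add_assoc _ _ _)
  add_comm x y := by
    induction x using Presented.ind; induction y using Presented.ind
    exact Presented.sound (Rel.add_comm _ _)
  zero_add x := by
    induction x using Presented.ind
    exact Presented.sound (Rel.zero_add _)
  add_zero x := by
    induction x using Presented.ind
    exact Presented.sound (Rel.trans (Rel.add_comm _ _) (Rel.zero_add _))
  neg_add_cancel x := by
    induction x using Presented.ind
    exact Presented.sound (Rel.neg_add _)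

theorem Presented.mk_add {A B : Type} [Finite A] [Finite B] {i : Γ} (x y : Term K G A B i) :
    (Presented.mk (.add x y) : Presented.Obj par R A B i) = Presented.mk x + Presented.mk y := rfl

instance Presented.smulInst (A B : Type) [Finite A] [Finite B] (i : Γ) :
    SMul K (Presented.Obj par R A B i) where
  smul a := Quotient.map (Term.smul a) fun _ _ h => Rel.smul_congr a h

theorem Presented.mk_smul {A B : Type} [Finite A] [Finite B] {i : Γ} (a : K) (x : Term K G A B i) :
    (Presented.mk (.smul a x) : Presented.Obj par R A B i) = a • Presented.mk x := rfl

instance Presented.moduleInst (A B : Type) [Finite A] [Finite B] (i : Γ) :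
    Module K (Presented.Obj par R A B i) :=
  Module.ofMinimalAxioms
    (fun a x y => by
      induction x using Presented.ind; induction y using Presented.ind
      exact Presented.sound (Rel.smul_add _ _ _))
    (fun a b x => by
      induction x using Presented.ind
      exact Presented.sound (Rel.add_smul _ _ _))
    (fun a b x => by
      induction x using Presented.ind
      exact Presented.sound (Rel.mul_smul _ _ _))
    (fun x => by
      induction x using Presented.ind
      exact Presented.sound (Rel.one_smul _))

variable (par R)

/-- The properad presented by the generators `G` and the relations `R`. -/
def Presented : ProperadData.{max 1 v w} K Γ where
  obj A B _ _ i := Presented.Obj par R A B i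
  grp A B _ _ i := Presented.addCommGroup A B i
  mod A B _ _ i := Presented.moduleInst A B i
  one := Presented.mk .one
  relabel e f :=
    { toFun := Quotient.map (Term.relabel e f) fun _ _ h => Rel.relabel_congr e f h
      map_add' := fun x y => by
        induction x using Presented.ind; induction y using Presented.ind
        exact Presented.sound (Rel.relabel_add _ _ _ _)
      map_smul' := fun a x => by
        induction x using Presented.ind
        exact Presented.sound (Rel.relabel_smul _ _ _ _) }
  comp h := LinearMap.mk₂ K
    (Quotient.map₂ (Term.comp h) fun _ _ hx _ _ hy => Rel.comp_congr h hx hy)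
    (fun x x' y => by
      induction x using Presented.ind; induction x' using Presented.ind
      induction y using Presented.ind
      exact Presented.sound (Rel.comp_add_left _ _ _ _))
    (fun a x y => by
      induction x using Presented.ind; induction y using Presented.ind
      exact Presented.sound (Rel.comp_smul_left _ _ _ _))
    (fun x y y' => by
      induction x using Presented.ind; induction y' using Presented.ind
      induction y using Presented.ind
      exact Presented.sound (Rel.comp_add_right _ _ _ _))
    (fun a x y => by
      induction x using Presented.ind; induction y using Presented.ind
      exact Presented.sound (Rel.comp_smul_right _ _ _ _))

/-- The element given by a generator. -/
def Presented.gen {A B : Type} [Finite A] [Finite B] {i : Γ} (g : G A B i) :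
    (Presented par R).obj A B i := Presented.mk (.gen g)

theorem Presented.isProperad : (Presented par R).IsProperad par where
  relabel_refl x := by
    induction x using Presented.ind
    exact Presented.sound (Rel.relabel_refl _)
  relabel_trans _ _ _ _ x := by
    induction x using Presented.ind
    exact Presented.sound (Rel.relabel_trans _ _ _ _ _)
  comp_relabel h a b c d e x y := by
    induction x using Presented.ind; induction y using Presented.ind
    exact Presented.sound (Rel.comp_relabel h a b c d e _ _)
  one_comp y := by
    induction y using Presented.ind
    exact Presented.sound (Rel.one_comp _)
  comp_one y := by
    induction y using Presented.ind
    exact Presented.sound (Rel.comp_one _)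
  assoc h₁ h₂ h₃ h₄ x y z := by
    induction x using Presented.ind; induction y using Presented.ind
    induction z using Presented.ind
    exact Presented.sound (Rel.assoc h₁ h₂ h₃ h₄ _ _ _)
  assoc_below h₁ h₂ h₃ h₄ x y z := by
    induction x using Presented.ind; induction y using Presented.ind
    induction z using Presented.ind
    exact Presented.sound (Rel.assoc_below h₁ h₂ h₃ h₄ _ _ _)
  assoc_above h₁ h₂ h₃ h₄ x y z := by
    induction x using Presented.ind; induction y using Presented.ind
    induction z using Presented.ind
    exact Presented.sound (Rel.assoc_above h₁ h₂ h₃ h₄ _ _ _)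

end Presentation

section Completion

variable {K : Type v} [Field K]

/-- The ways of writing a natural number as an ordered sum of two natural numbers. -/
structure Split (N : ℕ) where
  fst : ℕ
  snd : ℕ
  add : fst + snd = N

instance (N : ℕ) : Fintype (Split N) :=
  Fintype.ofEquiv (Finset.HasAntidiagonal.antidiagonal N)
    { toFun := fun p => ⟨p.1.1, p.1.2, Finset.HasAntidiagonal.mem_antidiagonal.1 p.2⟩
      invFun := fun p => ⟨(p.fst, p.snd), Finset.HasAntidiagonal.mem_antidiagonal.2 p.add⟩
      left_inv := fun _ => rfl
      right_inv := fun _ => rfl }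

theorem split_index {i j k : ℤ} (h : i + j = k) {N : ℕ} (p : Split N) :
    ((i, p.fst) : ℤ × ℕ) + (j, p.snd) = (k, N) := by
  rw [Prod.mk_add_mk, h, p.add]

/-- The completion of a properad with an additional grading by a weight in `ℕ` with respect to the
weight: its elements are the formal sums `∑ x N` of elements `x N` of weight `N`. -/
def ProperadData.completion (W : ProperadData.{u} K (ℤ × ℕ)) : ProperadData.{u} K ℤ where
  obj A B _ _ i := ∀ N : ℕ, W.obj A B (i, N)
  grp A B _ _ i := Pi.addCommGroup
  mod A B _ _ i := Pi.module _ _ _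
  one := Pi.single 0 W.one
  relabel e f := LinearMap.pi fun N => (W.relabel e f).comp (LinearMap.proj N)
  comp h := LinearMap.mk₂ K
    (fun x y N => ∑ p : Split N, W.comp (split_index h p) (x p.fst) (y p.snd))
    (fun x x' y => by
      funext N
      simp [Finset.sum_add_distrib])
    (fun a x y => by
      funext N
      simp [Finset.smul_sum])
    (fun x y y' => by
      funext N
      simp [Finset.sum_add_distrib])
    (fun a x y => by
      funext N
      simp [Finset.smul_sum])

theorem ProperadData.completion_comp (W : ProperadData.{u} K (ℤ × ℕ)) {A B C D E : Type} [Finite A]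
    [Finite B] [Finite C] [Finite D] [Finite E] [Nonempty E] {i j k : ℤ} (h : i + j = k)
    (x : W.completion.obj A (B ⊕ E) i) (y : W.completion.obj (E ⊕ C) D j) (N : ℕ) :
    W.completion.comp h x y N =
      ∑ p : Split N, W.comp (split_index h p) (x p.fst) (y p.snd) := rfl

theorem ProperadData.completion_relabel (W : ProperadData.{u} K (ℤ × ℕ)) {A A' B B' : Type}
    [Finite A] [Finite A'] [Finite B] [Finite B'] {i : ℤ} (e : A ≃ A') (f : B ≃ B')
    (x : W.completion.obj A B i) (N : ℕ) :
    W.completion.relabel e f x N = W.relabel e f (x N) := rfl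

theorem ProperadData.completion_smul (W : ProperadData.{u} K (ℤ × ℕ)) {A B : Type}
    [Finite A] [Finite B] {i : ℤ} (a : K) (x : W.completion.obj A B i) (N : ℕ) :
    (a • x) N = a • (x N : W.obj A B (i, N)) := rfl

theorem sum_assoc {M : Type*} [AddCommMonoid M] (N : ℕ)
    (F : ∀ s p q r t : ℕ, s + r = N → p + q = s → p + t = N → q + r = t → M) :
    (∑ a : Split N, ∑ b : Split a.fst,
        F a.fst b.fst b.snd a.snd (b.snd + a.snd) (a.add)
          (b.add)
          (by have := a.add
              have := b.add
              omega) rfl)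
      = ∑ a : Split N, ∑ b : Split a.snd,
        F (a.fst + b.fst) a.fst b.fst b.snd a.snd
          (by have := a.add
              have := b.add
              omega) rfl (a.add) (b.add) := by
  rw [← Fintype.sum_sigma', ← Fintype.sum_sigma']
  refine Finset.sum_bij'
    (fun a _ => ⟨⟨a.2.fst, a.2.snd + a.1.snd, ?_⟩, ⟨a.2.snd, a.1.snd, rfl⟩⟩)
    (fun a _ => ⟨⟨a.1.fst + a.2.fst, a.2.snd, ?_⟩, ⟨a.1.fst, a.2.fst, rfl⟩⟩)
    (fun _ _ => Finset.mem_univ _) (fun _ _ => Finset.mem_univ _) ?_ ?_ ?_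
  · have h1 := a.1.add
    have h2 := a.2.add
    omega
  · have h1 := a.1.add
    have h2 := a.2.add
    omega
  all_goals
    rintro ⟨⟨s, r, h⟩, ⟨p, q, h'⟩⟩ -
    cases h'
    rfl

theorem sum_swap_below {M : Type*} [AddCommMonoid M] (N : ℕ)
    (F : ∀ p q r s t : ℕ, p + r = s → s + q = N → p + q = t → t + r = N → M) :
    (∑ a : Split N, ∑ b : Split a.fst,
        F b.fst a.snd b.snd a.fst (b.fst + a.snd) (b.add)
          (a.add) rfl
          (by have := a.add
              have := b.add
              omega))
      = ∑ a : Split N, ∑ b : Split a.fst,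
        F b.fst b.snd a.snd (b.fst + a.snd) a.fst rfl
          (by have := a.add
              have := b.add
              omega) (b.add) (a.add) := by
  rw [← Fintype.sum_sigma', ← Fintype.sum_sigma']
  refine Finset.sum_bij'
    (fun a _ => ⟨⟨a.2.fst + a.1.snd, a.2.snd, ?_⟩, ⟨a.2.fst, a.1.snd, rfl⟩⟩)
    (fun a _ => ⟨⟨a.2.fst + a.1.snd, a.2.snd, ?_⟩, ⟨a.2.fst, a.1.snd, rfl⟩⟩)
    (fun _ _ => Finset.mem_univ _) (fun _ _ => Finset.mem_univ _) ?_ ?_ ?_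
  · have h1 := a.1.add
    have h2 := a.2.add
    omega
  · have h1 := a.1.add
    have h2 := a.2.add
    omega
  all_goals
    rintro ⟨⟨s, r, h⟩, ⟨p, q, h'⟩⟩ -
    cases h'
    rfl

theorem sum_swap_above {M : Type*} [AddCommMonoid M] (N : ℕ)
    (F : ∀ p q r s t : ℕ, p + r = s → q + s = N → q + r = t → p + t = N → M) :
    (∑ a : Split N, ∑ b : Split a.snd,
        F b.fst a.fst b.snd a.snd (a.fst + b.snd) (b.add)
          (a.add) rfl
          (by have := a.add
              have := b.add
              omega))
      = ∑ a : Split N, ∑ b : Split a.snd,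
        F a.fst b.fst b.snd (a.fst + b.snd) a.snd rfl
          (by have := a.add
              have := b.add
              omega) (b.add) (a.add) := by
  rw [← Fintype.sum_sigma', ← Fintype.sum_sigma']
  refine Finset.sum_bij'
    (fun a _ => ⟨⟨a.2.fst, a.1.fst + a.2.snd, ?_⟩, ⟨a.1.fst, a.2.snd, rfl⟩⟩)
    (fun a _ => ⟨⟨a.2.fst, a.1.fst + a.2.snd, ?_⟩, ⟨a.1.fst, a.2.snd, rfl⟩⟩)
    (fun _ _ => Finset.mem_univ _) (fun _ _ => Finset.mem_univ _) ?_ ?_ ?_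
  · have h1 := a.1.add
    have h2 := a.2.add
    omega
  · have h1 := a.1.add
    have h2 := a.2.add
    omega
  all_goals
    rintro ⟨⟨s, r, h⟩, ⟨p, q, h'⟩⟩ -
    cases h'
    rfl

theorem sum_left_zero {M : Type*} [AddCommMonoid M] (N : ℕ) (F : Split N → M)
    (h : ∀ p, p.fst ≠ 0 → F p = 0) :
    ∑ p, F p = F ⟨0, N, zero_add N⟩ := by
  refine Finset.sum_eq_single _ (fun b _ hb => h b fun h0 => hb ?_) (by simp)
  obtain ⟨p, q, this⟩ := b
  simp only at h0
  subst h0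
  simp only [zero_add] at this
  subst this
  rfl

theorem sum_right_zero {M : Type*} [AddCommMonoid M] (N : ℕ) (F : Split N → M)
    (h : ∀ p, p.snd ≠ 0 → F p = 0) :
    ∑ p, F p = F ⟨N, 0, add_zero N⟩ := by
  refine Finset.sum_eq_single _ (fun b _ hb => h b fun h0 => hb ?_) (by simp)
  obtain ⟨p, q, this⟩ := b
  simp only at h0
  subst h0
  simp only [add_zero] at this
  subst this
  rfl

theorem ProperadData.completion_isProperad {W : ProperadData.{u} K (ℤ × ℕ)}
    (hW : W.IsProperad (AddMonoidHom.fst ℤ ℕ)) :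
    W.completion.IsProperad (AddMonoidHom.id ℤ) where
  relabel_refl x := by
    funext N
    exact hW.relabel_refl (x N)
  relabel_trans e e' f f' x := by
    funext N
    exact hW.relabel_trans e e' f f' (x N)
  comp_relabel h a b c d e x y := by
    funext N
    simp only [completion_comp, completion_relabel, hW.comp_relabel, map_sum]
  one_comp y := by
    funext N
    rw [completion_comp, sum_left_zero]
    · exact hW.one_comp (y N)
    · rintro ⟨p, q, hb⟩ h0
      simp only at h0
      rw [completion_relabel]
      change W.comp _ (W.relabel _ _ ((Pi.single 0 W.one : ∀ N : ℕ, W.obj _ _ (0, N)) p)) _ = 0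
      rw [Pi.single_eq_of_ne h0]
      simp
  comp_one x := by
    funext N
    rw [completion_comp, sum_right_zero]
    · exact hW.comp_one (x N)
    · rintro ⟨p, q, hb⟩ h0
      simp only at h0
      rw [completion_relabel]
      change W.comp _ _ (W.relabel _ _ ((Pi.single 0 W.one : ∀ N : ℕ, W.obj _ _ (0, N)) q)) = 0
      rw [Pi.single_eq_of_ne h0]
      simp
  assoc h₁ h₂ h₃ h₄ x y z := by
    funext N
    simp only [completion_comp, completion_relabel, map_sum, LinearMap.sum_apply]
    refine (sum_assoc N (fun s p q r t e₁ e₂ e₃ e₄ =>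
      W.relabel (Equiv.sumAssoc _ _ _) (Equiv.sumAssoc _ _ _)
        (W.comp (show (_, s) + (_, r) = (_, N) by rw [Prod.mk_add_mk, h₂, e₁])
          (W.relabel (Equiv.refl _) (Equiv.sumSumSumComm _ _ _ _)
          (W.comp (show (_, p) + (_, q) = (_, s) by rw [Prod.mk_add_mk, h₁, e₂])
            (x p) (y q))) (z r)))).trans ?_
    refine Finset.sum_congr rfl fun a _ => Finset.sum_congr rfl fun b _ => ?_
    exact hW.assoc _ _ _ _ (x a.fst) (y b.fst) (z b.snd)
  assoc_below h₁ h₂ h₃ h₄ x y z := by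
    funext N
    rw [completion_smul]
    simp only [completion_comp, completion_relabel, map_sum, LinearMap.sum_apply, Finset.smul_sum]
    refine (sum_swap_below N (fun p q r s t e₁ e₂ e₃ e₄ =>
        (W.comp (show (_, s) + (_, q) = (_, N) by rw [Prod.mk_add_mk, h₂, e₂])
          (W.relabel (Equiv.refl _) (exchR _ _ _)
          (W.comp (show (_, p) + (_, r) = (_, s) by rw [Prod.mk_add_mk, h₁, e₁])
            (x p) (z r))) (y q)))).trans ?_
    refine Finset.sum_congr rfl fun a _ => Finset.sum_congr rfl fun b _ => ?_
    exact hW.assoc_below _ _ _ _ (x b.fst) (y b.snd) (z a.snd)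
  assoc_above h₁ h₂ h₃ h₄ x y z := by
    funext N
    rw [completion_smul]
    simp only [completion_comp, completion_relabel, map_sum, Finset.smul_sum]
    refine (sum_swap_above N (fun p q r s t e₁ e₂ e₃ e₄ =>
        (W.comp (show (_, q) + (_, s) = (_, N) by rw [Prod.mk_add_mk, h₂, e₂]) (y q)
          (W.relabel (exchL _ _ _) (Equiv.refl _)
          (W.comp (show (_, p) + (_, r) = (_, s) by rw [Prod.mk_add_mk, h₁, e₁])
            (x p) (z r)))))).trans ?_
    refine Finset.sum_congr rfl fun a _ => Finset.sum_congr rfl fun b _ => ?_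
    exact hW.assoc_above _ _ _ _ (x a.fst) (y b.fst) (z b.snd)

end Completion

section Derivations

variable {K : Type v} [Field K]

/-- A finite set of outputs, a finite set of inputs, and two degrees that differ by `r`. -/
structure Slot (r : ℤ) where
  out : Type
  inp : Type
  [finOut : Finite out]
  [finInp : Finite inp]
  src : ℤ
  tgt : ℤ
  add : src + r = tgt

attribute [instance] Slot.finOut Slot.finInp

/-- Families of linear maps of degree `r` on the components of `Q`. -/
abbrev Endo (Q : ProperadData.{u} K ℤ) (r : ℤ) : Type (max 1 u) :=
  ∀ S : Slot r, Q.obj S.out S.inp S.src →ₗ[K] Q.obj S.out S.inp S.tgt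

variable {Q : ProperadData.{u} K ℤ}

/-- The value of a family of linear maps on one component. -/
def Endo.app {r : ℤ} (D : Endo Q r) {A B : Type} [Finite A] [Finite B] {i j : ℤ} (h : i + r = j) :
    Q.obj A B i →ₗ[K] Q.obj A B j := D ⟨A, B, i, j, h⟩

/-- The graded commutator `D ∘ E - (-1)^{rs} E ∘ D`. -/
def Endo.comm {r s t : ℤ} (h : r + s = t) : Endo Q r →ₗ[K] Endo Q s →ₗ[K] Endo Q t :=
  LinearMap.mk₂ K
    (fun D E S =>
      (D.app (show S.src + s + r = S.tgt by have := S.add; omega)) ∘ₗ (E.app rfl)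
        - ksign K (r * s) •
          ((E.app (show S.src + r + s = S.tgt by have := S.add; omega)) ∘ₗ (D.app rfl)))
    (fun D D' E => by
      funext S
      ext x
      simp only [Endo.app, Pi.add_apply, LinearMap.add_apply, LinearMap.sub_apply,
        LinearMap.smul_apply, LinearMap.comp_apply, map_add, smul_add]
      abel)
    (fun a D E => by
      funext S
      ext x
      simp only [Endo.app, Pi.smul_apply, LinearMap.sub_apply, LinearMap.smul_apply,
        LinearMap.comp_apply, map_smul, smul_sub]
      rw [smul_comm])
    (fun D E E' => by
      funext S
      ext x
      simp only [Endo.app, Pi.add_apply, LinearMap.add_apply, LinearMap.sub_apply,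
        LinearMap.smul_apply, LinearMap.comp_apply, map_add, smul_add]
      abel)
    (fun a D E => by
      funext S
      ext x
      simp only [Endo.app, Pi.smul_apply, LinearMap.sub_apply, LinearMap.smul_apply,
        LinearMap.comp_apply, map_smul, smul_sub]
      rw [smul_comm])

theorem Endo.comm_app {r s t : ℤ} (h : r + s = t) (D : Endo Q r) (E : Endo Q s) {A B : Type}
    [Finite A] [Finite B] {i j m n : ℤ} (hj : i + t = j) (hm : i + s = m) (hm' : m + r = j)
    (hn : i + r = n) (hn' : n + s = j) (x : Q.obj A B i) :
    (Endo.comm h D E).app hj x = D.app hm' (E.app hm x) - ksign K (r * s) • E.app hn' (D.app hn x) := by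
  subst hm hn
  rfl

/-- The derivations of degree `r`. -/
def Der (Q : ProperadData.{u} K ℤ) (r : ℤ) : Submodule K (Endo Q r) where
  carrier := { D |
    (∀ {A A' B B' : Type} [Finite A] [Finite A'] [Finite B] [Finite B'] {i j : ℤ} (h : i + r = j)
      (e : A ≃ A') (f : B ≃ B') (x : Q.obj A B i),
      D.app h (Q.relabel e f x) = Q.relabel e f (D.app h x)) ∧
    ∀ {A B C X E : Type} [Finite A] [Finite B] [Finite C] [Finite X] [Finite E] [Nonempty E]
      {i j k i' j' k' : ℤ} (h : i + j = k) (hi : i + r = i') (hj : j + r = j') (hk : k + r = k')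
      (x : Q.obj A (B ⊕ E) i) (y : Q.obj (E ⊕ C) X j),
      D.app hk (Q.comp h x y) =
        Q.comp (show i' + j = k' by rw [← hi, ← hk, ← h]; ring) (D.app hi x) y
          + ksign K (r * i) •
            Q.comp (show i + j' = k' by rw [← hj, ← hk, ← h]; ring) x (D.app hj y) }
  zero_mem' := by
    refine ⟨?_, ?_⟩ <;> intros <;> simp [Endo.app]
  add_mem' := by
    rintro D D' ⟨h₁, h₂⟩ ⟨h₁', h₂'⟩
    refine ⟨?_, ?_⟩
    · intro A A' B B' _ _ _ _ i j h e f x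
      have e1 := h₁ h e f x
      have e2 := h₁' h e f x
      simp only [Endo.app] at e1 e2
      simp only [Endo.app, Pi.add_apply, LinearMap.add_apply, e1, e2, map_add]
    · intro A B C X E _ _ _ _ _ _ i j k i' j' k' h hi hj hk x y
      have e1 := h₂ h hi hj hk x y
      have e2 := h₂' h hi hj hk x y
      simp only [Endo.app] at e1 e2
      simp only [Endo.app, Pi.add_apply, LinearMap.add_apply, e1, e2, map_add, smul_add]
      abel
  smul_mem' := by
    rintro a D ⟨h₁, h₂⟩
    refine ⟨?_, ?_⟩
    · intro A A' B B' _ _ _ _ i j h e f x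
      have e1 := h₁ h e f x
      simp only [Endo.app] at e1
      simp only [Endo.app, Pi.smul_apply, LinearMap.smul_apply, e1, map_smul]
    · intro A B C X E _ _ _ _ _ _ i j k i' j' k' h hi hj hk x y
      have e1 := h₂ h hi hj hk x y
      simp only [Endo.app] at e1
      simp only [Endo.app, Pi.smul_apply, LinearMap.smul_apply, e1, map_smul, smul_add]
      rw [smul_comm a]

theorem ksign_add (m n : ℤ) : ksign K (m + n) = ksign K m * ksign K n := by
  simp [ksign, Int.negOnePow_add]

theorem Der.comm_mem {r s t : ℤ} (h : r + s = t) {D : Endo Q r} {E : Endo Q s}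
    (hD : D ∈ Der Q r) (hE : E ∈ Der Q s) : Endo.comm h D E ∈ Der Q t := by
  refine ⟨?_, ?_⟩
  · intro A A' B B' _ _ _ _ i j hj e f x
    have h1 : i + s + r = j := by rw [← hj, ← h]; ring
    have h2 : i + r + s = j := by rw [← hj, ← h]; ring
    rw [Endo.comm_app h D E hj rfl h1 rfl h2, Endo.comm_app h D E hj rfl h1 rfl h2,
      hE.1, hD.1, hD.1, hE.1, map_sub, map_smul]
  · intro A B C X F _ _ _ _ _ _ i j k i' j' k' hk hi hj hk' x y
    have e1 : i + s + r = i' := by rw [← hi, ← h]; ring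
    have e2 : i + r + s = i' := by rw [← hi, ← h]; ring
    have f1 : j + s + r = j' := by rw [← hj, ← h]; ring
    have f2 : j + r + s = j' := by rw [← hj, ← h]; ring
    have g1 : k + s + r = k' := by rw [← hk', ← h]; ring
    have g2 : k + r + s = k' := by rw [← hk', ← h]; ring
    rw [Endo.comm_app h D E hk' rfl g1 rfl g2, Endo.comm_app h D E hi rfl e1 rfl e2,
      Endo.comm_app h D E hj rfl f1 rfl f2, hE.2 hk rfl rfl rfl, hD.2 hk rfl rfl rfl]
    simp only [map_add, map_smul, map_sub, LinearMap.sub_apply, LinearMap.smul_apply]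
    rw [hD.2 _ e1 rfl g1, hD.2 _ rfl f1 g1, hE.2 _ e2 rfl g2, hE.2 _ rfl f2 g2]
    simp only [smul_add, smul_sub, smul_smul, ← ksign_add]
    have s1 : ksign K (r * (i + s)) = ksign K (r * s + r * i) := by ring_nf
    have s2 : ksign K (s * i) = ksign K (r * s + s * (i + r)) := by
      rw [show r * s + s * (i + r) = s * i + (r * s + r * s) by ring, ksign_add _ (r * s + r * s)]
      simp [ksign]
    have s3 : ksign K (s * i + r * i) = ksign K (t * i) := by rw [← h]; ring_nf
    have s4 : ksign K (r * s + (r * i + s * i)) = ksign K (t * i + r * s) := by rw [← h]; ring_nf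
    rw [s1, s2, s3, s4]
    abel

end Derivations

section Leibniz

variable {K : Type v} [Field K] {Q : ProperadData.{u} K ℤ} {r : ℤ}

/-- The value of a derivation of degree `r` on `x ∘ y`, if `x'` and `y'` are its values on `x` and
`y`. -/
def leib (Q : ProperadData.{u} K ℤ) {A B C D E : Type} [Finite A] [Finite B] [Finite C]
    [Finite D] [Finite E] [Nonempty E] {i j k i' j' k' : ℤ} (h : i + j = k) (hi : i + r = i')
    (hj : j + r = j') (hk : k + r = k') (x : Q.obj A (B ⊕ E) i) (x' : Q.obj A (B ⊕ E) i')
    (y : Q.obj (E ⊕ C) D j) (y' : Q.obj (E ⊕ C) D j') : Q.obj (A ⊕ C) (B ⊕ D) k' :=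
  Q.comp (show i' + j = k' by omega) x' y + ksign K (r * i) • Q.comp (show i + j' = k' by omega) x y'

section

variable {A B C D E : Type} [Finite A] [Finite B] [Finite C] [Finite D] [Finite E] [Nonempty E]
  {i j k i' j' k' : ℤ} (h : i + j = k) (hi : i + r = i') (hj : j + r = j') (hk : k + r = k')
  (x v : Q.obj A (B ⊕ E) i) (x' v' : Q.obj A (B ⊕ E) i') (y w : Q.obj (E ⊕ C) D j)
  (y' w' : Q.obj (E ⊕ C) D j')

theorem leib_add_left : leib Q h hi hj hk (x + v) (x' + v') y y' =
    leib Q h hi hj hk x x' y y' + leib Q h hi hj hk v v' y y' := by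
  simp only [leib, map_add, LinearMap.add_apply, smul_add]
  abel

theorem leib_add_right : leib Q h hi hj hk x x' (y + w) (y' + w') =
    leib Q h hi hj hk x x' y y' + leib Q h hi hj hk x x' w w' := by
  simp only [leib, map_add, smul_add]
  abel

theorem leib_smul_left (a : K) : leib Q h hi hj hk (a • x) (a • x') y y' =
    a • leib Q h hi hj hk x x' y y' := by
  simp only [leib, map_smul, LinearMap.smul_apply, smul_add, smul_smul, mul_comm]

theorem leib_smul_right (a : K) : leib Q h hi hj hk x x' (a • y) (a • y') =
    a • leib Q h hi hj hk x x' y y' := by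
  simp only [leib, map_smul, smul_add, smul_smul, mul_comm]

end

theorem leib_relabel (hQ : Q.IsProperad (AddMonoidHom.id ℤ))
    {A A' B B' C C' D D' E E' : Type} [Finite A] [Finite A'] [Finite B]
    [Finite B'] [Finite C] [Finite C'] [Finite D] [Finite D'] [Finite E] [Finite E']
    [Nonempty E] [Nonempty E'] {i j k i' j' k' : ℤ} (h : i + j = k) (hi : i + r = i')
    (hj : j + r = j') (hk : k + r = k') (a : A ≃ A') (b : B ≃ B')
    (c : C ≃ C') (d : D ≃ D') (e : E ≃ E') (x : Q.obj A (B ⊕ E) i) (x' : Q.obj A (B ⊕ E) i')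
    (y : Q.obj (E ⊕ C) D j) (y' : Q.obj (E ⊕ C) D j') :
    leib Q h hi hj hk (Q.relabel a (Equiv.sumCongr b e) x) (Q.relabel a (Equiv.sumCongr b e) x')
      (Q.relabel (Equiv.sumCongr e c) d y) (Q.relabel (Equiv.sumCongr e c) d y')
      = Q.relabel (Equiv.sumCongr a c) (Equiv.sumCongr b d) (leib Q h hi hj hk x x' y y') := by
  simp only [leib, hQ.comp_relabel, map_add, map_smul]

theorem leib_one_comp (hQ : Q.IsProperad (AddMonoidHom.id ℤ))
    {C D : Type} [Finite C] [Finite D] {i i' r' : ℤ} (hi : i + r = i')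
    (hr : 0 + r = r') (y : Q.obj (Fin 1 ⊕ C) D i) (y' : Q.obj (Fin 1 ⊕ C) D i') :
    leib Q (zero_add i) hr hi hi
      (Q.relabel (Equiv.refl (Fin 1)) (Equiv.emptySum Empty (Fin 1)).symm Q.one)
      (Q.relabel (Equiv.refl (Fin 1)) (Equiv.emptySum Empty (Fin 1)).symm 0) y y'
      = Q.relabel (Equiv.refl (Fin 1 ⊕ C)) (Equiv.emptySum Empty D).symm y' := by
  simp only [leib, map_zero, LinearMap.zero_apply, zero_add, mul_zero]
  rw [hQ.one_comp]
  simp [ksign]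

theorem leib_comp_one (hQ : Q.IsProperad (AddMonoidHom.id ℤ))
    {A B : Type} [Finite A] [Finite B] {i i' r' : ℤ} (hi : i + r = i')
    (hr : 0 + r = r') (x : Q.obj A (B ⊕ Fin 1) i) (x' : Q.obj A (B ⊕ Fin 1) i') :
    leib Q (add_zero i) hi hr hi x x'
      (Q.relabel (Equiv.sumEmpty (Fin 1) Empty).symm (Equiv.refl (Fin 1)) Q.one)
      (Q.relabel (Equiv.sumEmpty (Fin 1) Empty).symm (Equiv.refl (Fin 1)) 0)
      = Q.relabel (Equiv.sumEmpty A Empty).symm (Equiv.refl (B ⊕ Fin 1)) x' := by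
  simp only [leib, map_zero, smul_zero, add_zero]
  rw [hQ.comp_one]

theorem leib_assoc (hQ : Q.IsProperad (AddMonoidHom.id ℤ))
    {A B C D E₁ E₂ E₃ F G : Type} [Finite A] [Finite B] [Finite C] [Finite D]
    [Finite E₁] [Finite E₂] [Finite E₃] [Finite F] [Finite G] [Nonempty E₁] [Nonempty E₂]
    {i j k ij jk l i' j' k' ij' jk' l' : ℤ} (h₁ : i + j = ij) (h₂ : ij + k = l) (h₃ : j + k = jk)
    (h₄ : i + jk = l) (hi : i + r = i') (hj : j + r = j') (hk : k + r = k') (hij : ij + r = ij')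
    (hjk : jk + r = jk') (hl : l + r = l')
    (x : Q.obj A ((B ⊕ E₃) ⊕ E₁) i) (y : Q.obj (E₁ ⊕ C) (D ⊕ E₂) j)
    (z : Q.obj ((E₃ ⊕ E₂) ⊕ F) G k)
    (x' : Q.obj A ((B ⊕ E₃) ⊕ E₁) i') (y' : Q.obj (E₁ ⊕ C) (D ⊕ E₂) j')
    (z' : Q.obj ((E₃ ⊕ E₂) ⊕ F) G k') :
    Q.relabel (Equiv.sumAssoc A C F) (Equiv.sumAssoc B D G)
        (leib Q h₂ hij hk hl (Q.relabel (Equiv.refl (A ⊕ C)) (Equiv.sumSumSumComm B E₃ D E₂)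
          (Q.comp h₁ x y)) (Q.relabel (Equiv.refl (A ⊕ C)) (Equiv.sumSumSumComm B E₃ D E₂)
          (leib Q h₁ hi hj hij x x' y y')) z z')
      = leib Q h₄ hi hjk hl
          (Q.relabel (Equiv.refl A) ((exchR B E₃ E₁).trans (Equiv.sumAssoc B E₁ E₃)) x)
          (Q.relabel (Equiv.refl A) ((exchR B E₃ E₁).trans (Equiv.sumAssoc B E₁ E₃)) x')
          (Q.relabel (Equiv.sumSumSumComm E₁ C E₃ F) (Equiv.refl (D ⊕ G))
            (Q.comp h₃ y
              (Q.relabel ((Equiv.sumAssoc E₃ E₂ F).trans (exchL E₃ E₂ F)) (Equiv.refl G) z)))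
          (Q.relabel (Equiv.sumSumSumComm E₁ C E₃ F) (Equiv.refl (D ⊕ G))
            (leib Q h₃ hj hk hjk y y'
              (Q.relabel ((Equiv.sumAssoc E₃ E₂ F).trans (exchL E₃ E₂ F)) (Equiv.refl G) z)
              (Q.relabel ((Equiv.sumAssoc E₃ E₂ F).trans (exchL E₃ E₂ F)) (Equiv.refl G) z'))) := by
  simp only [leib, map_add, map_smul, LinearMap.add_apply, LinearMap.smul_apply, smul_add,
    smul_smul]
  rw [hQ.assoc _ _ h₃ (show i' + jk = l' by omega), hQ.assoc _ _ (show j' + k = jk' by omega)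
    (show i + jk' = l' by omega), hQ.assoc _ _ (show j + k' = jk' by omega)
    (show i + jk' = l' by omega)]
  rw [← ksign_add, show r * i + r * j = r * ij by rw [← h₁, mul_add]]
  abel

theorem leib_assoc_below (hQ : Q.IsProperad (AddMonoidHom.id ℤ))
    {A B C D E₁ E₂ F G : Type} [Finite A] [Finite B] [Finite C] [Finite D]
    [Finite E₁] [Finite E₂] [Finite F] [Finite G] [Nonempty E₁] [Nonempty E₂]
    {i j k ij ik l i' j' k' ij' ik' l' : ℤ} (h₁ : i + k = ik) (h₂ : ik + j = l) (h₃ : i + j = ij)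
    (h₄ : ij + k = l) (hi : i + r = i') (hj : j + r = j') (hk : k + r = k') (hij : ij + r = ij')
    (hik : ik + r = ik') (hl : l + r = l')
    (x : Q.obj A ((B ⊕ E₁) ⊕ E₂) i) (y : Q.obj (E₁ ⊕ C) D j) (z : Q.obj (E₂ ⊕ F) G k)
    (x' : Q.obj A ((B ⊕ E₁) ⊕ E₂) i') (y' : Q.obj (E₁ ⊕ C) D j') (z' : Q.obj (E₂ ⊕ F) G k') :
    leib Q h₂ hik hj hl (Q.relabel (Equiv.refl (A ⊕ F)) (exchR B E₁ G) (Q.comp h₁ x z))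
        (Q.relabel (Equiv.refl (A ⊕ F)) (exchR B E₁ G) (leib Q h₁ hi hk hik x x' z z')) y y'
      = ksign K (j * k) • Q.relabel (exchR A C F) (exchR B D G)
          (leib Q h₄ hij hk hl (Q.relabel (Equiv.refl (A ⊕ C)) (exchR B E₂ D)
            (Q.comp h₃ (Q.relabel (Equiv.refl A) (exchR B E₁ E₂) x) y))
            (Q.relabel (Equiv.refl (A ⊕ C)) (exchR B E₂ D)
            (leib Q h₃ hi hj hij (Q.relabel (Equiv.refl A) (exchR B E₁ E₂) x)
              (Q.relabel (Equiv.refl A) (exchR B E₁ E₂) x') y y')) z z') := by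
  simp only [leib, map_add, map_smul, LinearMap.add_apply, LinearMap.smul_apply, smul_add,
    smul_smul]
  rw [hQ.assoc_below _ _ (show i' + j = ij' by omega) (show ij' + k = l' by omega),
    hQ.assoc_below _ _ h₃ (show ij + k' = l' by omega),
    hQ.assoc_below _ _ (show i + j' = ij' by omega) (show ij' + k = l' by omega)]
  simp only [AddMonoidHom.id_apply, smul_smul, ← ksign_add]
  have e₁ : ksign K (r * i + j * k') = ksign K (j * k + r * ij) := by
    rw [← hk, ← h₃]; ring_nf
  have e₂ : ksign K (r * ik + j' * k) = ksign K (j * k + r * i) := by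
    rw [← hj, ← h₁, show r * (i + k) + (j + r) * k = j * k + r * i + (r * k + r * k) by ring,
      ksign_add _ (r * k + r * k)]
    simp [ksign]
  rw [e₁, e₂]
  abel

theorem leib_assoc_above (hQ : Q.IsProperad (AddMonoidHom.id ℤ))
    {A A' B B' C D E₁ E₂ : Type} [Finite A] [Finite A'] [Finite B] [Finite B']
    [Finite C] [Finite D] [Finite E₁] [Finite E₂] [Nonempty E₁] [Nonempty E₂]
    {i j k ik jk l i' j' k' ik' jk' l' : ℤ} (h₁ : i + k = ik) (h₂ : j + ik = l) (h₃ : j + k = jk)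
    (h₄ : i + jk = l) (hi : i + r = i') (hj : j + r = j') (hk : k + r = k') (hjk : jk + r = jk')
    (hik : ik + r = ik') (hl : l + r = l')
    (x : Q.obj A (B ⊕ E₁) i) (y : Q.obj A' (B' ⊕ E₂) j) (z : Q.obj (E₁ ⊕ (E₂ ⊕ C)) D k)
    (x' : Q.obj A (B ⊕ E₁) i') (y' : Q.obj A' (B' ⊕ E₂) j') (z' : Q.obj (E₁ ⊕ (E₂ ⊕ C)) D k') :
    leib Q h₂ hj hik hl y y' (Q.relabel (exchL A E₂ C) (Equiv.refl (B ⊕ D)) (Q.comp h₁ x z))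
        (Q.relabel (exchL A E₂ C) (Equiv.refl (B ⊕ D)) (leib Q h₁ hi hk hik x x' z z'))
      = ksign K (i * j) • Q.relabel (exchL A A' C) (exchL B B' D)
          (leib Q h₄ hi hjk hl x x' (Q.relabel (exchL A' E₁ C) (Equiv.refl (B' ⊕ D))
            (Q.comp h₃ y (Q.relabel (exchL E₁ E₂ C) (Equiv.refl D) z)))
            (Q.relabel (exchL A' E₁ C) (Equiv.refl (B' ⊕ D))
            (leib Q h₃ hj hk hjk y y' (Q.relabel (exchL E₁ E₂ C) (Equiv.refl D) z)
              (Q.relabel (exchL E₁ E₂ C) (Equiv.refl D) z')))) := by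
  simp only [leib, map_add, map_smul, smul_add, smul_smul]
  rw [hQ.assoc_above _ _ (show j' + k = jk' by omega) (show i + jk' = l' by omega),
    hQ.assoc_above _ _ h₃ (show i' + jk = l' by omega),
    hQ.assoc_above _ _ (show j + k' = jk' by omega) (show i + jk' = l' by omega)]
  simp only [AddMonoidHom.id_apply, smul_smul, ← ksign_add]
  have e₁ : ksign K (i * j') = ksign K (i * j + r * i) := by
    rw [← hj]; ring_nf
  have e₂ : ksign K (r * j + i' * j) = ksign K (i * j) := by
    rw [← hi, show r * j + (i + r) * j = i * j + (r * j + r * j) by ring,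
      ksign_add _ (r * j + r * j)]
    simp [ksign]
  have e₃ : ksign K (r * j + r * i + i * j) = ksign K (i * j + r * i + r * j) := by ring_nf
  simp only [e₁, e₂, e₃, ← add_assoc]
  abel

end Leibniz

section PresentedDerivation

variable {K : Type v} [Field K] {G : (A B : Type) → ℤ → Type w}
  {R : ∀ (A B : Type) (i : ℤ), Term K G A B i → Term K G A B i → Prop}

/-- The properad with integer degrees presented by the generators `G` and the relations `R`. -/
abbrev GradedPresented (R : ∀ (A B : Type) (i : ℤ), Term K G A B i → Term K G A B i → Prop) :
    ProperadData.{max 1 v w} K ℤ := Presented (AddMonoidHom.id ℤ) R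

/-- The element represented by a formal expression. -/
abbrev GradedPresented.mk (R : ∀ (A B : Type) (i : ℤ), Term K G A B i → Term K G A B i → Prop)
    {A B : Type} [Finite A] [Finite B] {i : ℤ} (x : Term K G A B i) :
    (GradedPresented R).obj A B i := Presented.mk x

theorem GradedPresented.mk_relabel {A A' B B' : Type} [Finite A] [Finite A'] [Finite B] [Finite B']
    {i : ℤ} (e : A ≃ A') (f : B ≃ B') (x : Term K G A B i) :
    (GradedPresented.mk R (.relabel e f x) : (GradedPresented R).obj A' B' i) = (GradedPresented R).relabel e f (GradedPresented.mk R x) := rfl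

theorem GradedPresented.mk_comp {A B C D E : Type} [Finite A] [Finite B] [Finite C] [Finite D] [Finite E]
    [Nonempty E] {i j k : ℤ} (h : i + j = k) (x : Term K G A (B ⊕ E) i) (y : Term K G (E ⊕ C) D j) :
    (GradedPresented.mk R (.comp h x y) : (GradedPresented R).obj (A ⊕ C) (B ⊕ D) k) = (GradedPresented R).comp h (GradedPresented.mk R x) (GradedPresented.mk R y) := rfl

/-- The value on a formal expression of the derivation of degree `r` that is given by `δ` on the
generators. -/
def Term.der {r : ℤ} (δ : ∀ (A B : Type) [Finite A] [Finite B] (i j : ℤ), i + r = j → G A B i →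
    (GradedPresented R).obj A B j) :
    ∀ {A B : Type} {i : ℤ}, Term K G A B i → ∀ j, i + r = j → Presented.Obj (AddMonoidHom.id ℤ) R A B j
  | _, _, _, @Term.gen _ _ _ _ A B _ _ i g, j, h => δ A B i j h g
  | _, _, _, .one, j, _ => (0 : (GradedPresented R).obj (Fin 1) (Fin 1) j)
  | _, _, _, @Term.relabel _ _ _ _ A A' B B' _ _ _ _ _ e f x, j, h =>
      (GradedPresented R).relabel e f (Term.der δ x j h)
  | _, _, _, @Term.comp _ _ _ _ A B C D E _ _ _ _ _ _ i j _ h x y, k', hk =>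
      ((GradedPresented R).comp (show i + r + j = k' by rw [← hk, ← h]; ring)
          (Term.der δ x (i + r) rfl) (GradedPresented.mk R y)
        + ksign K (r * i) •
          (GradedPresented R).comp (show i + (j + r) = k' by rw [← hk, ← h]; ring)
            (GradedPresented.mk R x) (Term.der δ y (j + r) rfl) :
        (GradedPresented R).obj (A ⊕ C) (B ⊕ D) k')
  | _, _, _, @Term.zero _ _ _ _ A B _ _ _, j, _ => (0 : (GradedPresented R).obj A B j)
  | _, _, _, @Term.add _ _ _ _ A B _ _ _ x y, j, h =>
      (Term.der δ x j h + Term.der δ y j h : (GradedPresented R).obj A B j)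
  | _, _, _, @Term.smul _ _ _ _ A B _ _ _ a x, j, h =>
      (a • Term.der δ x j h : (GradedPresented R).obj A B j)

variable {r : ℤ} (δ : ∀ (A B : Type) [Finite A] [Finite B] (i j : ℤ), i + r = j → G A B i →
    (GradedPresented R).obj A B j)

theorem Term.der_comp {A B C D E : Type} [Finite A] [Finite B] [Finite C] [Finite D] [Finite E]
    [Nonempty E] {i j k i' j' k' : ℤ} (h : i + j = k) (hi : i + r = i') (hj : j + r = j')
    (hk : k + r = k') (x : Term K G A (B ⊕ E) i) (y : Term K G (E ⊕ C) D j) :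
    (Term.comp h x y).der δ k' hk = leib (GradedPresented R) h hi hj hk (GradedPresented.mk R x)
      (x.der δ i' hi) (GradedPresented.mk R y) (y.der δ j' hj) := by
  subst hi hj
  rfl

theorem Term.der_relabel {A A' B B' : Type} [Finite A] [Finite A'] [Finite B] [Finite B']
    {i j : ℤ} (h : i + r = j) (e : A ≃ A') (f : B ≃ B') (x : Term K G A B i) :
    ((Term.relabel e f x).der δ j h : (GradedPresented R).obj A' B' j) = (GradedPresented R).relabel e f (x.der δ j h) := rfl

theorem Term.der_smul {A B : Type} [Finite A] [Finite B]
    {i j : ℤ} (h : i + r = j) (a : K) (x : Term K G A B i) :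
    ((Term.smul a x).der δ j h : (GradedPresented R).obj A B j) = a • x.der δ j h := rfl

theorem Term.der_rel (hδ : ∀ {A B : Type} {i : ℤ} {x y : Term K G A B i}, R A B i x y →
    ∀ j (h : i + r = j), x.der δ j h = y.der δ j h) {A B : Type} {i : ℤ} {x y : Term K G A B i}
    (hxy : Rel (AddMonoidHom.id ℤ) R x y) : ∀ j (h : i + r = j), x.der δ j h = y.der δ j h := by
  have law := Presented.isProperad (AddMonoidHom.id ℤ) R
  induction hxy with
  | of h => exact hδ h
  | refl => intros; rfl
  | symm _ ih => intro j h; exact (ih j h).symm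
  | trans _ _ ih ih' => intro j h; exact (ih j h).trans (ih' j h)
  | relabel_congr e f _ ih => intro j h; rw [Term.der_relabel, Term.der_relabel, ih]
  | comp_congr h hx hy ih ih' =>
    intro j hj
    rw [Term.der_comp δ h rfl rfl hj, Term.der_comp δ h rfl rfl hj, ih _ rfl, ih' _ rfl,
      show GradedPresented.mk R _ = _ from Presented.sound hx,
      show GradedPresented.mk R _ = _ from Presented.sound hy]
  | add_congr _ _ ih ih' => intro j h; exact congrArg₂ (· + ·) (ih j h) (ih' j h)
  | smul_congr a _ ih => intro j h; exact congrArg (a • ·) (ih j h)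
  | add_comm => intro j h; exact add_comm _ _
  | add_assoc => intro j h; exact add_assoc _ _ _
  | zero_add => intro j h; exact zero_add _
  | neg_add => intro j h; exact (congrArg (· + _) (neg_one_smul K _)).trans (neg_add_cancel _)
  | one_smul => intro j h; exact one_smul K _
  | mul_smul => intro j h; exact mul_smul _ _ _
  | add_smul => intro j h; exact add_smul _ _ _
  | smul_add => intro j h; exact smul_add _ _ _
  | relabel_add => intro j h; exact map_add _ _ _
  | relabel_smul => intro j h; exact map_smul _ _ _
  | comp_add_left h x x' y =>
    intro j hj
    exact (Term.der_comp δ h rfl rfl hj _ _).trans ((leib_add_left h rfl rfl hj _ _ _ _ _ _).trans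
      (congrArg₂ (· + ·) (Term.der_comp δ h rfl rfl hj _ _) (Term.der_comp δ h rfl rfl hj _ _)).symm)
  | comp_add_right h x y y' =>
    intro j hj
    exact (Term.der_comp δ h rfl rfl hj _ _).trans ((leib_add_right h rfl rfl hj _ _ _ _ _ _).trans
      (congrArg₂ (· + ·) (Term.der_comp δ h rfl rfl hj _ _) (Term.der_comp δ h rfl rfl hj _ _)).symm)
  | comp_smul_left h a x y =>
    intro j hj
    exact (Term.der_comp δ h rfl rfl hj _ _).trans ((leib_smul_left h rfl rfl hj _ _ _ _ a).trans
      (congrArg (a • ·) (Term.der_comp δ h rfl rfl hj _ _)).symm)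
  | comp_smul_right h a x y =>
    intro j hj
    exact (Term.der_comp δ h rfl rfl hj _ _).trans ((leib_smul_right h rfl rfl hj _ _ _ _ a).trans
      (congrArg (a • ·) (Term.der_comp δ h rfl rfl hj _ _)).symm)
  | relabel_refl x => intro j h; exact law.relabel_refl _
  | relabel_trans e e' f f' x => intro j h; exact law.relabel_trans _ _ _ _ _
  | comp_relabel h a b c d e x y =>
    intro k' hk
    exact (Term.der_comp δ h rfl rfl hk _ _).trans ((leib_relabel law h rfl rfl hk a b c d e _ _ _ _).trans
      (congrArg (Presented (AddMonoidHom.id ℤ) R |>.relabel _ _) (Term.der_comp δ h rfl rfl hk _ _)).symm)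
  | one_comp y =>
    intro j h
    exact (Term.der_comp δ _ rfl h h _ _).trans (leib_one_comp law h rfl _ _)
  | comp_one x =>
    intro j h
    exact (Term.der_comp δ _ h rfl h _ _).trans (leib_comp_one law h rfl _ _)
  | assoc h₁ h₂ h₃ h₄ x y z =>
    intro j h
    exact leib_assoc law h₁ h₂ h₃ h₄ rfl rfl rfl rfl rfl h _ _ _ _ _ _
  | assoc_below h₁ h₂ h₃ h₄ x y z =>
    intro j h
    exact leib_assoc_below law h₁ h₂ h₃ h₄ rfl rfl rfl rfl rfl h _ _ _ _ _ _
  | assoc_above h₁ h₂ h₃ h₄ x y z =>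
    intro j h
    exact leib_assoc_above law h₁ h₂ h₃ h₄ rfl rfl rfl rfl rfl h _ _ _ _ _ _

/-- The derivation of degree `r` of a presented properad that is given by `δ` on the generators. -/
def Presented.der (hδ : ∀ {A B : Type} {i : ℤ} {x y : Term K G A B i}, R A B i x y →
    ∀ j (h : i + r = j), x.der δ j h = y.der δ j h) : Endo (GradedPresented R) r := fun S =>
  { toFun := Quotient.lift (fun x : Term K G S.out S.inp S.src => x.der δ S.tgt S.add)
      fun _ _ h => Term.der_rel δ hδ h _ _
    map_add' := fun x y => by
      induction x using Presented.ind; induction y using Presented.ind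
      rfl
    map_smul' := fun a x => by
      induction x using Presented.ind
      rfl }

variable (hδ : ∀ {A B : Type} {i : ℤ} {x y : Term K G A B i}, R A B i x y →
    ∀ j (h : i + r = j), x.der δ j h = y.der δ j h)

theorem Presented.der_mem : Presented.der δ hδ ∈ Der (GradedPresented R) r := by
  refine ⟨?_, ?_⟩
  · intro A A' B B' _ _ _ _ i j h e f x
    induction x using Presented.ind
    rfl
  · intro A B C D E _ _ _ _ _ _ i j k i' j' k' h hi hj hk x y
    induction x using Presented.ind; induction y using Presented.ind
    exact Term.der_comp δ h hi hj hk _ _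

theorem Presented.der_gen {A B : Type} [Finite A] [Finite B] {i j : ℤ} (h : i + r = j)
    (g : G A B i) : (Presented.der δ hδ).app h (Presented.gen _ R g) = δ A B i j h g := rfl

end PresentedDerivation

section DGProperads

variable {K : Type v} [Field K]

/-- Dg properads: graded properads with a derivation `d` of degree one and square zero. -/
structure DGProperad (K : Type v) [Field K] where
  data : ProperadData.{u} K ℤ
  law : data.IsProperad (AddMonoidHom.id ℤ)
  d : Endo data 1
  d_mem : d ∈ Der data 1
  d_d : ∀ {A B : Type} [Finite A] [Finite B] {i j k : ℤ} (h : i + 1 = j) (h' : j + 1 = k)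
    (x : data.obj A B i), d.app h' (d.app h x) = 0

/-- Morphisms of graded properads. -/
structure ProperadData.Hom (Q : ProperadData.{u} K ℤ) (Q' : ProperadData.{w} K ℤ) where
  app : ∀ {A B : Type} [Finite A] [Finite B] {i : ℤ}, Q.obj A B i →ₗ[K] Q'.obj A B i
  map_one : app Q.one = Q'.one
  map_relabel : ∀ {A A' B B' : Type} [Finite A] [Finite A'] [Finite B] [Finite B'] {i : ℤ}
    (e : A ≃ A') (f : B ≃ B') (x : Q.obj A B i), app (Q.relabel e f x) = Q'.relabel e f (app x)
  map_comp : ∀ {A B C D E : Type} [Finite A] [Finite B] [Finite C] [Finite D] [Finite E]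
    [Nonempty E] {i j k : ℤ} (h : i + j = k) (x : Q.obj A (B ⊕ E) i) (y : Q.obj (E ⊕ C) D j),
    app (Q.comp h x y) = Q'.comp h (app x) (app y)

end DGProperads

section Families

variable {K : Type v} [Field K]

/-- The degree in `Q(m,n)` of the `(m,n)`-component of an element of degree `k` of
`∏ Q(m,n) ⊗ sgn_m^{⊗|c|} ⊗ sgn_n^{⊗|d|} [c(1-m)+d(1-n)]`. -/
def deg (c d k : ℤ) (m n : ℕ) : ℤ := k + c * (1 - m) + d * (1 - n)

theorem deg_add (c d : ℤ) {k l t : ℤ} (h : k + l = t) (m n : ℕ) :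
    deg c d k m n + l = deg c d t m n := by
  simp only [deg, ← h]
  ring

theorem deg_comp (c d : ℤ) {k l t : ℤ} (h : k + l = t) {m n : ℕ} (p : Split m) (q : Split n) :
    deg c d k p.fst (q.fst + 1) + deg c d l (1 + p.snd) q.snd = deg c d t m n := by
  obtain ⟨m₁, m₂, rfl⟩ := p
  obtain ⟨n₁, n₂, rfl⟩ := q
  simp only [deg, ← h]
  push_cast
  ring

/-- Families `η = (η_{m,n})`, with `m` outputs and `n` inputs, of total degree `k`. -/
abbrev Fam (Q : ProperadData.{u} K ℤ) (c d k : ℤ) : Type u :=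
  ∀ s : ℕ × ℕ, Q.obj (Fin s.1) (Fin s.2) (deg c d k s.1 s.2)

variable {Q : ProperadData.{u} K ℤ} {c d : ℤ}

def Fam.map {Q' : ProperadData.{w} K ℤ} (f : Q.Hom Q') {k : ℤ} (η : Fam Q c d k) :
    Fam Q' c d k := fun s => f.app (η s)

/-- The sum over all permutations, twisted by signs. -/
def skewSym (Q : ProperadData.{u} K ℤ) (c d : ℤ) {A B : Type} [Finite A] [Finite B] {m n : ℕ}
    {i : ℤ} (e : A ≃ Fin m) (f : B ≃ Fin n) : Q.obj A B i →ₗ[K] Q.obj (Fin m) (Fin n) i :=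
  ∑ σ : Equiv.Perm (Fin m), ∑ τ : Equiv.Perm (Fin n),
    (psign K c σ * psign K d τ) • Q.relabel (e.trans σ) (f.trans τ)

/-- The sum over `N₁ ⊔ N₂ = {1,…,n}` and `M₁ ⊔ M₂ = {1,…,m}` of the graphs with two vertices, the
upper one decorated by `η` and the lower one decorated by `ξ`, joined by exactly one edge: `η` has
the outputs `M₁` and the inputs `N₁` and the edge, `ξ` has the outputs `M₂` and the edge, and the
inputs `N₂`. The sum over such decompositions is written as a sum over all permutations, divided
by the orders of the stabilizers. -/
def star (Q : ProperadData.{u} K ℤ) (c d : ℤ) {k l t : ℤ} (h : k + l = t) :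
    Fam Q c d k →ₗ[K] Fam Q c d l →ₗ[K] Fam Q c d t :=
  LinearMap.mk₂ K
    (fun η ξ s => ∑ p : Split s.1, ∑ q : Split s.2,
      (((p.fst ! * p.snd ! * q.fst ! * q.snd ! : ℕ) : K)⁻¹ *
        ksign K ((deg c d k p.fst (q.fst + 1) + k) * deg c d l (1 + p.snd) q.snd
          + c * d * q.fst * p.snd)) •
      skewSym Q c d (finSumFinEquiv.trans (finCongr p.add)) (finSumFinEquiv.trans (finCongr q.add))
        (Q.comp (deg_comp c d h p q)
          (Q.relabel (Equiv.refl _) finSumFinEquiv.symm (η (p.fst, q.fst + 1)))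
          (Q.relabel finSumFinEquiv.symm (Equiv.refl _) (ξ (1 + p.snd, q.snd)))))
    (fun η η' ξ => by
      funext s
      simp only [Pi.add_apply, map_add, LinearMap.add_apply, smul_add, Finset.sum_add_distrib])
    (fun a η ξ => by
      funext s
      simp only [Pi.smul_apply, map_smul, LinearMap.smul_apply, Finset.smul_sum]
      refine Finset.sum_congr rfl fun p _ => Finset.sum_congr rfl fun q _ => ?_
      rw [smul_comm])
    (fun η ξ ξ' => by
      funext s
      simp only [Pi.add_apply, map_add, smul_add, Finset.sum_add_distrib])
    (fun a η ξ => by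
      funext s
      simp only [Pi.smul_apply, map_smul, Finset.smul_sum]
      refine Finset.sum_congr rfl fun p _ => Finset.sum_congr rfl fun q _ => ?_
      rw [smul_comm])

/-- The differential of `Q`, applied to every member of a family. -/
def Fam.diff (D : Endo Q 1) {k l : ℤ} (h : k + 1 = l) : Fam Q c d k →ₗ[K] Fam Q c d l :=
  LinearMap.pi fun s => (D.app (deg_add c d h s.1 s.2)) ∘ₗ (LinearMap.proj s)

/-- The degree `k` part of `∏_{m,n≥1} (Q(m,n) ⊗ sgn_m^{⊗|c|} ⊗ sgn_n^{⊗|d|})^{S_m×S_n}[c(1-m)+d(1-n)]`. -/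
def defSpace (Q : ProperadData.{u} K ℤ) (c d k : ℤ) : Submodule K (Fam Q c d k) where
  carrier := { η |
    (∀ (s : ℕ × ℕ) (σ : Equiv.Perm (Fin s.1)) (τ : Equiv.Perm (Fin s.2)),
      Q.relabel σ τ (η s) = (psign K c σ * psign K d τ) • η s) ∧
    ∀ s : ℕ × ℕ, s.1 = 0 ∨ s.2 = 0 → η s = 0 }
  zero_mem' := ⟨by simp, by simp⟩
  add_mem' := by
    rintro η ξ ⟨h₁, h₂⟩ ⟨h₁', h₂'⟩
    refine ⟨fun s σ τ => ?_, fun s hs => ?_⟩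
    · simp only [Pi.add_apply, map_add, h₁, h₁', smul_add]
    · simp only [Pi.add_apply, h₂ s hs, h₂' s hs, add_zero]
  smul_mem' := by
    rintro a η ⟨h₁, h₂⟩
    refine ⟨fun s σ τ => ?_, fun s hs => ?_⟩
    · simp only [Pi.smul_apply, map_smul, h₁]
      rw [smul_comm]
    · simp only [Pi.smul_apply, h₂ s hs, smul_zero]

theorem psign_mul {m : ℕ} (c : ℤ) (σ τ : Equiv.Perm (Fin m)) :
    psign K c (σ * τ) = psign K c σ * psign K c τ := by
  simp [psign, mul_zpow]

theorem psign_mul_self {m : ℕ} (c : ℤ) (σ : Equiv.Perm (Fin m)) :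
    psign K c σ * psign K c σ = 1 := by
  simp only [psign]
  norm_cast
  simp

theorem skewSym_relabel (hQ : Q.IsProperad (AddMonoidHom.id ℤ)) {A B : Type} [Finite A] [Finite B]
    {m n : ℕ} {i : ℤ} (e : A ≃ Fin m) (f : B ≃ Fin n) (σ : Equiv.Perm (Fin m))
    (τ : Equiv.Perm (Fin n)) (x : Q.obj A B i) :
    Q.relabel σ τ (skewSym Q c d e f x) = (psign K c σ * psign K d τ) • skewSym Q c d e f x := by
  simp only [skewSym, LinearMap.sum_apply, LinearMap.smul_apply, map_sum, map_smul,
    ← hQ.relabel_trans, Finset.smul_sum, smul_smul]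
  refine Fintype.sum_equiv (Equiv.mulLeft σ) _ _ fun σ' => ?_
  refine Fintype.sum_equiv (Equiv.mulLeft τ) _ _ fun τ' => ?_
  simp only [Equiv.coe_mulLeft, psign_mul]
  congr 1
  linear_combination (-psign K c σ' * psign K d τ' * psign K c σ * psign K c σ) * psign_mul_self (K := K) d τ
    - psign K c σ' * psign K d τ' * psign_mul_self (K := K) c σ

theorem star_mem (hQ : Q.IsProperad (AddMonoidHom.id ℤ)) {k l t : ℤ} (h : k + l = t)
    {η : Fam Q c d k} {ξ : Fam Q c d l} (hη : η ∈ defSpace Q c d k) (hξ : ξ ∈ defSpace Q c d l) :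
    star Q c d h η ξ ∈ defSpace Q c d t := by
  refine ⟨fun s σ τ => ?_, fun s hs => ?_⟩
  · simp only [star, LinearMap.mk₂_apply, map_sum, map_smul, skewSym_relabel hQ, Finset.smul_sum]
    refine Finset.sum_congr rfl fun p _ => Finset.sum_congr rfl fun q _ => ?_
    rw [smul_comm]
  · simp only [star, LinearMap.mk₂_apply]
    refine Finset.sum_eq_zero fun p _ => Finset.sum_eq_zero fun q _ => ?_
    rcases hs with hs | hs
    · rw [hη.2 (p.fst, q.fst + 1) (Or.inl (by have := p.add; dsimp only; omega))]
      simp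
    · rw [hξ.2 (1 + p.snd, q.snd) (Or.inr (by have := q.add; dsimp only; omega))]
      simp

theorem Fam.diff_mem {D : Endo Q 1} (hD : D ∈ Der Q 1) {k l : ℤ} (h : k + 1 = l) {η : Fam Q c d k}
    (hη : η ∈ defSpace Q c d k) : Fam.diff D h η ∈ defSpace Q c d l := by
  refine ⟨fun s σ τ => ?_, fun s hs => ?_⟩
  · simp only [Fam.diff, LinearMap.pi_apply, LinearMap.comp_apply, LinearMap.proj_apply]
    rw [← hD.1, hη.1, map_smul]
  · simp only [Fam.diff, LinearMap.pi_apply, LinearMap.comp_apply, LinearMap.proj_apply]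
    rw [hη.2 s hs, map_zero]

end Families

section LieAlgebras

/-- The data of a dg Lie algebra, with a differential of degree one. -/
structure DGLieData (K : Type v) [Field K] where
  obj : ℤ → Type w
  [grp : ∀ k, AddCommGroup (obj k)]
  [mod : ∀ k, Module K (obj k)]
  d : ∀ {i j : ℤ}, i + 1 = j → (obj i →ₗ[K] obj j)
  bracket : ∀ {i j k : ℤ}, i + j = k → (obj i →ₗ[K] obj j →ₗ[K] obj k)

attribute [instance] DGLieData.grp DGLieData.mod

variable {K : Type v} [Field K]

structure DGLieData.IsDGLie (L : DGLieData.{v, w} K) : Prop where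
  skew : ∀ {i j k : ℤ} (h : i + j = k) (h' : j + i = k) (x : L.obj i) (y : L.obj j),
    L.bracket h x y = -(ksign K (i * j) • L.bracket h' y x)
  jacobi : ∀ {i j k ij jk ik t : ℤ} (h₁ : j + k = jk) (h₂ : i + jk = t) (h₃ : i + j = ij)
    (h₄ : ij + k = t) (h₅ : i + k = ik) (h₆ : j + ik = t) (x : L.obj i) (y : L.obj j)
    (z : L.obj k),
    L.bracket h₂ x (L.bracket h₁ y z) =
      L.bracket h₄ (L.bracket h₃ x y) z + ksign K (i * j) • L.bracket h₆ y (L.bracket h₅ x z)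
  d_d : ∀ {i j k : ℤ} (h : i + 1 = j) (h' : j + 1 = k) (x : L.obj i), L.d h' (L.d h x) = 0
  d_bracket : ∀ {i j k i' j' k' : ℤ} (h : i + j = k) (hi : i + 1 = i') (hj : j + 1 = j')
    (hk : k + 1 = k') (h' : i' + j = k') (h'' : i + j' = k') (x : L.obj i) (y : L.obj j),
    L.d hk (L.bracket h x y) =
      L.bracket h' (L.d hi x) y + ksign K i • L.bracket h'' x (L.d hj y)

/-- Morphisms of dg Lie algebras. -/
structure DGLieData.Hom (L : DGLieData.{v, w} K) (L' : DGLieData.{v, u} K) where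
  app : ∀ {k : ℤ}, L.obj k →ₗ[K] L'.obj k
  map_d : ∀ {i j : ℤ} (h : i + 1 = j) (x : L.obj i), app (L.d h x) = L'.d h (app x)
  map_bracket : ∀ {i j k : ℤ} (h : i + j = k) (x : L.obj i) (y : L.obj j),
    app (L.bracket h x y) = L'.bracket h (app x) (app y)

end LieAlgebras

section Cohomology

variable {K : Type v} [Field K]

/-- The cohomology `ker g / im f`. -/
abbrev Coh {M N N' : Type*} [AddCommGroup M] [Module K M] [AddCommGroup N] [Module K N]
    [AddCommGroup N'] [Module K N'] (f : M →ₗ[K] N) (g : N →ₗ[K] N') : Type _ :=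
  ↥(LinearMap.ker g) ⧸ (LinearMap.range f).submoduleOf (LinearMap.ker g)

section Functoriality

variable {M₁ N₁ N₁' M₂ N₂ N₂' M₃ N₃ N₃' : Type*}
  [AddCommGroup M₁] [Module K M₁] [AddCommGroup N₁] [Module K N₁] [AddCommGroup N₁'] [Module K N₁']
  [AddCommGroup M₂] [Module K M₂] [AddCommGroup N₂] [Module K N₂] [AddCommGroup N₂'] [Module K N₂']
  [AddCommGroup M₃] [Module K M₃] [AddCommGroup N₃] [Module K N₃] [AddCommGroup N₃'] [Module K N₃']
  {f₁ : M₁ →ₗ[K] N₁} {g₁ : N₁ →ₗ[K] N₁'} {f₂ : M₂ →ₗ[K] N₂} {g₂ : N₂ →ₗ[K] N₂'}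
  {f₃ : M₃ →ₗ[K] N₃} {g₃ : N₃ →ₗ[K] N₃'}

/-- The class of a cocycle. -/
def Coh.mk (f₁ : M₁ →ₗ[K] N₁) {g₁ : N₁ →ₗ[K] N₁'} (x : N₁) (hx : g₁ x = 0) : Coh f₁ g₁ :=
  Submodule.Quotient.mk ⟨x, hx⟩

def Coh.map (p : N₁ →ₗ[K] N₂) (hp : ∀ x, g₁ x = 0 → g₂ (p x) = 0)
    (hp' : ∀ x, ∃ y, p (f₁ x) = f₂ y) : Coh f₁ g₁ →ₗ[K] Coh f₂ g₂ :=
  Submodule.mapQ _ _ (p.restrict hp) (by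
    rintro ⟨_, hx⟩ ⟨x, rfl⟩
    obtain ⟨y, hy⟩ := hp' x
    exact ⟨y, hy.symm⟩)

def Coh.map₂ (b : N₁ →ₗ[K] N₂ →ₗ[K] N₃) (hb : ∀ x y, g₁ x = 0 → g₂ y = 0 → g₃ (b x y) = 0)
    (hl : ∀ x y, g₂ y = 0 → ∃ z, b (f₁ x) y = f₃ z)
    (hr : ∀ x y, g₁ x = 0 → ∃ z, b x (f₂ y) = f₃ z) :
    Coh f₁ g₁ →ₗ[K] Coh f₂ g₂ →ₗ[K] Coh f₃ g₃ :=
  Submodule.liftQ _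
    (LinearMap.mk₂ K
      (fun (x : LinearMap.ker g₁) (y : Coh f₂ g₂) =>
        Coh.map (f₁ := f₂) (g₁ := g₂) (f₂ := f₃) (g₂ := g₃) (b x) (fun y hy => hb x y x.2 hy)
          (fun y => hr x y x.2) y)
      (fun x x' y => by
        obtain ⟨y, rfl⟩ := Submodule.Quotient.mk_surjective _ y
        refine congrArg Submodule.Quotient.mk (Subtype.ext ?_)
        change b (x + x' : N₁) (y : N₂) = b x y + b x' y
        rw [map_add, LinearMap.add_apply])
      (fun a x y => by
        obtain ⟨y, rfl⟩ := Submodule.Quotient.mk_surjective _ y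
        refine congrArg Submodule.Quotient.mk (Subtype.ext ?_)
        change b (a • x : N₁) (y : N₂) = a • b x y
        rw [map_smul, LinearMap.smul_apply])
      (fun x y y' => map_add _ y y')
      (fun a x y => map_smul _ a y))
    (by
      rintro ⟨_, hx⟩ ⟨x, rfl⟩
      refine LinearMap.ext fun y => ?_
      obtain ⟨y, rfl⟩ := Submodule.Quotient.mk_surjective _ y
      obtain ⟨z, hz⟩ := hl x y y.2
      exact (Submodule.Quotient.mk_eq_zero _).2 ⟨z, hz.symm⟩)

end Functoriality

/-- The cohomology of a dg Lie algebra. -/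
abbrev DGLieData.cohomology (L : DGLieData.{v, w} K) (k : ℤ) : Type w :=
  Coh (L.d (show k - 1 + 1 = k by ring)) (L.d (show k + 1 = k + 1 from rfl))

/-- The bracket induced on the cohomology of a dg Lie algebra. -/
def DGLieData.IsDGLie.bracket {L : DGLieData.{v, w} K} (hL : L.IsDGLie) {i j k : ℤ}
    (h : i + j = k) : L.cohomology i →ₗ[K] L.cohomology j →ₗ[K] L.cohomology k :=
  Coh.map₂ (L.bracket h)
    (fun x y hx hy => by
      rw [hL.d_bracket h rfl rfl rfl (by rw [← h]; ring) (by rw [← h]; ring), hx, hy]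
      simp)
    (fun x y hy => by
      refine ⟨L.bracket (show i - 1 + j = k - 1 by rw [← h]; ring) x y, ?_⟩
      rw [hL.d_bracket (i' := i) (j' := j + 1) _ (by ring) rfl _ h (by rw [← h]; ring), hy]
      simp)
    (fun x y hx => by
      refine ⟨ksign K i • L.bracket (show i + (j - 1) = k - 1 by rw [← h]; ring) x y, ?_⟩
      rw [map_smul, hL.d_bracket (i' := i + 1) (j' := j) _ rfl (by ring) _ (by rw [← h]; ring) h,
        hx, smul_add, smul_smul, ← ksign_add]
      simp [ksign])

variable {Q : ProperadData.{u} K ℤ}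

theorem Der.app_one (hQ : Q.IsProperad (AddMonoidHom.id ℤ)) {r j : ℤ} {D : Endo Q r}
    (hD : D ∈ Der Q r) (h : 0 + r = j) : D.app h Q.one = 0 := by
  have key := hD.2 (zero_add 0) h h h
    (Q.relabel (Equiv.refl (Fin 1)) (Equiv.emptySum Empty (Fin 1)).symm Q.one)
    (Q.relabel (Equiv.sumEmpty (Fin 1) Empty).symm (Equiv.refl (Fin 1)) Q.one)
  rw [hQ.one_comp, hD.1, hD.1, hD.1] at key
  have h1 := hQ.comp_one (i := j)
    (Q.relabel (Equiv.refl (Fin 1)) (Equiv.emptySum Empty (Fin 1)).symm (D.app h Q.one))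
  have h2 := hQ.one_comp (i := j)
    (Q.relabel (Equiv.sumEmpty (Fin 1) Empty).symm (Equiv.refl (Fin 1)) (D.app h Q.one))
  have h0 : ksign K (r * 0) = 1 := by simp [ksign]
  rw [h1, h2, h0, one_smul] at key
  have key' := right_eq_add.1 key
  have := congrArg (Q.relabel (Equiv.sumEmpty (Fin 1) Empty) (Equiv.emptySum Empty (Fin 1))) key'
  rw [← hQ.relabel_trans, ← hQ.relabel_trans, map_zero] at this
  simpa [hQ.relabel_refl] using this

/-- The cohomology of a component of `Q` with respect to `D`. -/
abbrev cohObj (D : Endo Q 1) (A B : Type) [Finite A] [Finite B] (i : ℤ) : Type u :=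
  Coh (D.app (A := A) (B := B) (show i - 1 + 1 = i by ring)) (D.app (show i + 1 = i + 1 from rfl))

/-- The cohomology properad of a properad with a derivation `D` of degree one and square zero. -/
def cohProperad (hQ : Q.IsProperad (AddMonoidHom.id ℤ)) {D : Endo Q 1} (hD : D ∈ Der Q 1) :
    ProperadData.{u} K ℤ where
  obj A B _ _ i := cohObj D A B i
  one := Coh.mk _ Q.one (Der.app_one hQ hD rfl)
  relabel e f := Coh.map (Q.relabel e f)
    (fun x hx => by rw [hD.1, hx, map_zero])
    (fun x => ⟨Q.relabel e f x, by rw [hD.1]⟩)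
  comp {A B C X E} _ _ _ _ _ _ {i j k} h := Coh.map₂ (Q.comp h)
    (fun x y hx hy => by rw [hD.2 h rfl rfl rfl, hx, hy]; simp)
    (fun x y hy => by
      refine ⟨Q.comp (show i - 1 + j = k - 1 by rw [← h]; ring) x y, ?_⟩
      rw [hD.2 (i' := i) (j' := j + 1) _ (by ring) rfl, hy]
      simp)
    (fun x y hx => by
      refine ⟨ksign K i • Q.comp (show i + (j - 1) = k - 1 by rw [← h]; ring) x y, ?_⟩
      rw [map_smul, hD.2 (i' := i + 1) (j' := j) _ rfl (by ring), hx, smul_add, smul_smul,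
        ← ksign_add]
      simp [ksign])

end Cohomology

section HomotopyLieBialgebras

variable (K : Type v) [Field K] (c d : ℤ)

/-- One generator with `m` outputs and `n` inputs, of degree `1 + c(1-m) + d(1-n)`, for all
`m, n ≥ 1` with `m + n ≥ 3`. -/
inductive HoGen (c d : ℤ) : (A B : Type) → ℤ → Type
  | e (m n : ℕ) (h : 1 ≤ m ∧ 1 ≤ n ∧ 3 ≤ m + n) : HoGen c d (Fin m) (Fin n) (deg c d 1 m n)

/-- The generators span `sgn_m^{⊗|c|} ⊗ sgn_n^{⊗|d|}`. -/
inductive HoRel : ∀ (A B : Type) (i : ℤ), Term K (HoGen c d) A B i → Term K (HoGen c d) A B i → Prop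
  | symm (m n : ℕ) (h : 1 ≤ m ∧ 1 ≤ n ∧ 3 ≤ m + n) (σ : Equiv.Perm (Fin m))
      (τ : Equiv.Perm (Fin n)) :
      HoRel (Fin m) (Fin n) (deg c d 1 m n) (.relabel σ τ (.gen (.e m n h)))
        (.smul (psign K c σ * psign K d τ) (.gen (.e m n h)))

/-- The free properad on the generators of homotopy Lie `(c,d)`-bialgebras. -/
def HoLB : ProperadData.{max 1 v} K ℤ := GradedPresented (HoRel K c d)

/-- The family of all generators. -/
def HoLB.e : Fam (HoLB K c d) c d 1 := fun s =>
  if h : 1 ≤ s.1 ∧ 1 ≤ s.2 ∧ 3 ≤ s.1 + s.2 then Presented.gen _ _ (.e s.1 s.2 h) else 0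

theorem HoLB.law : (HoLB K c d).IsProperad (AddMonoidHom.id ℤ) := Presented.isProperad _ _

theorem HoLB.e_pos {s : ℕ × ℕ} (h : 1 ≤ s.1 ∧ 1 ≤ s.2 ∧ 3 ≤ s.1 + s.2) :
    HoLB.e K c d s = Presented.gen (AddMonoidHom.id ℤ) (HoRel K c d) (.e s.1 s.2 h) := dif_pos h

theorem HoLB.e_neg {s : ℕ × ℕ} (h : ¬(1 ≤ s.1 ∧ 1 ≤ s.2 ∧ 3 ≤ s.1 + s.2)) :
    HoLB.e K c d s = 0 := dif_neg h

theorem HoLB.e_mem : HoLB.e K c d ∈ defSpace (HoLB K c d) c d 1 := by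
  refine ⟨fun s σ τ => ?_, fun s hs => ?_⟩
  · by_cases h : 1 ≤ s.1 ∧ 1 ≤ s.2 ∧ 3 ≤ s.1 + s.2
    · rw [HoLB.e_pos K c d h]
      exact Presented.sound (Rel.of (HoRel.symm s.1 s.2 h σ τ))
    · rw [HoLB.e_neg K c d h, map_zero, smul_zero]
  · exact HoLB.e_neg K c d (by omega)

/-- The differential of a generator: minus the sum of all graphs with two vertices, decorated by
generators and joined by exactly one edge. -/
def HoLB.dGen (s : ℕ × ℕ) {j : ℤ} (h : deg c d 1 s.1 s.2 + 1 = j) :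
    (HoLB K c d).obj (Fin s.1) (Fin s.2) j :=
  ((deg_add c d (show (1 : ℤ) + 1 = 2 by norm_num) s.1 s.2).symm.trans h) ▸
    -(star (HoLB K c d) c d (show (1 : ℤ) + 1 = 2 by norm_num) (HoLB.e K c d) (HoLB.e K c d) s)

theorem HoLB.dGen_relabel (s : ℕ × ℕ) {j : ℤ} (h : deg c d 1 s.1 s.2 + 1 = j)
    (σ : Equiv.Perm (Fin s.1)) (τ : Equiv.Perm (Fin s.2)) :
    (HoLB K c d).relabel σ τ (HoLB.dGen K c d s h) =
      (psign K c σ * psign K d τ) • HoLB.dGen K c d s h := by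
  have h' := (deg_add c d (show (1 : ℤ) + 1 = 2 by norm_num) s.1 s.2).symm.trans h
  subst h'
  simp only [HoLB.dGen, map_neg, smul_neg]
  rw [(star_mem (HoLB.law K c d) _ (HoLB.e_mem K c d) (HoLB.e_mem K c d)).1]

/-- The differential on the generators. -/
def HoLB.dGens (A B : Type) [Finite A] [Finite B] (i j : ℤ) (h : i + 1 = j)
    (g : HoGen c d A B i) : (HoLB K c d).obj A B j := by
  cases g with
  | e m n _ => exact HoLB.dGen K c d (m, n) h

theorem HoLB.dGens_rel {A B : Type} {i : ℤ} {x y : Term K (HoGen c d) A B i}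
    (h : HoRel K c d A B i x y) (j : ℤ) (hj : i + 1 = j) :
    Term.der (R := HoRel K c d) (HoLB.dGens K c d) x j hj = Term.der (HoLB.dGens K c d) y j hj := by
  obtain ⟨m, n, h, σ, τ⟩ := h
  exact HoLB.dGen_relabel K c d (m, n) hj σ τ

/-- The differential of the properad `HoLB`. -/
def HoLB.diff : Endo (HoLB K c d) 1 :=
  Presented.der (R := HoRel K c d) (HoLB.dGens K c d) (HoLB.dGens_rel K c d)

theorem HoLB.diff_mem : HoLB.diff K c d ∈ Der (HoLB K c d) 1 :=
  Presented.der_mem (R := HoRel K c d) (HoLB.dGens K c d) (HoLB.dGens_rel K c d)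

/-- The values of the differential on the generators. -/
theorem HoLB.diff_e (s : ℕ × ℕ) (h : 1 ≤ s.1 ∧ 1 ≤ s.2 ∧ 3 ≤ s.1 + s.2) :
    (HoLB.diff K c d).app (deg_add c d (show (1 : ℤ) + 1 = 2 by norm_num) s.1 s.2) (HoLB.e K c d s)
      = -star (HoLB K c d) c d (show (1 : ℤ) + 1 = 2 by norm_num) (HoLB.e K c d) (HoLB.e K c d) s := by
  rw [HoLB.e_pos K c d h]
  rfl

variable {K}

/-- A dg properad under `HoLB`: a morphism of dg properads from `HoLB` to `P`. -/
structure UnderHoLB (P : DGProperad.{u} K) (c d : ℤ) where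
  hom : (HoLB K c d).Hom P.data
  map_d : ∀ {A B : Type} [Finite A] [Finite B] {i j : ℤ} (h : i + 1 = j) (x : (HoLB K c d).obj A B i),
    hom.app ((HoLB.diff K c d).app h x) = P.d.app h (hom.app x)

variable {c d} {P : DGProperad.{u} K} (f : UnderHoLB P c d)

/-- The images in `P` of the generators of `HoLB`. -/
def UnderHoLB.π : Fam P.data c d 1 := Fam.map f.hom (HoLB.e K c d)

theorem UnderHoLB.π_mem : f.π ∈ defSpace P.data c d 1 := by
  have h := HoLB.e_mem K c d
  refine ⟨fun s σ τ => ?_, fun s hs => ?_⟩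
  · simp only [UnderHoLB.π, Fam.map]
    rw [← f.hom.map_relabel, h.1, map_smul]
  · simp only [UnderHoLB.π, Fam.map]
    rw [h.2 s hs, map_zero]

/-- The deformation complex of the morphism `f`, as a dg Lie algebra. -/
def UnderHoLB.defLie : DGLieData.{v, u} K where
  obj k := defSpace P.data c d k
  d {i j} h := LinearMap.restrict
    (Fam.diff P.d h + star P.data c d (show 1 + i = j by omega) f.π
      - ksign K i • (star P.data c d h).flip f.π)
    (fun _ hη => Submodule.sub_mem _
      (Submodule.add_mem _ (Fam.diff_mem P.d_mem h hη) (star_mem P.law _ f.π_mem hη))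
      (Submodule.smul_mem _ _ (star_mem P.law h hη f.π_mem)))
  bracket {i j k} h := LinearMap.mk₂ K
    (fun η ξ => ⟨ksign K (i * j) • star P.data c d (show j + i = k by omega) ξ η
      - star P.data c d h η ξ, Submodule.sub_mem _
        (Submodule.smul_mem _ _ (star_mem P.law _ ξ.2 η.2)) (star_mem P.law h η.2 ξ.2)⟩)
    (fun η η' ξ => by
      ext1
      simp only [Submodule.coe_add, map_add, LinearMap.add_apply, smul_add]
      abel)
    (fun a η ξ => by
      ext1
      simp only [Submodule.coe_smul, map_smul, LinearMap.smul_apply, smul_sub]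
      rw [smul_comm])
    (fun η ξ ξ' => by
      ext1
      simp only [Submodule.coe_add, map_add, LinearMap.add_apply, smul_add]
      abel)
    (fun a η ξ => by
      ext1
      simp only [Submodule.coe_smul, map_smul, LinearMap.smul_apply, smul_sub]
      rw [smul_comm])

end HomotopyLieBialgebras

section TwistedProperad

variable {K : Type v} [Field K] (P : DGProperad.{u} K) (c d : ℤ)

/-- The generators of the twisted properad: the elements of `P`, of weight zero, and the
Maurer-Cartan generators with `m ≥ 1` outputs and no inputs, of weight one. -/
inductive TwGen : (A B : Type) → ℤ × ℕ → Type (max 1 u)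
  | of {A B : Type} [Finite A] [Finite B] {i : ℤ} (a : P.data.obj A B i) : TwGen A B (i, 0)
  | mc (m : ℕ) : TwGen (Fin (m + 1)) (Fin 0) (deg c d 0 (m + 1) 0, 1)

/-- The relations that make `P` a subproperad, and the symmetry of the Maurer-Cartan generators. -/
inductive TwRel : ∀ (A B : Type) (i : ℤ × ℕ), Term K (TwGen P c d) A B i →
    Term K (TwGen P c d) A B i → Prop
  | of_add {A B : Type} [Finite A] [Finite B] {i : ℤ} (a b : P.data.obj A B i) :
      TwRel A B (i, 0) (.gen (.of (a + b))) (.add (.gen (.of a)) (.gen (.of b)))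
  | of_smul {A B : Type} [Finite A] [Finite B] {i : ℤ} (r : K) (a : P.data.obj A B i) :
      TwRel A B (i, 0) (.gen (.of (r • a))) (.smul r (.gen (.of a)))
  | of_one : TwRel (Fin 1) (Fin 1) 0 (.gen (.of P.data.one)) .one
  | of_relabel {A A' B B' : Type} [Finite A] [Finite A'] [Finite B] [Finite B'] {i : ℤ}
      (e : A ≃ A') (f : B ≃ B') (a : P.data.obj A B i) :
      TwRel A' B' (i, 0) (.gen (.of (P.data.relabel e f a))) (.relabel e f (.gen (.of a)))
  | of_comp {A B C D E : Type} [Finite A] [Finite B] [Finite C] [Finite D] [Finite E] [Nonempty E]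
      {i j k : ℤ} (h : i + j = k) (a : P.data.obj A (B ⊕ E) i) (b : P.data.obj (E ⊕ C) D j) :
      TwRel (A ⊕ C) (B ⊕ D) (k, 0) (.gen (.of (P.data.comp h a b)))
        (.comp (Prod.ext h rfl : ((i, 0) : ℤ × ℕ) + (j, 0) = (k, 0)) (.gen (.of a)) (.gen (.of b)))
  | mc_symm (m : ℕ) (σ : Equiv.Perm (Fin (m + 1))) :
      TwRel (Fin (m + 1)) (Fin 0) (deg c d 0 (m + 1) 0, 1)
        (.relabel σ (Equiv.refl (Fin 0)) (.gen (.mc m))) (.smul (psign K c σ) (.gen (.mc m)))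

/-- The properad freely generated by `P` and the Maurer-Cartan generators, with its grading by the
number of Maurer-Cartan generators. -/
def twFree : ProperadData.{max 1 u v} K (ℤ × ℕ) :=
  Presented (AddMonoidHom.fst ℤ ℕ) (TwRel P c d)

/-- The completion of the properad freely generated by `P` and the Maurer-Cartan generators. -/
def tw : ProperadData.{max 1 u v} K ℤ := (twFree P c d).completion

theorem tw_law : (tw P c d).IsProperad (AddMonoidHom.id ℤ) :=
  ProperadData.completion_isProperad (Presented.isProperad _ _)

/-- The weight zero elements given by the elements of `P`. -/
def twOf₀ {A B : Type} [Finite A] [Finite B] {i : ℤ} :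
    P.data.obj A B i →ₗ[K] (twFree P c d).obj A B (i, 0) where
  toFun a := Presented.gen (AddMonoidHom.fst ℤ ℕ) (TwRel P c d) (.of a)
  map_add' a b := Presented.sound (Rel.of (TwRel.of_add a b))
  map_smul' r a := Presented.sound (Rel.of (TwRel.of_smul r a))

/-- The component of weight `N` of the inclusion of `P`. -/
def twOfWeight (A B : Type) [Finite A] [Finite B] (i : ℤ) :
    ∀ N : ℕ, P.data.obj A B i →ₗ[K] (twFree P c d).obj A B (i, N)
  | 0 => twOf₀ P c d
  | _ + 1 => 0

/-- The inclusion of `P`. -/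
def twOf : P.data.Hom (tw P c d) where
  app {A B} _ _ i := LinearMap.pi (twOfWeight P c d A B i)
  map_one := by
    funext N
    rcases N with _ | N
    · exact Presented.sound (Rel.of TwRel.of_one)
    · rfl
  map_relabel e f x := by
    funext N
    refine Eq.trans ?_ (ProperadData.completion_relabel (twFree P c d) e f _ N).symm
    rcases N with _ | N
    · exact Presented.sound (Rel.of (TwRel.of_relabel e f x))
    · exact (map_zero ((twFree P c d).relabel e f)).symm
  map_comp {A B C D E} _ _ _ _ _ _ {i j k} h x y := by
    funext N
    refine Eq.trans ?_ (ProperadData.completion_comp (twFree P c d) h _ _ N).symm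
    rw [sum_left_zero]
    · rcases N with _ | N
      · exact Presented.sound (Rel.of (TwRel.of_comp h x y))
      · exact (map_zero ((twFree P c d).comp (split_index h ⟨0, N + 1, _⟩) _)).symm
    · rintro ⟨p, q, hpq⟩ hp
      obtain ⟨p, rfl⟩ := Nat.exists_eq_succ_of_ne_zero hp
      exact LinearMap.map_zero₂ ((twFree P c d).comp (split_index h ⟨p + 1, q, hpq⟩)) _

/-- The family of the Maurer-Cartan generators. -/
def mcFam : Fam (tw P c d) c d 0
  | (m + 1, 0) => Pi.single (M := fun N : ℕ =>
      (twFree P c d).obj (Fin (m + 1)) (Fin 0) (deg c d 0 (m + 1) 0, N)) 1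
      (Presented.gen (AddMonoidHom.fst ℤ ℕ) (TwRel P c d) (.mc m))
  | _ => 0

variable {P c d}

/-- The sum over all ways to attach one Maurer-Cartan generator, by one of its outputs, to an input
of a member of the family `η`. -/
def attachMC {k : ℤ} : Fam (tw P c d) c d k →ₗ[K] Fam (tw P c d) c d k :=
  (star (tw P c d) c d (add_zero k)).flip (mcFam P c d)

/-- The family of the sums, over all `k ≥ 0`, of `1/k!` times all ways to attach successively `k`
Maurer-Cartan generators to a member of the family `η` in `P`. The summand with index `k` has
weight `k`. -/
def expMC {k : ℤ} (η : Fam P.data c d k) : Fam (tw P c d) c d k := fun s N =>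
  ((N ! : ℕ) : K)⁻¹ • ((attachMC^[N] (Fam.map (twOf P c d) η)) s N)

/-- The bijection that splits off one element. -/
def splitFront {A : Type} (a : A) : A ≃ Fin 1 ⊕ {b : A // b ≠ a} := by
  classical
  exact (Equiv.sumCompl (fun b => b = a)).symm.trans
    (Equiv.sumCongr (Equiv.ofUnique _ (Fin 1)) (Equiv.refl _))

/-- The inner derivation of a properad that is given by an element `h` with one output and one
input: the sum of all ways to attach `h` to an output, minus the sum of all ways to attach it to
an input, with a sign. -/
def innerMap {Q : ProperadData.{u} K ℤ} {r : ℤ} (h : Q.obj (Fin 1) (Fin 1) r) {A B : Type}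
    [Finite A] [Finite B] {i j : ℤ} (hj : i + r = j) (a : Q.obj A B i) : Q.obj A B j :=
  letI := Fintype.ofFinite A
  letI := Fintype.ofFinite B
  ∑ o : A, Q.relabel (splitFront o).symm (Equiv.emptySum Empty B)
      (Q.comp (show r + i = j by omega)
        (Q.relabel (Equiv.refl (Fin 1)) (Equiv.emptySum Empty (Fin 1)).symm h)
        (Q.relabel (splitFront o) (Equiv.refl B) a))
    - ksign K (r * i) • ∑ b : B,
      Q.relabel (Equiv.sumEmpty A Empty) ((splitFront b).trans (Equiv.sumComm _ _)).symm
      (Q.comp hj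
        (Q.relabel (Equiv.refl A) ((splitFront b).trans (Equiv.sumComm _ _)) a)
        (Q.relabel (Equiv.sumEmpty (Fin 1) Empty).symm (Equiv.refl (Fin 1)) h))

/-- The restriction of a bilinear map to submodules. -/
def restrict₂ {M N L : Type*} [AddCommGroup M] [Module K M] [AddCommGroup N] [Module K N]
    [AddCommGroup L] [Module K L] (b : M →ₗ[K] N →ₗ[K] L) {p : Submodule K M} {q : Submodule K N}
    {r : Submodule K L} (h : ∀ x ∈ p, ∀ y ∈ q, b x y ∈ r) : p →ₗ[K] q →ₗ[K] r :=
  LinearMap.mk₂ K (fun x y => ⟨b x y, h x x.2 y y.2⟩)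
    (fun x x' y => Subtype.ext (LinearMap.map_add₂ b (x : M) (x' : M) (y : N)))
    (fun a x y => Subtype.ext (LinearMap.map_smul₂ b a (x : M) (y : N)))
    (fun x y y' => Subtype.ext (map_add (b x) (y : N) (y' : N)))
    (fun a x y => Subtype.ext (map_smul (b x) a (y : N)))

/-- The continuous derivations of degree `r` of a completed properad: for all `p` there is `q` such
that elements without terms of weight less than `q` have values without terms of weight less than
`p`. -/
def ContDer (W : ProperadData.{u} K (ℤ × ℕ)) (r : ℤ) : Submodule K (Endo W.completion r) where
  carrier := { D | D ∈ Der W.completion r ∧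
    ∀ (A B : Type) [Finite A] [Finite B] (i j : ℤ) (h : i + r = j) (p : ℕ), ∃ q : ℕ,
      ∀ x : W.completion.obj A B i, (∀ N < q, x N = 0) → ∀ N < p, D.app h x N = 0 }
  zero_mem' := ⟨Submodule.zero_mem _, fun _ _ _ _ _ _ _ _ => ⟨0, fun _ _ _ _ => rfl⟩⟩
  add_mem' := by
    rintro D D' ⟨h₁, h₂⟩ ⟨h₁', h₂'⟩
    refine ⟨Submodule.add_mem _ h₁ h₁', fun A B _ _ i j h p => ?_⟩
    obtain ⟨q, hq⟩ := h₂ A B i j h p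
    obtain ⟨q', hq'⟩ := h₂' A B i j h p
    refine ⟨max q q', fun x hx N hN => ?_⟩
    have e₁ := hq x (fun N hN => hx N (lt_max_of_lt_left hN)) N hN
    have e₂ := hq' x (fun N hN => hx N (lt_max_of_lt_right hN)) N hN
    exact (congrArg₂ (· + ·) e₁ e₂).trans (add_zero _)
  smul_mem' := by
    rintro a D ⟨h₁, h₂⟩
    refine ⟨Submodule.smul_mem _ a h₁, fun A B _ _ i j h p => ?_⟩
    obtain ⟨q, hq⟩ := h₂ A B i j h p
    refine ⟨q, fun x hx N hN => ?_⟩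
    exact (congrArg (a • ·) (hq x hx N hN)).trans (smul_zero _)

theorem ContDer.comm_mem {W : ProperadData.{u} K (ℤ × ℕ)} {r s t : ℤ} (h : r + s = t)
    {D : Endo W.completion r} {E : Endo W.completion s} (hD : D ∈ ContDer W r)
    (hE : E ∈ ContDer W s) : Endo.comm h D E ∈ ContDer W t := by
  refine ⟨Der.comm_mem h hD.1 hE.1, fun A B _ _ i j hj p => ?_⟩
  obtain ⟨q₁, h₁⟩ := hD.2 A B (i + s) j (by omega) p
  obtain ⟨q₂, h₂⟩ := hE.2 A B i (i + s) rfl q₁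
  obtain ⟨q₃, h₃⟩ := hE.2 A B (i + r) j (by omega) p
  obtain ⟨q₄, h₄⟩ := hD.2 A B i (i + r) rfl q₃
  refine ⟨max q₂ q₄, fun x hx N hN => ?_⟩
  rw [Endo.comm_app h D E hj rfl (by omega) rfl (by omega)]
  have e₁ := h₁ _ (h₂ x fun N hN => hx N (lt_max_of_lt_left hN)) N hN
  have e₂ := h₃ _ (h₄ x fun N hN => hx N (lt_max_of_lt_right hN)) N hN
  exact (congrArg₂ (fun a b => a - ksign K (r * s) • b) e₁ e₂).trans
    ((congrArg (0 - ·) (smul_zero _)).trans (sub_zero 0))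

/-- The dg Lie algebra of the continuous derivations of a completed properad with a differential
`D`: the bracket is the graded commutator, the differential is the commutator with `D`. -/
def derLie (W : ProperadData.{u} K (ℤ × ℕ)) {D : Endo W.completion 1} (hD : D ∈ ContDer W 1) :
    DGLieData.{v, max 1 u} K where
  obj r := ContDer W r
  d {i j} h := LinearMap.restrict (Endo.comm (show 1 + i = j by omega) D)
    (fun _ hE => ContDer.comm_mem _ hD hE)
  bracket h := restrict₂ (Endo.comm h) fun _ hE _ hF => ContDer.comm_mem h hE hF

/-- The commutator of two derivations. -/
def Der.comm {Q : ProperadData.{u} K ℤ} {r s t : ℤ} (h : r + s = t) (D : Der Q r) (E : Der Q s) :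
    Der Q t := ⟨Endo.comm h D E, Der.comm_mem h D.2 E.2⟩

end TwistedProperad

section Action

variable {K : Type v} [Field K] {P : DGProperad.{u} K} {c d : ℤ}

theorem deg_one_one (c d : ℤ) {k i j : ℤ} (h : i + k = j) : i + deg c d k 1 1 = j := by
  simp [deg, h]

/-- The derivation `D` takes the values of the twisted differential on the generators: with
`♦ = ∑_{k≥0} (1/k!) π_{1,k+1}(MC,…,MC,-)` it is `a ↦ ∂a + ♦ ∘ a ∓ a ∘ ♦` on `P`, and on the
Maurer-Cartan generators it is `MC_m ↦ ♦ ∘ MC_m - ∑_{k≥1} (1/k!) π_{*,k}(MC,…,MC)`. -/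
structure UnderHoLB.IsTwistedDifferential (f : UnderHoLB P c d) (D : Endo (tw P c d) 1) : Prop where
  of : ∀ {A B : Type} [Finite A] [Finite B] {i j : ℤ} (h : i + 1 = j) (a : P.data.obj A B i),
    D.app h ((twOf P c d).app a) = (twOf P c d).app (P.d.app h a)
      + innerMap (expMC f.π (1, 1)) (deg_one_one c d h) ((twOf P c d).app a)
  mc : ∀ m : ℕ, D.app (deg_add c d (zero_add 1) (m + 1) 0) (mcFam P c d (m + 1, 0)) =
    innerMap (expMC f.π (1, 1)) (deg_one_one c d (deg_add c d (zero_add 1) (m + 1) 0))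
      (mcFam P c d (m + 1, 0)) - expMC f.π (m + 1, 0)

/-- The derivation `E` takes the values of the action of `γ` on the generators: with
`◊ = -∑_{k≥0} (1/k!) γ_{1,k+1}(MC,…,MC,-)` it is `a ↦ ◊ ∘ a ∓ a ∘ ◊` on `P`, and on the
Maurer-Cartan generators it is `MC_m ↦ ◊ ∘ MC_m + ∑_{k≥1} (1/k!) γ_{*,k}(MC,…,MC)`. -/
structure IsActionOf {k : ℤ} (γ : Fam P.data c d k) (E : Endo (tw P c d) k) : Prop where
  of : ∀ {A B : Type} [Finite A] [Finite B] {i j : ℤ} (h : i + k = j) (a : P.data.obj A B i),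
    E.app h ((twOf P c d).app a) =
      innerMap (-expMC γ (1, 1)) (deg_one_one c d h) ((twOf P c d).app a)
  mc : ∀ m : ℕ, E.app (deg_add c d (zero_add k) (m + 1) 0) (mcFam P c d (m + 1, 0)) =
    innerMap (-expMC γ (1, 1)) (deg_one_one c d (deg_add c d (zero_add k) (m + 1) 0))
      (mcFam P c d (m + 1, 0)) + expMC γ (m + 1, 0)

end Action

end Twisting

end

open Twisting

/-! The theorem is Lie theory in a dg Lie algebra of families. The product `star` is not
associative, but its associator is governed by graphs with three vertices. In (η ⋆ ξ) ⋆ ζ the vertex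
ζ hangs from ξ (a chain) or from η (a vee, with two lower vertices). In η ⋆ (ξ ⋆ ζ) the vertex η
sits above ξ (the same chain) or above ζ (a wedge, with two upper vertices). These are
`star_star_left` and `star_star_right`. Chains cancel in the associator, and vees and wedges are
symmetric, up to a Koszul sign, in their two parallel vertices. Hence the commutator `brk` satisfies
the Jacobi identity (`brk_jacobi`). The images π of the generators satisfy [π, π] = 2∂π
(`UnderHoLB.brk_pi_pi`), and the differential of Def is ∂ twisted by this Maurer-Cartan element.

In TwP the family • of Maurer-Cartan generators has degree zero and no inputs, so attaching one
generator is the adjoint action of • (`attachMC_eq_brk`). By the Jacobi identity it is a derivation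
of the bracket, and γ̂ is the exponential of it, applied to γ. Instead of multiplying exponential
series, the proof characterizes γ̂ by the equation Eη = [•, η], where the Euler derivation E
multiplies by the weight; a solution is determined by its part of weight zero. Since E and [•, -]
are both derivations of the bracket, γ ↦ γ̂ respects brackets (`expMC_brk`).

Let `outerDer γ` be the continuous derivation that kills P and sends •_m to γ̂_{m,0}. It sends ξ̂ to
the bracket of the part of γ̂ without inputs with ξ̂ (`outerDer_expMC`). In a component of [γ̂, ξ̂]
without inputs the lower vertex has no inputs either, so outer derivations represent the bracket
(`comm_outerDer`). In the (1,1)-component one extra term appears, the commutator of γ̂_{1,1} and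
ξ̂_{1,1} (`expOne_brk`). A derivation D and the inner derivation of h commute to the inner
derivation of D(h) (`comm_innerDer`), so this extra term is exactly what makes Φ_γ = `outerDer γ` −
D_h with h = γ̂_{1,1} respect brackets (`comm_actionDer`).

The twisted differential is ∂ − Φ_π, where ∂ is extended by zero to the Maurer-Cartan generators.
Since [∂, Φ_γ] = Φ_{∂γ} (`comm_baseDer_actionDer`), the Maurer-Cartan equation makes its square
vanish, and Φ intertwines the differentials. The statement about cohomology is formal.

Two technical layers carry this. Graphs are represented by blocks (`blk`), the symmetrizations of
operations whose legs are labelled by arbitrary finite sets; a change of enumeration only costs a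
sign `esgn`. Continuous derivations of the completed properad exist for compatible values on the
generators (`tw_exists_der`) and are determined by them (`tw_der_ext`): the Leibniz rule is
compatible with every properad law, and each weight of a value depends on finitely many weights of
the argument. -/

noncomputable section

namespace Twisting

/-! ### Enumerations of finite sets and the signs that compare them. -/

section Enumerations

variable {K : Type v} [Field K]

/-- The enumeration of a disjoint union. -/
def sumEnum {A B : Type} {m n : ℕ} (e : A ≃ Fin m) (f : B ≃ Fin n) : A ⊕ B ≃ Fin (m + n) :=
  (Equiv.sumCongr e f).trans finSumFinEquiv

/-- The sign `(-1)^{c|σ|}` of the permutation that relates two enumerations of a set. -/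
def esgn (K : Type v) [Field K] (c : ℤ) {A : Type} {m m' : ℕ} (e : A ≃ Fin m) (e' : A ≃ Fin m') : K :=
  psign K c (e.symm.trans (e'.trans (finCongr (Fin.equiv_iff_eq.1 ⟨e'.symm.trans e⟩))))

variable (c : ℤ) {A B C : Type} {m m' m'' n n' : ℕ}

theorem psign_one : psign K c (1 : Equiv.Perm (Fin m)) = 1 := by simp [psign]

theorem psign_refl : psign K c (Equiv.refl (Fin m)) = 1 := psign_one c

theorem esgn_eq (e e' : A ≃ Fin m) : esgn K c e e' = psign K c (e.symm.trans e') := rfl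

theorem esgn_cast_right (e : A ≃ Fin m) (e' : A ≃ Fin m') (h : m' = n) :
    esgn K c e (e'.trans (finCongr h)) = esgn K c e e' := by
  subst h; rfl

theorem esgn_self (e : A ≃ Fin m) : esgn K c e e = 1 := by
  rw [esgn_eq, Equiv.symm_trans_self, psign_refl]

/-- Transition permutations compose and `psign` is multiplicative. This cocycle rule replaces
calculations with explicit permutations in all that follows. -/
theorem esgn_mul (e : A ≃ Fin m) (e' : A ≃ Fin m') (e'' : A ≃ Fin m'') :
    esgn K c e e' * esgn K c e' e'' = esgn K c e e'' := by
  obtain rfl : m' = m := Fin.equiv_iff_eq.1 ⟨e'.symm.trans e⟩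
  obtain rfl : m'' = m' := Fin.equiv_iff_eq.1 ⟨e''.symm.trans e⟩
  rw [esgn_eq, esgn_eq, esgn_eq, mul_comm, ← psign_mul]
  congr 1
  ext x
  simp

theorem esgn_mul_self (e : A ≃ Fin m) (e' : A ≃ Fin m') :
    esgn K c e e' * esgn K c e e' = 1 := psign_mul_self c _

theorem esgn_comm (e : A ≃ Fin m) (e' : A ≃ Fin m') : esgn K c e e' = esgn K c e' e := by
  have h := esgn_mul (K := K) c e e' e
  rw [esgn_self] at h
  linear_combination (esgn K c e' e) * h - (esgn K c e e') * esgn_mul_self (K := K) c e' e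

/-- Precomposing both enumerations with a bijection leaves the transition permutation itself
unchanged. -/
theorem esgn_trans (a : B ≃ A) (e : A ≃ Fin m) (e' : A ≃ Fin m') :
    esgn K c (a.trans e) (a.trans e') = esgn K c e e' := by
  obtain rfl : m' = m := Fin.equiv_iff_eq.1 ⟨e'.symm.trans e⟩
  rw [esgn_eq, esgn_eq]
  congr 1
  ext x
  simp

theorem esgn_trans_perm (e : A ≃ Fin m) (σ : Equiv.Perm (Fin m)) :
    esgn K c e (e.trans σ) = psign K c σ := by
  rw [esgn_eq]
  congr 1
  ext x
  simp

/-- The transition permutation is conjugate to the block sum of the two transition permutations,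
whose sign is the product. -/
theorem esgn_sumEnum (e e' : A ≃ Fin m) (f f' : B ≃ Fin n) :
    esgn K c (sumEnum e f) (sumEnum e' f') = esgn K c e e' * esgn K c f f' := by
  rw [esgn_eq, esgn_eq, esgn_eq]
  have h : (sumEnum e f).symm.trans (sumEnum e' f') = (finSumFinEquiv.symm.trans
      (Equiv.Perm.sumCongr (e.symm.trans e') (f.symm.trans f'))).trans finSumFinEquiv := by
    ext x
    obtain ⟨x, rfl⟩ := finSumFinEquiv.surjective x
    simp only [sumEnum, Equiv.symm_trans_apply, Equiv.trans_apply, Equiv.symm_apply_apply]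
    rcases x with x | x <;> simp
  rw [h, psign, Equiv.Perm.sign_symm_trans_trans, Equiv.Perm.sign_sumCongr, mul_zpow]
  simp [psign]

theorem esgn_sumEnum' (e : A ≃ Fin m) (e' : A ≃ Fin m') (f : B ≃ Fin n) (f' : B ≃ Fin n') :
    esgn K c (sumEnum e f) (sumEnum e' f') = esgn K c e e' * esgn K c f f' := by
  obtain rfl : m' = m := Fin.equiv_iff_eq.1 ⟨e'.symm.trans e⟩
  obtain rfl : n' = n := Fin.equiv_iff_eq.1 ⟨f'.symm.trans f⟩
  exact esgn_sumEnum c e e' f f'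

/-- Both bracketings list the elements in the same order; only the type of the index set differs. -/
theorem esgn_assoc (e : A ≃ Fin m) (f : B ≃ Fin n) {p : ℕ} (g : C ≃ Fin p) :
    esgn K c (sumEnum (sumEnum e f) g)
      ((Equiv.sumAssoc A B C).trans (sumEnum e (sumEnum f g))) = 1 := by
  have h : (Equiv.sumAssoc A B C).trans (sumEnum e (sumEnum f g))
      = (sumEnum (sumEnum e f) g).trans (finCongr (Nat.add_assoc m n p)) := by
    ext x
    rcases x with (x | x) | x <;> simp [sumEnum, Nat.add_assoc]
  rw [h, esgn_cast_right, esgn_self]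

theorem finRotate_pow_apply {N : ℕ} (k : ℕ) (x : Fin (N + 1)) :
    (((finRotate (N + 1)) ^ k) x : ℕ) = (x + k) % (N + 1) := by
  induction k with
  | zero => simp [Nat.mod_eq_of_lt x.2]
  | succ k ih =>
    rw [pow_succ', Equiv.Perm.mul_apply, finRotate_apply, Fin.val_add, ih, Fin.val_one']
    rw [← Nat.add_mod, ← add_assoc]

/-- The rotation of m + n > 0 points has sign (-1)^(m+n-1), and the product n(n-1) is even. -/
theorem sign_finRotate_pow (m n : ℕ) : Equiv.Perm.sign (finRotate (m + n) ^ n) = (-1) ^ (m * n) := by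
  rw [map_pow, sign_finRotate, ← pow_mul]
  rcases n with _ | n
  · simp
  · rw [show m + (n + 1) - 1 = m + n by omega, add_mul, pow_add, show n * (n + 1) = n * n + n by ring,
      Even.neg_one_pow (n := n * n + n) (by rw [← mul_add_one]; exact Nat.even_mul_succ_self n), mul_one]

theorem ksign_even (m : ℤ) (h : Even m) : ksign K m = 1 := by
  simp [ksign, Int.negOnePow_even _ h]

theorem ksign_congr {m n : ℤ} (h : Even (m - n)) : ksign K m = ksign K n := by
  rw [show m = (m - n) + n by ring, ksign_add, ksign_even _ h, one_mul]

/-- Exchanging two adjacent blocks of lengths m and n is the n-th power of the rotation of m + n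
points. -/
theorem esgn_swap (e : A ≃ Fin m) (f : B ≃ Fin n) :
    esgn K c (sumEnum e f) ((Equiv.sumComm A B).trans (sumEnum f e)) = ksign K (c * (m * n)) := by
  have h : (Equiv.sumComm A B).trans (sumEnum f e) = ((sumEnum e f).trans
      (finRotate (m + n) ^ n)).trans (finCongr (Nat.add_comm m n)) := by
    ext x
    -- The set contains `x`, so it is nonempty and the formula for powers of the rotation applies.
    obtain ⟨N, hN⟩ : ∃ N, m + n = N + 1 := Nat.exists_eq_succ_of_ne_zero
      (by have := (sumEnum e f x).2; omega)
    have h1 : ∀ (k : ℕ) (hk : k = N + 1) (y : Fin k),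
        (((finRotate k) ^ n) y : ℕ) = (y + n) % (N + 1) := by
      rintro k rfl y
      exact finRotate_pow_apply n y
    have h2 := h1 (m + n) hN (sumEnum e f x)
    simp only [Equiv.trans_apply, finCongr_apply, Fin.val_cast, h2]
    rcases x with x | x
    · have := (e x).2
      simp only [sumEnum, Equiv.sumComm_apply, Sum.swap_inl, Equiv.trans_apply, Equiv.sumCongr_apply,
        Sum.map_inr, Sum.map_inl, finSumFinEquiv_apply_right, finSumFinEquiv_apply_left,
        Fin.val_natAdd, Fin.val_castAdd]
      rw [Nat.mod_eq_of_lt (by omega), Nat.add_comm]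
    · have := (f x).2
      simp only [sumEnum, Equiv.sumComm_apply, Sum.swap_inr, Equiv.trans_apply, Equiv.sumCongr_apply,
        Sum.map_inr, Sum.map_inl, finSumFinEquiv_apply_right, finSumFinEquiv_apply_left,
        Fin.val_natAdd, Fin.val_castAdd]
      rw [show m + (f x : ℕ) + n = f x + (N + 1) by omega, Nat.add_mod_right,
        Nat.mod_eq_of_lt (by omega)]
  rw [h, esgn_cast_right, esgn_trans_perm, psign, sign_finRotate_pow, ksign, Int.negOnePow_def]
  congr 2
  rw [← zpow_natCast, ← zpow_mul]
  congr 1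
  push_cast
  ring

end Enumerations

/-! ### Blocks: symmetrized operations with arbitrarily labelled legs. -/

section Blocks

variable {K : Type v} [Field K] {Q : ProperadData.{u} K ℤ} {c d : ℤ}

/-- Transport along an equality of degrees. -/
def degCast (Q : ProperadData.{u} K ℤ) {A B : Type} [Finite A] [Finite B] {i j : ℤ} (h : i = j) :
    Q.obj A B i →ₗ[K] Q.obj A B j := h ▸ LinearMap.id

/-- The family whose only nonzero component is the skew symmetrization of `w`. -/
def blk (Q : ProperadData.{u} K ℤ) (c d k : ℤ) {A B : Type} [Finite A] [Finite B] {m n : ℕ}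
    (e : A ≃ Fin m) (f : B ≃ Fin n) {i : ℤ} (h : i = deg c d k m n) :
    Q.obj A B i →ₗ[K] Fam Q c d k :=
  LinearMap.pi fun s => if hs : m = s.1 ∧ n = s.2 then
    skewSym Q c d (e.trans (finCongr hs.1)) (f.trans (finCongr hs.2)) ∘ₗ
      degCast Q (by rw [h, hs.1, hs.2]) else 0

variable {A B : Type} [Finite A] [Finite B] {k i : ℤ} {m n m' n' : ℕ}

theorem blk_apply_self (e : A ≃ Fin m) (f : B ≃ Fin n) (w : Q.obj A B (deg c d k m n)) :
    blk Q c d k e f rfl w (m, n) = skewSym Q c d e f w := by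
  rw [blk, LinearMap.pi_apply, dif_pos ⟨rfl, rfl⟩]
  rfl

theorem blk_apply_ne (e : A ≃ Fin m) (f : B ≃ Fin n) (h : i = deg c d k m n) (w : Q.obj A B i)
    {s : ℕ × ℕ} (hs : ¬ (m = s.1 ∧ n = s.2)) : blk Q c d k e f h w s = 0 := by
  rw [blk, LinearMap.pi_apply, dif_neg hs]
  rfl

/-- Right translation by `σ` and `τ` permutes the summands; their characters come out of the sum
because they square to one. -/
theorem skewSym_trans (e : A ≃ Fin m) (f : B ≃ Fin n) (σ : Equiv.Perm (Fin m))
    (τ : Equiv.Perm (Fin n)) (w : Q.obj A B i) :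
    skewSym Q c d (e.trans σ) (f.trans τ) w = (psign K c σ * psign K d τ) • skewSym Q c d e f w := by
  simp only [skewSym, LinearMap.sum_apply, LinearMap.smul_apply, Finset.smul_sum, smul_smul]
  refine Fintype.sum_equiv (Equiv.mulRight σ) _ _ fun σ' => ?_
  refine Fintype.sum_equiv (Equiv.mulRight τ) _ _ fun τ' => ?_
  simp only [Equiv.coe_mulRight, psign_mul]
  congr 1
  linear_combination (-psign K c σ' * psign K d τ' * psign K c σ * psign K c σ) *
    psign_mul_self (K := K) d τ - psign K c σ' * psign K d τ' * psign_mul_self (K := K) c σ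

theorem skewSym_congr (e e' : A ≃ Fin m) (f f' : B ≃ Fin n) (w : Q.obj A B i) :
    skewSym Q c d e' f' w = (esgn K c e e' * esgn K d f f') • skewSym Q c d e f w := by
  have := skewSym_trans (c := c) (d := d) e f (e.symm.trans e') (f.symm.trans f') w
  rw [esgn_eq, esgn_eq, ← this]
  congr 2
  · ext; simp
  · ext; simp

theorem skewSym_relabel_left (hQ : Q.IsProperad (AddMonoidHom.id ℤ)) {A' B' : Type} [Finite A']
    [Finite B'] (a : A' ≃ A) (b : B' ≃ B) (e : A ≃ Fin m) (f : B ≃ Fin n) (w : Q.obj A' B' i) :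
    skewSym Q c d e f (Q.relabel a b w) = skewSym Q c d (a.trans e) (b.trans f) w := by
  simp only [skewSym, LinearMap.sum_apply, LinearMap.smul_apply, ← hQ.relabel_trans]
  rfl

/-- A block is canonical up to sign. Legs can therefore keep the label sets that compositions
produce, and enumerations are compared only at the end. -/
theorem blk_congr (e : A ≃ Fin m) (f : B ≃ Fin n) (e' : A ≃ Fin m') (f' : B ≃ Fin n')
    (h : i = deg c d k m n) (h' : i = deg c d k m' n') (w : Q.obj A B i) :
    blk Q c d k e' f' h' w = (esgn K c e e' * esgn K d f f') • blk Q c d k e f h w := by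
  obtain rfl : m' = m := Fin.equiv_iff_eq.1 ⟨e'.symm.trans e⟩
  obtain rfl : n' = n := Fin.equiv_iff_eq.1 ⟨f'.symm.trans f⟩
  subst h
  funext s
  by_cases hs : m' = s.1 ∧ n' = s.2
  · obtain ⟨s1, s2⟩ := s
    obtain ⟨rfl, rfl⟩ := hs
    rw [Pi.smul_apply, blk_apply_self, blk_apply_self]
    exact skewSym_congr e e' f f' w
  · rw [Pi.smul_apply, blk_apply_ne _ _ _ _ hs, blk_apply_ne _ _ _ _ hs, smul_zero]

theorem blk_relabel (hQ : Q.IsProperad (AddMonoidHom.id ℤ)) {A' B' : Type} [Finite A']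
    [Finite B'] (a : A' ≃ A) (b : B' ≃ B) (e : A ≃ Fin m) (f : B ≃ Fin n)
    (h : i = deg c d k m n) (w : Q.obj A' B' i) :
    blk Q c d k e f h (Q.relabel a b w) = blk Q c d k (a.trans e) (b.trans f) h w := by
  subst h
  funext s
  by_cases hs : m = s.1 ∧ n = s.2
  · obtain ⟨s1, s2⟩ := s
    obtain ⟨rfl, rfl⟩ := hs
    rw [blk_apply_self, blk_apply_self]
    exact skewSym_relabel_left hQ a b e f w
  · rw [blk_apply_ne _ _ _ _ hs, blk_apply_ne _ _ _ _ hs]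

/-- The families that are symmetric up to the signs of the permutations. -/
def symFam (Q : ProperadData.{u} K ℤ) (c d k : ℤ) : Submodule K (Fam Q c d k) where
  carrier := { η | ∀ (s : ℕ × ℕ) (σ : Equiv.Perm (Fin s.1)) (τ : Equiv.Perm (Fin s.2)),
      Q.relabel σ τ (η s) = (psign K c σ * psign K d τ) • η s }
  zero_mem' := by simp
  add_mem' h h' s σ τ := by simp only [Pi.add_apply, map_add, h s σ τ, h' s σ τ, smul_add]
  smul_mem' a η h s σ τ := by
    simp only [Pi.smul_apply, map_smul, h s σ τ]
    rw [smul_comm]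

/-- No symmetry of the arguments is needed, since `star` itself sums over all permutations of the
legs. -/
theorem star_symm (hQ : Q.IsProperad (AddMonoidHom.id ℤ)) {l t : ℤ} (h : k + l = t)
    (η : Fam Q c d k) (ξ : Fam Q c d l) : star Q c d h η ξ ∈ symFam Q c d t := by
  intro s σ τ
  simp only [star, LinearMap.mk₂_apply, map_sum, map_smul, skewSym_relabel hQ, Finset.smul_sum]
  refine Finset.sum_congr rfl fun p _ => Finset.sum_congr rfl fun q _ => ?_
  rw [smul_comm]

/-- Two labellings of the legs differ by permutations, under which a symmetric family only changes
by the sign. -/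
theorem symFam_relabel (hQ : Q.IsProperad (AddMonoidHom.id ℤ)) {η : Fam Q c d k}
    (hη : η ∈ symFam Q c d k) (a a' : Fin m ≃ A) (b b' : Fin n ≃ B) :
    Q.relabel a' b' (η (m, n)) =
      (esgn K c a.symm a'.symm * esgn K d b.symm b'.symm) • Q.relabel a b (η (m, n)) := by
  have h := hη (m, n) (a'.trans a.symm) (b'.trans b.symm)
  have h2 := congrArg (Q.relabel a b) h
  rw [← hQ.relabel_trans, map_smul] at h2
  have e1 : (a'.trans a.symm).trans a = a' := by ext; simp
  have e2 : (b'.trans b.symm).trans b = b' := by ext; simp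
  rw [e1, e2] at h2
  rw [h2, esgn_comm c a.symm, esgn_comm d b.symm, esgn_eq, esgn_eq]
  rfl

end Blocks

/-! ### Sums over permutations, organized by the leg that carries the edge. -/

section SumsOverEnumerations

/-- `H` is supported on the intersection of the rectangle with the antidiagonal, and both sums
reduce to that intersection. -/
theorem sum_split_eq {M : Type*} [AddCommMonoid M] (N : ℕ) (I I' : Finset ℕ) (H : ℕ → ℕ → M)
    (h₁ : ∀ a b, a + b ≠ N → H a b = 0) (h₂ : ∀ a b, ¬(a ∈ I ∧ b ∈ I') → H a b = 0) :
    ∑ a ∈ I, ∑ b ∈ I', H a b = ∑ p : Split N, H p.fst p.snd := by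
  rw [← Finset.sum_product']
  have h : ∑ p : Split N, H p.fst p.snd = ∑ x ∈ Finset.HasAntidiagonal.antidiagonal N, H x.1 x.2 :=
    Finset.sum_bij' (fun p _ => (p.fst, p.snd))
      (fun x hx => ⟨x.1, x.2, Finset.HasAntidiagonal.mem_antidiagonal.1 hx⟩)
      (fun p _ => Finset.HasAntidiagonal.mem_antidiagonal.2 p.add) (fun _ _ => Finset.mem_univ _)
      (fun _ _ => rfl) (fun _ _ => rfl) (fun _ _ => rfl)
  rw [h, ← Finset.sum_subset (Finset.inter_subset_left : (I ×ˢ I') ∩ Finset.HasAntidiagonal.antidiagonal N ⊆ _),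
    ← Finset.sum_subset (Finset.inter_subset_right : (I ×ˢ I') ∩ Finset.HasAntidiagonal.antidiagonal N ⊆ _)]
  · intro x hx hx'
    refine h₂ _ _ fun hI => hx' (Finset.mem_inter.2 ⟨Finset.mem_product.2 hI, hx⟩)
  · intro x hx hx'
    refine h₁ _ _ fun hI => hx' (Finset.mem_inter.2 ⟨hx, Finset.HasAntidiagonal.mem_antidiagonal.2 hI⟩)

/-- An injective family of (N+1)·N! enumerations of a set with N+1 elements exhausts all of them. In
the applications `b` is the leg to be glued and `τ` orders the remaining legs. -/
theorem sum_perm_eq {M : Type*} [AddCommMonoid M] {B : Type} [Fintype B] {N T : ℕ} (hT : T = N + 1)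
    (f : B ≃ Fin T) (F : (B ≃ Fin T) → M) (Ψ : B → Equiv.Perm (Fin N) → (B ≃ Fin T))
    (hΨ : ∀ b b' τ τ', Ψ b τ = Ψ b' τ' → b = b' ∧ τ = τ') :
    ∑ τ : Equiv.Perm (Fin T), F (f.trans τ) = ∑ b, ∑ τ, F (Ψ b τ) := by
  rw [← Fintype.sum_prod_type' (f := fun b τ => F (Ψ b τ))]
  symm
  refine Fintype.sum_bijective (fun x : B × Equiv.Perm (Fin N) => f.symm.trans (Ψ x.1 x.2)) ?_ _ _
    fun x => ?_
  · rw [Fintype.bijective_iff_injective_and_card]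
    refine ⟨fun x y hxy => ?_, ?_⟩
    · have h : Ψ x.1 x.2 = Ψ y.1 y.2 := by
        ext z
        have := Equiv.congr_fun hxy (f z)
        simpa using congrArg Fin.val this
      exact Prod.ext (hΨ _ _ _ _ h).1 (hΨ _ _ _ _ h).2
    · rw [Fintype.card_prod, Fintype.card_perm, Fintype.card_perm, Fintype.card_congr f, hT]
      simp [Nat.factorial_succ]
  · congr 1
    ext z
    simp

variable {B : Type}

/-- The element `b` is recovered as the preimage of the last position, and `τ` from the values on
the other elements. -/
theorem sumEnum_right_injective {N : ℕ} (g : B → (B ≃ Fin N ⊕ Fin 1)) (hg : ∀ b, g b b = Sum.inr 0)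
    (b b' : B) (τ τ' : Equiv.Perm (Fin N))
    (h : (g b).trans (sumEnum τ (Equiv.refl (Fin 1))) = (g b').trans (sumEnum τ' (Equiv.refl _))) :
    b = b' ∧ τ = τ' := by
  have h1 : ∀ x, Sum.map τ id (g b x) = Sum.map τ' id (g b' x) := fun x => by
    have := Equiv.congr_fun h x
    simpa [sumEnum] using this
  have h2 : b = b' := by
    have h3 := h1 b
    rw [hg] at h3
    rcases h4 : g b' b with x | x
    · rw [h4] at h3
      simp at h3
    · apply (g b').injective
      rw [h4, hg, Subsingleton.elim x 0]
  subst h2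
  refine ⟨rfl, ?_⟩
  ext x
  have := h1 ((g b).symm (Sum.inl x))
  simpa using congrArg (Sum.elim Fin.val fun _ => 0) this

theorem sumEnum_left_injective {N : ℕ} (g : B → (B ≃ Fin 1 ⊕ Fin N)) (hg : ∀ b, g b b = Sum.inl 0)
    (b b' : B) (τ τ' : Equiv.Perm (Fin N))
    (h : (g b).trans (sumEnum (Equiv.refl (Fin 1)) τ) = (g b').trans (sumEnum (Equiv.refl _) τ')) :
    b = b' ∧ τ = τ' := by
  have h1 : ∀ x, Sum.map id τ (g b x) = Sum.map id τ' (g b' x) := fun x => by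
    have := Equiv.congr_fun h x
    simpa [sumEnum] using this
  have h2 : b = b' := by
    have h3 := h1 b
    rw [hg] at h3
    rcases h4 : g b' b with x | x
    · apply (g b').injective
      rw [h4, hg, Subsingleton.elim x 0]
    · rw [h4] at h3
      simp at h3
  subst h2
  refine ⟨rfl, ?_⟩
  ext x
  have := h1 ((g b).symm (Sum.inr x))
  simpa using congrArg (Sum.elim (fun _ => 0) Fin.val) this

/-- Both maps send `b` to the marked point, so they identify the two complements of that point. This
is why attaching something to one leg does not depend on how the leg is split off. -/
theorem exists_sumCongr_right {X X' : Type} (g : B ≃ X ⊕ Fin 1) (g' : B ≃ X' ⊕ Fin 1) (b : B)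
    (h : g b = Sum.inr 0) (h' : g' b = Sum.inr 0) :
    ∃ ρ : X ≃ X', g' = g.trans (Equiv.sumCongr ρ (Equiv.refl _)) := by
  have key : ∀ {X X' : Type} (g : B ≃ X ⊕ Fin 1) (g' : B ≃ X' ⊕ Fin 1), g b = Sum.inr 0 →
      g' b = Sum.inr 0 → ∀ x, ∃ x', g' (g.symm (Sum.inl x)) = Sum.inl x' := by
    intro X X' g g' h h' x
    rcases h4 : g' (g.symm (Sum.inl x)) with y | y
    · exact ⟨y, rfl⟩
    · rw [Subsingleton.elim y 0, ← h', EmbeddingLike.apply_eq_iff_eq, Equiv.symm_apply_eq, h] at h4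
      simp at h4
  choose ρ hρ using key g g' h h'
  choose ρ' hρ' using key g' g h' h
  refine ⟨⟨ρ, ρ', fun x => ?_, fun x => ?_⟩, ?_⟩
  · have := hρ' (ρ x)
    rw [← hρ x] at this
    simpa using this.symm
  · have := hρ (ρ' x)
    rw [← hρ' x] at this
    simpa using this.symm
  · ext z
    obtain ⟨z, rfl⟩ := g.symm.surjective z
    rcases z with z | z
    · simp [hρ]
    · have hb : g.symm (Sum.inr 0) = b := by rw [← h, Equiv.symm_apply_apply]
      rw [Subsingleton.elim z 0]
      simp [hb, h, h']

theorem exists_sumCongr_left {X X' : Type} (g : B ≃ Fin 1 ⊕ X) (g' : B ≃ Fin 1 ⊕ X') (b : B)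
    (h : g b = Sum.inl 0) (h' : g' b = Sum.inl 0) :
    ∃ ρ : X ≃ X', g' = g.trans (Equiv.sumCongr (Equiv.refl _) ρ) := by
  obtain ⟨ρ, hρ⟩ := exists_sumCongr_right (g.trans (Equiv.sumComm _ _)) (g'.trans (Equiv.sumComm _ _))
    b (by simp [h]) (by simp [h'])
  refine ⟨ρ, ?_⟩
  ext z
  have := Equiv.congr_fun hρ z
  simp only [Equiv.trans_apply, Equiv.sumComm_apply] at this
  rw [← Sum.swap_swap (g' z), this]
  rcases h4 : g z with y | y <;> simp [h4]

end SumsOverEnumerations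

/-! ### The product of families as a sum of blocks. -/

section Star

variable {K : Type v} [Field K] {Q : ProperadData.{u} K ℤ} {c d : ℤ} {k l t : ℤ}

/-- The component of a family with `n + 1` inputs, with the last input marked. -/
def Fam.inMarked (η : Fam Q c d k) (m n : ℕ) :
    Q.obj (Fin m) (Fin n ⊕ Fin 1) (deg c d k m (n + 1)) :=
  Q.relabel (Equiv.refl _) finSumFinEquiv.symm (η (m, n + 1))

/-- The component of a family with `1 + m` outputs, with the first output marked. -/
def Fam.outMarked (η : Fam Q c d k) (m n : ℕ) :
    Q.obj (Fin 1 ⊕ Fin m) (Fin n) (deg c d k (1 + m) n) :=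
  Q.relabel finSumFinEquiv.symm (Equiv.refl _) (η (1 + m, n))

/-- The sign of a pair of components in `star`. -/
def starSign (K : Type v) [Field K] (c d k l : ℤ) (m₁ n₁ m₂ n₂ : ℕ) : K :=
  ksign K ((deg c d k m₁ (n₁ + 1) + k) * deg c d l (1 + m₂) n₂ + c * d * n₁ * m₂)

theorem deg_comp' (h : k + l = t) (m₁ n₁ m₂ n₂ : ℕ) :
    deg c d k m₁ (n₁ + 1) + deg c d l (1 + m₂) n₂ = deg c d t (m₁ + m₂) (n₁ + n₂) :=
  deg_comp c d h ⟨m₁, m₂, rfl⟩ ⟨n₁, n₂, rfl⟩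

theorem degCast_comp {A B C D E : Type} [Finite A] [Finite B] [Finite C] [Finite D] [Finite E]
    [Nonempty E] {i j r r' : ℤ} (h : i + j = r) (h' : r = r') (x : Q.obj A (B ⊕ E) i)
    (y : Q.obj (E ⊕ C) D j) : degCast Q h' (Q.comp h x y) = Q.comp (h.trans h') x y := by
  subst h'
  rfl

theorem sumEnum_refl (m n : ℕ) :
    sumEnum (Equiv.refl (Fin m)) (Equiv.refl (Fin n)) = finSumFinEquiv := by
  ext x
  simp [sumEnum]

/-- For families with finite support, the decompositions of all components are collected in one sum
over the numbers of free legs of the two vertices. The index of the component then disappears, and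
the products can be iterated block by block. -/
theorem star_eq_sum (h : k + l = t) (η : Fam Q c d k) (ξ : Fam Q c d l) (I J I' J' : Finset ℕ)
    (hη : ∀ m n, ¬(m ∈ I ∧ n ∈ J) → η (m, n + 1) = 0)
    (hξ : ∀ m n, ¬(m ∈ I' ∧ n ∈ J') → ξ (1 + m, n) = 0) :
    star Q c d h η ξ = ∑ m₁ ∈ I, ∑ m₂ ∈ I', ∑ n₁ ∈ J, ∑ n₂ ∈ J',
      (((m₁ ! * m₂ ! * n₁ ! * n₂ ! : ℕ) : K)⁻¹ * starSign K c d k l m₁ n₁ m₂ n₂) •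
        blk Q c d t (sumEnum (Equiv.refl (Fin m₁)) (Equiv.refl (Fin m₂)))
          (sumEnum (Equiv.refl (Fin n₁)) (Equiv.refl (Fin n₂))) (deg_comp' h m₁ n₁ m₂ n₂)
          (Q.comp rfl (η.inMarked m₁ n₁) (ξ.outMarked m₂ n₂)) := by
  funext ⟨M, N⟩
  have hz : ∀ m₁ m₂ n₁ n₂, ¬((m₁ ∈ I ∧ m₂ ∈ I') ∧ (n₁ ∈ J ∧ n₂ ∈ J')) →
      Q.comp rfl (η.inMarked m₁ n₁) (ξ.outMarked m₂ n₂) = 0 := by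
    intro m₁ m₂ n₁ n₂ hn
    by_cases h1 : m₁ ∈ I ∧ n₁ ∈ J
    · rw [Fam.outMarked, hξ m₂ n₂ (fun h2 => hn ⟨⟨h1.1, h2.1⟩, h1.2, h2.2⟩), map_zero, map_zero]
    · rw [Fam.inMarked, hη m₁ n₁ h1, map_zero, LinearMap.map_zero₂]
  simp only [Finset.sum_apply, Pi.smul_apply]
  -- A block contributes to the component (M, N) only if its free legs add up to M and N, so the
  -- rectangular sums collapse to antidiagonals.
  rw [sum_split_eq M]
  rotate_left
  · intro a b hab
    refine Finset.sum_eq_zero fun n₁ _ => Finset.sum_eq_zero fun n₂ _ => ?_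
    rw [blk_apply_ne _ _ _ _ (fun hs => hab hs.1), smul_zero]
  · intro a b hab
    refine Finset.sum_eq_zero fun n₁ _ => Finset.sum_eq_zero fun n₂ _ => ?_
    rw [hz _ _ _ _ (fun hs => hab hs.1), map_zero, Pi.zero_apply, smul_zero]
  simp only [star, LinearMap.mk₂_apply]
  refine Finset.sum_congr rfl fun p _ => ?_
  rw [sum_split_eq N]
  rotate_left
  · intro a b hab
    rw [blk_apply_ne _ _ _ _ (fun hs => hab hs.2), smul_zero]
  · intro a b hab
    rw [hz _ _ _ _ (fun hs => hab hs.2), map_zero, Pi.zero_apply, smul_zero]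
  refine Finset.sum_congr rfl fun q _ => ?_
  obtain ⟨m₁, m₂, rfl⟩ := p
  obtain ⟨n₁, n₂, rfl⟩ := q
  congr 1
  rw [blk, LinearMap.pi_apply, dif_pos ⟨rfl, rfl⟩, LinearMap.comp_apply, degCast_comp,
    sumEnum_refl, sumEnum_refl]
  rfl

end Star

/-! ### Product of a block with a family: a sum over the glued leg. -/

section StarBlocks

variable {K : Type v} [Field K] {Q : ProperadData.{u} K ℤ} {c d : ℤ} {k l t : ℤ}
  {A B : Type} [Finite A] [Finite B] {m n : ℕ} {i j r : ℤ}

theorem sumEnum_trans {A A' B B' : Type} (a : A ≃ A') (b : B ≃ B') (e : A' ≃ Fin m) (f : B' ≃ Fin n) :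
    (Equiv.sumCongr a b).trans (sumEnum e f) = sumEnum (a.trans e) (b.trans f) := by
  ext x
  rcases x with x | x <;> simp [sumEnum]

/-- Equivariance moves the renaming of the free legs out of the composition, where it is a change of
enumerations. -/
theorem blk_sumEnum_relabel (hQ : Q.IsProperad (AddMonoidHom.id ℤ)) {A' B' C D C' D' E : Type}
    [Finite A'] [Finite B'] [Finite C] [Finite D] [Finite C'] [Finite D'] [Finite E] [Nonempty E]
    {m₁ m₂ n₁ n₂ m₁' m₂' n₁' n₂' : ℕ} (a : A ≃ A') (b : B ≃ B') (a' : C ≃ C') (b' : D ≃ D')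
    (e₁ : A ≃ Fin m₁) (f₁ : B ≃ Fin n₁) (e₂ : C ≃ Fin m₂) (f₂ : D ≃ Fin n₂)
    (e₁' : A' ≃ Fin m₁') (f₁' : B' ≃ Fin n₁') (e₂' : C' ≃ Fin m₂') (f₂' : D' ≃ Fin n₂')
    (h : i + j = r) (h' : r = deg c d k (m₁ + m₂) (n₁ + n₂))
    (h'' : r = deg c d k (m₁' + m₂') (n₁' + n₂'))
    (x : Q.obj A (B ⊕ E) i) (y : Q.obj (E ⊕ C) D j) :
    blk Q c d k (sumEnum e₁' e₂') (sumEnum f₁' f₂') h''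
        (Q.comp h (Q.relabel a (Equiv.sumCongr b (Equiv.refl E)) x)
          (Q.relabel (Equiv.sumCongr (Equiv.refl E) a') b' y)) =
      (esgn K c e₁ (a.trans e₁') * esgn K c e₂ (a'.trans e₂') *
        (esgn K d f₁ (b.trans f₁') * esgn K d f₂ (b'.trans f₂'))) •
      blk Q c d k (sumEnum e₁ e₂) (sumEnum f₁ f₂) h' (Q.comp h x y) := by
  rw [hQ.comp_relabel, blk_relabel hQ, blk_congr (sumEnum e₁ e₂) (sumEnum f₁ f₂) _ _ h' h'',
    ← esgn_sumEnum', ← esgn_sumEnum', sumEnum_trans, sumEnum_trans]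

/-- The composition along one edge that ends in the input `b` does not depend on the choices. -/
theorem blk_comp_left_eq (hQ : Q.IsProperad (AddMonoidHom.id ℤ)) {X X' C D : Type} [Finite X]
    [Finite X'] [Finite C] [Finite D] {n' m₂ n₂ : ℕ}
    (e : A ≃ Fin m) (f : B ≃ Fin (n + 1)) (b : B) (g : B ≃ X ⊕ Fin 1) (g' : B ≃ X' ⊕ Fin 1)
    (hg : g b = Sum.inr 0) (hg' : g' b = Sum.inr 0) (p : X ≃ Fin n) (p' : X' ≃ Fin n')
    (e₂ : C ≃ Fin m₂) (f₂ : D ≃ Fin n₂) (h : i + j = r) (h' : r = deg c d k (m + m₂) (n + n₂))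
    (h'' : r = deg c d k (m + m₂) (n' + n₂))
    (w : Q.obj A B i) (y : Q.obj (Fin 1 ⊕ C) D j) :
    esgn K d f (g.trans (sumEnum p (Equiv.refl _))) •
        blk Q c d k (sumEnum e e₂) (sumEnum p f₂) h'
          (Q.comp h (Q.relabel (Equiv.refl A) g w) y) =
      esgn K d f (g'.trans (sumEnum p' (Equiv.refl _))) •
        blk Q c d k (sumEnum e e₂) (sumEnum p' f₂) h''
          (Q.comp h (Q.relabel (Equiv.refl A) g' w) y) := by
  -- The two splittings differ by a bijection `ρ` of the remaining inputs. Its sign enters once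
  -- through the prefactor and once through the block, and the two occurrences cancel.
  obtain ⟨ρ, rfl⟩ := exists_sumCongr_right g g' b hg hg'
  have h1 := blk_sumEnum_relabel hQ (c := c) (d := d) (k := k) (Equiv.refl A) ρ (Equiv.refl C)
    (Equiv.refl D) e p e₂ f₂ e p' e₂ f₂ h h' h'' (Q.relabel (Equiv.refl A) g w) y
  rw [← hQ.relabel_trans, Equiv.sumCongr_refl, hQ.relabel_refl] at h1
  have h2 : Q.relabel ((Equiv.refl A).trans (Equiv.refl A))
      (g.trans (Equiv.sumCongr ρ (Equiv.refl _))) w =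
      Q.relabel (Equiv.refl A) (g.trans (Equiv.sumCongr ρ (Equiv.refl _))) w := rfl
  rw [h2] at h1
  rw [h1, smul_smul]
  congr 1
  have h3 : (g.trans (Equiv.sumCongr ρ (Equiv.refl (Fin 1)))).trans (sumEnum p' (Equiv.refl _))
      = g.trans (sumEnum (ρ.trans p') (Equiv.refl _)) := by
    ext x
    rcases h4 : g x with z | z <;> simp [sumEnum, h4]
  have h4 := esgn_mul (K := K) d f (g.trans (sumEnum p (Equiv.refl _)))
    (g.trans (sumEnum (ρ.trans p') (Equiv.refl _)))
  rw [esgn_trans, esgn_sumEnum'] at h4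
  rw [h3]
  simp only [Equiv.refl_trans, esgn_self, one_mul, mul_one] at h4 ⊢
  linear_combination (esgn K d p (ρ.trans p')) * h4 -
    (esgn K d f (g.trans (sumEnum p (Equiv.refl _)))) * esgn_mul_self (K := K) d p (ρ.trans p')

/-- Mirror image of `blk_comp_left_eq`, for an edge that starts at the output `a` of the lower
vertex. -/
theorem blk_comp_right_eq (hQ : Q.IsProperad (AddMonoidHom.id ℤ)) {X X' C D : Type} [Finite X]
    [Finite X'] [Finite C] [Finite D] {m' m₁ n₁ : ℕ}
    (e : A ≃ Fin (1 + m)) (f : B ≃ Fin n) (a : A) (g : A ≃ Fin 1 ⊕ X) (g' : A ≃ Fin 1 ⊕ X')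
    (hg : g a = Sum.inl 0) (hg' : g' a = Sum.inl 0) (p : X ≃ Fin m) (p' : X' ≃ Fin m')
    (e₁ : C ≃ Fin m₁) (f₁ : D ≃ Fin n₁) (h : i + j = r) (h' : r = deg c d k (m₁ + m) (n₁ + n))
    (h'' : r = deg c d k (m₁ + m') (n₁ + n))
    (w : Q.obj A B j) (x : Q.obj C (D ⊕ Fin 1) i) :
    esgn K c e (g.trans (sumEnum (Equiv.refl _) p)) •
        blk Q c d k (sumEnum e₁ p) (sumEnum f₁ f) h'
          (Q.comp h x (Q.relabel g (Equiv.refl B) w)) =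
      esgn K c e (g'.trans (sumEnum (Equiv.refl _) p')) •
        blk Q c d k (sumEnum e₁ p') (sumEnum f₁ f) h''
          (Q.comp h x (Q.relabel g' (Equiv.refl B) w)) := by
  obtain ⟨ρ, rfl⟩ := exists_sumCongr_left g g' a hg hg'
  have h1 := blk_sumEnum_relabel hQ (c := c) (d := d) (k := k) (Equiv.refl C) (Equiv.refl D) ρ
    (Equiv.refl B) e₁ f₁ p f e₁ f₁ p' f h h' h'' x (Q.relabel g (Equiv.refl B) w)
  rw [← hQ.relabel_trans, Equiv.sumCongr_refl, hQ.relabel_refl] at h1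
  have h2 : Q.relabel (g.trans (Equiv.sumCongr (Equiv.refl _) ρ))
      ((Equiv.refl B).trans (Equiv.refl B)) w =
      Q.relabel (g.trans (Equiv.sumCongr (Equiv.refl _) ρ)) (Equiv.refl B) w := rfl
  rw [h2] at h1
  rw [h1, smul_smul]
  congr 1
  have h3 : (g.trans (Equiv.sumCongr (Equiv.refl (Fin 1)) ρ)).trans (sumEnum (Equiv.refl _) p')
      = g.trans (sumEnum (Equiv.refl _) (ρ.trans p')) := by
    ext x
    rcases h4 : g x with z | z <;> simp [sumEnum, h4]
  have h4 := esgn_mul (K := K) c e (g.trans (sumEnum (Equiv.refl _) p))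
    (g.trans (sumEnum (Equiv.refl _) (ρ.trans p')))
  rw [esgn_trans, esgn_sumEnum'] at h4
  rw [h3]
  simp only [Equiv.refl_trans, esgn_self, one_mul, mul_one] at h4 ⊢
  linear_combination (esgn K c p (ρ.trans p')) * h4 -
    (esgn K c e (g.trans (sumEnum (Equiv.refl _) p))) * esgn_mul_self (K := K) c p (ρ.trans p')

variable [CharZero K]

/-- Gluing the last input of a symmetrized operation amounts to gluing each of its inputs in turn: a
permutation of the inputs is a choice of the last one and an ordering of the other `n`. The m!·n!
permutations with the same choice give equal terms, which cancel two of the factorials in `star`. -/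
theorem star_blk_left (hQ : Q.IsProperad (AddMonoidHom.id ℤ)) [Fintype B] (h : k + l = t)
    (e : A ≃ Fin m) (f : B ≃ Fin (n + 1)) (hi : i = deg c d k m (n + 1)) (w : Q.obj A B i)
    (ξ : Fam Q c d l) (I' J' : Finset ℕ) (hξ : ∀ m n, ¬(m ∈ I' ∧ n ∈ J') → ξ (1 + m, n) = 0)
    (g : B → (B ≃ Fin n ⊕ Fin 1)) (hg : ∀ b, g b b = Sum.inr 0) :
    star Q c d h (blk Q c d k e f hi w) ξ = ∑ m₂ ∈ I', ∑ n₂ ∈ J',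
      (((m₂ ! * n₂ ! : ℕ) : K)⁻¹ * starSign K c d k l m n m₂ n₂) • ∑ b,
        esgn K d f ((g b).trans (sumEnum (Equiv.refl _) (Equiv.refl _))) •
        blk Q c d t (sumEnum e (Equiv.refl (Fin m₂)))
          (sumEnum (Equiv.refl (Fin n)) (Equiv.refl (Fin n₂)))
          (by rw [hi]; exact deg_comp' h m n m₂ n₂)
          (Q.comp rfl (Q.relabel (Equiv.refl A) (g b) w) (ξ.outMarked m₂ n₂)) := by
  subst hi
  rw [star_eq_sum h _ ξ {m} {n} I' J' _ hξ]
  swap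
  · intro m' n' hmn
    exact blk_apply_ne _ _ _ _ (fun hs => hmn ⟨by simp [hs.1], by simpa using hs.2.symm⟩)
  simp only [Finset.sum_singleton]
  refine Finset.sum_congr rfl fun m₂ _ => Finset.sum_congr rfl fun n₂ _ => ?_
  rw [Fam.inMarked, blk_apply_self, skewSym]
  simp only [LinearMap.sum_apply, LinearMap.smul_apply, map_sum, map_smul, ← hQ.relabel_trans]
  -- For a fixed ordering of the outputs, the sum over orderings of the inputs is grouped by the
  -- input that ends up last.
  have key : ∀ σ : Equiv.Perm (Fin m), ∑ τ : Equiv.Perm (Fin (n + 1)), (psign K c σ * psign K d τ) •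
      blk Q c d t (sumEnum (Equiv.refl (Fin m)) (Equiv.refl (Fin m₂)))
        (sumEnum (Equiv.refl (Fin n)) (Equiv.refl (Fin n₂))) (deg_comp' h m n m₂ n₂)
        (Q.comp rfl (Q.relabel ((e.trans σ).trans (Equiv.refl _))
          ((f.trans τ).trans finSumFinEquiv.symm) w) (ξ.outMarked m₂ n₂)) =
      ((n ! : ℕ) : K) • ∑ b, esgn K d f ((g b).trans (sumEnum (Equiv.refl _) (Equiv.refl _))) •
        blk Q c d t (sumEnum e (Equiv.refl (Fin m₂)))
          (sumEnum (Equiv.refl (Fin n)) (Equiv.refl (Fin n₂))) (deg_comp' h m n m₂ n₂)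
          (Q.comp rfl (Q.relabel (Equiv.refl A) (g b) w) (ξ.outMarked m₂ n₂)) := by
    intro σ
    have h1 : ∀ τ : Equiv.Perm (Fin (n + 1)), psign K d τ = esgn K d f (f.trans τ) :=
      fun τ => (esgn_trans_perm d f τ).symm
    simp only [h1]
    rw [sum_perm_eq rfl f (fun (ε : B ≃ Fin (n + 1)) => (psign K c σ * esgn K d f ε) •
      blk Q c d t (sumEnum (Equiv.refl (Fin m)) (Equiv.refl (Fin m₂)))
        (sumEnum (Equiv.refl (Fin n)) (Equiv.refl (Fin n₂))) (deg_comp' h m n m₂ n₂)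
        (Q.comp rfl (Q.relabel ((e.trans σ).trans (Equiv.refl _))
          (ε.trans finSumFinEquiv.symm) w) (ξ.outMarked m₂ n₂)))
      (fun b τ => (g b).trans (sumEnum τ (Equiv.refl (Fin 1)))) (sumEnum_right_injective g hg)]
    rw [Finset.smul_sum]
    refine Finset.sum_congr rfl fun b _ => ?_
    -- The signs of `σ` and `τ` appear both as coefficients and in the change of enumeration, so
    -- they cancel and the term depends on `b` only.
    have h2 : ∀ τ : Equiv.Perm (Fin n), (psign K c σ * esgn K d f
        ((g b).trans (sumEnum τ (Equiv.refl (Fin 1))))) •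
        blk Q c d t (sumEnum (Equiv.refl (Fin m)) (Equiv.refl (Fin m₂)))
        (sumEnum (Equiv.refl (Fin n)) (Equiv.refl (Fin n₂))) (deg_comp' h m n m₂ n₂)
        (Q.comp rfl (Q.relabel ((e.trans σ).trans (Equiv.refl _))
          (((g b).trans (sumEnum τ (Equiv.refl (Fin 1)))).trans finSumFinEquiv.symm) w)
          (ξ.outMarked m₂ n₂)) =
        esgn K d f ((g b).trans (sumEnum (Equiv.refl _) (Equiv.refl _))) •
        blk Q c d t (sumEnum e (Equiv.refl (Fin m₂)))
          (sumEnum (Equiv.refl (Fin n)) (Equiv.refl (Fin n₂))) (deg_comp' h m n m₂ n₂)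
          (Q.comp rfl (Q.relabel (Equiv.refl A) (g b) w) (ξ.outMarked m₂ n₂)) := by
      intro τ
      have h3 := blk_sumEnum_relabel hQ (c := c) (d := d) (k := t) (e.trans σ) τ (Equiv.refl (Fin m₂))
        (Equiv.refl (Fin n₂)) e (Equiv.refl _) (Equiv.refl _) (Equiv.refl _) (Equiv.refl _)
        (Equiv.refl _) (Equiv.refl _) (Equiv.refl _) rfl (deg_comp' h m n m₂ n₂)
        (deg_comp' h m n m₂ n₂) (Q.relabel (Equiv.refl A) (g b) w) (ξ.outMarked m₂ n₂)
      rw [← hQ.relabel_trans, Equiv.sumCongr_refl, hQ.relabel_refl] at h3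
      have h4 : ((g b).trans (sumEnum τ (Equiv.refl (Fin 1)))).trans finSumFinEquiv.symm =
          (g b).trans (Equiv.sumCongr τ (Equiv.refl (Fin 1))) := by
        ext x
        simp [sumEnum]
      rw [h4]
      have h5 : Q.relabel ((Equiv.refl A).trans (e.trans σ))
          ((g b).trans (Equiv.sumCongr τ (Equiv.refl (Fin 1)))) w =
          Q.relabel ((e.trans σ).trans (Equiv.refl (Fin m)))
            ((g b).trans (Equiv.sumCongr τ (Equiv.refl (Fin 1)))) w := rfl
      rw [h5] at h3
      rw [h3, smul_smul]
      congr 1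
      rw [← esgn_mul d f ((g b).trans (sumEnum (Equiv.refl _) (Equiv.refl _)))
        ((g b).trans (sumEnum τ (Equiv.refl (Fin 1)))), esgn_trans, esgn_sumEnum']
      have h6 : esgn K c e ((e.trans σ).trans (Equiv.refl _)) = psign K c σ :=
        esgn_trans_perm c e σ
      have h7 : esgn K d (Equiv.refl (Fin n)) τ = psign K d τ := rfl
      have h8 : esgn K d (Equiv.refl (Fin n)) (τ.trans (Equiv.refl _)) = psign K d τ := rfl
      simp only [Equiv.refl_trans, esgn_self, mul_one, h6, h7, h8]
      linear_combination (esgn K d f ((g b).trans (sumEnum (Equiv.refl _) (Equiv.refl _))) *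
        psign K d τ * psign K d τ) * psign_mul_self (K := K) c σ +
        (esgn K d f ((g b).trans (sumEnum (Equiv.refl _) (Equiv.refl _)))) *
          psign_mul_self (K := K) d τ
    simp only [h2]
    rw [Finset.sum_const, Finset.card_univ, Fintype.card_perm, Fintype.card_fin, Nat.cast_smul_eq_nsmul]
  -- Nothing depends on `σ` any more, so the sum over it contributes the factor m!.
  simp only [key]
  rw [Finset.sum_const, Finset.card_univ, Fintype.card_perm, Fintype.card_fin, ← Nat.cast_smul_eq_nsmul K,
    smul_smul, smul_smul]
  congr 1
  have h1 : ((m ! : ℕ) : K) ≠ 0 := by exact_mod_cast Nat.factorial_ne_zero m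
  have h2 : ((n ! : ℕ) : K) ≠ 0 := by exact_mod_cast Nat.factorial_ne_zero n
  have h3 : ((m₂ ! : ℕ) : K) ≠ 0 := by exact_mod_cast Nat.factorial_ne_zero m₂
  have h4 : ((n₂ ! : ℕ) : K) ≠ 0 := by exact_mod_cast Nat.factorial_ne_zero n₂
  push_cast
  field_simp

/-- The same argument with the roles of inputs and outputs exchanged: the edge starts at each output
of the lower block in turn. -/
theorem star_blk_right (hQ : Q.IsProperad (AddMonoidHom.id ℤ)) [Fintype A] (h : k + l = t)
    (e : A ≃ Fin (1 + m)) (f : B ≃ Fin n) (hi : i = deg c d l (1 + m) n) (w : Q.obj A B i)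
    (η : Fam Q c d k) (I J : Finset ℕ) (hη : ∀ m n, ¬(m ∈ I ∧ n ∈ J) → η (m, n + 1) = 0)
    (g : A → (A ≃ Fin 1 ⊕ Fin m)) (hg : ∀ a, g a a = Sum.inl 0) :
    star Q c d h η (blk Q c d l e f hi w) = ∑ m₁ ∈ I, ∑ n₁ ∈ J,
      (((m₁ ! * n₁ ! : ℕ) : K)⁻¹ * starSign K c d k l m₁ n₁ m n) • ∑ a,
        esgn K c e ((g a).trans (sumEnum (Equiv.refl _) (Equiv.refl _))) •
        blk Q c d t (sumEnum (Equiv.refl (Fin m₁)) (Equiv.refl (Fin m)))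
          (sumEnum (Equiv.refl (Fin n₁)) f)
          (by rw [hi]; exact deg_comp' h m₁ n₁ m n)
          (Q.comp rfl (η.inMarked m₁ n₁) (Q.relabel (g a) (Equiv.refl B) w)) := by
  subst hi
  rw [star_eq_sum h η _ I J {m} {n} hη]
  swap
  · intro m' n' hmn
    exact blk_apply_ne _ _ _ _ (fun hs => hmn ⟨by simpa using hs.1.symm, by simp [hs.2]⟩)
  simp only [Finset.sum_singleton]
  refine Finset.sum_congr rfl fun m₁ _ => Finset.sum_congr rfl fun n₁ _ => ?_
  rw [Fam.outMarked, blk_apply_self, skewSym]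
  simp only [LinearMap.sum_apply, LinearMap.smul_apply, map_sum, map_smul, ← hQ.relabel_trans]
  -- The outputs carry the edge here, so their orderings are regrouped for a fixed ordering of the
  -- inputs.
  rw [Finset.sum_comm]
  have key : ∀ τ : Equiv.Perm (Fin n), ∑ σ : Equiv.Perm (Fin (1 + m)), (psign K c σ * psign K d τ) •
      blk Q c d t (sumEnum (Equiv.refl (Fin m₁)) (Equiv.refl (Fin m)))
        (sumEnum (Equiv.refl (Fin n₁)) (Equiv.refl (Fin n))) (deg_comp' h m₁ n₁ m n)
        (Q.comp rfl (η.inMarked m₁ n₁) (Q.relabel ((e.trans σ).trans finSumFinEquiv.symm)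
          ((f.trans τ).trans (Equiv.refl _)) w)) =
      ((m ! : ℕ) : K) • ∑ a, esgn K c e ((g a).trans (sumEnum (Equiv.refl _) (Equiv.refl _))) •
        blk Q c d t (sumEnum (Equiv.refl (Fin m₁)) (Equiv.refl (Fin m)))
          (sumEnum (Equiv.refl (Fin n₁)) f) (deg_comp' h m₁ n₁ m n)
          (Q.comp rfl (η.inMarked m₁ n₁) (Q.relabel (g a) (Equiv.refl B) w)) := by
    intro τ
    have h1 : ∀ σ : Equiv.Perm (Fin (1 + m)), psign K c σ = esgn K c e (e.trans σ) :=
      fun σ => (esgn_trans_perm c e σ).symm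
    simp only [h1]
    rw [sum_perm_eq (Nat.add_comm 1 m) e (fun (ε : A ≃ Fin (1 + m)) => (esgn K c e ε * psign K d τ) •
      blk Q c d t (sumEnum (Equiv.refl (Fin m₁)) (Equiv.refl (Fin m)))
        (sumEnum (Equiv.refl (Fin n₁)) (Equiv.refl (Fin n))) (deg_comp' h m₁ n₁ m n)
        (Q.comp rfl (η.inMarked m₁ n₁) (Q.relabel (ε.trans finSumFinEquiv.symm)
          ((f.trans τ).trans (Equiv.refl _)) w)))
      (fun a σ => (g a).trans (sumEnum (Equiv.refl (Fin 1)) σ)) (sumEnum_left_injective g hg)]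
    rw [Finset.smul_sum]
    refine Finset.sum_congr rfl fun a _ => ?_
    have h2 : ∀ σ : Equiv.Perm (Fin m), (esgn K c e
        ((g a).trans (sumEnum (Equiv.refl (Fin 1)) σ)) * psign K d τ) •
        blk Q c d t (sumEnum (Equiv.refl (Fin m₁)) (Equiv.refl (Fin m)))
        (sumEnum (Equiv.refl (Fin n₁)) (Equiv.refl (Fin n))) (deg_comp' h m₁ n₁ m n)
        (Q.comp rfl (η.inMarked m₁ n₁) (Q.relabel
          (((g a).trans (sumEnum (Equiv.refl (Fin 1)) σ)).trans finSumFinEquiv.symm)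
          ((f.trans τ).trans (Equiv.refl _)) w)) =
        esgn K c e ((g a).trans (sumEnum (Equiv.refl _) (Equiv.refl _))) •
        blk Q c d t (sumEnum (Equiv.refl (Fin m₁)) (Equiv.refl (Fin m)))
          (sumEnum (Equiv.refl (Fin n₁)) f) (deg_comp' h m₁ n₁ m n)
          (Q.comp rfl (η.inMarked m₁ n₁) (Q.relabel (g a) (Equiv.refl B) w)) := by
      intro σ
      have h3 := blk_sumEnum_relabel hQ (c := c) (d := d) (k := t) (Equiv.refl (Fin m₁))
        (Equiv.refl (Fin n₁)) σ (f.trans τ) (Equiv.refl _) (Equiv.refl _) (Equiv.refl _) f (Equiv.refl _)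
        (Equiv.refl _) (Equiv.refl _) (Equiv.refl _) rfl (deg_comp' h m₁ n₁ m n)
        (deg_comp' h m₁ n₁ m n) (η.inMarked m₁ n₁) (Q.relabel (g a) (Equiv.refl B) w)
      rw [← hQ.relabel_trans, Equiv.sumCongr_refl, hQ.relabel_refl] at h3
      have h4 : ((g a).trans (sumEnum (Equiv.refl (Fin 1)) σ)).trans finSumFinEquiv.symm =
          (g a).trans (Equiv.sumCongr (Equiv.refl (Fin 1)) σ) := by
        ext x
        simp [sumEnum]
      rw [h4]
      have h5 : Q.relabel ((g a).trans (Equiv.sumCongr (Equiv.refl (Fin 1)) σ))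
          ((Equiv.refl B).trans (f.trans τ)) w =
          Q.relabel ((g a).trans (Equiv.sumCongr (Equiv.refl (Fin 1)) σ))
            ((f.trans τ).trans (Equiv.refl (Fin n))) w := rfl
      rw [h5] at h3
      rw [h3, smul_smul]
      congr 1
      rw [← esgn_mul c e ((g a).trans (sumEnum (Equiv.refl _) (Equiv.refl _)))
        ((g a).trans (sumEnum (Equiv.refl (Fin 1)) σ)), esgn_trans, esgn_sumEnum']
      have h6 : esgn K d f ((f.trans τ).trans (Equiv.refl _)) = psign K d τ :=
        esgn_trans_perm d f τ
      have h7 : esgn K c (Equiv.refl (Fin m)) σ = psign K c σ := rfl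
      have h8 : esgn K c (Equiv.refl (Fin m)) (σ.trans (Equiv.refl _)) = psign K c σ := rfl
      simp only [Equiv.refl_trans, esgn_self, one_mul, h6, h7, h8]
      linear_combination (esgn K c e ((g a).trans (sumEnum (Equiv.refl _) (Equiv.refl _))) *
        psign K d τ * psign K d τ) * psign_mul_self (K := K) c σ +
        (esgn K c e ((g a).trans (sumEnum (Equiv.refl _) (Equiv.refl _)))) *
          psign_mul_self (K := K) d τ
    simp only [h2]
    rw [Finset.sum_const, Finset.card_univ, Fintype.card_perm, Fintype.card_fin, Nat.cast_smul_eq_nsmul]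
  simp only [key]
  rw [Finset.sum_const, Finset.card_univ, Fintype.card_perm, Fintype.card_fin, ← Nat.cast_smul_eq_nsmul K,
    smul_smul, smul_smul]
  congr 1
  have h1 : ((m ! : ℕ) : K) ≠ 0 := by exact_mod_cast Nat.factorial_ne_zero m
  have h2 : ((n ! : ℕ) : K) ≠ 0 := by exact_mod_cast Nat.factorial_ne_zero n
  have h3 : ((m₁ ! : ℕ) : K) ≠ 0 := by exact_mod_cast Nat.factorial_ne_zero m₁
  have h4 : ((n₁ ! : ℕ) : K) ≠ 0 := by exact_mod_cast Nat.factorial_ne_zero n₁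
  push_cast
  field_simp

end StarBlocks

/-! ### Sign identities for graphs with three vertices. -/

section Signs

variable {K : Type v} [Field K] (c : ℤ) {A B C : Type} {m n p : ℕ}

/-- Only parities matter, so sign identities become polynomial identities over `ZMod 2`, taken
modulo the idempotence of its elements. -/
theorem ksign_eq_of_zmod {a b : ℤ} (h : (a : ZMod 2) = b) : ksign K a = ksign K b := by
  refine ksign_congr ?_
  rw [← ZMod.intCast_eq_zero_iff_even]
  push_cast
  rw [h, sub_self]

theorem zmod_two_mul_self (a : ZMod 2) : a * a = a := by revert a; decide

theorem esgn_assoc_symm (e : A ≃ Fin m) (f : B ≃ Fin n) (g : C ≃ Fin p) :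
    esgn K c (sumEnum e (sumEnum f g))
      ((Equiv.sumAssoc A B C).symm.trans (sumEnum (sumEnum e f) g)) = 1 := by
  rw [← esgn_assoc c e f g, ← esgn_trans c (Equiv.sumAssoc A B C), ← Equiv.trans_assoc,
    Equiv.self_trans_symm, Equiv.refl_trans, esgn_comm]

/-- The exchange factors into two reassociations, of sign one, and a swap of adjacent blocks. -/
theorem esgn_exchR (e : A ≃ Fin m) (f : B ≃ Fin n) (g : C ≃ Fin p) :
    esgn K c (sumEnum (sumEnum e f) g) ((exchR A B C).trans (sumEnum (sumEnum e g) f))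
      = ksign K (c * (n * p)) := by
  rw [← esgn_mul c _ ((Equiv.sumAssoc A B C).trans (sumEnum e (sumEnum f g))), esgn_assoc, one_mul,
    exchR, Equiv.trans_assoc, Equiv.trans_assoc, esgn_trans,
    ← esgn_mul c _ ((Equiv.sumCongr (Equiv.refl A) (Equiv.sumComm B C)).trans
      (sumEnum e (sumEnum g f))), esgn_trans, esgn_assoc_symm, mul_one, sumEnum_trans, esgn_sumEnum',
    esgn_swap, Equiv.refl_trans, esgn_self, one_mul]

theorem esgn_exchL (e : A ≃ Fin m) (f : B ≃ Fin n) (g : C ≃ Fin p) :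
    esgn K c (sumEnum e (sumEnum f g)) ((exchL A B C).trans (sumEnum f (sumEnum e g)))
      = ksign K (c * (m * n)) := by
  rw [← esgn_mul c _ ((Equiv.sumAssoc A B C).symm.trans (sumEnum (sumEnum e f) g)), esgn_assoc_symm,
    one_mul, exchL, Equiv.trans_assoc, Equiv.trans_assoc, esgn_trans,
    ← esgn_mul c _ ((Equiv.sumCongr (Equiv.sumComm A B) (Equiv.refl C)).trans
      (sumEnum (sumEnum f e) g)), esgn_trans, esgn_assoc, mul_one, sumEnum_trans, esgn_sumEnum',
    esgn_swap, Equiv.refl_trans, esgn_self, mul_one]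

variable (K)

/-- Both ways of assembling a chain of three vertices carry the same sign. This is why chains cancel
in the associator of `star`. -/
theorem starSign_chain (c d k l p : ℤ) {kl lp : ℤ} (hkl : k + l = kl) (hlp : l + p = lp)
    (m₁ n₁ m₂ n₂ m₃ n₃ : ℕ) :
    starSign K c d k l m₁ n₁ m₂ (n₂ + 1) * starSign K c d kl p (m₁ + m₂) (n₁ + n₂) m₃ n₃ =
      starSign K c d l p (1 + m₂) n₂ m₃ n₃ * starSign K c d k lp m₁ n₁ (m₂ + m₃) (n₂ + n₃) := by
  simp only [starSign, ← ksign_add, deg]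
  refine ksign_eq_of_zmod ?_
  subst hkl hlp
  push_cast
  -- Products of degrees contain the squares of `c` and `d`, which must be reduced modulo 2.
  have hc := zmod_two_mul_self c
  have hd := zmod_two_mul_self d
  grind

/-- Exchanging two lower vertices costs the Koszul sign of the degrees of the components, a sign for
transposing the two glued inputs, and the signs of exchanging the blocks of outputs and of inputs.
Combined with the signs of `star`, all that survives is the Koszul sign of the degrees `l` and `p`
of the families. -/
theorem starSign_below (c d k l p : ℤ) {kl kp : ℤ} (hkl : k + l = kl) (hkp : k + p = kp)
    (m₁ n₁ m₂ n₂ m₃ n₃ : ℕ) :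
    starSign K c d k l m₁ (n₁ + 1) m₂ n₂ * ksign K (d * n₂) *
        starSign K c d kl p (m₁ + m₂) (n₁ + n₂) m₃ n₃ =
      ksign K (l * p) * (starSign K c d k p m₁ (n₁ + 1) m₃ n₃ * ksign K (d * n₃) *
        starSign K c d kp l (m₁ + m₃) (n₁ + n₃) m₂ n₂) *
        (ksign K (deg c d p (1 + m₃) n₃ * deg c d l (1 + m₂) n₂) * ksign K d) *
        (ksign K (c * (m₂ * m₃)) * ksign K (d * (n₂ * n₃))) := by
  simp only [starSign, ← ksign_add, deg]
  refine ksign_eq_of_zmod ?_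
  subst hkl hkp
  push_cast
  have hc := zmod_two_mul_self c
  have hd := zmod_two_mul_self d
  grind

/-- The analogue for two upper vertices, where the two glued outputs of the lower vertex are
transposed. -/
theorem starSign_above (c d k l p : ℤ) {lp kp : ℤ} (hlp : l + p = lp) (hkp : k + p = kp)
    (m₁ n₁ m₂ n₂ m₃ n₃ : ℕ) :
    starSign K c d l p m₂ n₂ (1 + m₃) n₃ * ksign K (c * m₂) *
        starSign K c d k lp m₁ n₁ (m₂ + m₃) (n₂ + n₃) =
      ksign K (k * l) * (starSign K c d k p m₁ n₁ (1 + m₃) n₃ * ksign K (c * m₁) *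
        starSign K c d l kp m₂ n₂ (m₁ + m₃) (n₁ + n₃)) *
        (ksign K (deg c d l m₂ (n₂ + 1) * deg c d k m₁ (n₁ + 1)) * ksign K c) *
        (ksign K (c * (m₁ * m₂)) * ksign K (d * (n₁ * n₂))) := by
  simp only [starSign, ← ksign_add, deg]
  refine ksign_eq_of_zmod ?_
  subst hlp hkp
  push_cast
  have hc := zmod_two_mul_self c
  have hd := zmod_two_mul_self d
  grind

end Signs

/-! ### Associativity for chains. -/

section ChainLaw

variable {K : Type v} [Field K] {Q : ProperadData.{u} K ℤ}

/-- This is `assoc` with an empty set `E₃` of edges between the outer vertices; the rest of the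
proof removes the empty summands from the label sets. -/
theorem ProperadData.IsProperad.chain (hQ : Q.IsProperad (AddMonoidHom.id ℤ))
    {A B C D E₁ E₂ F G : Type} [Finite A] [Finite B] [Finite C] [Finite D]
    [Finite E₁] [Finite E₂] [Finite F] [Finite G] [Nonempty E₁] [Nonempty E₂]
    {i j k ij jk l : ℤ} (h₁ : i + j = ij) (h₂ : ij + k = l) (h₃ : j + k = jk) (h₄ : i + jk = l)
    (x : Q.obj A (B ⊕ E₁) i) (y : Q.obj (E₁ ⊕ C) (D ⊕ E₂) j) (z : Q.obj (E₂ ⊕ F) G k) :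
    Q.relabel (Equiv.sumAssoc A C F) (Equiv.sumAssoc B D G)
        (Q.comp h₂ (Q.relabel (Equiv.refl (A ⊕ C)) (Equiv.sumAssoc B D E₂).symm
          (Q.comp h₁ x y)) z)
      = Q.comp h₄ x (Q.relabel (Equiv.sumAssoc E₁ C F) (Equiv.refl (D ⊕ G)) (Q.comp h₃ y z)) := by
  have h := hQ.assoc (E₃ := Empty) h₁ h₂ h₃ h₄
    (Q.relabel (Equiv.refl A) (Equiv.sumCongr (Equiv.sumEmpty B Empty).symm (Equiv.refl E₁)) x) y
    (Q.relabel (Equiv.sumCongr (Equiv.emptySum Empty E₂).symm (Equiv.refl F)) (Equiv.refl G) z)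
  have e1 := hQ.comp_relabel h₁ (Equiv.refl A) (Equiv.sumEmpty B Empty).symm (Equiv.refl C)
    (Equiv.refl (D ⊕ E₂)) (Equiv.refl E₁) x y
  rw [Equiv.sumCongr_refl, hQ.relabel_refl] at e1
  rw [e1, ← hQ.relabel_trans, ← hQ.relabel_trans, ← hQ.relabel_trans] at h
  have e2 := hQ.comp_relabel h₂ (Equiv.refl (A ⊕ C)) (Equiv.refl (B ⊕ D)) (Equiv.refl F)
    (Equiv.refl G) (Equiv.emptySum Empty E₂).symm
    (Q.relabel (Equiv.refl (A ⊕ C)) (Equiv.sumAssoc B D E₂).symm (Q.comp h₁ x y)) z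
  rw [← hQ.relabel_trans, Equiv.sumCongr_refl, Equiv.sumCongr_refl, hQ.relabel_refl] at e2
  have e3 : ((Equiv.sumAssoc B D E₂).symm.trans (Equiv.sumCongr (Equiv.refl (B ⊕ D))
      (Equiv.emptySum Empty E₂).symm)) = (Equiv.sumCongr (Equiv.sumEmpty B Empty).symm
        (Equiv.refl (D ⊕ E₂))).trans (Equiv.sumSumSumComm B Empty D E₂) := by
    ext x
    rcases x with x | x | x <;> rfl
  rw [e3] at e2
  have e4 : (Equiv.sumCongr (Equiv.emptySum Empty E₂).symm (Equiv.refl F)).trans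
      ((Equiv.sumAssoc Empty E₂ F).trans (exchL Empty E₂ F)) =
      Equiv.sumCongr (Equiv.refl E₂) (Equiv.emptySum Empty F).symm := by
    ext x
    rcases x with x | x <;> rfl
  have e5 := hQ.comp_relabel h₃ (Equiv.refl (E₁ ⊕ C)) (Equiv.refl D) (Equiv.emptySum Empty F).symm
    (Equiv.refl G) (Equiv.refl E₂) y z
  rw [Equiv.sumCongr_refl, Equiv.sumCongr_refl, hQ.relabel_refl] at e5
  have e6 : (Equiv.sumCongr (Equiv.sumEmpty B Empty).symm (Equiv.refl E₁)).trans
      ((exchR B Empty E₁).trans (Equiv.sumAssoc B E₁ Empty)) =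
      Equiv.sumCongr (Equiv.refl B) (Equiv.sumEmpty E₁ Empty).symm := by
    ext x
    rcases x with x | x <;> rfl
  have e7 := hQ.comp_relabel h₄ (Equiv.refl A) (Equiv.refl B) (Equiv.refl (C ⊕ F))
    (Equiv.refl (D ⊕ G)) (Equiv.sumEmpty E₁ Empty).symm x
    (Q.relabel (Equiv.sumAssoc E₁ C F) (Equiv.refl (D ⊕ G)) (Q.comp h₃ y z))
  rw [← hQ.relabel_trans, Equiv.sumCongr_refl, Equiv.sumCongr_refl, hQ.relabel_refl] at e7
  have e8 : (Equiv.sumAssoc E₁ C F).trans (Equiv.sumCongr (Equiv.sumEmpty E₁ Empty).symm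
      (Equiv.refl (C ⊕ F))) = (Equiv.sumCongr (Equiv.refl (E₁ ⊕ C)) (Equiv.emptySum Empty F).symm).trans
        (Equiv.sumSumSumComm E₁ C Empty F) := by
    ext x
    rcases x with (x | x) | x <;> rfl
  rw [e8] at e7
  have e9 : ((Equiv.refl G).trans (Equiv.refl G)) = Equiv.refl G := rfl
  rw [e4, e6, e9, e5, ← hQ.relabel_trans, Equiv.sumCongr_refl] at h
  exact (congrArg _ e2).symm.trans (h.trans e7)

end ChainLaw

/-! ### Splitting one leg off an enumerated set. -/

section Splitting

variable {A B : Type} {m n : ℕ}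

/-- The bijection that makes the element `b` of an enumerated set the last one. -/
def splitLast (f : B ≃ Fin (n + 1)) (b : B) : B ≃ Fin n ⊕ Fin 1 :=
  (f.trans (Equiv.swap (f b) (finSumFinEquiv (Sum.inr 0)))).trans finSumFinEquiv.symm

theorem splitLast_self (f : B ≃ Fin (n + 1)) (b : B) : splitLast f b b = Sum.inr 0 := by
  simp only [splitLast, Equiv.trans_apply, Equiv.swap_apply_left, Equiv.symm_apply_apply]

/-- The bijection that makes the element `a` of an enumerated set the first one. -/
def splitFirst (e : A ≃ Fin (1 + m)) (a : A) : A ≃ Fin 1 ⊕ Fin m :=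
  (e.trans (Equiv.swap (e a) (finSumFinEquiv (Sum.inl 0)))).trans finSumFinEquiv.symm

theorem splitFirst_self (e : A ≃ Fin (1 + m)) (a : A) : splitFirst e a a = Sum.inl 0 := by
  simp only [splitFirst, Equiv.trans_apply, Equiv.swap_apply_left, Equiv.symm_apply_apply]

end Splitting

/-! ### The three kinds of graphs with three vertices: chain, vee and wedge. -/

section Triples

variable {K : Type v} [Field K] {Q : ProperadData.{u} K ℤ} {c d : ℤ} {k l p kl lp t : ℤ}

/-- The component of a family with the first output and the last input marked. -/
def Fam.bothMarked (η : Fam Q c d k) (m n : ℕ) :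
    Q.obj (Fin 1 ⊕ Fin m) (Fin n ⊕ Fin 1) (deg c d k (1 + m) (n + 1)) :=
  Q.relabel finSumFinEquiv.symm finSumFinEquiv.symm (η (1 + m, n + 1))

/-- The component of a family with the last two inputs marked. -/
def Fam.inMarked₂ (η : Fam Q c d k) (m n : ℕ) :
    Q.obj (Fin m) ((Fin n ⊕ Fin 1) ⊕ Fin 1) (deg c d k m (n + 1 + 1)) :=
  Q.relabel (Equiv.refl _) (sumEnum finSumFinEquiv (Equiv.refl _)).symm (η (m, n + 1 + 1))

/-- The component of a family with the first two outputs marked. -/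
def Fam.outMarked₂ (η : Fam Q c d k) (m n : ℕ) :
    Q.obj (Fin 1 ⊕ (Fin 1 ⊕ Fin m)) (Fin n) (deg c d k (1 + (1 + m)) n) :=
  Q.relabel (sumEnum (Equiv.refl _) finSumFinEquiv).symm (Equiv.refl _) (η (1 + (1 + m), n))

/-- The enumeration of a disjoint union of three intervals. -/
abbrev enum₃ (m₁ m₂ m₃ : ℕ) : (Fin m₁ ⊕ Fin m₂) ⊕ Fin m₃ ≃ Fin (m₁ + m₂ + m₃) :=
  sumEnum (sumEnum (Equiv.refl _) (Equiv.refl _)) (Equiv.refl _)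

/-- The enumeration of a disjoint union of three intervals. -/
abbrev enum₃' (m₁ m₂ m₃ : ℕ) : Fin m₁ ⊕ (Fin m₂ ⊕ Fin m₃) ≃ Fin (m₁ + (m₂ + m₃)) :=
  sumEnum (Equiv.refl _) (sumEnum (Equiv.refl _) (Equiv.refl _))

theorem deg_chain (h : k + l = kl) (h' : kl + p = t) (m₁ n₁ m₂ n₂ m₃ n₃ : ℕ) :
    deg c d k m₁ (n₁ + 1) + deg c d l (1 + m₂) (n₂ + 1) + deg c d p (1 + m₃) n₃ =
      deg c d t (m₁ + m₂ + m₃) (n₁ + n₂ + n₃) := by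
  subst h h'
  simp only [deg]
  push_cast
  ring

theorem deg_vee (h : k + l = kl) (h' : kl + p = t) (m₁ n₁ m₂ n₂ m₃ n₃ : ℕ) :
    deg c d k m₁ (n₁ + 1 + 1) + deg c d l (1 + m₂) n₂ + deg c d p (1 + m₃) n₃ =
      deg c d t (m₁ + m₂ + m₃) (n₁ + n₂ + n₃) := by
  subst h h'
  simp only [deg]
  push_cast
  ring

theorem deg_wedge (h : l + p = lp) (h' : k + lp = t) (m₁ n₁ m₂ n₂ m₃ n₃ : ℕ) :
    deg c d k m₁ (n₁ + 1) + (deg c d l m₂ (n₂ + 1) + deg c d p (1 + (1 + m₃)) n₃) =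
      deg c d t (m₁ + (m₂ + m₃)) (n₁ + (n₂ + n₃)) := by
  subst h h'
  simp only [deg]
  push_cast
  ring

/-- The graphs in which `η` is above `ξ` and `ξ` is above `ζ`. -/
def chainBlk (h : k + l = kl) (h' : kl + p = t) (η : Fam Q c d k) (ξ : Fam Q c d l)
    (ζ : Fam Q c d p) (m₁ n₁ m₂ n₂ m₃ n₃ : ℕ) : Fam Q c d t :=
  blk Q c d t (enum₃ m₁ m₂ m₃) (enum₃ n₁ n₂ n₃) (deg_chain h h' m₁ n₁ m₂ n₂ m₃ n₃)
    (Q.comp rfl (Q.relabel (Equiv.refl _) (Equiv.sumAssoc _ _ _).symm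
      (Q.comp rfl (η.inMarked m₁ n₁) (ξ.bothMarked m₂ n₂))) (ζ.outMarked m₃ n₃))

/-- The graphs in which `η` is above both `ξ` and `ζ`. -/
def veeBlk (h : k + l = kl) (h' : kl + p = t) (η : Fam Q c d k) (ξ : Fam Q c d l)
    (ζ : Fam Q c d p) (m₁ n₁ m₂ n₂ m₃ n₃ : ℕ) : Fam Q c d t :=
  blk Q c d t (enum₃ m₁ m₂ m₃) (enum₃ n₁ n₂ n₃) (deg_vee h h' m₁ n₁ m₂ n₂ m₃ n₃)
    (Q.comp rfl (Q.relabel (Equiv.refl _) (exchR _ _ _)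
      (Q.comp rfl (η.inMarked₂ m₁ n₁) (ξ.outMarked m₂ n₂))) (ζ.outMarked m₃ n₃))

/-- The graphs in which both `η` and `ξ` are above `ζ`. -/
def wedgeBlk (h : l + p = lp) (h' : k + lp = t) (η : Fam Q c d k) (ξ : Fam Q c d l)
    (ζ : Fam Q c d p) (m₁ n₁ m₂ n₂ m₃ n₃ : ℕ) : Fam Q c d t :=
  blk Q c d t (enum₃' m₁ m₂ m₃) (enum₃' n₁ n₂ n₃) (deg_wedge h h' m₁ n₁ m₂ n₂ m₃ n₃)
    (Q.comp rfl (η.inMarked m₁ n₁) (Q.relabel (exchL _ _ _) (Equiv.refl _)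
      (Q.comp rfl (ξ.inMarked m₂ n₂) (ζ.outMarked₂ m₃ n₃))))

theorem esgn_symm_eq {X : Type} {m : ℕ} (e : X ≃ Fin m) (h : Fin m ≃ X) :
    esgn K c e h.symm = esgn K c (Equiv.refl _) (h.trans e) := by
  rw [← esgn_trans c h e h.symm, Equiv.self_trans_symm, esgn_comm]

/-- By the symmetry of the family, marking an arbitrary further input gives the standard component
with two marked inputs, up to the sign of that choice. The next three lemmas do the same for the
other positions of the marked legs. -/
theorem Fam.inMarked_relabel_vee (hQ : Q.IsProperad (AddMonoidHom.id ℤ)) {η : Fam Q c d k}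
    (hη : η ∈ symFam Q c d k) {m n : ℕ} (g : Fin (n + 1) ≃ Fin n ⊕ Fin 1) :
    Q.relabel (Equiv.refl _) (Equiv.sumCongr g (Equiv.refl _)) (η.inMarked m (n + 1)) =
      esgn K d (Equiv.refl _) (g.trans (sumEnum (Equiv.refl _) (Equiv.refl _))) •
        η.inMarked₂ m n := by
  rw [Fam.inMarked, Fam.inMarked₂, ← hQ.relabel_trans]
  rw [symFam_relabel hQ hη (Equiv.refl _) _ (sumEnum finSumFinEquiv (Equiv.refl _)).symm,
    sumEnum_refl]
  congr 1
  have h : (finSumFinEquiv.symm.trans (Equiv.sumCongr g (Equiv.refl (Fin 1)))).symm =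
    sumEnum g.symm (Equiv.refl _) := rfl
  rw [h, Equiv.symm_symm, esgn_sumEnum', ← esgn_symm_eq]
  simp [esgn_self]

theorem Fam.outMarked_relabel_chain (hQ : Q.IsProperad (AddMonoidHom.id ℤ)) {η : Fam Q c d k}
    (hη : η ∈ symFam Q c d k) {m n : ℕ} (g : Fin (n + 1) ≃ Fin n ⊕ Fin 1) :
    Q.relabel (Equiv.refl _) g (η.outMarked m (n + 1)) =
      esgn K d (Equiv.refl _) (g.trans (sumEnum (Equiv.refl _) (Equiv.refl _))) •
        η.bothMarked m n := by
  rw [Fam.outMarked, Fam.bothMarked, ← hQ.relabel_trans]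
  rw [symFam_relabel hQ hη finSumFinEquiv.symm _ finSumFinEquiv.symm, sumEnum_refl]
  congr 1
  rw [← esgn_symm_eq]
  have h : (finSumFinEquiv.symm.trans (Equiv.refl (Fin 1 ⊕ Fin m))) = finSumFinEquiv.symm := rfl
  rw [h, esgn_self, one_mul]
  rfl

theorem Fam.inMarked_relabel_chain (hQ : Q.IsProperad (AddMonoidHom.id ℤ)) {η : Fam Q c d k}
    (hη : η ∈ symFam Q c d k) {m n : ℕ} (g : Fin (1 + m) ≃ Fin 1 ⊕ Fin m) :
    Q.relabel g (Equiv.refl _) (η.inMarked (1 + m) n) =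
      esgn K c (Equiv.refl _) (g.trans (sumEnum (Equiv.refl _) (Equiv.refl _))) •
        η.bothMarked m n := by
  rw [Fam.inMarked, Fam.bothMarked, ← hQ.relabel_trans]
  rw [symFam_relabel hQ hη finSumFinEquiv.symm _ finSumFinEquiv.symm, sumEnum_refl]
  congr 1
  rw [← esgn_symm_eq]
  have h : (finSumFinEquiv.symm.trans (Equiv.refl (Fin n ⊕ Fin 1))) = finSumFinEquiv.symm := rfl
  rw [h, esgn_self, mul_one]
  rfl

theorem Fam.outMarked_relabel_wedge (hQ : Q.IsProperad (AddMonoidHom.id ℤ)) {η : Fam Q c d k}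
    (hη : η ∈ symFam Q c d k) {m n : ℕ} (g : Fin (1 + m) ≃ Fin 1 ⊕ Fin m) :
    Q.relabel (Equiv.sumCongr (Equiv.refl _) g) (Equiv.refl _) (η.outMarked (1 + m) n) =
      esgn K c (Equiv.refl _) (g.trans (sumEnum (Equiv.refl _) (Equiv.refl _))) •
        η.outMarked₂ m n := by
  rw [Fam.outMarked, Fam.outMarked₂, ← hQ.relabel_trans]
  rw [symFam_relabel hQ hη (sumEnum (Equiv.refl _) finSumFinEquiv).symm _ (Equiv.refl _),
    sumEnum_refl]
  congr 1
  have h : (finSumFinEquiv.symm.trans (Equiv.sumCongr (Equiv.refl (Fin 1)) g)).symm =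
    sumEnum (Equiv.refl _) g.symm := rfl
  rw [h, Equiv.symm_symm, esgn_sumEnum', ← esgn_symm_eq]
  simp [esgn_self]

end Triples

/-! ### Products with a block, with free choice of the splitting of each leg. -/

section StarBlocks

variable {K : Type v} [Field K] [CharZero K] {Q : ProperadData.{u} K ℤ} {c d : ℤ} {k l t : ℤ}
  {A B : Type} [Finite A] [Finite B] {m n : ℕ} {i : ℤ}

/-- The form of `star_blk_left` that fits iterated products: for each glued input the term may be
computed with its own splitting and its own labelling of the remaining inputs, and the block may
have no inputs at all. -/
theorem star_blk_left' (hQ : Q.IsProperad (AddMonoidHom.id ℤ)) [Fintype B] (h : k + l = t)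
    (e : A ≃ Fin m) (f : B ≃ Fin n) (hi : i = deg c d k m n) (w : Q.obj A B i)
    (ξ : Fam Q c d l) (I' J' : Finset ℕ) (hξ : ∀ m n, ¬(m ∈ I' ∧ n ∈ J') → ξ (1 + m, n) = 0)
    (Z : B → ℕ → ℕ → Fam Q c d t)
    (hZ : ∀ b m₂ n₂, ∃ (n' : ℕ) (_ : n' + 1 = n) (X : Type) (_ : Finite X) (g : B ≃ X ⊕ Fin 1)
      (r : X ≃ Fin n') (hd : i + deg c d l (1 + m₂) n₂ = deg c d t (m + m₂) (n' + n₂)),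
      g b = Sum.inr 0 ∧ Z b m₂ n₂ =
        (((m₂ ! * n₂ ! : ℕ) : K)⁻¹ * starSign K c d k l m n' m₂ n₂) •
        esgn K d f (g.trans (sumEnum r (Equiv.refl _))) •
        blk Q c d t (sumEnum e (Equiv.refl (Fin m₂))) (sumEnum r (Equiv.refl (Fin n₂))) hd
          (Q.comp rfl (Q.relabel (Equiv.refl A) g w) (ξ.outMarked m₂ n₂))) :
    star Q c d h (blk Q c d k e f hi w) ξ = ∑ m₂ ∈ I', ∑ n₂ ∈ J', ∑ b, Z b m₂ n₂ := by
  -- Nothing can be attached to a block without inputs, and the right-hand side is a sum over an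
  -- empty set.
  rcases n with _ | n
  · rw [star_eq_sum h _ ξ ∅ ∅ I' J' _ hξ]
    · have : IsEmpty B := f.isEmpty
      simp
    · intro m' n' _
      exact blk_apply_ne _ _ _ _ (fun hs => absurd hs.2 (Nat.succ_ne_zero n').symm)
  · rw [star_blk_left hQ h e f hi w ξ I' J' hξ (splitLast f) (splitLast_self f)]
    refine Finset.sum_congr rfl fun m₂ _ => Finset.sum_congr rfl fun n₂ _ => ?_
    rw [Finset.smul_sum]
    refine Finset.sum_congr rfl fun b _ => ?_
    obtain ⟨n', hn, X, _, g, r, hd, hg, hZ⟩ := hZ b m₂ n₂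
    obtain rfl : n' = n := by omega
    rw [hZ]
    congr 1
    exact blk_comp_left_eq hQ e f b (splitLast f b) g (splitLast_self f b) hg (Equiv.refl _) r
      (Equiv.refl _) (Equiv.refl _) rfl _ _ w (ξ.outMarked m₂ n₂)

theorem star_blk_right' (hQ : Q.IsProperad (AddMonoidHom.id ℤ)) [Fintype A] (h : k + l = t)
    (e : A ≃ Fin m) (f : B ≃ Fin n) (hi : i = deg c d l m n) (w : Q.obj A B i)
    (η : Fam Q c d k) (I J : Finset ℕ) (hη : ∀ m n, ¬(m ∈ I ∧ n ∈ J) → η (m, n + 1) = 0)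
    (Z : A → ℕ → ℕ → Fam Q c d t)
    (hZ : ∀ a m₁ n₁, ∃ (m' : ℕ) (_ : 1 + m' = m) (X : Type) (_ : Finite X) (g : A ≃ Fin 1 ⊕ X)
      (r : X ≃ Fin m') (hd : deg c d k m₁ (n₁ + 1) + i = deg c d t (m₁ + m') (n₁ + n)),
      g a = Sum.inl 0 ∧ Z a m₁ n₁ =
        (((m₁ ! * n₁ ! : ℕ) : K)⁻¹ * starSign K c d k l m₁ n₁ m' n) •
        esgn K c e (g.trans (sumEnum (Equiv.refl _) r)) •
        blk Q c d t (sumEnum (Equiv.refl (Fin m₁)) r) (sumEnum (Equiv.refl (Fin n₁)) f) hd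
          (Q.comp rfl (η.inMarked m₁ n₁) (Q.relabel g (Equiv.refl B) w))) :
    star Q c d h η (blk Q c d l e f hi w) = ∑ m₁ ∈ I, ∑ n₁ ∈ J, ∑ a, Z a m₁ n₁ := by
  obtain rfl | ⟨m, rfl⟩ : m = 0 ∨ ∃ m', m = 1 + m' := by
    rcases m with _ | m
    · exact Or.inl rfl
    · exact Or.inr ⟨m, Nat.add_comm _ _⟩
  · rw [star_eq_sum h η _ I J ∅ ∅ hη]
    · have : IsEmpty A := e.isEmpty
      simp
    · intro m' n' _
      exact blk_apply_ne _ _ _ _ (fun hs => absurd hs.1 (by dsimp only; omega))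
  · rw [star_blk_right hQ h e f hi w η I J hη (splitFirst e) (splitFirst_self e)]
    refine Finset.sum_congr rfl fun m₁ _ => Finset.sum_congr rfl fun n₁ _ => ?_
    rw [Finset.smul_sum]
    refine Finset.sum_congr rfl fun a _ => ?_
    obtain ⟨m', hm, X, _, g, r, hd, hg, hZ⟩ := hZ a m₁ n₁
    obtain rfl : m' = m := by omega
    rw [hZ]
    congr 1
    exact blk_comp_right_eq hQ e f a (splitFirst e a) g (splitFirst_self e a) hg (Equiv.refl _) r
      (Equiv.refl _) (Equiv.refl _) rfl _ _ w (η.inMarked m₁ n₁)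

end StarBlocks

/-! ### Each term of an iterated product as a chain, a vee or a wedge. -/

section Terms

variable {K : Type v} [Field K] {Q : ProperadData.{u} K ℤ} {c d : ℤ} {k l p kl lp t : ℤ}

/-- The glued input belongs to `η` and has to pass the `n₂` inputs of `ξ` to become the last one,
which costs the sign on the right. -/
theorem vee_term (hQ : Q.IsProperad (AddMonoidHom.id ℤ)) (h : k + l = kl) (h' : kl + p = t)
    {η : Fam Q c d k} (hη : η ∈ symFam Q c d k) (ξ : Fam Q c d l) (ζ : Fam Q c d p)
    (m₁ n₁ m₂ n₂ m₃ n₃ : ℕ) (g : Fin (n₁ + 1) ≃ Fin n₁ ⊕ Fin 1) :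
    esgn K d (sumEnum (Equiv.refl (Fin (n₁ + 1))) (Equiv.refl (Fin n₂)))
        (((Equiv.sumCongr g (Equiv.refl _)).trans (exchR _ _ _)).trans
          (sumEnum (sumEnum (Equiv.refl _) (Equiv.refl _)) (Equiv.refl _))) •
      blk Q c d t (enum₃ m₁ m₂ m₃) (enum₃ n₁ n₂ n₃) (deg_vee h h' m₁ n₁ m₂ n₂ m₃ n₃)
        (Q.comp rfl (Q.relabel (Equiv.refl _) ((Equiv.sumCongr g (Equiv.refl _)).trans (exchR _ _ _))
          (Q.comp rfl (η.inMarked m₁ (n₁ + 1)) (ξ.outMarked m₂ n₂))) (ζ.outMarked m₃ n₃)) =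
      ksign K (d * n₂) • veeBlk h h' η ξ ζ m₁ n₁ m₂ n₂ m₃ n₃ := by
  have e1 := hQ.comp_relabel rfl (Equiv.refl _) g (Equiv.refl _) (Equiv.refl _) (Equiv.refl _)
    (η.inMarked m₁ (n₁ + 1)) (ξ.outMarked m₂ n₂)
  rw [Equiv.sumCongr_refl, Equiv.sumCongr_refl, hQ.relabel_refl,
    Fam.inMarked_relabel_vee hQ hη] at e1
  have e2 := hQ.relabel_trans (Equiv.refl _) (Equiv.refl _)
    (Equiv.sumCongr g (Equiv.refl (Fin n₂))) (exchR _ _ _)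
    (Q.comp rfl (η.inMarked m₁ (n₁ + 1)) (ξ.outMarked m₂ n₂))
  rw [← e1] at e2
  rw [show (Equiv.refl (Fin m₁ ⊕ Fin m₂)) = (Equiv.refl _).trans (Equiv.refl _) from rfl, e2]
  simp only [map_smul, LinearMap.smul_apply]
  rw [smul_smul, veeBlk]
  congr 1
  rw [Equiv.trans_assoc, ← esgn_mul d _ ((Equiv.sumCongr g (Equiv.refl _)).trans
    (sumEnum (sumEnum (Equiv.refl _) (Equiv.refl _)) (Equiv.refl _))), esgn_trans, esgn_exchR,
    sumEnum_trans, esgn_sumEnum', Equiv.refl_trans, esgn_self, mul_one]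
  have := esgn_mul_self (K := K) d (Equiv.refl (Fin (n₁ + 1)))
    (g.trans (sumEnum (Equiv.refl _) (Equiv.refl _)))
  rw [mul_right_comm, this]
  simp

/-- The glued input belongs to `ξ`, whose inputs already come last, so no sign arises. -/
theorem chain_term_left (hQ : Q.IsProperad (AddMonoidHom.id ℤ)) (h : k + l = kl) (h' : kl + p = t)
    (η : Fam Q c d k) {ξ : Fam Q c d l} (hξ : ξ ∈ symFam Q c d l) (ζ : Fam Q c d p)
    (m₁ n₁ m₂ n₂ m₃ n₃ : ℕ) (g : Fin (n₂ + 1) ≃ Fin n₂ ⊕ Fin 1) :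
    esgn K d (sumEnum (Equiv.refl (Fin n₁)) (Equiv.refl (Fin (n₂ + 1))))
        (((Equiv.sumCongr (Equiv.refl _) g).trans (Equiv.sumAssoc _ _ _).symm).trans
          (sumEnum (sumEnum (Equiv.refl _) (Equiv.refl _)) (Equiv.refl _))) •
      blk Q c d t (enum₃ m₁ m₂ m₃) (enum₃ n₁ n₂ n₃) (deg_chain h h' m₁ n₁ m₂ n₂ m₃ n₃)
        (Q.comp rfl (Q.relabel (Equiv.refl _)
          ((Equiv.sumCongr (Equiv.refl _) g).trans (Equiv.sumAssoc _ _ _).symm)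
          (Q.comp rfl (η.inMarked m₁ n₁) (ξ.outMarked m₂ (n₂ + 1)))) (ζ.outMarked m₃ n₃)) =
      chainBlk h h' η ξ ζ m₁ n₁ m₂ n₂ m₃ n₃ := by
  have e1 := hQ.comp_relabel rfl (Equiv.refl _) (Equiv.refl _) (Equiv.refl _) g (Equiv.refl _)
    (η.inMarked m₁ n₁) (ξ.outMarked m₂ (n₂ + 1))
  rw [Equiv.sumCongr_refl, Equiv.sumCongr_refl, Equiv.sumCongr_refl, hQ.relabel_refl,
    Fam.outMarked_relabel_chain hQ hξ] at e1
  have e2 := hQ.relabel_trans (Equiv.refl _) (Equiv.refl _)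
    (Equiv.sumCongr (Equiv.refl (Fin n₁)) g) (Equiv.sumAssoc _ _ _).symm
    (Q.comp rfl (η.inMarked m₁ n₁) (ξ.outMarked m₂ (n₂ + 1)))
  rw [← e1] at e2
  rw [show (Equiv.refl (Fin m₁ ⊕ Fin m₂)) = (Equiv.refl _).trans (Equiv.refl _) from rfl, e2]
  simp only [map_smul, LinearMap.smul_apply]
  rw [smul_smul, chainBlk]
  rw [Equiv.trans_assoc, ← esgn_mul d _ ((Equiv.sumCongr (Equiv.refl _) g).trans
    (sumEnum (Equiv.refl _) (sumEnum (Equiv.refl _) (Equiv.refl _)))), esgn_trans, esgn_assoc_symm,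
    sumEnum_trans, esgn_sumEnum', Equiv.refl_trans, esgn_self, one_mul, mul_one]
  have := esgn_mul_self (K := K) d (Equiv.refl (Fin (n₂ + 1)))
    (g.trans (sumEnum (Equiv.refl _) (Equiv.refl _)))
  rw [this, one_smul]

/-- The same chain, now assembled from below. The law `chain` identifies the two composites, and the
reassociation of the legs has sign one. -/
theorem chain_term_right (hQ : Q.IsProperad (AddMonoidHom.id ℤ)) (h : k + l = kl) (h' : kl + p = t)
    (η : Fam Q c d k) {ξ : Fam Q c d l} (hξ : ξ ∈ symFam Q c d l) (ζ : Fam Q c d p)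
    (m₁ n₁ m₂ n₂ m₃ n₃ : ℕ) (g : Fin (1 + m₂) ≃ Fin 1 ⊕ Fin m₂)
    (hd : deg c d k m₁ (n₁ + 1) + (deg c d l (1 + m₂) (n₂ + 1) + deg c d p (1 + m₃) n₃) =
      deg c d t (m₁ + (m₂ + m₃)) (n₁ + (n₂ + n₃))) :
    esgn K c (sumEnum (Equiv.refl (Fin (1 + m₂))) (Equiv.refl (Fin m₃)))
        (((Equiv.sumCongr g (Equiv.refl _)).trans (Equiv.sumAssoc _ _ _)).trans
          (sumEnum (Equiv.refl _) (sumEnum (Equiv.refl _) (Equiv.refl _)))) •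
      blk Q c d t (enum₃' m₁ m₂ m₃) (enum₃' n₁ n₂ n₃) hd
        (Q.comp rfl (η.inMarked m₁ n₁) (Q.relabel
          ((Equiv.sumCongr g (Equiv.refl _)).trans (Equiv.sumAssoc _ _ _)) (Equiv.refl _)
          (Q.comp rfl (ξ.inMarked (1 + m₂) n₂) (ζ.outMarked m₃ n₃)))) =
      chainBlk h h' η ξ ζ m₁ n₁ m₂ n₂ m₃ n₃ := by
  have e1 := hQ.comp_relabel rfl g (Equiv.refl _) (Equiv.refl _) (Equiv.refl _) (Equiv.refl _)
    (ξ.inMarked (1 + m₂) n₂) (ζ.outMarked m₃ n₃)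
  rw [Equiv.sumCongr_refl, Equiv.sumCongr_refl, Equiv.sumCongr_refl, hQ.relabel_refl,
    Fam.inMarked_relabel_chain hQ hξ] at e1
  have e2 := hQ.relabel_trans (Equiv.sumCongr g (Equiv.refl (Fin m₃))) (Equiv.sumAssoc _ _ _)
    (Equiv.refl _) (Equiv.refl _)
    (Q.comp rfl (ξ.inMarked (1 + m₂) n₂) (ζ.outMarked m₃ n₃))
  rw [← e1] at e2
  rw [show (Equiv.refl (Fin n₂ ⊕ Fin n₃)) = (Equiv.refl _).trans (Equiv.refl _) from rfl, e2]
  simp only [map_smul, LinearMap.smul_apply]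
  rw [smul_smul, chainBlk]
  rw [Equiv.trans_assoc, ← esgn_mul c _ ((Equiv.sumCongr g (Equiv.refl _)).trans
    (sumEnum (sumEnum (Equiv.refl _) (Equiv.refl _)) (Equiv.refl _))), esgn_trans, esgn_assoc,
    sumEnum_trans, esgn_sumEnum', Equiv.refl_trans, esgn_self, mul_one, mul_one]
  have := esgn_mul_self (K := K) c (Equiv.refl (Fin (1 + m₂)))
    (g.trans (sumEnum (Equiv.refl _) (Equiv.refl _)))
  rw [this, one_smul]
  have e3 := hQ.chain rfl (add_assoc _ _ _) rfl rfl (η.inMarked m₁ n₁) (ξ.bothMarked m₂ n₂)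
    (ζ.outMarked m₃ n₃)
  have hd' := deg_chain (c := c) (d := d) h h' m₁ n₁ m₂ n₂ m₃ n₃
  -- The two bracketings of the sum of the three degrees are equal but not by definition, so the
  -- block is transported along that equality.
  have e4 : ∀ {i : ℤ} (hi : deg c d k m₁ (n₁ + 1) + deg c d l (1 + m₂) (n₂ + 1) +
      deg c d p (1 + m₃) n₃ = i) (hi' : i = deg c d t (m₁ + m₂ + m₃) (n₁ + n₂ + n₃)),
      blk Q c d t (enum₃ m₁ m₂ m₃) (enum₃ n₁ n₂ n₃) hi' (Q.comp hi (Q.relabel (Equiv.refl _)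
        (Equiv.sumAssoc _ _ _).symm (Q.comp rfl (η.inMarked m₁ n₁) (ξ.bothMarked m₂ n₂)))
          (ζ.outMarked m₃ n₃)) =
      blk Q c d t (enum₃ m₁ m₂ m₃) (enum₃ n₁ n₂ n₃) hd' (Q.comp rfl (Q.relabel (Equiv.refl _)
        (Equiv.sumAssoc _ _ _).symm (Q.comp rfl (η.inMarked m₁ n₁) (ξ.bothMarked m₂ n₂)))
          (ζ.outMarked m₃ n₃)) := by
    intro i hi hi'
    subst hi
    rfl
  rw [← e4 (add_assoc _ _ _) ((add_assoc _ _ _).symm.trans hd')]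
  have e5 : (Q.relabel (Equiv.sumAssoc (Fin 1) (Fin m₂) (Fin m₃))
      ((Equiv.refl (Fin n₂ ⊕ Fin n₃)).trans (Equiv.refl _))
      (Q.comp rfl (ξ.bothMarked m₂ n₂) (ζ.outMarked m₃ n₃))) =
      (Q.relabel (Equiv.sumAssoc (Fin 1) (Fin m₂) (Fin m₃)) (Equiv.refl (Fin n₂ ⊕ Fin n₃))
      (Q.comp rfl (ξ.bothMarked m₂ n₂) (ζ.outMarked m₃ n₃))) := rfl
  have e6 := blk_relabel hQ (c := c) (d := d) (k := t) (Equiv.sumAssoc (Fin m₁) (Fin m₂) (Fin m₃))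
    (Equiv.sumAssoc (Fin n₁) (Fin n₂) (Fin n₃)) (enum₃' m₁ m₂ m₃) (enum₃' n₁ n₂ n₃) hd
    (Q.comp (add_assoc _ _ _) (Q.relabel (Equiv.refl _)
        (Equiv.sumAssoc _ _ _).symm (Q.comp rfl (η.inMarked m₁ n₁) (ξ.bothMarked m₂ n₂)))
          (ζ.outMarked m₃ n₃))
  rw [e3] at e6
  refine e6.trans ?_
  rw [blk_congr (enum₃ m₁ m₂ m₃) (enum₃ n₁ n₂ n₃) _ _ ((add_assoc _ _ _).symm.trans hd') hd,
    esgn_assoc, esgn_assoc, one_mul, one_smul]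

/-- The glued output belongs to `ζ` and has to pass the `m₂` outputs of `ξ` to become the first one.
-/
theorem wedge_term (hQ : Q.IsProperad (AddMonoidHom.id ℤ)) (h : l + p = lp) (h' : k + lp = t)
    (η : Fam Q c d k) (ξ : Fam Q c d l) {ζ : Fam Q c d p} (hζ : ζ ∈ symFam Q c d p)
    (m₁ n₁ m₂ n₂ m₃ n₃ : ℕ) (g : Fin (1 + m₃) ≃ Fin 1 ⊕ Fin m₃) :
    esgn K c (sumEnum (Equiv.refl (Fin m₂)) (Equiv.refl (Fin (1 + m₃))))
        (((Equiv.sumCongr (Equiv.refl _) g).trans (exchL _ _ _)).trans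
          (sumEnum (Equiv.refl _) (sumEnum (Equiv.refl _) (Equiv.refl _)))) •
      blk Q c d t (enum₃' m₁ m₂ m₃) (enum₃' n₁ n₂ n₃) (deg_wedge h h' m₁ n₁ m₂ n₂ m₃ n₃)
        (Q.comp rfl (η.inMarked m₁ n₁) (Q.relabel
          ((Equiv.sumCongr (Equiv.refl _) g).trans (exchL _ _ _)) (Equiv.refl _)
          (Q.comp rfl (ξ.inMarked m₂ n₂) (ζ.outMarked (1 + m₃) n₃)))) =
      ksign K (c * m₂) • wedgeBlk h h' η ξ ζ m₁ n₁ m₂ n₂ m₃ n₃ := by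
  have e1 := hQ.comp_relabel rfl (Equiv.refl _) (Equiv.refl _) g (Equiv.refl _) (Equiv.refl _)
    (ξ.inMarked m₂ n₂) (ζ.outMarked (1 + m₃) n₃)
  rw [Equiv.sumCongr_refl, Equiv.sumCongr_refl, hQ.relabel_refl,
    Fam.outMarked_relabel_wedge hQ hζ] at e1
  have e2 := hQ.relabel_trans (Equiv.sumCongr (Equiv.refl (Fin m₂)) g) (exchL _ _ _)
    (Equiv.refl _) (Equiv.refl _)
    (Q.comp rfl (ξ.inMarked m₂ n₂) (ζ.outMarked (1 + m₃) n₃))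
  rw [← e1] at e2
  rw [show (Equiv.refl (Fin n₂ ⊕ Fin n₃)) = (Equiv.refl _).trans (Equiv.refl _) from rfl, e2]
  simp only [map_smul]
  rw [smul_smul, wedgeBlk]
  congr 1
  rw [Equiv.trans_assoc, ← esgn_mul c _ ((Equiv.sumCongr (Equiv.refl _) g).trans
    (sumEnum (Equiv.refl _) (sumEnum (Equiv.refl _) (Equiv.refl _)))), esgn_trans, esgn_exchL,
    sumEnum_trans, esgn_sumEnum', Equiv.refl_trans, esgn_self, one_mul]
  have := esgn_mul_self (K := K) c (Equiv.refl (Fin (1 + m₃)))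
    (g.trans (sumEnum (Equiv.refl _) (Equiv.refl _)))
  rw [mul_right_comm, this]
  simp

/-- Exchanging the two marked inputs is a transposition. -/
theorem Fam.inMarked₂_exchR (hQ : Q.IsProperad (AddMonoidHom.id ℤ)) {η : Fam Q c d k}
    (hη : η ∈ symFam Q c d k) (m n : ℕ) :
    Q.relabel (Equiv.refl _) (exchR _ _ _) (η.inMarked₂ m n) = ksign K d • η.inMarked₂ m n := by
  rw [Fam.inMarked₂, ← hQ.relabel_trans]
  rw [symFam_relabel hQ hη (Equiv.refl _) _ (sumEnum finSumFinEquiv (Equiv.refl _)).symm]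
  congr 1
  have h := esgn_exchR (K := K) d (Equiv.refl (Fin n)) (Equiv.refl (Fin 1)) (Equiv.refl (Fin 1))
  rw [sumEnum_refl] at h
  rw [Equiv.symm_symm, ← esgn_trans d (exchR (Fin n) (Fin 1) (Fin 1)), esgn_comm d]
  have h2 : (exchR (Fin n) (Fin 1) (Fin 1)).trans
      (((sumEnum finSumFinEquiv (Equiv.refl (Fin 1))).symm.trans (exchR _ _ _)).symm) =
      sumEnum finSumFinEquiv (Equiv.refl (Fin 1)) := by
    ext x
    simp
  rw [h2, h]
  have h3 : esgn K c (Equiv.refl (Fin m)).symm ((Equiv.refl (Fin m)).trans (Equiv.refl _)).symm = 1 :=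
    esgn_self c _
  rw [h3]
  simp

theorem Fam.outMarked₂_exchL (hQ : Q.IsProperad (AddMonoidHom.id ℤ)) {η : Fam Q c d k}
    (hη : η ∈ symFam Q c d k) (m n : ℕ) :
    Q.relabel (exchL _ _ _) (Equiv.refl _) (η.outMarked₂ m n) = ksign K c • η.outMarked₂ m n := by
  rw [Fam.outMarked₂, ← hQ.relabel_trans]
  rw [symFam_relabel hQ hη (sumEnum (Equiv.refl _) finSumFinEquiv).symm _ (Equiv.refl _)]
  congr 1
  have h := esgn_exchL (K := K) c (Equiv.refl (Fin 1)) (Equiv.refl (Fin 1)) (Equiv.refl (Fin m))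
  rw [sumEnum_refl] at h
  rw [Equiv.symm_symm, ← esgn_trans c (exchL (Fin 1) (Fin 1) (Fin m)), esgn_comm c]
  have h2 : (exchL (Fin 1) (Fin 1) (Fin m)).trans
      (((sumEnum (Equiv.refl (Fin 1)) finSumFinEquiv).symm.trans (exchL _ _ _)).symm) =
      sumEnum (Equiv.refl (Fin 1)) finSumFinEquiv := by
    ext x
    simp
  rw [h2, h]
  have h3 : esgn K d (Equiv.refl (Fin n)).symm ((Equiv.refl (Fin n)).trans (Equiv.refl _)).symm = 1 :=
    esgn_self d _
  rw [h3]
  simp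

theorem blk_comp_cast {A B C D E : Type} [Finite A] [Finite B] [Finite C] [Finite D] [Finite E]
    [Nonempty E] {m n : ℕ} {i j r r' : ℤ} (e : A ⊕ C ≃ Fin m) (f : B ⊕ D ≃ Fin n)
    (h : i + j = r) (hr : r = deg c d t m n) (h' : i + j = r') (hr' : r' = deg c d t m n)
    (x : Q.obj A (B ⊕ E) i) (y : Q.obj (E ⊕ C) D j) :
    blk Q c d t e f hr (Q.comp h x y) = blk Q c d t e f hr' (Q.comp h' x y) := by
  subst h h'
  rfl

/-- The law `assoc_below` exchanges the lower vertices. The four signs come from the Koszul rule,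
from transposing the two glued inputs of `η`, and from exchanging the blocks of outputs and of
inputs. -/
theorem veeBlk_symm (hQ : Q.IsProperad (AddMonoidHom.id ℤ)) {kp : ℤ} (h : k + l = kl)
    (h' : kl + p = t) (h₂ : k + p = kp) (h₂' : kp + l = t)
    {η : Fam Q c d k} (hη : η ∈ symFam Q c d k) (ξ : Fam Q c d l) (ζ : Fam Q c d p)
    (m₁ n₁ m₂ n₂ m₃ n₃ : ℕ) :
    veeBlk h₂ h₂' η ζ ξ m₁ n₁ m₃ n₃ m₂ n₂ =
      ((ksign K (deg c d l (1 + m₂) n₂ * deg c d p (1 + m₃) n₃) * ksign K d) *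
        (ksign K (c * (m₂ * m₃)) * ksign K (d * (n₂ * n₃)))) •
        veeBlk h h' η ξ ζ m₁ n₁ m₂ n₂ m₃ n₃ := by
  have h0 : deg c d k m₁ (n₁ + 1 + 1) + deg c d p (1 + m₃) n₃ + deg c d l (1 + m₂) n₂ =
      deg c d t (m₁ + m₂ + m₃) (n₁ + n₂ + n₃) := by
    simp only [deg, ← h', ← h]
    push_cast
    ring
  have e1 := hQ.assoc_below rfl h0 rfl (deg_vee h h' m₁ n₁ m₂ n₂ m₃ n₃) (η.inMarked₂ m₁ n₁)
    (ξ.outMarked m₂ n₂) (ζ.outMarked m₃ n₃)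
  rw [Fam.inMarked₂_exchR hQ hη] at e1
  simp only [map_smul, LinearMap.smul_apply, AddMonoidHom.id_apply, smul_smul] at e1
  have hd : deg c d t (m₁ + m₂ + m₃) (n₁ + n₂ + n₃) = deg c d t (m₁ + m₃ + m₂) (n₁ + n₃ + n₂) := by
    rw [Nat.add_right_comm m₁, Nat.add_right_comm n₁]
  rw [veeBlk, blk_comp_cast _ _ rfl _ h0 hd, e1, map_smul, veeBlk]
  rw [blk_comp_cast (enum₃ m₁ m₂ m₃) (enum₃ n₁ n₂ n₃) rfl (deg_vee h h' m₁ n₁ m₂ n₂ m₃ n₃)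
    (deg_vee h h' m₁ n₁ m₂ n₂ m₃ n₃) rfl, blk_relabel hQ,
    blk_congr (enum₃ m₁ m₂ m₃) (enum₃ n₁ n₂ n₃) _ _ rfl, esgn_exchR, esgn_exchR, smul_smul]

/-- The same for two upper vertices, by the law `assoc_above`; here the two glued outputs of `ζ` are
transposed. -/
theorem wedgeBlk_symm (hQ : Q.IsProperad (AddMonoidHom.id ℤ)) {kp : ℤ} (h : l + p = lp)
    (h' : k + lp = t) (h₂ : k + p = kp) (h₂' : l + kp = t)
    (η : Fam Q c d k) (ξ : Fam Q c d l) {ζ : Fam Q c d p} (hζ : ζ ∈ symFam Q c d p)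
    (m₁ n₁ m₂ n₂ m₃ n₃ : ℕ) :
    wedgeBlk h₂ h₂' ξ η ζ m₂ n₂ m₁ n₁ m₃ n₃ =
      ((ksign K (deg c d k m₁ (n₁ + 1) * deg c d l m₂ (n₂ + 1)) * ksign K c) *
        (ksign K (c * (m₁ * m₂)) * ksign K (d * (n₁ * n₂)))) •
        wedgeBlk h h' η ξ ζ m₁ n₁ m₂ n₂ m₃ n₃ := by
  have h0 : deg c d l m₂ (n₂ + 1) + (deg c d k m₁ (n₁ + 1) + deg c d p (1 + (1 + m₃)) n₃) =
      deg c d t (m₁ + (m₂ + m₃)) (n₁ + (n₂ + n₃)) := by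
    simp only [deg, ← h', ← h]
    push_cast
    ring
  have e1 := hQ.assoc_above rfl h0 rfl (deg_wedge h h' m₁ n₁ m₂ n₂ m₃ n₃) (η.inMarked m₁ n₁)
    (ξ.inMarked m₂ n₂) (ζ.outMarked₂ m₃ n₃)
  rw [Fam.outMarked₂_exchL hQ hζ] at e1
  simp only [map_smul, AddMonoidHom.id_apply, smul_smul] at e1
  have hd : deg c d t (m₁ + (m₂ + m₃)) (n₁ + (n₂ + n₃)) =
      deg c d t (m₂ + (m₁ + m₃)) (n₂ + (n₁ + n₃)) := by
    rw [Nat.add_left_comm m₁, Nat.add_left_comm n₁]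
  rw [wedgeBlk, blk_comp_cast _ _ rfl _ h0 hd, e1, map_smul, wedgeBlk]
  rw [blk_comp_cast (enum₃' m₁ m₂ m₃) (enum₃' n₁ n₂ n₃) rfl (deg_wedge h h' m₁ n₁ m₂ n₂ m₃ n₃)
    (deg_wedge h h' m₁ n₁ m₂ n₂ m₃ n₃) rfl, blk_relabel hQ,
    blk_congr (enum₃' m₁ m₂ m₃) (enum₃' n₁ n₂ n₃) _ _ rfl, esgn_exchL, esgn_exchL, smul_smul]

end Terms

/-! ### Index shifts from all legs to the legs that remain free. -/

section Shift

variable {M : Type*} [AddCommMonoid M]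

/-- The pairs of natural numbers less than `N`. -/
abbrev box (N : ℕ) : Finset (ℕ × ℕ) := Finset.range N ×ˢ Finset.range N

/-- Gluing one of n + 1 legs leaves n of them. There is no term with zero legs, and the vanishing of
`G` at the top of the range compensates for the lost index. -/
theorem sum_range_shift (N : ℕ) (F G : ℕ → M) (h : ∀ n, F (n + 1) = G n) (h₀ : F 0 = 0)
    (hG : ∀ n, N ≤ n + 1 → G n = 0) : ∑ n ∈ Finset.range N, F n = ∑ n ∈ Finset.range N, G n := by
  rcases N with _ | N
  · rfl
  · rw [Finset.sum_range_succ', Finset.sum_range_succ, h₀, hG N le_rfl]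
    simp only [h]

theorem sum_box_shift_snd (N : ℕ) (F G : ℕ × ℕ → M) (h : ∀ m n, F (m, n + 1) = G (m, n))
    (h₀ : ∀ m, F (m, 0) = 0) (hG : ∀ m n, N ≤ n + 1 → G (m, n) = 0) :
    ∑ s ∈ box N, F s = ∑ s ∈ box N, G s := by
  rw [Finset.sum_product, Finset.sum_product]
  exact Finset.sum_congr rfl fun m _ => sum_range_shift N _ _ (h m) (h₀ m) (hG m)

theorem sum_box_shift_fst (N : ℕ) (F G : ℕ × ℕ → M) (h : ∀ m n, F (1 + m, n) = G (m, n))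
    (h₀ : ∀ n, F (0, n) = 0) (hG : ∀ m n, N ≤ m + 1 → G (m, n) = 0) :
    ∑ s ∈ box N, F s = ∑ s ∈ box N, G s := by
  rw [Finset.sum_product_right, Finset.sum_product_right]
  exact Finset.sum_congr rfl fun n _ => sum_range_shift N _ _
    (fun m => by rw [Nat.add_comm]; exact h m n) (h₀ n) (fun m => hG m n)

end Shift

/-! ### Sums of all chains, vees and wedges, and their symmetries. -/

section Decomposition

variable {K : Type v} [Field K] {Q : ProperadData.{u} K ℤ} {c d : ℤ} {k l p kl lp t : ℤ}

/-- Families all of whose components with at least `N` inputs or outputs vanish. -/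
def Fam.BoundedBy (N : ℕ) (η : Fam Q c d k) : Prop := ∀ s, N ≤ s.1 ∨ N ≤ s.2 → η s = 0

/-- The inverse of the product of the factorials of the entries of a pair. -/
def facInv (K : Type v) [Field K] (s : ℕ × ℕ) : K := ((s.1 ! * s.2 ! : ℕ) : K)⁻¹

theorem star_eq_sum_box (h : k + l = t) {η : Fam Q c d k} {ξ : Fam Q c d l} {N : ℕ}
    (hη : η.BoundedBy N) (hξ : ξ.BoundedBy N) :
    star Q c d h η ξ = ∑ a ∈ box N, ∑ b ∈ box N,
      (facInv K a * facInv K b * starSign K c d k l a.1 a.2 b.1 b.2) •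
        blk Q c d t (sumEnum (Equiv.refl (Fin a.1)) (Equiv.refl (Fin b.1)))
          (sumEnum (Equiv.refl (Fin a.2)) (Equiv.refl (Fin b.2))) (deg_comp' h a.1 a.2 b.1 b.2)
          (Q.comp rfl (η.inMarked a.1 a.2) (ξ.outMarked b.1 b.2)) := by
  rw [star_eq_sum h η ξ (Finset.range N) (Finset.range N) (Finset.range N) (Finset.range N)]
  · rw [Finset.sum_product]
    refine Finset.sum_congr rfl fun m₁ _ => ?_
    rw [Finset.sum_comm]
    refine Finset.sum_congr rfl fun n₁ _ => ?_
    rw [Finset.sum_product]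
    refine Finset.sum_congr rfl fun m₂ _ => Finset.sum_congr rfl fun n₂ _ => ?_
    congr 2
    simp only [facInv]
    push_cast
    rw [← mul_inv]
    congr 1
    ring
  · intro m n hmn
    simp only [Finset.mem_range] at hmn
    exact hη _ (by dsimp only; omega)
  · intro m n hmn
    simp only [Finset.mem_range] at hmn
    exact hξ _ (by dsimp only; omega)

variable (h : k + l = kl) (h' : kl + p = t) (η : Fam Q c d k) (ξ : Fam Q c d l) (ζ : Fam Q c d p)
  (N : ℕ)

/-- The sum of the graphs in which `η` is above `ξ` and `ξ` is above `ζ`. -/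
def chainSum : Fam Q c d t := ∑ x ∈ box N, ∑ y ∈ box N, ∑ z ∈ box N,
  (facInv K x * facInv K y * facInv K z * (starSign K c d k l x.1 x.2 y.1 (y.2 + 1) *
    starSign K c d kl p (x.1 + y.1) (x.2 + y.2) z.1 z.2)) •
    chainBlk h h' η ξ ζ x.1 x.2 y.1 y.2 z.1 z.2

/-- The sum of the graphs in which `η` is above both `ξ` and `ζ`. -/
def veeSum : Fam Q c d t := ∑ x ∈ box N, ∑ y ∈ box N, ∑ z ∈ box N,
  (facInv K x * facInv K y * facInv K z * (starSign K c d k l x.1 (x.2 + 1) y.1 y.2 *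
    ksign K (d * y.2) * starSign K c d kl p (x.1 + y.1) (x.2 + y.2) z.1 z.2)) •
    veeBlk h h' η ξ ζ x.1 x.2 y.1 y.2 z.1 z.2

/-- The sum of the graphs in which both `η` and `ξ` are above `ζ`. -/
def wedgeSum (h : l + p = lp) (h' : k + lp = t) : Fam Q c d t :=
  ∑ x ∈ box N, ∑ y ∈ box N, ∑ z ∈ box N,
  (facInv K x * facInv K y * facInv K z * (starSign K c d l p y.1 y.2 (1 + z.1) z.2 *
    ksign K (c * y.1) * starSign K c d k lp x.1 x.2 (y.1 + z.1) (y.2 + z.2))) •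
    wedgeBlk h h' η ξ ζ x.1 x.2 y.1 y.2 z.1 z.2

variable {η ξ ζ N}

/-- Termwise symmetry: the signs of `veeBlk_symm` and `starSign_below` cancel except for the Koszul
sign of the degrees of the families. -/
theorem veeSum_symm (hQ : Q.IsProperad (AddMonoidHom.id ℤ)) {kp : ℤ} (h₂ : k + p = kp)
    (h₂' : kp + l = t) (hη : η ∈ symFam Q c d k) :
    veeSum h h' η ξ ζ N = ksign K (l * p) • veeSum h₂ h₂' η ζ ξ N := by
  simp only [veeSum, Finset.smul_sum]
  refine Finset.sum_congr rfl fun x _ => ?_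
  rw [Finset.sum_comm]
  refine Finset.sum_congr rfl fun z _ => Finset.sum_congr rfl fun y _ => ?_
  rw [veeBlk_symm hQ h h' h₂ h₂' hη ξ ζ, smul_smul, smul_smul, starSign_below K c d k l p h h₂,
    mul_comm (deg c d p _ _)]
  congr 1
  ring

theorem wedgeSum_symm (hQ : Q.IsProperad (AddMonoidHom.id ℤ)) {kp : ℤ} (h : l + p = lp)
    (h' : k + lp = t) (h₂ : k + p = kp) (h₂' : l + kp = t) (hζ : ζ ∈ symFam Q c d p) :
    wedgeSum η ξ ζ N h h' = ksign K (k * l) • wedgeSum ξ η ζ N h₂ h₂' := by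
  simp only [wedgeSum, Finset.smul_sum]
  rw [Finset.sum_comm]
  refine Finset.sum_congr rfl fun y _ => Finset.sum_congr rfl fun x _ =>
    Finset.sum_congr rfl fun z _ => ?_
  rw [wedgeBlk_symm hQ h h' h₂ h₂' η ξ hζ, smul_smul, smul_smul,
    starSign_above K c d k l p h h₂, mul_comm (deg c d l _ _)]
  congr 1
  ring

end Decomposition

/-! ### Iterated products in terms of chains, vees and wedges. -/

section Associator

variable {K : Type v} [Field K] [CharZero K] {Q : ProperadData.{u} K ℤ} {c d : ℤ}
  {k l p kl lp t : ℤ} {η : Fam Q c d k} {ξ : Fam Q c d l} {ζ : Fam Q c d p} {N : ℕ}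

/-- The n + 1 equal choices of the glued input turn 1/(n+1)! into 1/n!. -/
theorem facInv_succ_snd (m n : ℕ) : facInv K (m, n + 1) * ((n + 1 : ℕ) : K) = facInv K (m, n) := by
  have : ((n + 1 : ℕ) : K) ≠ 0 := by exact_mod_cast Nat.succ_ne_zero n
  simp only [facInv, Nat.factorial_succ]
  push_cast at this ⊢
  field_simp

theorem facInv_succ_fst (m n : ℕ) : facInv K (1 + m, n) * ((1 + m : ℕ) : K) = facInv K (m, n) := by
  have : ((m + 1 : ℕ) : K) ≠ 0 := by exact_mod_cast Nat.succ_ne_zero m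
  rw [Nat.add_comm 1 m]
  simp only [facInv, Nat.factorial_succ]
  push_cast at this ⊢
  field_simp

/-- The edge to `ζ` starts at an input of `η`, which gives a vee, or at an input of `ξ`, which gives
a chain. -/
theorem star_star_left (hQ : Q.IsProperad (AddMonoidHom.id ℤ)) (h : k + l = kl) (h' : kl + p = t)
    (hη : η ∈ symFam Q c d k) (hξ : ξ ∈ symFam Q c d l)
    (bη : η.BoundedBy N) (bξ : ξ.BoundedBy N) (bζ : ζ.BoundedBy N) :
    star Q c d h' (star Q c d h η ξ) ζ = veeSum h h' η ξ ζ N + chainSum h h' η ξ ζ N := by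
  -- By symmetry all `a.2` inputs of `η` give the same vee, and all `b.2` inputs of `ξ` the same
  -- chain. Where the subtraction is truncated at zero, the coefficient is zero too.
  have key : ∀ a b : ℕ × ℕ, star Q c d h'
      (blk Q c d kl (sumEnum (Equiv.refl (Fin a.1)) (Equiv.refl (Fin b.1)))
          (sumEnum (Equiv.refl (Fin a.2)) (Equiv.refl (Fin b.2))) (deg_comp' h a.1 a.2 b.1 b.2)
          (Q.comp rfl (η.inMarked a.1 a.2) (ξ.outMarked b.1 b.2))) ζ =
      ∑ z ∈ box N, ((a.2 : K) • (facInv K z *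
          starSign K c d kl p (a.1 + b.1) (a.2 - 1 + b.2) z.1 z.2) • ksign K (d * b.2) •
            veeBlk h h' η ξ ζ a.1 (a.2 - 1) b.1 b.2 z.1 z.2 +
        (b.2 : K) • (facInv K z * starSign K c d kl p (a.1 + b.1) (a.2 + (b.2 - 1)) z.1 z.2) •
            chainBlk h h' η ξ ζ a.1 a.2 b.1 (b.2 - 1) z.1 z.2) := by
    rintro ⟨m₁, n₁⟩ ⟨m₂, n₂⟩
    rw [star_blk_left' hQ h' _ _ _ _ ζ (Finset.range N) (Finset.range N) ?_
      (fun x m₃ n₃ => Sum.elim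
        (fun _ => (facInv K (m₃, n₃) * starSign K c d kl p (m₁ + m₂) (n₁ - 1 + n₂) m₃ n₃) •
          ksign K (d * n₂) • veeBlk h h' η ξ ζ m₁ (n₁ - 1) m₂ n₂ m₃ n₃)
        (fun _ => (facInv K (m₃, n₃) * starSign K c d kl p (m₁ + m₂) (n₁ + (n₂ - 1)) m₃ n₃) •
          chainBlk h h' η ξ ζ m₁ n₁ m₂ (n₂ - 1) m₃ n₃) x) ?_, Finset.sum_product]
    · refine Finset.sum_congr rfl fun m₃ _ => Finset.sum_congr rfl fun n₃ _ => ?_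
      simp only [Fintype.sum_sum_type, Sum.elim_inl, Sum.elim_inr, Finset.sum_const,
        Finset.card_univ, Fintype.card_fin, Nat.cast_smul_eq_nsmul]
    · intro m n hmn
      simp only [Finset.mem_range] at hmn
      exact bζ _ (by dsimp only; omega)
    · rintro (b | b) m₃ n₃
      · obtain ⟨n₁, rfl⟩ : ∃ n, n₁ = n + 1 := Nat.exists_eq_succ_of_ne_zero (by
          rintro rfl
          exact b.elim0)
        refine ⟨n₁ + n₂, by dsimp only; omega, Fin n₁ ⊕ Fin n₂, inferInstance,
          (Equiv.sumCongr (splitLast (Equiv.refl _) b) (Equiv.refl _)).trans (exchR _ _ _),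
          sumEnum (Equiv.refl _) (Equiv.refl _), ?_, ?_, ?_⟩
        · exact deg_vee h h' m₁ n₁ m₂ n₂ m₃ n₃
        · simp only [Equiv.trans_apply, Equiv.sumCongr_apply, Sum.map_inl, splitLast_self]
          rfl
        · rw [Sum.elim_inl]
          exact congrArg _ (vee_term hQ h h' hη ξ ζ m₁ n₁ m₂ n₂ m₃ n₃ _).symm
      · obtain ⟨n₂, rfl⟩ : ∃ n, n₂ = n + 1 := Nat.exists_eq_succ_of_ne_zero (by
          rintro rfl
          exact b.elim0)
        refine ⟨n₁ + n₂, by dsimp only; omega, Fin n₁ ⊕ Fin n₂, inferInstance,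
          (Equiv.sumCongr (Equiv.refl _) (splitLast (Equiv.refl _) b)).trans
            (Equiv.sumAssoc _ _ _).symm,
          sumEnum (Equiv.refl _) (Equiv.refl _), ?_, ?_, ?_⟩
        · exact deg_chain h h' m₁ n₁ m₂ n₂ m₃ n₃
        · simp only [Equiv.trans_apply, Equiv.sumCongr_apply, Sum.map_inr, splitLast_self]
          rfl
        · rw [Sum.elim_inr]
          exact congrArg _ (chain_term_left hQ h h' η hξ ζ m₁ n₁ m₂ n₂ m₃ n₃ _).symm
  rw [star_eq_sum_box h bη bξ]
  simp only [map_sum, LinearMap.sum_apply, map_smul, LinearMap.smul_apply, key,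
    Finset.sum_add_distrib, smul_add]
  congr 1
  · rw [veeSum]
    -- The index passes from the inputs of `η` before gluing to those left after it; the number of
    -- choices is absorbed by the factorial.
    refine sum_box_shift_snd N _ _ ?_ ?_ ?_
    · intro m n
      refine Finset.sum_congr rfl fun y _ => ?_
      rw [Finset.smul_sum]
      refine Finset.sum_congr rfl fun z _ => ?_
      simp only [smul_smul, Nat.add_sub_cancel]
      congr 1
      rw [← facInv_succ_snd m n]
      ring
    · simp
    · intro m n hn
      refine Finset.sum_eq_zero fun y _ => Finset.sum_eq_zero fun z _ => ?_
      rw [veeBlk, Fam.inMarked₂, bη _ (Or.inr (by dsimp only; omega))]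
      simp
  · rw [chainSum]
    refine Finset.sum_congr rfl fun x _ => ?_
    refine sum_box_shift_snd N _ _ ?_ ?_ ?_
    · intro m n
      rw [Finset.smul_sum]
      refine Finset.sum_congr rfl fun z _ => ?_
      simp only [smul_smul, Nat.add_sub_cancel]
      congr 1
      rw [← facInv_succ_snd m n]
      ring
    · simp
    · intro m n hn
      refine Finset.sum_eq_zero fun z _ => ?_
      rw [chainBlk, Fam.bothMarked, bξ _ (Or.inr (by dsimp only; omega))]
      simp

/-- The edge from `η` ends at an output of `ξ`, which gives a chain, or at an output of `ζ`, which
gives a wedge. -/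
theorem star_star_right (hQ : Q.IsProperad (AddMonoidHom.id ℤ)) (hkl : k + l = kl)
    (hkl' : kl + p = t) (h : l + p = lp) (h' : k + lp = t)
    (hξ : ξ ∈ symFam Q c d l) (hζ : ζ ∈ symFam Q c d p)
    (bη : η.BoundedBy N) (bξ : ξ.BoundedBy N) (bζ : ζ.BoundedBy N) :
    star Q c d h' η (star Q c d h ξ ζ) = chainSum hkl hkl' η ξ ζ N + wedgeSum η ξ ζ N h h' := by
  have key : ∀ a b : ℕ × ℕ, star Q c d h' η
      (blk Q c d lp (sumEnum (Equiv.refl (Fin a.1)) (Equiv.refl (Fin b.1)))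
          (sumEnum (Equiv.refl (Fin a.2)) (Equiv.refl (Fin b.2))) (deg_comp' h a.1 a.2 b.1 b.2)
          (Q.comp rfl (ξ.inMarked a.1 a.2) (ζ.outMarked b.1 b.2))) =
      ∑ x ∈ box N, ((a.1 : K) • (facInv K x *
          starSign K c d k lp x.1 x.2 (a.1 - 1 + b.1) (a.2 + b.2)) •
            chainBlk hkl hkl' η ξ ζ x.1 x.2 (a.1 - 1) a.2 b.1 b.2 +
        (b.1 : K) • (facInv K x * starSign K c d k lp x.1 x.2 (a.1 + (b.1 - 1)) (a.2 + b.2)) •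
            ksign K (c * a.1) • wedgeBlk h h' η ξ ζ x.1 x.2 a.1 a.2 (b.1 - 1) b.2) := by
    rintro ⟨m₂, n₂⟩ ⟨m₃, n₃⟩
    rw [star_blk_right' hQ h' _ _ _ _ η (Finset.range N) (Finset.range N) ?_
      (fun x m₁ n₁ => Sum.elim
        (fun _ => (facInv K (m₁, n₁) * starSign K c d k lp m₁ n₁ (m₂ - 1 + m₃) (n₂ + n₃)) •
          chainBlk hkl hkl' η ξ ζ m₁ n₁ (m₂ - 1) n₂ m₃ n₃)
        (fun _ => (facInv K (m₁, n₁) * starSign K c d k lp m₁ n₁ (m₂ + (m₃ - 1)) (n₂ + n₃)) •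
          ksign K (c * m₂) • wedgeBlk h h' η ξ ζ m₁ n₁ m₂ n₂ (m₃ - 1) n₃) x) ?_,
      Finset.sum_product]
    · refine Finset.sum_congr rfl fun m₁ _ => Finset.sum_congr rfl fun n₁ _ => ?_
      simp only [Fintype.sum_sum_type, Sum.elim_inl, Sum.elim_inr, Finset.sum_const,
        Finset.card_univ, Fintype.card_fin, Nat.cast_smul_eq_nsmul]
    · intro m n hmn
      simp only [Finset.mem_range] at hmn
      exact bη _ (by dsimp only; omega)
    · rintro (a | a) m₁ n₁
      · obtain ⟨m₂, rfl⟩ : ∃ m, m₂ = 1 + m := ⟨m₂ - 1, by have := a.2; omega⟩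
        have hd : deg c d k m₁ (n₁ + 1) + (deg c d l (1 + m₂) (n₂ + 1) + deg c d p (1 + m₃) n₃) =
            deg c d t (m₁ + (m₂ + m₃)) (n₁ + (n₂ + n₃)) := by
          simp only [deg, ← h', ← h]
          push_cast
          ring
        refine ⟨m₂ + m₃, by dsimp only; omega, Fin m₂ ⊕ Fin m₃, inferInstance,
          (Equiv.sumCongr (splitFirst (Equiv.refl _) a) (Equiv.refl _)).trans
            (Equiv.sumAssoc _ _ _),
          sumEnum (Equiv.refl _) (Equiv.refl _), hd, ?_, ?_⟩
        · simp only [Equiv.trans_apply, Equiv.sumCongr_apply, Sum.map_inl, splitFirst_self]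
          rfl
        · have e := chain_term_right hQ hkl hkl' η hξ ζ m₁ n₁ m₂ n₂ m₃ n₃
            (splitFirst (Equiv.refl _) a) hd
          rw [Sum.elim_inl, show 1 + m₂ - 1 = m₂ by omega]
          exact congrArg _ e.symm
      · obtain ⟨m₃, rfl⟩ : ∃ m, m₃ = 1 + m := ⟨m₃ - 1, by have := a.2; omega⟩
        refine ⟨m₂ + m₃, by dsimp only; omega, Fin m₂ ⊕ Fin m₃, inferInstance,
          (Equiv.sumCongr (Equiv.refl _) (splitFirst (Equiv.refl _) a)).trans (exchL _ _ _),
          sumEnum (Equiv.refl _) (Equiv.refl _), deg_wedge h h' m₁ n₁ m₂ n₂ m₃ n₃, ?_, ?_⟩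
        · simp only [Equiv.trans_apply, Equiv.sumCongr_apply, Sum.map_inr, splitFirst_self]
          rfl
        · rw [Sum.elim_inr, show 1 + m₃ - 1 = m₃ by omega]
          exact congrArg _ (wedge_term hQ h h' η ξ hζ m₁ n₁ m₂ n₂ m₃ n₃ _).symm
  rw [star_eq_sum_box h bξ bζ]
  simp only [map_sum, map_smul, key, Finset.sum_add_distrib, smul_add]
  congr 1
  · refine Eq.trans ?_ Finset.sum_comm
    refine sum_box_shift_fst N _ _ ?_ ?_ ?_
    · intro m n
      refine Eq.trans ?_ Finset.sum_comm
      refine Finset.sum_congr rfl fun z _ => ?_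
      rw [Finset.smul_sum]
      refine Finset.sum_congr rfl fun x _ => ?_
      simp only [smul_smul, Nat.add_sub_cancel_left]
      congr 1
      -- The agreement of the signs makes this chain sum literally the one in `star_star_left`.
      rw [← facInv_succ_fst m n, starSign_chain K c d k l p hkl h]
      ring
    · simp
    · intro m n hn
      refine Finset.sum_eq_zero fun x _ => Finset.sum_eq_zero fun z _ => ?_
      rw [chainBlk, Fam.bothMarked, bξ _ (Or.inl (by dsimp only; omega))]
      simp
  · refine Eq.trans ?_ Finset.sum_comm
    refine Finset.sum_congr rfl fun y _ => ?_
    refine Eq.trans ?_ Finset.sum_comm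
    refine sum_box_shift_fst N _ _ ?_ ?_ ?_
    · intro m n
      rw [Finset.smul_sum]
      refine Finset.sum_congr rfl fun x _ => ?_
      simp only [smul_smul, Nat.add_sub_cancel_left]
      congr 1
      rw [← facInv_succ_fst m n]
      ring
    · simp
    · intro m n hn
      refine Finset.sum_eq_zero fun x _ => ?_
      rw [wedgeBlk, Fam.outMarked₂, bζ _ (Or.inl (by dsimp only; omega))]
      simp

end Associator

theorem ksign_cases (K : Type v) [Field K] (n : ℤ) : ksign K n = 1 ∨ ksign K n = -1 := by
  rcases Int.even_or_odd n with h | h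
  · exact Or.inl (by simp [ksign, Int.negOnePow_even n h])
  · exact Or.inr (by simp [ksign, Int.negOnePow_odd n h])

theorem ksign_mul_self (K : Type v) [Field K] (n : ℤ) : ksign K n * ksign K n = 1 := by
  rcases ksign_cases K n with h | h <;> rw [h] <;> ring

/-! ### The Lie bracket of families and the Jacobi identity. -/

section Bracket

variable {K : Type v} [Field K] (Q : ProperadData.{u} K ℤ) (c d : ℤ) {k l p kl lp kp t : ℤ}

/-- The commutator of the product `star`, with the opposite sign. -/
def brk (h : k + l = t) : Fam Q c d k →ₗ[K] Fam Q c d l →ₗ[K] Fam Q c d t :=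
  LinearMap.mk₂ K (fun η ξ => ksign K (k * l) • star Q c d ((add_comm l k).trans h) ξ η -
      star Q c d h η ξ)
    (fun η η' ξ => by
      simp only [map_add, LinearMap.add_apply, smul_add]
      abel)
    (fun a η ξ => by
      simp only [map_smul, LinearMap.smul_apply, smul_sub]
      rw [smul_comm])
    (fun η ξ ξ' => by
      simp only [map_add, LinearMap.add_apply, smul_add]
      abel)
    (fun a η ξ => by
      simp only [map_smul, LinearMap.smul_apply, smul_sub]
      rw [smul_comm])

variable {Q c d}

theorem brk_apply (h : k + l = t) (h' : l + k = t) (η : Fam Q c d k) (ξ : Fam Q c d l) :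
    brk Q c d h η ξ = ksign K (k * l) • star Q c d h' ξ η - star Q c d h η ξ := rfl

theorem brk_skew (h : k + l = t) (h' : l + k = t) (η : Fam Q c d k) (ξ : Fam Q c d l) :
    brk Q c d h η ξ = -(ksign K (k * l) • brk Q c d h' ξ η) := by
  rw [brk_apply h h', brk_apply h' h, smul_sub, smul_smul, mul_comm l k, ksign_mul_self, one_smul]
  abel

/-- Two families have the same components with less than `N` inputs and outputs. -/
def Fam.EqBelow (N : ℕ) (η η' : Fam Q c d k) : Prop := ∀ s, s.1 < N → s.2 < N → η s = η' s

/-- The family of the components with less than `N` inputs and outputs. -/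
def Fam.trunc (N : ℕ) (η : Fam Q c d k) : Fam Q c d k := fun s =>
  if s.1 < N ∧ s.2 < N then η s else 0

theorem Fam.trunc_boundedBy (N : ℕ) (η : Fam Q c d k) : (η.trunc N).BoundedBy N :=
  fun _ hs => if_neg (by omega)

theorem Fam.trunc_eqBelow (N : ℕ) (η : Fam Q c d k) : (η.trunc N).EqBelow N η :=
  fun _ h h' => if_pos ⟨h, h'⟩

theorem Fam.trunc_mem {N : ℕ} {η : Fam Q c d k} (hη : η ∈ symFam Q c d k) :
    η.trunc N ∈ symFam Q c d k := by
  intro s σ τ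
  rw [Fam.trunc]
  split_ifs
  · exact hη s σ τ
  · simp

theorem Fam.EqBelow.mono {N N' : ℕ} (h : N ≤ N') {η η' : Fam Q c d k} (hη : η.EqBelow N' η') :
    η.EqBelow N η' := fun s h₁ h₂ => hη s (h₁.trans_le h) (h₂.trans_le h)

/-- A vertex of a graph with one internal edge has at most one more output and one more input than
the whole graph. -/
theorem Fam.EqBelow.star (h : k + l = t) {N : ℕ} {η η' : Fam Q c d k} {ξ ξ' : Fam Q c d l}
    (hη : η.EqBelow (N + 1) η') (hξ : ξ.EqBelow (N + 1) ξ') :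
    (star Q c d h η ξ).EqBelow N (star Q c d h η' ξ') := by
  intro s h₁ h₂
  simp only [Twisting.star, LinearMap.mk₂_apply]
  refine Finset.sum_congr rfl fun p _ => Finset.sum_congr rfl fun q _ => ?_
  have hp := p.add
  have hq := q.add
  rw [hη (p.fst, q.fst + 1) (by dsimp only; omega) (by dsimp only; omega),
    hξ (1 + p.snd, q.snd) (by dsimp only; omega) (by dsimp only; omega)]

theorem Fam.EqBelow.brk (h : k + l = t) {N : ℕ} {η η' : Fam Q c d k} {ξ ξ' : Fam Q c d l}
    (hη : η.EqBelow (N + 1) η') (hξ : ξ.EqBelow (N + 1) ξ') :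
    (brk Q c d h η ξ).EqBelow N (brk Q c d h η' ξ') := by
  intro s h₁ h₂
  have h' : l + k = t := (add_comm l k).trans h
  rw [brk_apply h h', brk_apply h h', Pi.sub_apply, Pi.sub_apply, Pi.smul_apply, Pi.smul_apply,
    hη.star h hξ s h₁ h₂, hξ.star h' hη s h₁ h₂]

variable [CharZero K]

/-- The identity has twelve iterated products. Each chain occurs once from either bracketing and
cancels; vees and wedges cancel in pairs by their symmetry in the parallel vertices. Thus `star` is
Lie-admissible. -/
theorem brk_jacobi_of_boundedBy (hQ : Q.IsProperad (AddMonoidHom.id ℤ)) {i j k ij jk ik t : ℤ}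
    (h₁ : j + k = jk) (h₂ : i + jk = t) (h₃ : i + j = ij)
    (h₄ : ij + k = t) (h₅ : i + k = ik) (h₆ : j + ik = t) {x : Fam Q c d i} {y : Fam Q c d j}
    {z : Fam Q c d k} (hx : x ∈ symFam Q c d i) (hy : y ∈ symFam Q c d j)
    (hz : z ∈ symFam Q c d k) (N : ℕ) (bx : x.BoundedBy N) (by' : y.BoundedBy N)
    (bz : z.BoundedBy N) :
    brk Q c d h₂ x (brk Q c d h₁ y z) =
      brk Q c d h₄ (brk Q c d h₃ x y) z + ksign K (i * j) • brk Q c d h₆ y (brk Q c d h₅ x z) := by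
  have g₁ : k + j = jk := by omega
  have g₂ : jk + i = t := by omega
  have g₃ : j + i = ij := by omega
  have g₄ : k + ij = t := by omega
  have g₅ : k + i = ik := by omega
  have g₆ : ik + j = t := by omega
  rw [brk_apply h₂ g₂, brk_apply h₁ g₁, brk_apply h₄ g₄, brk_apply h₃ g₃, brk_apply h₆ g₆,
    brk_apply h₅ g₅]
  have e₁ := star_star_left hQ h₃ h₄ hx hy bx by' bz
  have e₂ := star_star_left hQ h₅ g₆ hx hz bx bz by'
  have e₃ := star_star_left hQ g₃ h₄ hy hx by' bx bz
  have e₄ := star_star_left hQ h₁ g₂ hy hz by' bz bx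
  have e₅ := star_star_left hQ g₅ g₆ hz hx bz bx by'
  have e₆ := star_star_left hQ g₁ g₂ hz hy bz by' bx
  have f₁ := star_star_right hQ h₃ h₄ h₁ h₂ hy hz bx by' bz
  have f₂ := star_star_right hQ h₅ g₆ g₁ h₂ hz hy bx bz by'
  have f₃ := star_star_right hQ g₃ h₄ h₅ h₆ hx hz by' bx bz
  have f₄ := star_star_right hQ h₁ g₂ g₅ h₆ hz hx by' bz bx
  have f₅ := star_star_right hQ g₅ g₆ h₃ g₄ hx hy bz bx by'
  have f₆ := star_star_right hQ g₁ g₂ g₃ g₄ hy hx bz by' bx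
  -- For each top vertex only one order of the lower vertices is kept, and likewise for wedges, so
  -- that equal graphs become syntactically equal.
  rw [veeSum_symm h₅ g₆ hQ h₃ h₄ hx] at e₂
  rw [veeSum_symm h₁ g₂ hQ g₃ h₄ hy] at e₄
  rw [veeSum_symm g₁ g₂ hQ g₅ g₆ hz] at e₆
  rw [wedgeSum_symm hQ h₅ h₆ h₁ h₂ hz] at f₃
  rw [wedgeSum_symm hQ h₃ g₄ g₁ h₂ hy] at f₅
  rw [wedgeSum_symm hQ g₃ g₄ g₅ h₆ hx] at f₆
  simp only [map_sub, map_smul, LinearMap.sub_apply, LinearMap.smul_apply, e₁, e₂, e₃, e₄, e₅, e₆,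
    f₁, f₂, f₃, f₄, f₅, f₆]
  subst h₁ h₃ h₅
  simp only [mul_add, add_mul, ksign_add, mul_comm k j, mul_comm k i, mul_comm j i]
  -- All coefficients are products of three independent signs, and for each choice of these the
  -- identity is linear.
  rcases ksign_cases K (i * j) with s | s <;> rcases ksign_cases K (i * k) with s' | s' <;>
    rcases ksign_cases K (j * k) with s'' | s'' <;> rw [s, s', s''] <;> module

/-- Every component of an iterated bracket depends on finitely many components of the arguments, so
it can be computed after truncation. -/
theorem brk_jacobi (hQ : Q.IsProperad (AddMonoidHom.id ℤ)) {i j k ij jk ik t : ℤ}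
    (h₁ : j + k = jk) (h₂ : i + jk = t) (h₃ : i + j = ij)
    (h₄ : ij + k = t) (h₅ : i + k = ik) (h₆ : j + ik = t) {x : Fam Q c d i} {y : Fam Q c d j}
    {z : Fam Q c d k} (hx : x ∈ symFam Q c d i) (hy : y ∈ symFam Q c d j)
    (hz : z ∈ symFam Q c d k) :
    brk Q c d h₂ x (brk Q c d h₁ y z) =
      brk Q c d h₄ (brk Q c d h₃ x y) z + ksign K (i * j) • brk Q c d h₆ y (brk Q c d h₅ x z) := by
  funext s
  -- `N` exceeds both indices of the component, and truncating at N + 2 allows for the one step lost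
  -- in each of the two brackets.
  set N := s.1 + s.2 + 1 with hN
  have h := congrFun (brk_jacobi_of_boundedBy hQ h₁ h₂ h₃ h₄ h₅ h₆ (Fam.trunc_mem hx)
    (Fam.trunc_mem hy) (Fam.trunc_mem hz) (N + 2) (Fam.trunc_boundedBy _ _)
    (Fam.trunc_boundedBy _ _) (Fam.trunc_boundedBy _ _)) s
  have tx := Fam.trunc_eqBelow (N + 2) x
  have ty := Fam.trunc_eqBelow (N + 2) y
  have tz := Fam.trunc_eqBelow (N + 2) z
  have s₁ : s.1 < N := by omega
  have s₂ : s.2 < N := by omega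
  rw [Pi.add_apply, Pi.smul_apply] at h ⊢
  rw [((tx.mono (Nat.le_succ _)).brk h₂ (ty.brk h₁ tz)) s s₁ s₂,
    ((tx.brk h₃ ty).brk h₄ (tz.mono (Nat.le_succ _))) s s₁ s₂,
    ((ty.mono (Nat.le_succ _)).brk h₆ (tx.brk h₅ tz)) s s₁ s₂] at h
  exact h

end Bracket

/-! ### Special cases of the equivariance of compositions. -/

section RelabelComp

variable {K : Type v} [Field K] {Γ : Type} [AddCommMonoid Γ] {par : Γ →+ ℤ}
  {Q : ProperadData.{u} K Γ} (hQ : Q.IsProperad par)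
  {A A' B B' C C' D D' E E' : Type} [Finite A] [Finite A'] [Finite B]
  [Finite B'] [Finite C] [Finite C'] [Finite D] [Finite D'] [Finite E] [Finite E']
  [Nonempty E] [Nonempty E'] {i j k : Γ} (h : i + j = k)

include hQ

theorem ProperadData.IsProperad.comp_relabel_left (a : A ≃ A') (b : B ≃ B')
    (x : Q.obj A (B ⊕ E) i) (y : Q.obj (E ⊕ C) D j) :
    Q.comp h (Q.relabel a (Equiv.sumCongr b (Equiv.refl E)) x) y =
      Q.relabel (Equiv.sumCongr a (Equiv.refl C)) (Equiv.sumCongr b (Equiv.refl D))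
        (Q.comp h x y) := by
  have := hQ.comp_relabel h a b (Equiv.refl C) (Equiv.refl D) (Equiv.refl E) x y
  rwa [Equiv.sumCongr_refl, hQ.relabel_refl] at this

theorem ProperadData.IsProperad.comp_relabel_right (c : C ≃ C') (d : D ≃ D')
    (x : Q.obj A (B ⊕ E) i) (y : Q.obj (E ⊕ C) D j) :
    Q.comp h x (Q.relabel (Equiv.sumCongr (Equiv.refl E) c) d y) =
      Q.relabel (Equiv.sumCongr (Equiv.refl A) c) (Equiv.sumCongr (Equiv.refl B) d)
        (Q.comp h x y) := by
  have := hQ.comp_relabel h (Equiv.refl A) (Equiv.refl B) c d (Equiv.refl E) x y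
  rwa [Equiv.sumCongr_refl, hQ.relabel_refl] at this

theorem ProperadData.IsProperad.comp_relabel_mid (e : E ≃ E')
    (x : Q.obj A (B ⊕ E) i) (y : Q.obj (E' ⊕ C) D j) :
    Q.comp h (Q.relabel (Equiv.refl A) (Equiv.sumCongr (Equiv.refl B) e) x) y =
      Q.comp h x (Q.relabel (Equiv.sumCongr e.symm (Equiv.refl C)) (Equiv.refl D) y) := by
  have := hQ.comp_relabel h (Equiv.refl A) (Equiv.refl B) (Equiv.refl C) (Equiv.refl D) e x
    (Q.relabel (Equiv.sumCongr e.symm (Equiv.refl C)) (Equiv.refl D) y)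
  rw [← hQ.relabel_trans, Equiv.sumCongr_trans, Equiv.symm_trans_self, Equiv.sumCongr_refl,
    Equiv.sumCongr_refl, hQ.relabel_refl] at this
  rw [← this, Equiv.refl_trans, Equiv.refl_trans, Equiv.sumCongr_refl, hQ.relabel_refl]

theorem ProperadData.IsProperad.relabel_injective (e : A ≃ A') (f : B ≃ B') {x y : Q.obj A B i}
    (h : Q.relabel e f x = Q.relabel e f y) : x = y := by
  have h' := congrArg (Q.relabel e.symm f.symm) h
  rwa [← hQ.relabel_trans, ← hQ.relabel_trans, Equiv.self_trans_symm, Equiv.self_trans_symm,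
    hQ.relabel_refl, hQ.relabel_refl] at h'

omit hQ in
theorem ProperadData.relabel_eq {e e' : A ≃ A'} {f f' : B ≃ B'} (he : ∀ x, e x = e' x)
    (hf : ∀ x, f x = f' x) (x : Q.obj A B i) : Q.relabel e f x = Q.relabel e' f' x := by
  rw [Equiv.ext he, Equiv.ext hf]

end RelabelComp

/-! ### Attaching an operation with one output and one input to a leg. -/

section Insertion

variable {K : Type v} [Field K] {Q : ProperadData.{u} K ℤ} {r : ℤ}

/-- Attach `h` to a marked output. -/
def topIns (h : Q.obj (Fin 1) (Fin 1) r) {A B : Type} [Finite A] [Finite B] {i j : ℤ}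
    (hj : i + r = j) : Q.obj (Fin 1 ⊕ A) B i →ₗ[K] Q.obj (Fin 1 ⊕ A) B j :=
  Q.relabel (Equiv.refl _) (Equiv.emptySum Empty B) ∘ₗ Q.comp (show r + i = j by omega)
    (Q.relabel (Equiv.refl (Fin 1)) (Equiv.emptySum Empty (Fin 1)).symm h)

/-- Attach `h` to a marked input. -/
def botIns (h : Q.obj (Fin 1) (Fin 1) r) {A B : Type} [Finite A] [Finite B] {i j : ℤ}
    (hj : i + r = j) : Q.obj A (B ⊕ Fin 1) i →ₗ[K] Q.obj A (B ⊕ Fin 1) j :=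
  Q.relabel (Equiv.sumEmpty A Empty) (Equiv.refl _) ∘ₗ (Q.comp hj).flip
    (Q.relabel (Equiv.sumEmpty (Fin 1) Empty).symm (Equiv.refl (Fin 1)) h)

/-- Attach `h` to the output `o`. -/
def outIns (h : Q.obj (Fin 1) (Fin 1) r) {A B : Type} [Finite A] [Finite B] {i j : ℤ}
    (hj : i + r = j) (o : A) : Q.obj A B i →ₗ[K] Q.obj A B j :=
  Q.relabel (splitFront o).symm (Equiv.refl _) ∘ₗ topIns h hj ∘ₗ
    Q.relabel (splitFront o) (Equiv.refl _)

/-- Attach `h` to the input `b`. -/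
def inIns (h : Q.obj (Fin 1) (Fin 1) r) {A B : Type} [Finite A] [Finite B] {i j : ℤ}
    (hj : i + r = j) (b : B) : Q.obj A B i →ₗ[K] Q.obj A B j :=
  Q.relabel (Equiv.refl _) ((splitFront b).trans (Equiv.sumComm _ _)).symm ∘ₗ botIns h hj ∘ₗ
    Q.relabel (Equiv.refl _) ((splitFront b).trans (Equiv.sumComm _ _))

theorem splitFront_self {A : Type} (a : A) : splitFront a a = Sum.inl 0 := by
  simp [splitFront, Equiv.sumCompl]

variable (hQ : Q.IsProperad (AddMonoidHom.id ℤ)) (h : Q.obj (Fin 1) (Fin 1) r)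
  {A A' B B' C D E : Type} [Finite A] [Finite A'] [Finite B] [Finite B'] [Finite C] [Finite D]
  [Finite E] {i i' j j' k k' : ℤ}

include hQ

theorem topIns_relabel (hj : i + r = j) (a : A ≃ A') (b : B ≃ B') (x : Q.obj (Fin 1 ⊕ A) B i) :
    topIns h hj (Q.relabel (Equiv.sumCongr (Equiv.refl _) a) b x) =
      Q.relabel (Equiv.sumCongr (Equiv.refl _) a) b (topIns h hj x) := by
  simp only [topIns, LinearMap.comp_apply]
  rw [hQ.comp_relabel_right, ← hQ.relabel_trans, ← hQ.relabel_trans]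
  refine ProperadData.relabel_eq ?_ ?_ _
  · rintro (x | x) <;> rfl
  · rintro (x | x)
    · exact x.elim
    · rfl

theorem botIns_relabel (hj : i + r = j) (a : A ≃ A') (b : B ≃ B') (x : Q.obj A (B ⊕ Fin 1) i) :
    botIns h hj (Q.relabel a (Equiv.sumCongr b (Equiv.refl _)) x) =
      Q.relabel a (Equiv.sumCongr b (Equiv.refl _)) (botIns h hj x) := by
  simp only [botIns, LinearMap.comp_apply, LinearMap.flip_apply]
  rw [hQ.comp_relabel_left, ← hQ.relabel_trans, ← hQ.relabel_trans]
  refine ProperadData.relabel_eq ?_ ?_ _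
  · rintro (x | x)
    · rfl
    · exact x.elim
  · rintro (x | x) <;> rfl

/-- Any two ways of splitting off `o` differ by a relabelling of the other outputs, with which the
insertion commutes. -/
theorem outIns_eq (hj : i + r = j) (o : A) (s : A ≃ Fin 1 ⊕ A') (hs : s o = Sum.inl 0)
    (x : Q.obj A B i) : outIns h hj o x =
      Q.relabel s.symm (Equiv.refl _) (topIns h hj (Q.relabel s (Equiv.refl _) x)) := by
  obtain ⟨ρ, hρ⟩ := exists_sumCongr_left (splitFront o) s o (splitFront_self o) hs
  rw [hρ]
  have e := hQ.relabel_trans (splitFront o) (Equiv.sumCongr (Equiv.refl _) ρ) (Equiv.refl B)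
    (Equiv.refl B) x
  rw [show (Equiv.refl B).trans (Equiv.refl B) = Equiv.refl B from rfl] at e
  rw [e, topIns_relabel hQ, ← hQ.relabel_trans]
  simp only [outIns, LinearMap.comp_apply]
  refine ProperadData.relabel_eq ?_ ?_ _
  · rintro (x | x) <;> simp
  · intro x
    rfl

theorem inIns_eq (hj : i + r = j) (o : B) (s : B ≃ B' ⊕ Fin 1) (hs : s o = Sum.inr 0)
    (x : Q.obj A B i) : inIns h hj o x =
      Q.relabel (Equiv.refl _) s.symm (botIns h hj (Q.relabel (Equiv.refl _) s x)) := by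
  obtain ⟨ρ, hρ⟩ := exists_sumCongr_right ((splitFront o).trans (Equiv.sumComm _ _)) s o
    (by simp [splitFront_self]) hs
  rw [hρ]
  have e := hQ.relabel_trans (Equiv.refl A) (Equiv.refl A)
    ((splitFront o).trans (Equiv.sumComm _ _)) (Equiv.sumCongr ρ (Equiv.refl _)) x
  rw [show (Equiv.refl A).trans (Equiv.refl A) = Equiv.refl A from rfl] at e
  rw [e, botIns_relabel hQ, ← hQ.relabel_trans]
  simp only [inIns, LinearMap.comp_apply]
  refine ProperadData.relabel_eq ?_ ?_ _
  · intro x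
    rfl
  · rintro (x | x) <;> simp

theorem outIns_relabel (hj : i + r = j) (a : A ≃ A') (b : B ≃ B') (o : A) (x : Q.obj A B i) :
    outIns h hj (a o) (Q.relabel a b x) = Q.relabel a b (outIns h hj o x) := by
  rw [outIns_eq hQ h hj (a o) (a.symm.trans (splitFront o)) (by simp [splitFront_self]),
    outIns_eq hQ h hj o (splitFront o) (splitFront_self o), ← hQ.relabel_trans,
    ← hQ.relabel_trans]
  have e : Q.relabel (a.trans (a.symm.trans (splitFront o))) (b.trans (Equiv.refl B')) x =
      Q.relabel (Equiv.sumCongr (Equiv.refl _) (Equiv.refl _)) b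
        (Q.relabel (splitFront o) (Equiv.refl _) x) := by
    rw [← hQ.relabel_trans]
    exact ProperadData.relabel_eq (fun x => by simp) (fun x => rfl) x
  rw [e, topIns_relabel hQ, ← hQ.relabel_trans]
  exact ProperadData.relabel_eq (fun x => by simp) (fun x => rfl) _

theorem inIns_relabel (hj : i + r = j) (a : A ≃ A') (b : B ≃ B') (o : B) (x : Q.obj A B i) :
    inIns h hj (b o) (Q.relabel a b x) = Q.relabel a b (inIns h hj o x) := by
  set s := (splitFront o).trans (Equiv.sumComm _ _) with hs
  have hso : s o = Sum.inr 0 := by simp [hs, splitFront_self]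
  rw [inIns_eq hQ h hj (b o) (b.symm.trans s) (by simp [hso]),
    inIns_eq hQ h hj o s hso, ← hQ.relabel_trans, ← hQ.relabel_trans]
  have e : Q.relabel (a.trans (Equiv.refl A')) (b.trans (b.symm.trans s)) x =
      Q.relabel a (Equiv.sumCongr (Equiv.refl _) (Equiv.refl _))
        (Q.relabel (Equiv.refl _) s x) := by
    rw [← hQ.relabel_trans]
    exact ProperadData.relabel_eq (fun x => rfl) (fun x => by simp) x
  rw [e, botIns_relabel hQ, ← hQ.relabel_trans]
  exact ProperadData.relabel_eq (fun x => rfl) (fun x => by simp) _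

theorem innerMap_eq [Fintype A] [Fintype B] (hj : i + r = j) (x : Q.obj A B i) :
    innerMap h hj x = ∑ o, outIns h hj o x - ksign K (r * i) • ∑ b, inIns h hj b x := by
  have e1 : Fintype.ofFinite A = ‹Fintype A› := Subsingleton.elim _ _
  have e2 : Fintype.ofFinite B = ‹Fintype B› := Subsingleton.elim _ _
  rw [innerMap, e1, e2]
  congr 1
  · refine Finset.sum_congr rfl fun o _ => ?_
    simp only [outIns, topIns, LinearMap.comp_apply]
    rw [← hQ.relabel_trans]
    rfl
  · congr 1
    refine Finset.sum_congr rfl fun o _ => ?_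
    simp only [inIns, botIns, LinearMap.comp_apply, LinearMap.flip_apply]
    rw [← hQ.relabel_trans]
    rfl

variable [Nonempty E] (hk : i + j = k)

/-- Here `h`, `x` and `y` form a chain, so no sign occurs. -/
theorem topIns_comp_left (hi : i + r = i') (hkr : k + r = k') (hk' : i' + j = k')
    (x : Q.obj (Fin 1 ⊕ A) (B ⊕ E) i) (y : Q.obj (E ⊕ C) D j) :
    topIns h hkr (Q.relabel (Equiv.sumAssoc _ _ _) (Equiv.refl _) (Q.comp hk x y)) =
      Q.relabel (Equiv.sumAssoc _ _ _) (Equiv.refl _) (Q.comp hk' (topIns h hi x) y) := by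
  simp only [topIns, LinearMap.comp_apply]
  rw [← hQ.chain (by omega) hk' hk (by omega)]
  have e : Q.relabel (Equiv.refl (Fin 1 ⊕ A)) (Equiv.emptySum Empty (B ⊕ E))
      (Q.comp (show r + i = i' by omega)
        (Q.relabel (Equiv.refl (Fin 1)) (Equiv.emptySum Empty (Fin 1)).symm h) x) =
      Q.relabel (Equiv.refl _) (Equiv.sumCongr (Equiv.emptySum Empty B) (Equiv.refl E))
        (Q.relabel (Equiv.refl (Fin 1 ⊕ A)) (Equiv.sumAssoc Empty B E).symm
        (Q.comp (show r + i = i' by omega)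
        (Q.relabel (Equiv.refl (Fin 1)) (Equiv.emptySum Empty (Fin 1)).symm h) x)) := by
    rw [← hQ.relabel_trans]
    refine ProperadData.relabel_eq (fun x => rfl) ?_ _
    rintro (x | x | x)
    · exact x.elim
    · rfl
    · rfl
  rw [e, hQ.comp_relabel_left, ← hQ.relabel_trans, ← hQ.relabel_trans]
  refine ProperadData.relabel_eq ?_ ?_ _
  · rintro ((x | x) | x) <;> rfl
  · rintro ((x | x) | x)
    · exact x.elim
    · rfl
    · rfl

theorem botIns_comp_right (hj : j + r = j') (hkr : k + r = k') (hk' : i + j' = k')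
    (x : Q.obj A (B ⊕ E) i) (y : Q.obj (E ⊕ C) (D ⊕ Fin 1) j) :
    botIns h hkr (Q.relabel (Equiv.refl _) (Equiv.sumAssoc _ _ _).symm (Q.comp hk x y)) =
      Q.relabel (Equiv.refl _) (Equiv.sumAssoc _ _ _).symm (Q.comp hk' x (botIns h hj y)) := by
  simp only [botIns, LinearMap.comp_apply, LinearMap.flip_apply]
  have e0 := hQ.chain hk hkr hj hk' x y
    (Q.relabel (Equiv.sumEmpty (Fin 1) Empty).symm (Equiv.refl (Fin 1)) h)
  have e : Q.relabel (Equiv.sumEmpty (E ⊕ C) Empty) (Equiv.refl (D ⊕ Fin 1))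
      (Q.comp hj y (Q.relabel (Equiv.sumEmpty (Fin 1) Empty).symm (Equiv.refl (Fin 1)) h)) =
      Q.relabel (Equiv.sumCongr (Equiv.refl E) (Equiv.sumEmpty C Empty)) (Equiv.refl _)
        (Q.relabel (Equiv.sumAssoc E C Empty) (Equiv.refl (D ⊕ Fin 1))
      (Q.comp hj y (Q.relabel (Equiv.sumEmpty (Fin 1) Empty).symm (Equiv.refl (Fin 1)) h))) := by
    rw [← hQ.relabel_trans]
    refine ProperadData.relabel_eq ?_ (fun x => rfl) _
    rintro ((x | x) | x)
    · rfl
    · rfl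
    · exact x.elim
  rw [e, hQ.comp_relabel_right, ← e0, ← hQ.relabel_trans, ← hQ.relabel_trans]
  refine ProperadData.relabel_eq ?_ ?_ _
  · rintro ((x | x) | x)
    · rfl
    · rfl
    · exact x.elim
  · rintro ((x | x) | x) <;> rfl

/-- Here `h` and `x` are both above `y`. The law `assoc_above` applies and produces the Koszul sign
of moving `h` past `x`. -/
theorem topIns_comp_right (hj : j + r = j') (hkr : k + r = k') (hk' : i + j' = k')
    (x : Q.obj A (B ⊕ E) i) (y : Q.obj (E ⊕ (Fin 1 ⊕ C)) D j) :
    topIns h hkr (Q.relabel (exchL _ _ _) (Equiv.refl _) (Q.comp hk x y)) =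
      ksign K (r * i) • Q.relabel (exchL _ _ _) (Equiv.refl _) (Q.comp hk' x
        (Q.relabel (exchL _ _ _) (Equiv.refl _)
          (topIns h hj (Q.relabel (exchL _ _ _) (Equiv.refl _) y)))) := by
  simp only [topIns, LinearMap.comp_apply]
  rw [hQ.assoc_above hk (by omega) (show r + j = j' by omega) hk', map_smul]
  have e : ∀ w : Q.obj (Fin 1 ⊕ (E ⊕ C)) (Empty ⊕ D) j', Q.relabel (exchL _ _ _) (Equiv.refl _)
      (Q.relabel (Equiv.refl _) (Equiv.emptySum Empty D) w) =
      Q.relabel (Equiv.sumCongr (Equiv.refl _) (Equiv.refl _)) (Equiv.emptySum Empty D)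
        (Q.relabel (exchL _ _ _) (Equiv.refl _) w) := by
    intro w
    rw [← hQ.relabel_trans, ← hQ.relabel_trans]
    refine ProperadData.relabel_eq (fun x => by simp) (fun x => rfl) _
  rw [e, hQ.comp_relabel_right, ← hQ.relabel_trans, ← hQ.relabel_trans]
  rw [AddMonoidHom.id_apply, AddMonoidHom.id_apply, mul_comm i r]
  congr 1
  refine ProperadData.relabel_eq ?_ ?_ _
  · rintro (x | x | x) <;> rfl
  · rintro (x | x | x)
    · rfl
    · exact x.elim
    · rfl

/-- Here `h` and `y` are both below `x`, which is the situation of `assoc_below`. -/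
theorem botIns_comp_left (hi : i + r = i') (hkr : k + r = k') (hk' : i' + j = k')
    (x : Q.obj A ((B ⊕ Fin 1) ⊕ E) i) (y : Q.obj (E ⊕ C) D j) :
    botIns h hkr (Q.relabel (Equiv.refl _) (exchR _ _ _) (Q.comp hk x y)) =
      ksign K (r * j) • Q.relabel (Equiv.refl _) (exchR _ _ _) (Q.comp hk'
        (Q.relabel (Equiv.refl _) (exchR _ _ _)
          (botIns h hi (Q.relabel (Equiv.refl _) (exchR _ _ _) x))) y) := by
  simp only [botIns, LinearMap.comp_apply, LinearMap.flip_apply]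
  rw [hQ.assoc_below hk hkr hi hk', map_smul]
  have e : ∀ w : Q.obj (A ⊕ Empty) ((B ⊕ E) ⊕ Fin 1) i', Q.relabel (Equiv.refl _) (exchR _ _ _)
      (Q.relabel (Equiv.sumEmpty A Empty) (Equiv.refl _) w) =
      Q.relabel (Equiv.sumEmpty A Empty) (Equiv.sumCongr (Equiv.refl _) (Equiv.refl _))
        (Q.relabel (Equiv.refl _) (exchR _ _ _) w) := by
    intro w
    rw [← hQ.relabel_trans, ← hQ.relabel_trans]
    refine ProperadData.relabel_eq (fun x => rfl) (fun x => by simp) _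
  rw [e, hQ.comp_relabel_left, ← hQ.relabel_trans, ← hQ.relabel_trans]
  rw [AddMonoidHom.id_apply, AddMonoidHom.id_apply]
  congr 1
  refine ProperadData.relabel_eq ?_ ?_ _
  · rintro ((x | x) | x)
    · rfl
    · exact x.elim
    · rfl
  · rintro ((x | x) | x) <;> rfl

omit [Finite E] [Nonempty E] in
-- An operation inserted on one of the edges between `x` and `y` may be regarded as attached to `x`
-- or to `y`. The other edges `E`, possibly none, bypass it; this is where `assoc` with edges
-- between the outer vertices is needed.
theorem botIns_comp_eq_comp_topIns [Finite E] (hi : i + r = i') (hj : j + r = j')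
    (hk₁ : i' + j = k') (hk₂ : i + j' = k')
    (x : Q.obj A ((B ⊕ E) ⊕ Fin 1) i) (y : Q.obj (Fin 1 ⊕ (E ⊕ C)) D j) :
    Q.comp hk₁ (Q.relabel (Equiv.refl _) (Equiv.sumAssoc _ _ _) (botIns h hi x))
        (Q.relabel ((exchL _ _ _).trans (Equiv.sumAssoc _ _ _).symm) (Equiv.refl _) y) =
      Q.comp hk₂ (Q.relabel (Equiv.refl _) (Equiv.sumAssoc _ _ _) x)
        (Q.relabel ((exchL _ _ _).trans (Equiv.sumAssoc _ _ _).symm) (Equiv.refl _)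
          (topIns h hj y)) := by
  set z := Q.relabel ((exchL (Fin 1) E C).trans (Equiv.sumAssoc E (Fin 1) C).symm) (Equiv.refl _) y
    with hz
  -- In `assoc` the middle vertex is `h`, joined by one edge to each of `x` and `y`, and `E₃` is
  -- `E`.
  have key := hQ.assoc hi hk₁ (show r + j = j' by omega) hk₂ x
    (Q.relabel (Equiv.sumEmpty (Fin 1) Empty).symm (Equiv.emptySum Empty (Fin 1)).symm h) z
  have e1 : Q.relabel ((Equiv.sumAssoc E (Fin 1) C).trans (exchL E (Fin 1) C)) (Equiv.refl D) z
      = y := by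
    rw [hz, ← hQ.relabel_trans]
    refine (ProperadData.relabel_eq (e' := Equiv.refl _) (f' := Equiv.refl _) ?_ (fun x => rfl)
      _).trans (hQ.relabel_refl _)
    rintro (x | x | x) <;> rfl
  have e2 : Q.comp (show r + j = j' by omega)
      (Q.relabel (Equiv.sumEmpty (Fin 1) Empty).symm (Equiv.emptySum Empty (Fin 1)).symm h) y =
      Q.relabel (Equiv.sumCongr (Equiv.sumEmpty (Fin 1) Empty).symm (Equiv.refl _))
        (Equiv.emptySum Empty D).symm (topIns h hj y) := by
    have := hQ.comp_relabel_left (show r + j = j' by omega) (Equiv.sumEmpty (Fin 1) Empty).symm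
      (Equiv.refl Empty) (Q.relabel (Equiv.refl (Fin 1)) (Equiv.emptySum Empty (Fin 1)).symm h) y
    rw [← hQ.relabel_trans, Equiv.sumCongr_refl, Equiv.sumCongr_refl] at this
    refine this.trans ?_
    simp only [topIns, LinearMap.comp_apply]
    rw [← hQ.relabel_trans]
    exact ProperadData.relabel_eq (fun x => rfl) (fun x => by simp) _
  have e3 : Q.comp hi x
      (Q.relabel (Equiv.sumEmpty (Fin 1) Empty).symm (Equiv.emptySum Empty (Fin 1)).symm h) =
      Q.relabel (Equiv.sumEmpty A Empty).symm
        (Equiv.sumCongr (Equiv.refl _) (Equiv.emptySum Empty (Fin 1)).symm) (botIns h hi x) := by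
    have := hQ.comp_relabel_right hi (Equiv.refl Empty) (Equiv.emptySum Empty (Fin 1)).symm x
      (Q.relabel (Equiv.sumEmpty (Fin 1) Empty).symm (Equiv.refl (Fin 1)) h)
    rw [← hQ.relabel_trans, Equiv.sumCongr_refl, Equiv.sumCongr_refl] at this
    refine this.trans ?_
    simp only [botIns, LinearMap.comp_apply, LinearMap.flip_apply]
    rw [← hQ.relabel_trans]
    exact ProperadData.relabel_eq (fun x => by simp) (fun x => rfl) _
  have e4 := hQ.comp_relabel_left hk₁ (Equiv.sumEmpty A Empty).symm (Equiv.sumEmpty B Empty).symm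
    (Q.relabel (Equiv.refl _) (Equiv.sumAssoc _ _ _) (botIns h hi x)) z
  have e5 := hQ.comp_relabel hk₂ (Equiv.refl A) (Equiv.refl B) (Equiv.emptySum Empty C).symm
    (Equiv.emptySum Empty D).symm (Equiv.sumComm E (Fin 1))
    (Q.relabel (Equiv.refl _) (Equiv.sumAssoc _ _ _) x)
    (Q.relabel ((exchL _ _ _).trans (Equiv.sumAssoc _ _ _).symm) (Equiv.refl _) (topIns h hj y))
  rw [← hQ.relabel_trans] at e4
  rw [← hQ.relabel_trans, ← hQ.relabel_trans] at e5
  rw [e1, e2, e3, ← hQ.relabel_trans, ← hQ.relabel_trans] at key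
  refine hQ.relabel_injective (Equiv.sumCongr (Equiv.refl A) (Equiv.emptySum Empty C).symm)
    (Equiv.sumCongr (Equiv.refl B) (Equiv.emptySum Empty D).symm) ?_
  rw [← e5]
  refine Eq.trans ?_ (key.trans ?_)
  · refine Eq.trans ?_ (congrArg (fun w => Q.relabel (Equiv.sumAssoc A Empty C)
      (Equiv.sumAssoc B Empty D) (Q.comp hk₁ w z)) (ProperadData.relabel_eq
      (e := (Equiv.refl A).trans (Equiv.sumEmpty A Empty).symm)
      (f := (Equiv.sumAssoc B E (Fin 1)).trans
        (Equiv.sumCongr (Equiv.sumEmpty B Empty).symm (Equiv.refl _))) (fun x => rfl) ?_ _))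
    rotate_left
    · rintro ((x | x) | x) <;> rfl
    · refine Eq.trans ?_ (congrArg _ e4.symm)
      rw [← hQ.relabel_trans]
      refine ProperadData.relabel_eq ?_ ?_ _
      · rintro (x | x) <;> rfl
      · rintro (x | x) <;> rfl
  · refine congrArg₂ (fun v w => Q.comp hk₂ v w) (ProperadData.relabel_eq (fun x => rfl) ?_ _)
      (ProperadData.relabel_eq ?_ (fun x => rfl) _)
    · rintro ((x | x) | x) <;> rfl
    · rintro (x | x | x) <;> rfl

end Insertion

/-! ### Insertions into a composite. -/

section InnerDerivations

variable {K : Type v} [Field K] {Q : ProperadData.{u} K ℤ} {r s : ℤ}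
  (hQ : Q.IsProperad (AddMonoidHom.id ℤ)) (h : Q.obj (Fin 1) (Fin 1) r)
  {A A' B B' C D E : Type} [Finite A] [Finite A'] [Finite B] [Finite B'] [Finite C] [Finite D]
  [Finite E] [Nonempty E] {i i' j j' k k' : ℤ} (hk : i + j = k)

include hQ

theorem outIns_comp_left (hi : i + r = i') (hkr : k + r = k') (hk' : i' + j = k') (a : A)
    (x : Q.obj A (B ⊕ E) i) (y : Q.obj (E ⊕ C) D j) :
    outIns h hkr (Sum.inl a) (Q.comp hk x y) = Q.comp hk' (outIns h hi a x) y := by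
  have hs := splitFront_self a
  generalize splitFront a = s at hs
  rw [outIns_eq hQ h hkr _ ((Equiv.sumCongr s (Equiv.refl C)).trans (Equiv.sumAssoc _ _ _))
    (by simp [hs]), outIns_eq hQ h hi a s hs]
  have e := topIns_comp_left hQ h hk hi hkr hk' (Q.relabel s (Equiv.refl _) x) y
  have e1 := hQ.comp_relabel_left hk s (Equiv.refl B) x y
  have e2 := hQ.comp_relabel_left hk' s.symm (Equiv.refl B)
    (topIns h hi (Q.relabel s (Equiv.refl _) x)) y
  rw [Equiv.sumCongr_refl] at e1 e2
  rw [e2]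
  rw [e1, ← hQ.relabel_trans] at e
  rw [show (Equiv.refl (B ⊕ D)) = (Equiv.sumCongr (Equiv.refl B) (Equiv.refl D)).trans
    (Equiv.refl _) by simp, e, ← hQ.relabel_trans]
  refine ProperadData.relabel_eq ?_ (fun x => by simp) _
  rintro (x | x) <;> simp

theorem inIns_comp_right (hj : j + r = j') (hkr : k + r = k') (hk' : i + j' = k') (b : D)
    (x : Q.obj A (B ⊕ E) i) (y : Q.obj (E ⊕ C) D j) :
    inIns h hkr (Sum.inr b) (Q.comp hk x y) = Q.comp hk' x (inIns h hj b y) := by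
  obtain ⟨D', _, s, hs⟩ : ∃ (D' : Type) (_ : Finite D') (s : D ≃ D' ⊕ Fin 1), s b = Sum.inr 0 :=
    ⟨_, inferInstance, (splitFront b).trans (Equiv.sumComm _ _), by simp [splitFront_self]⟩
  rw [inIns_eq hQ h hkr _ ((Equiv.sumCongr (Equiv.refl B) s).trans (Equiv.sumAssoc _ _ _).symm)
    (by simp [hs]), inIns_eq hQ h hj b s hs]
  have e := botIns_comp_right hQ h hk hj hkr hk' x (Q.relabel (Equiv.refl _) s y)
  have e1 := hQ.comp_relabel_right hk (Equiv.refl C) s x y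
  have e2 := hQ.comp_relabel_right hk' (Equiv.refl C) s.symm x
    (botIns h hj (Q.relabel (Equiv.refl _) s y))
  rw [Equiv.sumCongr_refl] at e1 e2
  rw [e2]
  rw [e1, ← hQ.relabel_trans] at e
  rw [show (Equiv.refl (A ⊕ C)) = (Equiv.sumCongr (Equiv.refl A) (Equiv.refl C)).trans
    (Equiv.refl _) by simp, e, ← hQ.relabel_trans]
  refine ProperadData.relabel_eq (fun x => by simp) ?_ _
  rintro (x | x) <;> simp

theorem outIns_comp_right (hj : j + r = j') (hkr : k + r = k') (hk' : i + j' = k') (a : C)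
    (x : Q.obj A (B ⊕ E) i) (y : Q.obj (E ⊕ C) D j) :
    outIns h hkr (Sum.inr a) (Q.comp hk x y) =
      ksign K (r * i) • Q.comp hk' x (outIns h hj (Sum.inr a) y) := by
  have hs := splitFront_self a
  generalize splitFront a = s at hs
  rw [outIns_eq hQ h hkr _ ((Equiv.sumCongr (Equiv.refl A) s).trans (exchL _ _ _))
    (by simp [hs, exchL]), outIns_eq hQ h hj _ ((Equiv.sumCongr (Equiv.refl E) s).trans (exchL _ _ _))
    (by simp [hs, exchL])]
  have e := topIns_comp_right hQ h hk hj hkr hk' x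
    (Q.relabel (Equiv.sumCongr (Equiv.refl E) s) (Equiv.refl _) y)
  have e1 := hQ.comp_relabel_right hk s (Equiv.refl D) x y
  rw [Equiv.sumCongr_refl] at e1
  rw [e1, ← hQ.relabel_trans, ← hQ.relabel_trans] at e
  simp only [Equiv.trans_refl] at e
  rw [e, map_smul, ← hQ.relabel_trans]
  congr 1
  have e2 := hQ.comp_relabel_right hk' s.symm (Equiv.refl D) x
    (Q.relabel (exchL _ _ _) (Equiv.refl _) (topIns h hj
      (Q.relabel ((Equiv.sumCongr (Equiv.refl E) s).trans (exchL _ _ _)) (Equiv.refl _) y)))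
  rw [← hQ.relabel_trans] at e2
  refine Eq.trans ?_ (e2.symm.trans (congrArg _ (ProperadData.relabel_eq ?_ ?_ _)))
  · refine ProperadData.relabel_eq ?_ (fun x => by simp) _
    rintro (x | x | x) <;> simp [exchL]
  · rintro (x | x | x) <;> simp [exchL]
  · intro x
    simp

theorem inIns_comp_left (hi : i + r = i') (hkr : k + r = k') (hk' : i' + j = k') (b : B)
    (x : Q.obj A (B ⊕ E) i) (y : Q.obj (E ⊕ C) D j) :
    inIns h hkr (Sum.inl b) (Q.comp hk x y) =
      ksign K (r * j) • Q.comp hk' (inIns h hi (Sum.inl b) x) y := by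
  obtain ⟨B', _, s, hs⟩ : ∃ (B' : Type) (_ : Finite B') (s : B ≃ B' ⊕ Fin 1), s b = Sum.inr 0 :=
    ⟨_, inferInstance, (splitFront b).trans (Equiv.sumComm _ _), by simp [splitFront_self]⟩
  rw [inIns_eq hQ h hkr _ ((Equiv.sumCongr s (Equiv.refl D)).trans (exchR _ _ _))
    (by simp [hs, exchR]), inIns_eq hQ h hi _ ((Equiv.sumCongr s (Equiv.refl E)).trans (exchR _ _ _))
    (by simp [hs, exchR])]
  have e := botIns_comp_left hQ h hk hi hkr hk'
    (Q.relabel (Equiv.refl _) (Equiv.sumCongr s (Equiv.refl E)) x) y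
  have e1 := hQ.comp_relabel_left hk (Equiv.refl A) s x y
  rw [Equiv.sumCongr_refl] at e1
  rw [e1, ← hQ.relabel_trans, ← hQ.relabel_trans] at e
  simp only [Equiv.trans_refl] at e
  rw [e, map_smul, ← hQ.relabel_trans]
  congr 1
  have e2 := hQ.comp_relabel_left hk' (Equiv.refl A) s.symm
    (Q.relabel (Equiv.refl _) (exchR _ _ _) (botIns h hi
      (Q.relabel (Equiv.refl _) ((Equiv.sumCongr s (Equiv.refl E)).trans (exchR _ _ _)) x))) y
  rw [← hQ.relabel_trans] at e2
  refine Eq.trans ?_ (e2.symm.trans (congrArg (fun w => Q.comp hk' w y)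
    (ProperadData.relabel_eq ?_ ?_ _)))
  · refine ProperadData.relabel_eq (fun x => by simp) ?_ _
    rintro ((x | x) | x) <;> simp [exchR]
  · intro x
    simp
  · rintro ((x | x) | x) <;> simp [exchR]

/-- Both sides insert `h` on the edge `e`. Splitting `e` off the set of glued edges reduces this to
`botIns_comp_eq_comp_topIns`. -/
theorem inIns_comp_eq_comp_outIns (hi : i + r = i') (hj : j + r = j') (hk₁ : i' + j = k')
    (hk₂ : i + j' = k') (e : E) (x : Q.obj A (B ⊕ E) i) (y : Q.obj (E ⊕ C) D j) :
    Q.comp hk₁ (inIns h hi (Sum.inr e) x) y = Q.comp hk₂ x (outIns h hj (Sum.inl e) y) := by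
  obtain ⟨E', _, s, hs⟩ : ∃ (E' : Type) (_ : Finite E') (s : E ≃ E' ⊕ Fin 1), s e = Sum.inr 0 :=
    ⟨_, inferInstance, (splitFront e).trans (Equiv.sumComm _ _), by simp [splitFront_self]⟩
  rw [inIns_eq hQ h hi _ ((Equiv.sumCongr (Equiv.refl B) s).trans (Equiv.sumAssoc _ _ _).symm)
    (by simp [hs]), outIns_eq hQ h hj _ ((Equiv.sumCongr s (Equiv.refl C)).trans
      ((Equiv.sumAssoc _ _ _).trans (exchL _ _ _))) (by simp [hs, exchL])]
  have key := botIns_comp_eq_comp_topIns hQ h hi hj hk₁ hk₂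
    (Q.relabel (Equiv.refl _) ((Equiv.sumCongr (Equiv.refl B) s).trans (Equiv.sumAssoc _ _ _).symm) x)
    (Q.relabel ((Equiv.sumCongr s (Equiv.refl C)).trans
      ((Equiv.sumAssoc _ _ _).trans (exchL _ _ _))) (Equiv.refl _) y)
  set X := botIns h hi (Q.relabel (Equiv.refl _)
    ((Equiv.sumCongr (Equiv.refl B) s).trans (Equiv.sumAssoc _ _ _).symm) x) with hX
  set Y := topIns h hj (Q.relabel ((Equiv.sumCongr s (Equiv.refl C)).trans
      ((Equiv.sumAssoc _ _ _).trans (exchL _ _ _))) (Equiv.refl _) y) with hY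
  rw [← hQ.relabel_trans, ← hQ.relabel_trans] at key
  have m₁ := hQ.comp_relabel_mid hk₁ s.symm (Q.relabel (Equiv.refl _) (Equiv.sumAssoc _ _ _) X) y
  have m₂ := hQ.comp_relabel_mid hk₂ s x (Q.relabel ((exchL (Fin 1) E' C).trans
    (Equiv.sumAssoc _ _ _).symm) (Equiv.refl _) Y)
  rw [← hQ.relabel_trans] at m₁ m₂
  refine Eq.trans (congrArg (fun w => Q.comp hk₁ w y) (ProperadData.relabel_eq ?_ ?_ _))
    (m₁.trans (Eq.trans (congrArg _ (ProperadData.relabel_eq ?_ ?_ _)) (key.trans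
      (Eq.trans (congrArg (fun w => Q.comp hk₂ w _) (ProperadData.relabel_eq ?_ ?_ _))
        (m₂.trans (congrArg _ (ProperadData.relabel_eq ?_ ?_ _)))))))
  · intro x
    rfl
  · rintro ((x | x) | x) <;> simp
  · rintro (x | x)
    · rcases hx : s x with x' | x' <;> simp [exchL, hx]
    · simp [exchL]
  · intro x
    rfl
  · intro x
    rfl
  · rintro (x | x)
    · simp
    · rcases hx : s x with x' | x' <;> simp [hx]
  · rintro (x | x | x) <;> simp [exchL]
  · intro x
    rfl

end InnerDerivations

/-! ### Inner derivations. -/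

section InnerDer

variable {K : Type v} [Field K] {Q : ProperadData.{u} K ℤ} {r s t : ℤ}

/-- The inner derivation given by `h`. -/
def innerDer (h : Q.obj (Fin 1) (Fin 1) r) : Endo Q r := fun S =>
  letI := Fintype.ofFinite S.out
  letI := Fintype.ofFinite S.inp
  ∑ o : S.out, outIns h S.add o - ksign K (r * S.src) • ∑ b : S.inp, inIns h S.add b

theorem topIns_add (h h' : Q.obj (Fin 1) (Fin 1) r) {A B : Type} [Finite A] [Finite B] {i j : ℤ}
    (hj : i + r = j) (x : Q.obj (Fin 1 ⊕ A) B i) :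
    topIns (h + h') hj x = topIns h hj x + topIns h' hj x := by
  simp [topIns]

theorem topIns_smul (a : K) (h : Q.obj (Fin 1) (Fin 1) r) {A B : Type} [Finite A] [Finite B]
    {i j : ℤ} (hj : i + r = j) (x : Q.obj (Fin 1 ⊕ A) B i) :
    topIns (a • h) hj x = a • topIns h hj x := by
  simp [topIns]

theorem botIns_add (h h' : Q.obj (Fin 1) (Fin 1) r) {A B : Type} [Finite A] [Finite B] {i j : ℤ}
    (hj : i + r = j) (x : Q.obj A (B ⊕ Fin 1) i) :
    botIns (h + h') hj x = botIns h hj x + botIns h' hj x := by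
  simp [botIns]

theorem botIns_smul (a : K) (h : Q.obj (Fin 1) (Fin 1) r) {A B : Type} [Finite A] [Finite B]
    {i j : ℤ} (hj : i + r = j) (x : Q.obj A (B ⊕ Fin 1) i) :
    botIns (a • h) hj x = a • botIns h hj x := by
  simp [botIns]

variable (hQ : Q.IsProperad (AddMonoidHom.id ℤ)) (h h' : Q.obj (Fin 1) (Fin 1) r)
  {A B : Type} [Finite A] [Finite B] {i i' j j' k k' : ℤ}

include hQ

theorem innerDer_app (hj : i + r = j) (x : Q.obj A B i) :
    (innerDer h).app hj x = innerMap h hj x := by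
  let := Fintype.ofFinite A
  let := Fintype.ofFinite B
  rw [innerMap_eq hQ]
  simp [innerDer, Endo.app]

theorem innerMap_add (hj : i + r = j) (x : Q.obj A B i) :
    innerMap (h + h') hj x = innerMap h hj x + innerMap h' hj x := by
  let := Fintype.ofFinite A
  let := Fintype.ofFinite B
  rw [innerMap_eq hQ, innerMap_eq hQ, innerMap_eq hQ]
  simp only [outIns, inIns, LinearMap.comp_apply, topIns_add, botIns_add, map_add,
    Finset.sum_add_distrib, smul_add]
  abel

theorem innerMap_smul (a : K) (hj : i + r = j) (x : Q.obj A B i) :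
    innerMap (a • h) hj x = a • innerMap h hj x := by
  let := Fintype.ofFinite A
  let := Fintype.ofFinite B
  rw [innerMap_eq hQ, innerMap_eq hQ]
  simp only [outIns, inIns, LinearMap.comp_apply, topIns_smul, botIns_smul, map_smul,
    ← Finset.smul_sum, smul_sub]
  rw [smul_comm]

theorem innerMap_neg (hj : i + r = j) (x : Q.obj A B i) :
    innerMap (-h) hj x = -innerMap h hj x := by
  rw [← neg_one_smul K, innerMap_smul hQ, neg_one_smul]

theorem innerMap_sub (hj : i + r = j) (x : Q.obj A B i) :
    innerMap (h - h') hj x = innerMap h hj x - innerMap h' hj x := by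
  rw [sub_eq_add_neg, innerMap_add hQ, innerMap_neg hQ, ← sub_eq_add_neg]

/-- Insertions at the free legs of a composite are insertions at the legs of its factors. Insertions
at the glued edges come once from above and once from below, with opposite signs, and cancel. -/
theorem innerDer_mem : innerDer h ∈ Der Q r := by
  refine ⟨?_, ?_⟩
  · intro A A' B B' _ _ _ _ i j hj e f x
    let := Fintype.ofFinite A
    let := Fintype.ofFinite B
    let := Fintype.ofFinite A'
    let := Fintype.ofFinite B'
    rw [innerDer_app hQ, innerDer_app hQ, innerMap_eq hQ, innerMap_eq hQ, map_sub, map_smul,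
      map_sum, map_sum]
    congr 1
    · rw [← Equiv.sum_comp e]
      exact Finset.sum_congr rfl fun o _ => outIns_relabel hQ h hj e f o x
    · congr 1
      rw [← Equiv.sum_comp f]
      exact Finset.sum_congr rfl fun o _ => inIns_relabel hQ h hj e f o x
  · intro A B C D E _ _ _ _ _ _ i j k i' j' k' hk hi hj hk' x y
    let := Fintype.ofFinite A
    let := Fintype.ofFinite B
    let := Fintype.ofFinite C
    let := Fintype.ofFinite D
    let := Fintype.ofFinite E
    have g₁ : i' + j = k' := by omega
    have g₂ : i + j' = k' := by omega
    rw [innerDer_app hQ, innerDer_app hQ, innerDer_app hQ, innerMap_eq hQ, innerMap_eq hQ,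
      innerMap_eq hQ]
    simp only [Fintype.sum_sum_type, outIns_comp_left hQ h hk hi hk' g₁,
      outIns_comp_right hQ h hk hj hk' g₂, inIns_comp_left hQ h hk hi hk' g₁,
      inIns_comp_right hQ h hk hj hk' g₂, map_sub, map_add, map_sum, map_smul,
      LinearMap.sub_apply, LinearMap.add_apply, LinearMap.sum_apply, LinearMap.smul_apply,
      inIns_comp_eq_comp_outIns hQ h hi hj g₁ g₂, ← Finset.smul_sum]
    rw [show r * k = r * i + r * j by rw [← hk]; ring, ksign_add]
    rcases ksign_cases K (r * i) with s₁ | s₁ <;> rcases ksign_cases K (r * j) with s₂ | s₂ <;>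
      rw [s₁, s₂] <;> module

omit hQ in
theorem der_topIns {D : Endo Q s} (hD : D ∈ Der Q s) {r' : ℤ} (hr : r + s = r')
    (hj : i + r = j) (hi : i + s = i') (hj' : j + s = j') (x : Q.obj (Fin 1 ⊕ A) B i) :
    D.app hj' (topIns h hj x) = topIns (D.app hr h) (show i + r' = j' by omega) x +
      ksign K (s * r) • topIns h (show i' + r = j' by omega) (D.app hi x) := by
  simp only [topIns, LinearMap.comp_apply]
  rw [hD.1, hD.2 _ hr hi hj', hD.1, map_add, map_smul]

omit hQ in
theorem der_botIns {D : Endo Q s} (hD : D ∈ Der Q s) {r' : ℤ} (hr : r + s = r')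
    (hj : i + r = j) (hi : i + s = i') (hj' : j + s = j') (x : Q.obj A (B ⊕ Fin 1) i) :
    D.app hj' (botIns h hj x) = botIns h (show i' + r = j' by omega) (D.app hi x) +
      ksign K (s * i) • botIns (D.app hr h) (show i + r' = j' by omega) x := by
  simp only [botIns, LinearMap.comp_apply, LinearMap.flip_apply]
  rw [hD.1, hD.2 _ hi hr hj', hD.1, map_add, map_smul]

/-- Insertion is built from relabellings and compositions, so it obeys the Leibniz rule with respect
to the inserted operation and its argument. -/
theorem der_innerMap {D : Endo Q s} (hD : D ∈ Der Q s) {r' : ℤ} (hr : r + s = r')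
    (hj : i + r = j) (hi : i + s = i') (hj' : j + s = j') (x : Q.obj A B i) :
    D.app hj' (innerMap h hj x) = innerMap (D.app hr h) (show i + r' = j' by omega) x +
      ksign K (s * r) • innerMap h (show i' + r = j' by omega) (D.app hi x) := by
  let := Fintype.ofFinite A
  let := Fintype.ofFinite B
  rw [innerMap_eq hQ, innerMap_eq hQ, innerMap_eq hQ]
  simp only [map_sub, map_sum, map_smul, outIns, inIns, LinearMap.comp_apply, hD.1,
    der_topIns h hD hr hj hi hj', der_botIns h hD hr hj hi hj', map_add, Finset.sum_add_distrib,
    ← Finset.smul_sum]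
  subst hi hr
  simp only [mul_add, add_mul, ksign_add, mul_comm r s]
  rcases ksign_cases K (r * i) with s₁ | s₁ <;> rcases ksign_cases K (s * r) with s₂ | s₂ <;>
    rcases ksign_cases K (s * i) with s₃ | s₃ <;>
      rw [s₁, s₂, s₃] <;> module

end InnerDer

/-! ### Derivations acting on families. -/

section FamDer

variable {K : Type v} [Field K] {Q : ProperadData.{u} K ℤ} {c d : ℤ} {r k l p : ℤ}

/-- The values of a derivation on the members of a family. -/
def Endo.fam (D : Endo Q r) (h : k + r = l) : Fam Q c d k →ₗ[K] Fam Q c d l :=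
  LinearMap.pi fun s => (D.app (deg_add c d h s.1 s.2)) ∘ₗ (LinearMap.proj s)

theorem Endo.fam_apply (D : Endo Q r) (h : k + r = l) (η : Fam Q c d k) (s : ℕ × ℕ) :
    D.fam h η s = D.app (deg_add c d h s.1 s.2) (η s) := rfl

theorem der_skewSym {D : Endo Q r} (hD : D ∈ Der Q r) {A B : Type} [Finite A] [Finite B] {m n : ℕ}
    {i j : ℤ} (hj : i + r = j) (e : A ≃ Fin m) (f : B ≃ Fin n) (x : Q.obj A B i) :
    D.app hj (skewSym Q c d e f x) = skewSym Q c d e f (D.app hj x) := by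
  simp only [skewSym, LinearMap.sum_apply, LinearMap.smul_apply, map_sum, map_smul, hD.1]

/-- The Leibniz rule for compositions involves the degree of the component of `η`; the summand `k`
in the sign of `star` converts this into the degree `k` of the family. -/
theorem der_star {D : Endo Q r} (hD : D ∈ Der Q r) {k' l' t t' : ℤ} (h : k + l = t)
    (hk : k + r = k') (hl : l + r = l') (ht : t + r = t') (h₁ : k' + l = t') (h₂ : k + l' = t')
    (η : Fam Q c d k) (ξ : Fam Q c d l) :
    D.fam ht (star Q c d h η ξ) =
      star Q c d h₁ (D.fam hk η) ξ + ksign K (r * k) • star Q c d h₂ η (D.fam hl ξ) := by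
  funext s
  rw [Endo.fam_apply, Pi.add_apply, Pi.smul_apply]
  simp only [star, LinearMap.mk₂_apply, map_sum, map_smul, Finset.smul_sum,
    ← Finset.sum_add_distrib]
  refine Finset.sum_congr rfl fun p _ => Finset.sum_congr rfl fun q _ => ?_
  rw [der_skewSym hD, hD.2 _ (deg_add c d hk _ _) (deg_add c d hl _ _) (deg_add c d ht _ _),
    hD.1, hD.1, map_add, map_smul, smul_add, smul_smul, smul_smul]
  simp only [Endo.fam_apply]
  congr 2
  · rw [← deg_add c d hk, ← hk]
    have : (deg c d k p.fst (q.fst + 1) + r + (k + r)) * deg c d l (1 + p.snd) q.snd +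
        c * d * q.fst * p.snd = (deg c d k p.fst (q.fst + 1) + k) * deg c d l (1 + p.snd) q.snd +
        c * d * q.fst * p.snd + (r * deg c d l (1 + p.snd) q.snd +
          r * deg c d l (1 + p.snd) q.snd) := by ring
    rw [this, ksign_add _ (_ + _), ksign_add (r * _), ksign_mul_self, mul_one]
  · rw [← deg_add c d hl]
    have : (deg c d k p.fst (q.fst + 1) + k) * (deg c d l (1 + p.snd) q.snd + r) +
        c * d * q.fst * p.snd = ((deg c d k p.fst (q.fst + 1) + k) * deg c d l (1 + p.snd) q.snd +
        c * d * q.fst * p.snd) + r * deg c d k p.fst (q.fst + 1) + r * k := by ring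
    rw [this, ksign_add _ (r * k), ksign_add _ (r * deg c d k _ _)]
    linear_combination (-((p.fst ! * p.snd ! * q.fst ! * q.snd ! : ℕ) : K)⁻¹ *
      ksign K ((deg c d k p.fst (q.fst + 1) + k) * deg c d l (1 + p.snd) q.snd +
        c * d * q.fst * p.snd) * ksign K (r * deg c d k p.fst (q.fst + 1))) *
        ksign_mul_self K (r * k)

theorem der_brk {D : Endo Q r} (hD : D ∈ Der Q r) {k' l' t t' : ℤ} (h : k + l = t)
    (hk : k + r = k') (hl : l + r = l') (ht : t + r = t') (h₁ : k' + l = t') (h₂ : k + l' = t')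
    (η : Fam Q c d k) (ξ : Fam Q c d l) :
    D.fam ht (brk Q c d h η ξ) =
      brk Q c d h₁ (D.fam hk η) ξ + ksign K (r * k) • brk Q c d h₂ η (D.fam hl ξ) := by
  rw [brk_apply h (by omega), brk_apply h₁ (by omega), brk_apply h₂ (by omega), map_sub, map_smul,
    der_star hD h hk hl ht h₁ h₂, der_star hD _ hl hk ht (by omega) (by omega)]
  subst hk hl
  simp only [mul_add, add_mul, ksign_add, mul_comm k r]
  rcases ksign_cases K (r * k) with s₁ | s₁ <;> rcases ksign_cases K (r * l) with s₂ | s₂ <;>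
      rw [s₁, s₂] <;> module

end FamDer

/-! ### Homogeneous elements of a completion. -/

section Homogeneous

variable {K : Type v} [Field K] {W : ProperadData.{u} K (ℤ × ℕ)} {A A' B B' C D E : Type}
  [Finite A] [Finite A'] [Finite B] [Finite B'] [Finite C] [Finite D] [Finite E] [Nonempty E]
  {i j k : ℤ} {M N : ℕ}

/-- The elements of weight `i.2`, as elements of the completion. -/
def homog (W : ProperadData.{u} K (ℤ × ℕ)) (i : ℤ × ℕ) :
    W.obj A B i →ₗ[K] W.completion.obj A B i.1 :=
  LinearMap.single K (fun N : ℕ => W.obj A B (i.1, N)) i.2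

theorem homog_self (i : ℤ × ℕ) (x : W.obj A B i) : homog W i x i.2 = x :=
  Pi.single_eq_same (M := fun N : ℕ => W.obj A B (i.1, N)) i.2 x

theorem homog_ne (i : ℤ × ℕ) (x : W.obj A B i) (h : N ≠ i.2) : homog W i x N = 0 :=
  Pi.single_eq_of_ne (M := fun N : ℕ => W.obj A B (i.1, N)) h x

theorem homog_relabel (i : ℤ × ℕ) (e : A ≃ A') (f : B ≃ B') (x : W.obj A B i) :
    homog W i (W.relabel e f x) = W.completion.relabel e f (homog W i x) := by
  funext N
  rw [ProperadData.completion_relabel]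
  by_cases h : N = i.2
  · subst h
    rw [homog_self, homog_self]
  · rw [homog_ne i _ h, homog_ne i _ h, map_zero]

theorem homog_comp {i j k : ℤ × ℕ} (h : i + j = k) (x : W.obj A (B ⊕ E) i)
    (y : W.obj (E ⊕ C) D j) :
    homog W k (W.comp h x y) =
      W.completion.comp (congrArg Prod.fst h) (homog W i x) (homog W j y) := by
  obtain ⟨i, p⟩ := i
  obtain ⟨j, q⟩ := j
  obtain ⟨k, N⟩ := k
  obtain ⟨rfl, rfl⟩ := Prod.mk.inj h
  funext M
  rw [ProperadData.completion_comp]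
  by_cases hM : M = p + q
  · subst hM
    rw [homog_self (i + j, p + q)]
    rw [Finset.sum_eq_single (⟨p, q, rfl⟩ : Split (p + q))]
    · rw [homog_self (i, p), homog_self (j, q)]
    · rintro ⟨p', q', h'⟩ - hne
      have : p' ≠ p := by
        rintro rfl
        obtain rfl : q' = q := by omega
        exact hne rfl
      rw [homog_ne (i, p) x this, LinearMap.map_zero₂]
    · simp
  · rw [homog_ne _ _ hM]
    symm
    refine Finset.sum_eq_zero fun s _ => ?_
    by_cases hp : s.fst = p
    · rw [homog_ne (j, q) y (fun hq => hM (by rw [← s.add, hp, hq])), map_zero]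
    · rw [homog_ne (i, p) x hp, LinearMap.map_zero₂]

theorem completion_comp_eq_zero (h : i + j = k) (x : W.completion.obj A (B ⊕ E) i)
    (y : W.completion.obj (E ⊕ C) D j) (p q : ℕ) (hx : ∀ N < p, x N = 0) (hy : ∀ N < q, y N = 0)
    (hN : N < p + q) : W.completion.comp h x y N = 0 := by
  rw [ProperadData.completion_comp]
  refine Finset.sum_eq_zero fun s _ => ?_
  have := s.add
  by_cases hp : s.fst < p
  · rw [hx _ hp, LinearMap.map_zero₂]
  · rw [hy s.snd (by omega), map_zero]

/-- Subtracting the finitely many terms of weight less than `M` leaves an element that `F`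
annihilates by `hF`. -/
theorem eq_zero_of_homog {V : Type*} [AddCommGroup V] [Module K V]
    (F : W.completion.obj A B i →ₗ[K] V) (M : ℕ)
    (hF : ∀ x : W.completion.obj A B i, (∀ N < M, x N = 0) → F x = 0)
    (h : ∀ (N : ℕ) (x : W.obj A B (i, N)), F (homog W (i, N) x) = 0) : F = 0 := by
  ext x
  have h1 : F (x - ∑ N ∈ Finset.range M, homog W (i, N) (x N)) = 0 := by
    refine hF _ fun N hN => ?_
    have e : (x - ∑ N ∈ Finset.range M, homog W (i, N) (x N)) N =
        x N - ∑ L ∈ Finset.range M, homog W (i, L) (x L) N :=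
      congrArg (x N - ·) (Finset.sum_apply N _ _)
    rw [e, Finset.sum_eq_single N, homog_self (i, N), sub_self]
    · intro L _ hL
      exact homog_ne (i, L) _ (Ne.symm hL)
    · intro hN'
      exact absurd (Finset.mem_range.2 hN) hN'
  rw [map_sub, map_sum] at h1
  simpa [h] using h1

end Homogeneous

/-! ### Leibniz rule on formal expressions, with values in the completion. -/

section WeightedDerivation

variable {K : Type v} [Field K] {G : (A B : Type) → ℤ × ℕ → Type w}
  {R : ∀ (A B : Type) (i : ℤ × ℕ), Term K G A B i → Term K G A B i → Prop}

/-- The properad with integer degrees and weights presented by the generators `G` and the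
relations `R`. -/
abbrev WeightedPresented (R : ∀ (A B : Type) (i : ℤ × ℕ), Term K G A B i → Term K G A B i → Prop) :
    ProperadData.{max 1 v w} K (ℤ × ℕ) := Presented (AddMonoidHom.fst ℤ ℕ) R

/-- The element of the completion represented by a formal expression. -/
def Term.val (R : ∀ (A B : Type) (i : ℤ × ℕ), Term K G A B i → Term K G A B i → Prop)
    {A B : Type} [Finite A] [Finite B] {i : ℤ × ℕ} (x : Term K G A B i) :
    (WeightedPresented R).completion.obj A B i.1 :=
  homog (WeightedPresented R) i (Presented.mk x)

theorem Term.val_relabel {A A' B B' : Type} [Finite A] [Finite A'] [Finite B] [Finite B']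
    {i : ℤ × ℕ} (e : A ≃ A') (f : B ≃ B') (x : Term K G A B i) :
    (Term.relabel e f x).val R = (WeightedPresented R).completion.relabel e f (x.val R) :=
  homog_relabel (W := WeightedPresented R) i e f (Presented.mk x)

theorem Term.val_comp {A B C D E : Type} [Finite A] [Finite B] [Finite C] [Finite D] [Finite E]
    [Nonempty E] {i j k : ℤ × ℕ} (h : i + j = k) (x : Term K G A (B ⊕ E) i)
    (y : Term K G (E ⊕ C) D j) :
    (Term.comp h x y).val R =
      (WeightedPresented R).completion.comp (congrArg Prod.fst h) (x.val R) (y.val R) :=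
  homog_comp (W := WeightedPresented R) h (Presented.mk x) (Presented.mk y)

theorem Term.val_add {A B : Type} [Finite A] [Finite B] {i : ℤ × ℕ} (x y : Term K G A B i) :
    (Term.add x y).val R = x.val R + y.val R :=
  map_add (homog (WeightedPresented R) i) (Presented.mk x) (Presented.mk y)

theorem Term.val_smul {A B : Type} [Finite A] [Finite B] {i : ℤ × ℕ} (a : K) (x : Term K G A B i) :
    (Term.smul a x).val R = a • x.val R :=
  map_smul (homog (WeightedPresented R) i) a (Presented.mk x)

theorem Term.val_zero (A B : Type) [Finite A] [Finite B] (i : ℤ × ℕ) :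
    (Term.zero A B i : Term K G A B i).val R = 0 :=
  map_zero (homog (A := A) (B := B) (WeightedPresented R) i)

theorem Term.val_one : (Term.one : Term K G _ _ _).val R = (WeightedPresented R).completion.one :=
  rfl

/-- The value on a formal expression of the derivation of degree `r` that is given by `δ` on the
generators. -/
def Term.cder {r : ℤ} (δ : ∀ (A B : Type) [Finite A] [Finite B] (i : ℤ × ℕ) (j : ℤ), i.1 + r = j →
    G A B i → (WeightedPresented R).completion.obj A B j) :
    ∀ {A B : Type} {i : ℤ × ℕ}, Term K G A B i → ∀ j, i.1 + r = j →
      ∀ N : ℕ, Presented.Obj (AddMonoidHom.fst ℤ ℕ) R A B (j, N)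
  | _, _, _, @Term.gen _ _ _ _ A B _ _ i g, j, h => δ A B i j h g
  | _, _, _, .one, j, _ => (0 : (WeightedPresented R).completion.obj (Fin 1) (Fin 1) j)
  | _, _, _, @Term.relabel _ _ _ _ _ _ _ _ _ _ _ _ _ e f x, j, h =>
      (WeightedPresented R).completion.relabel e f (Term.cder δ x j h)
  | _, _, _, @Term.comp _ _ _ _ _ _ _ _ _ _ _ _ _ _ _ i j _ h x y, _, hk =>
      leib (WeightedPresented R).completion (congrArg Prod.fst h) rfl rfl hk (x.val R)
        (Term.cder δ x (i.1 + r) rfl) (y.val R) (Term.cder δ y (j.1 + r) rfl)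
  | _, _, _, @Term.zero _ _ _ _ A B _ _ _, j, _ =>
      (0 : (WeightedPresented R).completion.obj A B j)
  | _, _, _, @Term.add _ _ _ _ A B _ _ _ x y, j, h =>
      (Term.cder δ x j h + Term.cder δ y j h : (WeightedPresented R).completion.obj A B j)
  | _, _, _, @Term.smul _ _ _ _ A B _ _ _ a x, j, h =>
      (a • Term.cder δ x j h : (WeightedPresented R).completion.obj A B j)

variable {r : ℤ} (δ : ∀ (A B : Type) [Finite A] [Finite B] (i : ℤ × ℕ) (j : ℤ), i.1 + r = j →
    G A B i → (WeightedPresented R).completion.obj A B j)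

theorem Term.cder_comp {A B C D E : Type} [Finite A] [Finite B] [Finite C] [Finite D] [Finite E]
    [Nonempty E] {i j k : ℤ × ℕ} {i' j' k' : ℤ} (h : i + j = k) (hi : i.1 + r = i')
    (hj : j.1 + r = j') (hk : k.1 + r = k') (x : Term K G A (B ⊕ E) i) (y : Term K G (E ⊕ C) D j) :
    (Term.comp h x y).cder δ k' hk = leib (WeightedPresented R).completion (congrArg Prod.fst h)
      hi hj hk (x.val R) (x.cder δ i' hi) (y.val R) (y.cder δ j' hj) := by
  subst hi hj
  rfl

theorem Term.cder_relabel {A A' B B' : Type} [Finite A] [Finite A'] [Finite B] [Finite B']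
    {i : ℤ × ℕ} {j : ℤ} (h : i.1 + r = j) (e : A ≃ A') (f : B ≃ B') (x : Term K G A B i) :
    (Term.relabel e f x).cder δ j h =
      (WeightedPresented R).completion.relabel e f (x.cder δ j h) := rfl

/-- The Leibniz rule is compatible with each law of a properad, by the `leib_` lemmas. Hence the
recursion on formal expressions descends to the quotient as soon as it respects the given relations
`R`. -/
theorem Term.cder_rel (hδ : ∀ {A B : Type} {i : ℤ × ℕ} {x y : Term K G A B i}, R A B i x y →
    ∀ j (h : i.1 + r = j), x.cder δ j h = y.cder δ j h) {A B : Type} {i : ℤ × ℕ}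
    {x y : Term K G A B i} (hxy : Rel (AddMonoidHom.fst ℤ ℕ) R x y) :
    ∀ j (h : i.1 + r = j), x.cder δ j h = y.cder δ j h := by
  have law := ProperadData.completion_isProperad (Presented.isProperad (AddMonoidHom.fst ℤ ℕ) R)
  have vmk : ∀ {A B : Type} [Finite A] [Finite B] {i : ℤ × ℕ} {x y : Term K G A B i},
    Rel (AddMonoidHom.fst ℤ ℕ) R x y → x.val R = y.val R := 
    fun {A B} _ _ {i} {x y} h =>
      congrArg (homog (A := A) (B := B) (WeightedPresented R) i) (Presented.sound h)
  have neg : ∀ {A B : Type} [Finite A] [Finite B] {j : ℤ}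
    (v : (WeightedPresented R).completion.obj A B j), (-1 : K) • v + v = 0 := fun v => by
      rw [neg_one_smul, neg_add_cancel]
  have adds : ∀ {A B : Type} [Finite A] [Finite B] {j : ℤ} (a b : K)
    (v : (WeightedPresented R).completion.obj A B j), (a + b) • v = a • v + b • v :=
      fun a b v => add_smul a b v
  have sadd : ∀ {A B : Type} [Finite A] [Finite B] {j : ℤ} (a : K)
    (v w : (WeightedPresented R).completion.obj A B j), a • (v + w) = a • v + a • w :=
      fun a v w => smul_add a v w
  induction hxy with
  | of h => exact hδ h
  | refl => intros; rfl
  | symm _ ih => intro j h; exact (ih j h).symm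
  | trans _ _ ih ih' => intro j h; exact (ih j h).trans (ih' j h)
  | relabel_congr e f _ ih =>
    intro j h
    exact congrArg ((WeightedPresented R).completion.relabel e f) (ih j h)
  | @comp_congr _ _ _ _ _ _ _ _ _ _ _ _ _ _ h x x' y y' hx hy ih ih' =>
    intro j hj
    rw [Term.cder_comp δ h rfl rfl hj x y, Term.cder_comp δ h rfl rfl hj x' y', ih _ rfl,
      ih' _ rfl, vmk hx, vmk hy]
  | add_congr _ _ ih ih' => intro j h; exact congrArg₂ (· + ·) (ih j h) (ih' j h)
  | smul_congr a _ ih => intro j h; exact congrArg (a • ·) (ih j h)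
  | add_comm => intro j h; exact add_comm _ _
  | add_assoc => intro j h; exact add_assoc _ _ _
  | zero_add => intro j h; exact zero_add _
  | neg_add x => intro j h; exact neg (x.cder δ j h)
  | one_smul => intro j h; exact one_smul K _
  | mul_smul => intro j h; exact mul_smul _ _ _
  | add_smul a b x => intro j h; exact adds a b (x.cder δ j h)
  | smul_add a x y => intro j h; exact sadd a (x.cder δ j h) (y.cder δ j h)
  | relabel_add => intro j h; exact map_add _ _ _
  | relabel_smul => intro j h; exact map_smul _ _ _
  | comp_add_left h x x' y =>
    intro j hj
    have e := Term.cder_comp δ h rfl rfl hj (Term.add x x') y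
    rw [Term.val_add] at e
    exact e.trans ((leib_add_left _ rfl rfl hj _ _ _ _ _ _).trans
      (congrArg₂ (· + ·) (Term.cder_comp δ h rfl rfl hj _ _)
        (Term.cder_comp δ h rfl rfl hj _ _)).symm)
  | comp_add_right h x y y' =>
    intro j hj
    have e := Term.cder_comp δ h rfl rfl hj x (Term.add y y')
    rw [Term.val_add] at e
    exact e.trans ((leib_add_right _ rfl rfl hj _ _ _ _ _ _).trans
      (congrArg₂ (· + ·) (Term.cder_comp δ h rfl rfl hj _ _)
        (Term.cder_comp δ h rfl rfl hj _ _)).symm)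
  | comp_smul_left h a x y =>
    intro j hj
    have e := Term.cder_comp δ h rfl rfl hj (Term.smul a x) y
    rw [Term.val_smul] at e
    exact e.trans ((leib_smul_left _ rfl rfl hj _ _ _ _ a).trans
      (congrArg (a • ·) (Term.cder_comp δ h rfl rfl hj _ _)).symm)
  | comp_smul_right h a x y =>
    intro j hj
    have e := Term.cder_comp δ h rfl rfl hj x (Term.smul a y)
    rw [Term.val_smul] at e
    exact e.trans ((leib_smul_right _ rfl rfl hj _ _ _ _ a).trans
      (congrArg (a • ·) (Term.cder_comp δ h rfl rfl hj _ _)).symm)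
  | relabel_refl x => intro j h; exact law.relabel_refl _
  | relabel_trans e e' f f' x => intro j h; exact law.relabel_trans _ _ _ _ _
  | comp_relabel h a b c d e x y =>
    intro k' hk
    have e₁ := Term.cder_comp δ h rfl rfl hk (Term.relabel a (Equiv.sumCongr b e) x)
      (Term.relabel (Equiv.sumCongr e c) d y)
    rw [Term.val_relabel, Term.val_relabel] at e₁
    exact e₁.trans ((leib_relabel law _ rfl rfl hk a b c d e _ _ _ _).trans
      (congrArg ((WeightedPresented R).completion.relabel _ _)
        (Term.cder_comp δ h rfl rfl hk x y)).symm)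
  | one_comp y =>
    intro j h
    have e := Term.cder_comp δ (zero_add _) rfl h h (Term.relabel (Equiv.refl (Fin 1))
      (Equiv.emptySum Empty (Fin 1)).symm Term.one) y
    rw [Term.val_relabel, Term.val_one] at e
    exact e.trans (leib_one_comp law h rfl _ _)
  | comp_one x =>
    intro j h
    have e := Term.cder_comp δ (add_zero _) h rfl h x
      (Term.relabel (Equiv.sumEmpty (Fin 1) Empty).symm (Equiv.refl (Fin 1)) Term.one)
    rw [Term.val_relabel, Term.val_one] at e
    exact e.trans (leib_comp_one law h rfl _ _)
  | assoc h₁ h₂ h₃ h₄ x y z =>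
    intro j h
    have e₁ := Term.cder_comp δ h₁ rfl rfl rfl x y
    have e₂ := Term.cder_comp δ h₂ rfl rfl h (Term.relabel (Equiv.refl _)
      (Equiv.sumSumSumComm _ _ _ _) (Term.comp h₁ x y)) z
    have e₃ := Term.cder_comp δ h₃ rfl rfl rfl y (Term.relabel
      ((Equiv.sumAssoc _ _ _).trans (exchL _ _ _)) (Equiv.refl _) z)
    have e₄ := Term.cder_comp δ h₄ rfl rfl h (Term.relabel (Equiv.refl _)
      ((exchR _ _ _).trans (Equiv.sumAssoc _ _ _)) x)
      (Term.relabel (Equiv.sumSumSumComm _ _ _ _) (Equiv.refl _) (Term.comp h₃ y (Term.relabel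
      ((Equiv.sumAssoc _ _ _).trans (exchL _ _ _)) (Equiv.refl _) z)))
    rw [Term.cder_relabel, e₁] at e₂
    rw [Term.cder_relabel δ _ _ _ (Term.comp _ _ _), e₃] at e₄
    simp only [Term.val_relabel, Term.val_comp] at e₂ e₄
    exact (congrArg ((WeightedPresented R).completion.relabel _ _) e₂).trans
      ((leib_assoc law _ _ (congrArg Prod.fst h₃) (congrArg Prod.fst h₄) rfl rfl rfl rfl rfl h
      _ _ _ _ _ _).trans e₄.symm)
  | assoc_below h₁ h₂ h₃ h₄ x y z =>
    intro j h
    have e₁ := Term.cder_comp δ h₁ rfl rfl rfl x z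
    have e₂ := Term.cder_comp δ h₂ rfl rfl h (Term.relabel (Equiv.refl _)
      (exchR _ _ _) (Term.comp h₁ x z)) y
    have e₃ := Term.cder_comp δ h₃ rfl rfl rfl (Term.relabel (Equiv.refl _) (exchR _ _ _) x) y
    have e₄ := Term.cder_comp δ h₄ rfl rfl h (Term.relabel (Equiv.refl _) (exchR _ _ _)
      (Term.comp h₃ (Term.relabel (Equiv.refl _) (exchR _ _ _) x) y)) z
    rw [Term.cder_relabel, e₁] at e₂
    rw [Term.cder_relabel, e₃] at e₄
    simp only [Term.val_relabel, Term.val_comp] at e₂ e₄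
    exact e₂.trans ((leib_assoc_below law _ _ (congrArg Prod.fst h₃) (congrArg Prod.fst h₄) rfl rfl
      rfl rfl rfl h _ _ _ _ _ _).trans (congrArg (fun v => ksign K _ •
        (WeightedPresented R).completion.relabel _ _ v) e₄.symm))
  | assoc_above h₁ h₂ h₃ h₄ x y z =>
    intro j h
    have e₁ := Term.cder_comp δ h₁ rfl rfl rfl x z
    have e₂ := Term.cder_comp δ h₂ rfl rfl h y (Term.relabel (exchL _ _ _) (Equiv.refl _)
      (Term.comp h₁ x z))
    have e₃ := Term.cder_comp δ h₃ rfl rfl rfl y (Term.relabel (exchL _ _ _) (Equiv.refl _) z)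
    have e₄ := Term.cder_comp δ h₄ rfl rfl h x (Term.relabel (exchL _ _ _) (Equiv.refl _)
      (Term.comp h₃ y (Term.relabel (exchL _ _ _) (Equiv.refl _) z)))
    rw [Term.cder_relabel, e₁] at e₂
    rw [Term.cder_relabel, e₃] at e₄
    simp only [Term.val_relabel, Term.val_comp] at e₂ e₄
    exact e₂.trans ((leib_assoc_above law _ _ (congrArg Prod.fst h₃) (congrArg Prod.fst h₄) rfl rfl
      rfl rfl rfl h _ _ _ _ _ _).trans (congrArg (fun v => ksign K _ •
        (WeightedPresented R).completion.relabel _ _ v) e₄.symm))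

/-- Weights add under composition, so the bound passes from the generators to all expressions. It
keeps the sums over weights in the completion finite. -/
theorem Term.cder_eq_zero
    (hw : ∀ (A B : Type) [Finite A] [Finite B] (i : ℤ × ℕ) (j : ℤ) (h : i.1 + r = j) (g : G A B i),
      ∀ N < i.2, δ A B i j h g N = 0)
    {A B : Type} {i : ℤ × ℕ} (x : Term K G A B i) : ∀ (_ : Finite A) (_ : Finite B) (j : ℤ)
      (h : i.1 + r = j), ∀ N < i.2, (x.cder δ j h N : (WeightedPresented R).obj A B (j, N)) = 0 := by
  induction x with
  | gen g => intro _ _ j h N hN; exact hw _ _ _ _ h g N hN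
  | one => intro _ _ j h N hN; rfl
  | relabel e f x ih =>
    intro _ _ j h N hN
    exact (congrArg _ (ih inferInstance inferInstance j h N hN)).trans
      (map_zero ((WeightedPresented R).relabel e f))
  | comp h x y ih ih' =>
    intro _ _ k' hk N hN
    have hh := congrArg Prod.snd h
    rw [Prod.snd_add] at hh
    have e₁ := completion_comp_eq_zero (W := WeightedPresented R) (N := N)
      (show _ = k' by rw [← hk, ← h, Prod.fst_add]; ring)
      (x.cder δ _ rfl) (y.val R) _ _ (ih inferInstance inferInstance _ rfl)
      (fun N hN => homog_ne _ _ hN.ne) (by omega)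
    have e₂ := completion_comp_eq_zero (W := WeightedPresented R) (N := N)
      (show _ = k' by rw [← hk, ← h, Prod.fst_add]; ring)
      (x.val R) (y.cder δ _ rfl) _ _ (fun N hN => homog_ne _ _ hN.ne)
      (ih' inferInstance inferInstance _ rfl) (by omega)
    refine (congrFun (Term.cder_comp δ h rfl rfl hk x y) N).trans ?_
    exact (congrArg₂ (fun a b => a + ksign K (r * _) • b) e₁ e₂).trans
      (by rw [smul_zero, add_zero])
  | zero => intro _ _ j h N hN; rfl
  | add x y ih ih' =>
    intro _ _ j h N hN
    exact (congrArg₂ (· + ·) (ih inferInstance inferInstance j h N hN)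
      (ih' inferInstance inferInstance j h N hN)).trans (add_zero _)
  | smul a x ih =>
    intro _ _ j h N hN
    exact (congrArg (a • ·) (ih inferInstance inferInstance j h N hN)).trans (smul_zero _)

end WeightedDerivation

/-! ### Weights of values, and continuous derivations of completions. -/

section WeightPart

variable {K : Type v} [Field K] {W : ProperadData.{u} K (ℤ × ℕ)} {A B : Type} [Finite A] [Finite B]
  {j : ℤ}

/-- The part of weight `N` of an element of the completion. -/
def weightPart (N : ℕ) : W.completion.obj A B j →ₗ[K] W.obj A B (j, N) :=
  LinearMap.proj N

end WeightPart

section Filtered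

variable {K : Type v} [Field K] {W : ProperadData.{u} K (ℤ × ℕ)} {r : ℤ}

/-- The family of maps `D` does not decrease the weight. -/
def Endo.Filtered (D : Endo W.completion r) : Prop :=
  ∀ {A B : Type} [Finite A] [Finite B] {i j : ℤ} (h : i + r = j) (p : ℕ)
    (x : W.completion.obj A B i), (∀ N < p, x N = 0) → ∀ N < p, D.app h x N = 0

theorem Endo.Filtered.mem {D : Endo W.completion r} (hD : D.Filtered)
    (h : D ∈ Der W.completion r) : D ∈ ContDer W r :=
  ⟨h, fun _ _ _ _ _ _ h p => ⟨p, hD h p⟩⟩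

/-- By continuity the part of weight `p` of a value depends on finitely many weights of the
argument. -/
theorem ContDer.app_eq_zero {D : Endo W.completion r} (hD : D ∈ ContDer W r) {A B : Type} [Finite A]
    [Finite B] {i j : ℤ} (h : i + r = j)
    (h0 : ∀ (N : ℕ) (x : W.obj A B (i, N)), D.app h (homog W (i, N) x) = 0)
    (x : W.completion.obj A B i) : D.app h x = 0 := by
  funext p
  obtain ⟨q, hq⟩ := hD.2 A B i j h (p + 1)
  have := eq_zero_of_homog (weightPart p ∘ₗ D.app h) q
    (fun x hx => hq x hx p (Nat.lt_succ_self p)) (fun N x => congrFun (h0 N x) p)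
  exact LinearMap.congr_fun this x

/-- For a fixed weight `M` of the value, both sides of each identity see only terms of weight at
most `M` of the arguments, because no map involved lowers the weight. The arguments can therefore be
made homogeneous one after the other. -/
theorem Der.of_homog {D : Endo W.completion r} (hD : D.Filtered)
    (h₁ : ∀ {A A' B B' : Type} [Finite A] [Finite A'] [Finite B] [Finite B'] {i : ℤ × ℕ} {j : ℤ}
      (h : i.1 + r = j) (e : A ≃ A') (f : B ≃ B') (x : W.obj A B i),
      D.app h (homog W i (W.relabel e f x)) = W.completion.relabel e f (D.app h (homog W i x)))
    (h₂ : ∀ {A B C X E : Type} [Finite A] [Finite B] [Finite C] [Finite X] [Finite E] [Nonempty E]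
      {i j k : ℤ × ℕ} {i' j' k' : ℤ} (h : i + j = k) (hi : i.1 + r = i') (hj : j.1 + r = j')
      (hk : k.1 + r = k') (x : W.obj A (B ⊕ E) i) (y : W.obj (E ⊕ C) X j),
      D.app hk (homog W k (W.comp h x y)) = leib W.completion (congrArg Prod.fst h) hi hj hk
        (homog W i x) (D.app hi (homog W i x)) (homog W j y) (D.app hj (homog W j y))) :
    D ∈ Der W.completion r := by
  refine ⟨?_, ?_⟩
  · intro A A' B B' _ _ _ _ i j h e f x
    funext M
    have := eq_zero_of_homog (weightPart M ∘ₗ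
      (D.app h ∘ₗ W.completion.relabel e f - W.completion.relabel e f ∘ₗ D.app h)) (M + 1)
      (fun x hx => ?_) (fun N x => ?_)
    · exact sub_eq_zero.1 (LinearMap.congr_fun this x)
    · have e₁ := hD h (M + 1) (W.completion.relabel e f x)
        (fun N hN => (congrArg (W.relabel e f) (hx N hN)).trans (map_zero _)) M (Nat.lt_succ_self M)
      have e₂ : W.completion.relabel e f (D.app h x) M = 0 :=
        (congrArg (W.relabel e f) (hD h (M + 1) x hx M (Nat.lt_succ_self M))).trans (map_zero _)
      exact (congrArg₂ (· - ·) e₁ e₂).trans (sub_zero _)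
    · have := h₁ (i := (i, N)) h e f x
      rw [homog_relabel] at this
      exact congrFun (sub_eq_zero.2 this) M
  · intro A B C X E _ _ _ _ _ _ i j k i' j' k' h hi hj hk x y
    funext M
    -- `F` and `G` are the defect of the Leibniz rule, as a linear map of the upper and of the lower
    -- operation respectively.
    let F : W.completion.obj (E ⊕ C) X j → W.completion.obj A (B ⊕ E) i →ₗ[K]
        W.completion.obj (A ⊕ C) (B ⊕ X) k' := fun y =>
      D.app hk ∘ₗ (W.completion.comp h).flip y - ((W.completion.comp (by omega)).flip y ∘ₗ D.app hi
        + ksign K (r * i) • (W.completion.comp (by omega)).flip (D.app hj y))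
    let G : W.completion.obj A (B ⊕ E) i → W.completion.obj (E ⊕ C) X j →ₗ[K]
        W.completion.obj (A ⊕ C) (B ⊕ X) k' := fun x =>
      D.app hk ∘ₗ W.completion.comp h x - (W.completion.comp (by omega) (D.app hi x)
        + ksign K (r * i) • (W.completion.comp (by omega) x) ∘ₗ D.app hj)
    have key : ∀ x y, F y x M = 0 := by
      intro x y
      have := eq_zero_of_homog (weightPart M ∘ₗ
        F y) (M + 1) (fun x hx => ?_) (fun p x => ?_)
      · exact LinearMap.congr_fun this x
      · have e₁ := hD hk (M + 1) (W.completion.comp h x y) (fun N hN =>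
          completion_comp_eq_zero h x y (M + 1) 0 hx (fun _ h => absurd h (Nat.not_lt_zero _)) hN)
          M (Nat.lt_succ_self M)
        have e₂ := completion_comp_eq_zero (W := W) (show i' + j = k' by omega) (D.app hi x) y
          (M + 1) 0 (hD hi (M + 1) x hx) (fun _ h => absurd h (Nat.not_lt_zero _))
          (Nat.lt_succ_self M)
        have e₃ := completion_comp_eq_zero (W := W) (show i + j' = k' by omega) x (D.app hj y)
          (M + 1) 0 hx (fun _ h => absurd h (Nat.not_lt_zero _)) (Nat.lt_succ_self M)
        refine (congrArg₂ (· - ·) e₁ (congrArg₂ (fun a b => a + ksign K (r * i) • b) e₂ e₃)).trans ?_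
        rw [smul_zero, add_zero, sub_zero]
      · have := eq_zero_of_homog (weightPart M ∘ₗ
          G (homog W (i, p) x)) (M + 1) (fun y hy => ?_) (fun q y => ?_)
        · exact LinearMap.congr_fun this y
        · have e₁ := hD hk (M + 1) (W.completion.comp h (homog W (i, p) x) y) (fun N hN =>
            completion_comp_eq_zero h _ y 0 (M + 1) (fun _ h => absurd h (Nat.not_lt_zero _)) hy
              (by omega)) M (Nat.lt_succ_self M)
          have e₂ := completion_comp_eq_zero (W := W) (show i' + j = k' by omega)
            (D.app hi (homog W (i, p) x)) y
            0 (M + 1) (fun _ h => absurd h (Nat.not_lt_zero _)) hy (N := M) (by omega)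
          have e₃ := completion_comp_eq_zero (W := W) (show i + j' = k' by omega)
            (homog W (i, p) x) (D.app hj y)
            0 (M + 1) (fun _ h => absurd h (Nat.not_lt_zero _)) (hD hj (M + 1) y hy) (N := M)
            (by omega)
          refine (congrArg₂ (· - ·) e₁
            (congrArg₂ (fun a b => a + ksign K (r * i) • b) e₂ e₃)).trans ?_
          rw [smul_zero, add_zero, sub_zero]
        · have := h₂ (i := (i, p)) (j := (j, q)) (k := (k, p + q)) (Prod.ext h rfl) hi hj hk x y
          rw [homog_comp] at this
          exact congrFun (sub_eq_zero.2 this) M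
    exact sub_eq_zero.1 (key x y)

/-- The elements without terms of weight less than `p`. -/
def weightGE (W : ProperadData.{u} K (ℤ × ℕ)) (A B : Type) [Finite A] [Finite B] (i : ℤ) (p : ℕ) :
    Submodule K (W.completion.obj A B i) where
  carrier := { x | ∀ N < p, x N = 0 }
  zero_mem' _ _ := rfl
  add_mem' hx hy N hN := (congrArg₂ (· + ·) (hx N hN) (hy N hN)).trans (add_zero _)
  smul_mem' a _ hx N hN := (congrArg (a • ·) (hx N hN)).trans (smul_zero _)

theorem weightGE_relabel {A A' B B' : Type} [Finite A] [Finite A'] [Finite B] [Finite B'] {i : ℤ}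
    {p : ℕ} (e : A ≃ A') (f : B ≃ B') {x : W.completion.obj A B i} (hx : x ∈ weightGE W A B i p) :
    W.completion.relabel e f x ∈ weightGE W A' B' i p :=
  fun N hN => (congrArg (W.relabel e f) (hx N hN)).trans (map_zero _)

/-- Weights add and the weight of every term of `h` is nonnegative, so an insertion of `h` cannot
lower the weight. -/
theorem innerDer_filtered (h : W.completion.obj (Fin 1) (Fin 1) r) :
    (innerDer h).Filtered := by
  intro A B _ _ i j hj p x hx
  let := Fintype.ofFinite A
  let := Fintype.ofFinite B
  have e : (innerDer h).app hj x =
      ∑ o : A, outIns h hj o x - ksign K (r * i) • ∑ b : B, inIns h hj b x := by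
    simp [innerDer, Endo.app]
  rw [e]
  change _ ∈ weightGE W A B j p
  change x ∈ weightGE W A B i p at hx
  refine Submodule.sub_mem _ (Submodule.sum_mem _ fun o _ => ?_)
    (Submodule.smul_mem _ _ (Submodule.sum_mem _ fun o _ => ?_))
  · refine weightGE_relabel (splitFront o).symm (Equiv.refl _)
      (weightGE_relabel (Equiv.refl _) (Equiv.emptySum Empty B) fun N hN => ?_)
    exact completion_comp_eq_zero (W := W) _ _ _ 0 p (fun _ h => absurd h (Nat.not_lt_zero _))
      (weightGE_relabel (splitFront o) (Equiv.refl _) hx) (by omega)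
  · refine weightGE_relabel (Equiv.refl _) ((splitFront o).trans (Equiv.sumComm _ _)).symm
      (weightGE_relabel (Equiv.sumEmpty A Empty) (Equiv.refl _) fun N hN => ?_)
    exact completion_comp_eq_zero (W := W) hj
      (W.completion.relabel (Equiv.refl _) ((splitFront o).trans (Equiv.sumComm _ _)) x)
      (W.completion.relabel (Equiv.sumEmpty (Fin 1) Empty).symm (Equiv.refl (Fin 1)) h) p 0
      (weightGE_relabel (Equiv.refl _) ((splitFront o).trans (Equiv.sumComm _ _)) hx)
      (fun _ h => absurd h (Nat.not_lt_zero _)) (by omega)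

theorem innerDer_mem_contDer (hW : W.completion.IsProperad (AddMonoidHom.id ℤ))
    (h : W.completion.obj (Fin 1) (Fin 1) r) : innerDer h ∈ ContDer W r :=
  Endo.Filtered.mem (innerDer_filtered h) (innerDer_mem hW h)

end Filtered

/-! ### Derivations of completed presented properads: uniqueness and existence. -/

section WeightedDerivation

variable {K : Type v} [Field K] {G : (A B : Type) → ℤ × ℕ → Type w}
  {R : ∀ (A B : Type) (i : ℤ × ℕ), Term K G A B i → Term K G A B i → Prop} {r : ℤ}

/-- A continuous derivation that vanishes on the generators is zero. -/
theorem ContDer.eq_zero_of_gen {D : Endo (WeightedPresented R).completion r}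
    (hD : D ∈ ContDer (WeightedPresented R) r)
    (h0 : ∀ {A B : Type} [Finite A] [Finite B] {i : ℤ × ℕ} {j : ℤ} (h : i.1 + r = j) (g : G A B i),
      D.app h ((Term.gen g).val R) = 0) : D = 0 := by
  have law := ProperadData.completion_isProperad (Presented.isProperad (AddMonoidHom.fst ℤ ℕ) R)
  have key : ∀ {A B : Type} {i : ℤ × ℕ} (x : Term K G A B i) (_ : Finite A) (_ : Finite B) (j : ℤ)
      (h : i.1 + r = j), D.app h (x.val R) = 0 := by
    intro A B i x
    induction x with
    | @gen _ _ _ _ i g => intro _ _ j h; exact h0 h g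
    | one => intro _ _ j h; exact Der.app_one law hD.1 h
    | relabel e f x ih =>
      intro _ _ j h
      rw [Term.val_relabel, hD.1.1, ih inferInstance inferInstance, map_zero]
    | comp h x y ih ih' =>
      intro _ _ k' hk
      rw [Term.val_comp, hD.1.2 _ rfl rfl hk, ih inferInstance inferInstance,
        ih' inferInstance inferInstance, LinearMap.map_zero₂, map_zero, smul_zero, add_zero]
    | zero => intro _ _ j h; rw [Term.val_zero, map_zero]
    | add x y ih ih' =>
      intro _ _ j h
      rw [Term.val_add, map_add, ih inferInstance inferInstance, ih' inferInstance inferInstance,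
        add_zero]
    | smul a x ih =>
      intro _ _ j h
      rw [Term.val_smul, map_smul, ih inferInstance inferInstance, smul_zero]
  -- Continuity reduces the claim to homogeneous elements, and these are represented by formal
  -- expressions.
  funext S
  ext x
  refine ContDer.app_eq_zero (A := S.out) (B := S.inp) hD S.add (fun N y => ?_) x
  exact Presented.ind (p := fun y => D.app S.add (homog (WeightedPresented R) (S.src, N) y) = 0)
    (fun y => key y S.finOut S.finInp S.tgt S.add) y

variable (δ : ∀ (A B : Type) [Finite A] [Finite B] (i : ℤ × ℕ) (j : ℤ), i.1 + r = j →
    G A B i → (WeightedPresented R).completion.obj A B j)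
  (hδ : ∀ {A B : Type} {i : ℤ × ℕ} {x y : Term K G A B i}, R A B i x y →
    ∀ j (h : i.1 + r = j), x.cder δ j h = y.cder δ j h)

/-- The values on homogeneous elements of the derivation given by `δ` on the generators. -/
def Presented.cder {A B : Type} [Finite A] [Finite B] {i : ℤ × ℕ} {j : ℤ} (h : i.1 + r = j) :
    (WeightedPresented R).obj A B i →ₗ[K] (WeightedPresented R).completion.obj A B j where
  toFun := Quotient.lift (fun x : Term K G A B i => x.cder δ j h) fun _ _ e => Term.cder_rel δ hδ e _ _
  map_add' x y := by
    induction x using Presented.ind; induction y using Presented.ind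
    rfl
  map_smul' a x := by
    induction x using Presented.ind
    rfl

/-- The derivation of the completion that is given by `δ` on the generators. -/
def Presented.completionDer : Endo (WeightedPresented R).completion r := fun S =>
  -- Terms of weight above `M` are left out; for generator values that do not lower the weight they
  -- would not contribute.
  LinearMap.pi fun M => ∑ N ∈ Finset.range (M + 1),
    weightPart M ∘ₗ
      Presented.cder δ hδ (i := (S.src, N)) S.add ∘ₗ
        weightPart N

theorem Presented.completionDer_apply {A B : Type} [Finite A] [Finite B] {i j : ℤ} (h : i + r = j)
    (x : (WeightedPresented R).completion.obj A B i) (M : ℕ) :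
    (Presented.completionDer δ hδ).app h x M = ∑ N ∈ Finset.range (M + 1),
      Presented.cder δ hδ (i := (i, N)) h (x N) M := by
  refine (LinearMap.sum_apply _ _ _).trans ?_
  rfl

theorem Presented.completionDer_filtered : (Presented.completionDer δ hδ).Filtered := by
  intro A B _ _ i j h p x hx N hN
  rw [Presented.completionDer_apply]
  refine Finset.sum_eq_zero fun L hL => ?_
  rw [hx L (by have := Finset.mem_range.1 hL; omega)]
  exact congrFun (map_zero (Presented.cder δ hδ (i := (i, L)) h)) N

/-- The cut-off in the defining sum loses nothing, since by `Term.cder_eq_zero` the value on an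
element of weight `i.2` has no terms of smaller weight. -/
theorem Presented.completionDer_homog
    (hw : ∀ (A B : Type) [Finite A] [Finite B] (i : ℤ × ℕ) (j : ℤ) (h : i.1 + r = j) (g : G A B i),
      ∀ N < i.2, δ A B i j h g N = 0)
    {A B : Type} [Finite A] [Finite B] {i : ℤ × ℕ} {j : ℤ}
    (h : i.1 + r = j) (x : (WeightedPresented R).obj A B i) :
    (Presented.completionDer δ hδ).app h (homog (WeightedPresented R) i x) =
      Presented.cder δ hδ h x := by
  funext M
  rw [Presented.completionDer_apply]
  by_cases hM : i.2 < M + 1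
  · rw [Finset.sum_eq_single i.2, homog_self]
    · intro N _ hN
      rw [homog_ne i x hN]
      exact congrFun (map_zero (Presented.cder δ hδ (i := (i.1, N)) h)) M
    · intro h
      exact absurd (Finset.mem_range.2 hM) h
  · rw [Finset.sum_eq_zero]
    · symm
      induction x using Presented.ind
      exact Term.cder_eq_zero δ hw _ inferInstance inferInstance j h M (by omega)
    · intro N hN
      have := Finset.mem_range.1 hN
      rw [homog_ne i x (by omega)]
      exact congrFun (map_zero (Presented.cder δ hδ (i := (i.1, N)) h)) M

theorem Presented.completionDer_mem
    (hw : ∀ (A B : Type) [Finite A] [Finite B] (i : ℤ × ℕ) (j : ℤ) (h : i.1 + r = j) (g : G A B i),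
      ∀ N < i.2, δ A B i j h g N = 0) :
    Presented.completionDer δ hδ ∈ ContDer (WeightedPresented R) r := by
  refine Endo.Filtered.mem (Presented.completionDer_filtered δ hδ)
    (Der.of_homog (Presented.completionDer_filtered δ hδ) ?_ ?_)
  · intro A A' B B' _ _ _ _ i j h e f x
    rw [Presented.completionDer_homog δ hδ hw, Presented.completionDer_homog δ hδ hw]
    induction x using Presented.ind
    rfl
  · intro A B C D E _ _ _ _ _ _ i j k i' j' k' h hi hj hk x y
    rw [Presented.completionDer_homog δ hδ hw, Presented.completionDer_homog δ hδ hw,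
      Presented.completionDer_homog δ hδ hw]
    induction x using Presented.ind; induction y using Presented.ind
    exact Term.cder_comp δ h hi hj hk _ _

theorem Presented.completionDer_gen
    (hw : ∀ (A B : Type) [Finite A] [Finite B] (i : ℤ × ℕ) (j : ℤ) (h : i.1 + r = j) (g : G A B i),
      ∀ N < i.2, δ A B i j h g N = 0)
    {A B : Type} [Finite A] [Finite B] {i : ℤ × ℕ} {j : ℤ}
    (h : i.1 + r = j) (g : G A B i) :
    (Presented.completionDer δ hδ).app h ((Term.gen g).val R) = δ A B i j h g :=
  Presented.completionDer_homog δ hδ hw h _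

end WeightedDerivation

/-! ### Derivations of the twisted properad from values on its generators. -/

section TwistedDerivations

variable {K : Type v} [Field K] {P : DGProperad.{u} K} {c d r : ℤ}

theorem twOf_eq_val {A B : Type} [Finite A] [Finite B] {i : ℤ} (a : P.data.obj A B i) :
    (twOf P c d).app a = (Term.gen (TwGen.of a)).val (TwRel P c d) := by
  funext N
  rcases N with _ | N
  · exact (homog_self (W := twFree P c d) (i, 0) _).symm
  · exact (homog_ne (W := twFree P c d) (i, 0) _ (Nat.succ_ne_zero N)).symm

/-- The values on the generators of a derivation of the twisted properad. -/
def twGenDer (δ : Endo P.data r)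
    (β : ∀ m : ℕ, (tw P c d).obj (Fin (m + 1)) (Fin 0) (deg c d r (m + 1) 0)) (A B : Type) [Finite A]
    [Finite B] (i : ℤ × ℕ) (j : ℤ) (h : i.1 + r = j) (g : TwGen P c d A B i) :
    (tw P c d).obj A B j := by
  cases g with
  | of a => exact (twOf P c d).app (δ.app h a)
  | mc m => exact ((deg_add c d (zero_add r) (m + 1) 0).symm.trans h) ▸ β m

variable {δ : Endo P.data r} (hδ : δ ∈ Der P.data r)
  {β : ∀ m : ℕ, (tw P c d).obj (Fin (m + 1)) (Fin 0) (deg c d r (m + 1) 0)}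
  (hβ : ∀ (m : ℕ) (σ : Equiv.Perm (Fin (m + 1))),
    (tw P c d).relabel σ (Equiv.refl (Fin 0)) (β m) = psign K c σ • β m)
  (hβ₀ : ∀ m : ℕ, β m 0 = 0)

include hδ hβ in
-- The relations that come from `P` are respected because `δ` is a derivation of `P`, and the
-- symmetry of the Maurer-Cartan generators because of `hβ`.
theorem twGenDer_rel {A B : Type} {i : ℤ × ℕ} {x y : Term K (TwGen P c d) A B i}
    (h : TwRel P c d A B i x y) (j : ℤ) (hj : i.1 + r = j) :
    Term.cder (R := TwRel P c d) (twGenDer δ β) x j hj = Term.cder (twGenDer δ β) y j hj := by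
  cases h with
  | of_add a b =>
    exact (congrArg (twOf P c d).app (map_add (δ.app hj) a b)).trans (map_add (twOf P c d).app _ _)
  | of_smul t a =>
    exact (congrArg (twOf P c d).app (map_smul (δ.app hj) t a)).trans
      (map_smul (twOf P c d).app _ _)
  | of_one =>
    exact (congrArg (twOf P c d).app (Der.app_one P.law hδ hj)).trans (map_zero (twOf P c d).app)
  | of_relabel e f a =>
    exact (congrArg (twOf P c d).app (hδ.1 hj e f a)).trans ((twOf P c d).map_relabel e f _)
  | of_comp h a b =>
    have e := Term.cder_comp (R := TwRel P c d) (twGenDer δ β)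
      (Prod.ext h rfl : ((_, 0) : ℤ × ℕ) + (_, 0) = (_, 0)) rfl rfl hj
      (Term.gen (TwGen.of a)) (Term.gen (TwGen.of b))
    rw [← twOf_eq_val, ← twOf_eq_val] at e
    refine Eq.trans ?_ e.symm
    refine (congrArg (twOf P c d).app (hδ.2 h rfl rfl hj a b)).trans ?_
    refine (map_add (twOf P c d).app _ _).trans ?_
    refine congrArg₂ (· + ·) ((twOf P c d).map_comp _ _ _)
      ((map_smul (twOf P c d).app _ _).trans (congrArg (_ • ·) ((twOf P c d).map_comp _ _ _)))
  | mc_symm m σ =>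
    obtain rfl : deg c d r (m + 1) 0 = j := (deg_add c d (zero_add r) (m + 1) 0).symm.trans hj
    exact hβ m σ

include hδ hβ hβ₀ in
/-- The existence of the derivation of the twisted properad with given values on the generators. -/
theorem tw_exists_der : ∃ D ∈ ContDer (twFree P c d) r,
    (∀ {A B : Type} [Finite A] [Finite B] {i j : ℤ} (h : i + r = j) (a : P.data.obj A B i),
      D.app h ((twOf P c d).app a) = (twOf P c d).app (δ.app h a)) ∧
    ∀ m : ℕ, D.app (deg_add c d (zero_add r) (m + 1) 0) (mcFam P c d (m + 1, 0)) = β m := by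
  have hw : ∀ (A B : Type) [Finite A] [Finite B] (i : ℤ × ℕ) (j : ℤ) (h : i.1 + r = j)
      (g : TwGen P c d A B i), ∀ N < i.2, twGenDer δ β A B i j h g N = 0 := by
    intro A B _ _ i j h g N hN
    cases g with
    | of a => exact absurd hN (Nat.not_lt_zero _)
    | mc m =>
      obtain rfl : deg c d r (m + 1) 0 = j := (deg_add c d (zero_add r) (m + 1) 0).symm.trans h
      -- A Maurer-Cartan generator has weight one, so the only condition is that its value has no
      -- term of weight zero.
      obtain rfl : N = 0 := Nat.lt_one_iff.1 hN
      exact hβ₀ m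
  refine ⟨Presented.completionDer (R := TwRel P c d) (twGenDer δ β) (twGenDer_rel hδ hβ),
    Presented.completionDer_mem _ _ hw, ?_, ?_⟩
  · intro A B _ _ i j h a
    rw [twOf_eq_val]
    exact Presented.completionDer_gen _ _ hw (i := (i, 0)) h _
  · intro m
    exact Presented.completionDer_gen (R := TwRel P c d) (twGenDer δ β) (twGenDer_rel hδ hβ) hw
      (deg_add c d (zero_add r) (m + 1) 0) (TwGen.mc m)

/-- A continuous derivation of the twisted properad is determined by its values on the generators. -/
theorem tw_der_ext {D E : Endo (tw P c d) r} (hD : D ∈ ContDer (twFree P c d) r)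
    (hE : E ∈ ContDer (twFree P c d) r)
    (h₁ : ∀ {A B : Type} [Finite A] [Finite B] {i j : ℤ} (h : i + r = j) (a : P.data.obj A B i),
      D.app h ((twOf P c d).app a) = E.app h ((twOf P c d).app a))
    (h₂ : ∀ m : ℕ, D.app (deg_add c d (zero_add r) (m + 1) 0) (mcFam P c d (m + 1, 0)) =
      E.app (deg_add c d (zero_add r) (m + 1) 0) (mcFam P c d (m + 1, 0))) : D = E := by
  refine sub_eq_zero.1 (ContDer.eq_zero_of_gen (R := TwRel P c d)
    (Submodule.sub_mem (ContDer (twFree P c d) r) hD hE) ?_)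
  intro A B _ _ i j h g
  cases g with
  | of a => 
    rw [← twOf_eq_val]
    exact sub_eq_zero.2 (h₁ h a)
  | mc m =>
    obtain rfl : deg c d r (m + 1) 0 = j := (deg_add c d (zero_add r) (m + 1) 0).symm.trans h
    exact sub_eq_zero.2 (h₂ m)

end TwistedDerivations

/-! ### Transport along equalities of degrees. -/

section CastDeg

variable {K : Type v} [Field K] {Q : ProperadData.{u} K ℤ} {A B : Type} [Finite A] [Finite B]
  {i j r s : ℤ}

/-- The identification of components of equal degree. -/
def castDeg (h : i = j) : Q.obj A B i →ₗ[K] Q.obj A B j := h ▸ LinearMap.id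

/-- Needed because `deg c d k 1 1` equals `k` without being definitionally equal to it. -/
theorem innerMap_castDeg (e : r = s) (h : Q.obj (Fin 1) (Fin 1) r) (hj : i + s = j)
    (hj' : i + r = j) (x : Q.obj A B i) : innerMap (castDeg e h) hj x = innerMap h hj' x := by
  subst e
  rfl

theorem Endo.app_castDeg (D : Endo Q r) {i' j' : ℤ} (e : i = i') (e' : j = j') (h : i + r = j)
    (h' : i' + r = j') (x : Q.obj A B i) :
    D.app h' (castDeg e x) = castDeg e' (D.app h x) := by
  subst e e'
  rfl

end CastDeg

/-! ### The Euler derivation of a completion. -/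

section Euler

variable {K : Type v} [Field K] (W : ProperadData.{u} K (ℤ × ℕ)) {A B : Type} [Finite A] [Finite B]
  {i : ℤ} {c d k l t : ℤ}

/-- The derivation that multiplies the elements of weight `N` by `N`. -/
def euler : Endo W.completion 0 := fun S =>
  castDeg ((add_zero _).symm.trans S.add) ∘ₗ
    (LinearMap.pi fun N => (N : K) • weightPart N :
      W.completion.obj S.out S.inp S.src →ₗ[K] W.completion.obj S.out S.inp S.src)

theorem euler_app (h : i + 0 = i) (x : W.completion.obj A B i) (N : ℕ) :
    (euler W).app h x N = (N : K) • x N := rfl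

/-- The weights of the two factors of each term of a composite add up to the weight of that term. -/
theorem euler_mem : euler W ∈ Der W.completion 0 := by
  refine ⟨?_, ?_⟩
  · intro A A' B B' _ _ _ _ i j h e f x
    obtain rfl : i = j := (add_zero i).symm.trans h
    funext N
    rw [ProperadData.completion_relabel, euler_app, euler_app, ProperadData.completion_relabel,
      map_smul]
  · intro A B C X E _ _ _ _ _ _ i j k i' j' k' h hi hj hk x y
    obtain rfl : i = i' := (add_zero i).symm.trans hi
    obtain rfl : j = j' := (add_zero j).symm.trans hj
    obtain rfl : k = k' := (add_zero k).symm.trans hk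
    rw [zero_mul, show ksign K 0 = 1 by simp [ksign], one_smul]
    funext N
    rw [euler_app]
    refine Eq.trans ?_ (Finset.sum_add_distrib (s := Finset.univ)
      (f := fun p : Split N => W.comp (split_index h p) ((euler W).app hi x p.fst) (y p.snd))
      (g := fun p : Split N => W.comp (split_index h p) (x p.fst) ((euler W).app hj y p.snd)))
    rw [ProperadData.completion_comp, Finset.smul_sum]
    refine Finset.sum_congr rfl fun p _ => ?_
    rw [euler_app, euler_app, map_smul, map_smul, LinearMap.smul_apply, ← add_smul,
      ← Nat.cast_add, p.add]

/-- The families without terms of weight less than `p`. -/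
def famGE (c d k : ℤ) (p : ℕ) : Submodule K (Fam W.completion c d k) where
  carrier := { η | ∀ s, η s ∈ weightGE W (Fin s.1) (Fin s.2) (deg c d k s.1 s.2) p }
  zero_mem' _ := Submodule.zero_mem _
  add_mem' hx hy s := Submodule.add_mem _ (hx s) (hy s)
  smul_mem' a _ hx s := Submodule.smul_mem _ a (hx s)

variable {W}

theorem famGE_zero (η : Fam W.completion c d k) : η ∈ famGE W c d k 0 :=
  fun _ _ hN => absurd hN (Nat.not_lt_zero _)

theorem star_mem_famGE {p q : ℕ} (h : k + l = t) {η : Fam W.completion c d k}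
    {ξ : Fam W.completion c d l} (hη : η ∈ famGE W c d k p) (hξ : ξ ∈ famGE W c d l q) :
    star W.completion c d h η ξ ∈ famGE W c d t (p + q) := by
  intro s
  simp only [star, LinearMap.mk₂_apply]
  refine Submodule.sum_mem _ fun m _ => Submodule.sum_mem _ fun n _ => Submodule.smul_mem _ _ ?_
  simp only [skewSym, LinearMap.sum_apply, LinearMap.smul_apply]
  refine Submodule.sum_mem _ fun σ _ => Submodule.sum_mem _ fun τ _ => Submodule.smul_mem _ _ ?_
  refine weightGE_relabel _ _ fun N hN => ?_
  exact completion_comp_eq_zero (W := W) _ _ _ p q (weightGE_relabel _ _ (hη _))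
    (weightGE_relabel _ _ (hξ _)) hN

theorem brk_mem_famGE {p q : ℕ} (h : k + l = t) {η : Fam W.completion c d k}
    {ξ : Fam W.completion c d l} (hη : η ∈ famGE W c d k p) (hξ : ξ ∈ famGE W c d l q) :
    brk W.completion c d h η ξ ∈ famGE W c d t (p + q) := by
  rw [brk_apply h (by omega)]
  refine Submodule.sub_mem _ (Submodule.smul_mem _ _ ?_) (star_mem_famGE h hη hξ)
  rw [add_comm]
  exact star_mem_famGE _ hξ hη

/-- In characteristic zero different weights are different eigenvalues, so an eigenvector of
eigenvalue `L` is concentrated in weight `L`. -/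
theorem eq_zero_of_euler [CharZero K] {η : Fam W.completion c d k} {L N : ℕ} (h : k + 0 = k)
    (hη : (euler W).fam h η = (L : K) • η) (hN : N ≠ L) (s : ℕ × ℕ) : η s N = 0 := by
  have e : (N : K) • η s N = (L : K) • η s N := congrFun (congrFun hη s) N
  rw [← sub_eq_zero, ← sub_smul, smul_eq_zero, sub_eq_zero, Nat.cast_inj] at e
  exact e.resolve_left hN

end Euler

/-! ### Images of families under morphisms of properads. -/

section MapFam

variable {K : Type v} [Field K] {Q : ProperadData.{u} K ℤ} {Q' : ProperadData.{w} K ℤ}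
  (f : Q.Hom Q') {c d k l t : ℤ}

theorem hom_skewSym {A B : Type} [Finite A] [Finite B] {m n : ℕ} {i : ℤ} (e : A ≃ Fin m)
    (e' : B ≃ Fin n) (x : Q.obj A B i) :
    f.app (skewSym Q c d e e' x) = skewSym Q' c d e e' (f.app x) := by
  simp only [skewSym, LinearMap.sum_apply, LinearMap.smul_apply, map_sum, map_smul, f.map_relabel]

theorem Fam.map_star (h : k + l = t) (η : Fam Q c d k) (ξ : Fam Q c d l) :
    Fam.map f (star Q c d h η ξ) = star Q' c d h (Fam.map f η) (Fam.map f ξ) := by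
  funext s
  simp only [Fam.map, star, LinearMap.mk₂_apply, map_sum, map_smul, hom_skewSym, f.map_comp,
    f.map_relabel]

theorem Fam.map_brk (h : k + l = t) (η : Fam Q c d k) (ξ : Fam Q c d l) :
    Fam.map f (brk Q c d h η ξ) = brk Q' c d h (Fam.map f η) (Fam.map f ξ) := by
  rw [brk_apply h (by omega), brk_apply h (by omega), ← Fam.map_star, ← Fam.map_star]
  funext s
  simp only [Fam.map, Pi.sub_apply, Pi.smul_apply, map_sub, map_smul]

theorem Fam.map_mem {η : Fam Q c d k} (hη : η ∈ symFam Q c d k) :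
    Fam.map f η ∈ symFam Q' c d k := by
  intro s σ τ
  simp only [Fam.map, ← f.map_relabel, hη s σ τ, map_smul]

end MapFam

/-! ### Weights in the twisted properad. -/

section TwistedWeights

variable {K : Type v} [Field K] (P : DGProperad.{u} K) (c d : ℤ) {k l t : ℤ}

/-- The derivation of the twisted properad that multiplies the elements of weight `N` by `N`. -/
def twEuler : Endo (tw P c d) 0 := euler (twFree P c d)

/-- The families in the twisted properad without terms of weight less than `p`. -/
def twGE (k : ℤ) (p : ℕ) : Submodule K (Fam (tw P c d) c d k) := famGE (twFree P c d) c d k p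

variable {P c d}

theorem twEuler_mem : twEuler P c d ∈ Der (tw P c d) 0 := euler_mem _

theorem twEuler_fam (h : k + 0 = k) (η : Fam (tw P c d) c d k) (s : ℕ × ℕ) (N : ℕ) :
    (twEuler P c d).fam h η s N = (N : K) • (η s N : (twFree P c d).obj _ _ _) := rfl

theorem twGE_zero (η : Fam (tw P c d) c d k) : η ∈ twGE P c d k 0 := famGE_zero η

theorem star_mem_twGE {p q : ℕ} (h : k + l = t) {η : Fam (tw P c d) c d k}
    {ξ : Fam (tw P c d) c d l} (hη : η ∈ twGE P c d k p) (hξ : ξ ∈ twGE P c d l q) :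
    star (tw P c d) c d h η ξ ∈ twGE P c d t (p + q) := star_mem_famGE h hη hξ

theorem brk_mem_twGE {p q : ℕ} (h : k + l = t) {η : Fam (tw P c d) c d k}
    {ξ : Fam (tw P c d) c d l} (hη : η ∈ twGE P c d k p) (hξ : ξ ∈ twGE P c d l q) :
    brk (tw P c d) c d h η ξ ∈ twGE P c d t (p + q) := brk_mem_famGE h hη hξ

theorem eq_zero_of_twEuler [CharZero K] {η : Fam (tw P c d) c d k} {L N : ℕ} (h : k + 0 = k)
    (hη : (twEuler P c d).fam h η = (L : K) • η) (hN : N ≠ L) (s : ℕ × ℕ) : η s N = 0 :=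
  eq_zero_of_euler h hη hN s

end TwistedWeights

/-! ### Attaching Maurer-Cartan generators, and its exponential. -/

section Exponential

variable {K : Type v} [Field K] {P : DGProperad.{u} K} {c d k l t : ℤ}

theorem mcFam_inp (m n : ℕ) : mcFam P c d (m, n + 1) = 0 := by
  rcases m with _ | m <;> rfl

theorem mcFam_zero (n : ℕ) : mcFam P c d (0, n) = 0 := by
  rcases n with _ | n <;> rfl

theorem mcFam_mem : mcFam P c d ∈ symFam (tw P c d) c d 0 := by
  rintro ⟨m, n⟩ σ τ
  rcases m with _ | m
  · rw [mcFam_zero, map_zero, smul_zero]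
  rcases n with _ | n
  · obtain rfl : τ = Equiv.refl (Fin 0) := Subsingleton.elim _ _
    have e : (Term.relabel σ (Equiv.refl (Fin 0)) (Term.gen (TwGen.mc m))).val (TwRel P c d) =
        (Term.smul (psign K c σ) (Term.gen (TwGen.mc m))).val (TwRel P c d) :=
      congrArg (homog (A := Fin (m + 1)) (B := Fin 0) (twFree P c d) (deg c d 0 (m + 1) 0, 1))
        (Presented.sound (Rel.of (TwRel.mc_symm m σ)))
    rw [Term.val_relabel, Term.val_smul] at e
    rw [show psign K d (Equiv.refl (Fin 0)) = 1 by simp [psign], mul_one]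
    exact e
  · rw [mcFam_inp, map_zero, smul_zero]

theorem mcFam_mem_twGE : mcFam P c d ∈ twGE P c d 0 1 := by
  rintro ⟨m, n⟩ N hN
  rcases m with _ | m
  · rw [mcFam_zero]
    rfl
  rcases n with _ | n
  · exact homog_ne (W := twFree P c d) (deg c d 0 (m + 1) 0, 1) _ hN.ne
  · rw [mcFam_inp]
    rfl

theorem euler_mcFam (h : (0 : ℤ) + 0 = 0) :
    (twEuler P c d).fam h (mcFam P c d) = mcFam P c d := by
  funext ⟨m, n⟩ N
  refine (twEuler_fam h (mcFam P c d) (m, n) N).trans ?_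
  by_cases hN : N = 1
  · rw [hN, Nat.cast_one, one_smul]
  · have : mcFam P c d (m, n) N = 0 := by
      rcases m with _ | m
      · rw [mcFam_zero]
        rfl
      rcases n with _ | n
      · exact homog_ne (W := twFree P c d) (deg c d 0 (m + 1) 0, 1) _ hN
      · rw [mcFam_inp]
        rfl
    rw [this, smul_zero]

/-- Nothing can be attached to operations without inputs. -/
theorem star_eq_zero_of_inp {Q : ProperadData.{w} K ℤ} (h : k + l = t) {η : Fam Q c d k}
    (hη : ∀ m n, η (m, n + 1) = 0) (ξ : Fam Q c d l) : star Q c d h η ξ = 0 := by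
  funext s
  simp only [star, LinearMap.mk₂_apply, hη, map_zero, LinearMap.zero_apply, smul_zero,
    Finset.sum_const_zero, Pi.zero_apply]

/-- The Maurer-Cartan generators have no inputs, so one of the two terms of the bracket vanishes.
Attaching a generator is thus an adjoint action, to which the Jacobi identity applies. -/
theorem attachMC_eq_brk (η : Fam (tw P c d) c d k) :
    attachMC η = brk (tw P c d) c d (zero_add k) (mcFam P c d) η := by
  rw [brk_apply (zero_add k) (add_zero k), star_eq_zero_of_inp _ mcFam_inp, zero_mul, sub_zero,
    show ksign K 0 = 1 by simp [ksign], one_smul]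
  rfl

theorem attachMC_apply (η : Fam (tw P c d) c d k) :
    attachMC η = star (tw P c d) c d (add_zero k) η (mcFam P c d) := rfl

theorem attachMC_mem (η : Fam (tw P c d) c d k) : attachMC η ∈ symFam (tw P c d) c d k := by
  rw [attachMC_apply]
  exact star_symm (tw_law P c d) _ _ _

theorem attachMC_iterate_mem {η : Fam (tw P c d) c d k} (hη : η ∈ symFam (tw P c d) c d k) (N : ℕ) :
    attachMC^[N] η ∈ symFam (tw P c d) c d k := by
  rcases N with _ | N
  · exact hη
  · rw [Function.iterate_succ_apply']
    exact attachMC_mem _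

theorem attachMC_mem_twGE {p : ℕ} {η : Fam (tw P c d) c d k}
    (hη : η ∈ twGE P c d k p) :
    attachMC η ∈ twGE P c d k (p + 1) := by
  rw [attachMC_apply]
  exact star_mem_twGE _ hη mcFam_mem_twGE

/-- This is the Jacobi identity with the family of Maurer-Cartan generators; that family has degree
zero, so no sign appears. -/
theorem attachMC_brk [CharZero K] (h : k + l = t) {η : Fam (tw P c d) c d k} {ξ : Fam (tw P c d) c d l}
    (hη : η ∈ symFam (tw P c d) c d k) (hξ : ξ ∈ symFam (tw P c d) c d l) :
    attachMC (brk (tw P c d) c d h η ξ) =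
      brk (tw P c d) c d h (attachMC η) ξ + brk (tw P c d) c d h η (attachMC ξ) := by
  rw [attachMC_eq_brk, attachMC_eq_brk, attachMC_eq_brk,
    brk_jacobi (tw_law P c d) h (zero_add t) (zero_add k) h (zero_add l) h mcFam_mem hη hξ,
    zero_mul, show ksign K 0 = 1 by simp [ksign], one_smul]

/-- The commutator of a derivation with the operator that attaches a Maurer-Cartan generator. -/
theorem der_attachMC {D : Endo (tw P c d) l} (hD : D ∈ Der (tw P c d) l) (h : k + l = t)
    (h' : l + k = t) (η : Fam (tw P c d) c d k) :
    D.fam h (attachMC η) = attachMC (D.fam h η) +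
      brk (tw P c d) c d h' (D.fam (zero_add l) (mcFam P c d)) η := by
  rw [attachMC_eq_brk, attachMC_eq_brk,
    der_brk hD (zero_add k) (zero_add l) h h h' (zero_add t), mul_zero,
    show ksign K 0 = 1 by simp [ksign], one_smul, add_comm]

/-- The Maurer-Cartan generators have Euler eigenvalue one, so each attachment raises the eigenvalue
by one. -/
theorem euler_attachMC_iterate (h : k + 0 = k) (η : Fam P.data c d k) (N : ℕ) :
    (twEuler P c d).fam h (attachMC^[N] (Fam.map (twOf P c d) η)) =
      (N : K) • attachMC^[N] (Fam.map (twOf P c d) η) := by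
  induction N with
  | zero =>
    rw [Nat.cast_zero, zero_smul]
    funext s N
    refine (twEuler_fam h _ s N).trans ?_
    rcases N with _ | N
    · rw [Nat.cast_zero, zero_smul]
      rfl
    · exact smul_zero ((N + 1 : ℕ) : K)
  | succ N ih =>
    rw [Function.iterate_succ_apply']
    refine (der_attachMC twEuler_mem h (zero_add k) _).trans ?_
    rw [ih, map_smul, euler_mcFam, ← attachMC_eq_brk]
    push_cast
    rw [add_smul, one_smul]

/-- The partial sums of `expMC`. -/
def expSum (M : ℕ) (η : Fam P.data c d k) : Fam (tw P c d) c d k :=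
  ∑ N ∈ Finset.range M, ((N ! : ℕ) : K)⁻¹ • attachMC^[N] (Fam.map (twOf P c d) η)

variable [CharZero K]

theorem attachMC_iterate_ne {L N : ℕ} (hN : N ≠ L) (η : Fam P.data c d k) (s : ℕ × ℕ) :
    attachMC^[L] (Fam.map (twOf P c d) η) s N = 0 :=
  eq_zero_of_twEuler (add_zero k) (euler_attachMC_iterate (add_zero k) η L) hN s

theorem expSum_apply {M N : ℕ} (h : N < M) (η : Fam P.data c d k) (s : ℕ × ℕ) :
    expSum M η s N = expMC η s N := by
  have e : expSum M η s N = ∑ L ∈ Finset.range M,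
      ((L ! : ℕ) : K)⁻¹ • attachMC^[L] (Fam.map (twOf P c d) η) s N := by
    rw [expSum, Finset.sum_apply]
    exact Finset.sum_apply N _ _
  rw [e, Finset.sum_eq_single N]
  · rfl
  · intro L _ hL
    rw [attachMC_iterate_ne (Ne.symm hL), smul_zero]
  · intro h'
    exact absurd (Finset.mem_range.2 h) h'

theorem expMC_sub_expSum (M : ℕ) (η : Fam P.data c d k) :
    expMC η - expSum M η ∈ twGE P c d k M :=
  fun s _ hN => sub_eq_zero.2 (expSum_apply hN η s).symm

omit [CharZero K] in
theorem expMC_mem {η : Fam P.data c d k} (hη : η ∈ symFam P.data c d k) :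
    expMC η ∈ symFam (tw P c d) c d k := by
  intro s σ τ
  funext N
  have := congrFun (attachMC_iterate_mem (Fam.map_mem (twOf P c d) hη) N s σ τ) N
  refine (map_smul ((twFree P c d).relabel σ τ) ((N ! : ℕ) : K)⁻¹ _).trans
    ((congrArg (((N ! : ℕ) : K)⁻¹ • ·) this).trans ?_)
  exact smul_comm ((N ! : ℕ) : K)⁻¹ (psign K c σ * psign K d τ)
    (attachMC^[N] (Fam.map (twOf P c d) η) s N : (twFree P c d).obj _ _ _)

/-- The differential equation of the exponential: in weight N + 1 it says that (N+1)/(N+1)! = 1/N!.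
-/
theorem euler_expMC (h : k + 0 = k) (η : Fam P.data c d k) :
    (twEuler P c d).fam h (expMC η) = attachMC (expMC η) := by
  funext s N
  refine (twEuler_fam h _ s N).trans ?_
  rcases N with _ | N
  · rw [Nat.cast_zero, zero_smul]
    exact (attachMC_mem_twGE (twGE_zero (expMC η)) s 0 Nat.zero_lt_one).symm
  · have e₁ := attachMC_mem_twGE (expMC_sub_expSum (N + 1) η) s (N + 1) (Nat.lt_succ_self _)
    rw [map_sub] at e₁
    have e₂ : attachMC (expMC η) s (N + 1) = attachMC (expSum (N + 1) η) s (N + 1) :=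
      sub_eq_zero.1 e₁
    rw [e₂]
    have e₃ : attachMC (expSum (N + 1) η) = ∑ L ∈ Finset.range (N + 1),
        ((L ! : ℕ) : K)⁻¹ • attachMC^[L + 1] (Fam.map (twOf P c d) η) := by
      simp only [expSum, map_sum, map_smul, Function.iterate_succ_apply']
    have e₄ : attachMC (expSum (N + 1) η) s (N + 1) = ∑ L ∈ Finset.range (N + 1),
        ((L ! : ℕ) : K)⁻¹ • attachMC^[L + 1] (Fam.map (twOf P c d) η) s (N + 1) := by
      rw [e₃, Finset.sum_apply]
      exact Finset.sum_apply (N + 1) _ _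
    rw [e₄, Finset.sum_eq_single N]
    · change ((N + 1 : ℕ) : K) • ((((N + 1)! : ℕ) : K)⁻¹ • _) = _
      rw [smul_smul]
      congr 1
      have h1 : ((N ! : ℕ) : K) ≠ 0 := Nat.cast_ne_zero.2 (Nat.factorial_ne_zero N)
      have h2 : ((N + 1 : ℕ) : K) ≠ 0 := Nat.cast_ne_zero.2 (Nat.succ_ne_zero N)
      rw [Nat.factorial_succ, Nat.cast_mul]
      field_simp
    · intro L _ hL
      rw [attachMC_iterate_ne (by omega), smul_zero]
    · intro h'
      exact absurd (Finset.mem_range.2 (Nat.lt_succ_self N)) h'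

/-- Uniqueness for the differential equation. Attaching raises the weight, so a solution that
vanishes below weight p + 1 ≥ 1 also vanishes in weight p + 1, where the Euler derivation acts by a
nonzero scalar. -/
theorem eq_zero_of_euler_eq_attachMC {η : Fam (tw P c d) c d k} (h : k + 0 = k)
    (he : (twEuler P c d).fam h η = attachMC η) (h0 : η ∈ twGE P c d k 1) :
    η = 0 := by
  have key : ∀ p : ℕ, η ∈ twGE P c d k (p + 1) := by
    intro p
    induction p with
    | zero => exact h0
    | succ p ih =>
      intro s N hN
      have e₁ := attachMC_mem_twGE ih s N hN
      rw [← he] at e₁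
      rcases N with _ | N
      · exact h0 s 0 Nat.zero_lt_one
      · rw [twEuler_fam] at e₁
        exact (smul_eq_zero.1 e₁).resolve_left (Nat.cast_ne_zero.2 (Nat.succ_ne_zero N))
  funext s n
  exact key n s n (Nat.lt_succ_self n)

/-- `expMC` is compatible with the brackets. -/
theorem expMC_brk (h : k + l = t) {η : Fam P.data c d k} {ξ : Fam P.data c d l}
    (hη : η ∈ symFam P.data c d k) (hξ : ξ ∈ symFam P.data c d l) :
    expMC (brk P.data c d h η ξ) = brk (tw P c d) c d h (expMC η) (expMC ξ) := by
  -- Both sides solve the differential equation, as the Euler derivation and `attachMC` are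
  -- derivations of the bracket; both start with the bracket in `P` in weight zero.
  refine sub_eq_zero.1 (eq_zero_of_euler_eq_attachMC (add_zero t) ?_ ?_)
  · rw [map_sub, map_sub, euler_expMC, attachMC_brk h (expMC_mem hη) (expMC_mem hξ)]
    congr 1
    refine (der_brk twEuler_mem h (add_zero k) (add_zero l)
      (add_zero t) h h _ _).trans ?_
    rw [zero_mul, show ksign K 0 = 1 by simp [ksign], one_smul, euler_expMC, euler_expMC]
  · have hs : ∀ {k : ℤ} (η : Fam P.data c d k),
        expMC η - Fam.map (twOf P c d) η ∈ twGE P c d k 1 := by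
      intro k η
      have e : expSum 1 η = Fam.map (twOf P c d) η := by
        simp [expSum]
      rw [← e]
      exact expMC_sub_expSum 1 η
    have e₁ := hs (brk P.data c d h η ξ)
    have e₂ := brk_mem_twGE h (hs η) (twGE_zero (Fam.map (twOf P c d) ξ))
    have e₃ := brk_mem_twGE h (twGE_zero (expMC η)) (hs ξ)
    rw [Fam.map_brk] at e₁
    have := Submodule.sub_mem _ e₁ (Submodule.add_mem _ e₂ e₃)
    rw [LinearMap.map_sub₂, map_sub] at this
    convert this using 1
    abel

/-- The value of a continuous derivation on `expMC η` is determined by its values on the partial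
sums. -/
theorem fam_expMC_eq {D : Endo (tw P c d) l} (hD : D ∈ ContDer (twFree P c d) l) (h : k + l = t)
    (η : Fam P.data c d k) {Y : Fam (tw P c d) c d t}
    (hY : ∀ M : ℕ, D.fam h (expSum (M + 1) η) - Y ∈ twGE P c d t M) :
    D.fam h (expMC η) = Y := by
  funext s N
  -- By continuity the part of weight `N` of the value ignores terms of weight at least `q`, so a
  -- partial sum beyond both `q` and `N` suffices.
  obtain ⟨q, hq⟩ := hD.2 (Fin s.1) (Fin s.2) _ _ (deg_add c d h s.1 s.2) (N + 1)
  have e₁ : D.fam h (expMC η - expSum (max q (N + 1) + 1) η) s N = 0 :=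
    hq ((expMC η - expSum (max q (N + 1) + 1) η) s) (fun L hL => expMC_sub_expSum (max q (N + 1) + 1) η s L (by omega)) N (Nat.lt_succ_self N)
  have e₂ := hY (max q (N + 1)) s N (by omega)
  rw [map_sub] at e₁
  exact (sub_eq_zero.1 e₁).trans (sub_eq_zero.1 e₂)

end Exponential

/-! ### Components of brackets without inputs and with one input and one output. -/

section OneOne

variable {K : Type v} [Field K] {Q : ProperadData.{u} K ℤ} {c d k l t : ℤ} {i j r : ℤ}

/-- The composition of operations with one output and one input. -/
def oneComp (h : r + i = j) (g : Q.obj (Fin 1) (Fin 1) r) (x : Q.obj (Fin 1) (Fin 1) i) :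
    Q.obj (Fin 1) (Fin 1) j :=
  Q.relabel (Equiv.sumEmpty (Fin 1) Empty) (Equiv.emptySum Empty (Fin 1)) (Q.comp h
    (Q.relabel (Equiv.refl (Fin 1)) (Equiv.emptySum Empty (Fin 1)).symm g)
    (Q.relabel (Equiv.sumEmpty (Fin 1) Empty).symm (Equiv.refl (Fin 1)) x))

/-- The part of a family that consists of the operations without inputs. -/
def Fam.zeroInp (η : Fam Q c d k) : Fam Q c d k
  | (m, 0) => η (m, 0)
  | (_, _ + 1) => 0

/-- The inputs of the lower vertex are inputs of the whole graph. -/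
theorem star_zeroInp (h : k + l = t) (η : Fam Q c d k) (ξ : Fam Q c d l) (m : ℕ) :
    star Q c d h η ξ (m, 0) = star Q c d h η ξ.zeroInp (m, 0) := by
  simp only [star, LinearMap.mk₂_apply]
  refine Finset.sum_congr rfl fun p _ => Finset.sum_congr rfl fun q _ => ?_
  obtain ⟨a, b, hab⟩ := q
  obtain rfl : b = 0 := by
    have : a + b = 0 := hab
    omega
  rfl

theorem Fam.zeroInp_inp (η : Fam Q c d k) (m n : ℕ) : η.zeroInp (m, n + 1) = 0 := rfl

theorem Fam.zeroInp_mem {η : Fam Q c d k} (hη : η ∈ symFam Q c d k) : η.zeroInp ∈ symFam Q c d k := by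
  rintro ⟨m, n⟩ σ τ
  rcases n with _ | n
  · exact hη (m, 0) σ τ
  · rw [Fam.zeroInp_inp, map_zero, smul_zero]

variable (hQ : Q.IsProperad (AddMonoidHom.id ℤ))

include hQ

theorem innerMap_one_one (hj : i + r = j) (hj' : r + i = j) (g : Q.obj (Fin 1) (Fin 1) r)
    (x : Q.obj (Fin 1) (Fin 1) i) :
    innerMap g hj x = oneComp hj' g x - ksign K (r * i) • oneComp hj x g := by
  rw [innerMap_eq hQ]
  simp only [Finset.univ_unique, Finset.sum_singleton]
  congr 1
  · rw [outIns_eq hQ g hj _ (Equiv.sumEmpty (Fin 1) Empty).symm (by simp)]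
    simp only [topIns, LinearMap.comp_apply]
    rw [← hQ.relabel_trans]
    rfl
  · congr 1
    rw [inIns_eq hQ g hj _ (Equiv.emptySum Empty (Fin 1)).symm (by simp)]
    simp only [botIns, LinearMap.comp_apply, LinearMap.flip_apply]
    rw [← hQ.relabel_trans]
    rfl

/-- By the hypotheses the upper vertex needs a free output and the lower vertex a free input. A
graph with one output and one input is then a composition along its only path, and its sign in
`star` is trivial. -/
theorem star_one_one (h : k + l = t) (hj : deg c d k 1 1 + deg c d l 1 1 = deg c d t 1 1)
    {η : Fam Q c d k} {ξ : Fam Q c d l} (hη : ∀ n, η (0, n) = 0) (hξ : ∀ m, ξ (m, 0) = 0) :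
    star Q c d h η ξ (1, 1) = oneComp hj (η (1, 1)) (ξ (1, 1)) := by
  simp only [star, LinearMap.mk₂_apply]
  rw [Finset.sum_eq_single (⟨1, 0, rfl⟩ : Split 1), Finset.sum_eq_single (⟨0, 1, rfl⟩ : Split 1)]
  · have e₁ : ((1 ! * 0 ! * 0 ! * 1 ! : ℕ) : K)⁻¹ * ksign K ((deg c d k 1 (0 + 1) + k) *
        deg c d l (1 + 0) 1 + c * d * (0 : ℕ) * (0 : ℕ)) = 1 := by
      have : (deg c d k 1 (0 + 1) + k) * deg c d l (1 + 0) 1 + c * d * (0 : ℕ) * (0 : ℕ) =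
          k * l + k * l := by
        simp only [deg]
        push_cast
        ring
      rw [this, ksign_add, ksign_mul_self]
      simp
    rw [e₁, one_smul]
    simp only [skewSym, Finset.univ_unique, Finset.sum_singleton, LinearMap.smul_apply]
    have e₂ : psign K c (default : Equiv.Perm (Fin 1)) * psign K d (default : Equiv.Perm (Fin 1)) = 1 := by
      simp [psign, Subsingleton.elim (default : Equiv.Perm (Fin 1)) 1]
    rw [e₂, one_smul, oneComp]
    have e₃ := hQ.relabel_trans (Equiv.refl (Fin 1)) (Equiv.refl (Fin 1))
      (Equiv.emptySum Empty (Fin 1)).symm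
      (Equiv.sumCongr (Equiv.equivOfIsEmpty Empty (Fin 0)) (Equiv.refl (Fin 1))) (η (1, 1))
    have e₄ := hQ.relabel_trans (Equiv.sumEmpty (Fin 1) Empty).symm
      (Equiv.sumCongr (Equiv.refl (Fin 1)) (Equiv.equivOfIsEmpty Empty (Fin 0)))
      (Equiv.refl (Fin 1)) (Equiv.refl (Fin 1)) (ξ (1, 1))
    have e₅ := hQ.comp_relabel hj (Equiv.refl (Fin 1)) (Equiv.equivOfIsEmpty Empty (Fin 0))
      (Equiv.equivOfIsEmpty Empty (Fin 0)) (Equiv.refl (Fin 1)) (Equiv.refl (Fin 1))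
      (Q.relabel (Equiv.refl (Fin 1)) (Equiv.emptySum Empty (Fin 1)).symm (η (1, 1)))
      (Q.relabel (Equiv.sumEmpty (Fin 1) Empty).symm (Equiv.refl (Fin 1)) (ξ (1, 1)))
    rw [← e₃, ← e₄] at e₅
    have e₆ : Q.comp (deg_comp c d h (⟨1, 0, rfl⟩ : Split 1) (⟨0, 1, rfl⟩ : Split 1))
        (Q.relabel (Equiv.refl _) finSumFinEquiv.symm (η (1, 0 + 1)))
        (Q.relabel finSumFinEquiv.symm (Equiv.refl _) (ξ (1 + 0, 1))) =
        Q.relabel (Equiv.sumCongr (Equiv.refl (Fin 1)) (Equiv.equivOfIsEmpty Empty (Fin 0)))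
          (Equiv.sumCongr (Equiv.equivOfIsEmpty Empty (Fin 0)) (Equiv.refl (Fin 1)))
          (Q.comp hj (Q.relabel (Equiv.refl (Fin 1)) (Equiv.emptySum Empty (Fin 1)).symm (η (1, 1)))
      (Q.relabel (Equiv.sumEmpty (Fin 1) Empty).symm (Equiv.refl (Fin 1)) (ξ (1, 1)))) := by
      rw [← e₅]
      refine congrArg₂ (fun a b => Q.comp hj a b) ?_ ?_
      · refine ProperadData.relabel_eq (fun _ => Subsingleton.elim _ _) (fun x => ?_) _
        rw [← Equiv.symm_apply_eq]
        exact Subsingleton.elim (α := Fin 1) _ _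
      · refine ProperadData.relabel_eq (fun x => ?_) (fun _ => Subsingleton.elim _ _) _
        rw [← Equiv.symm_apply_eq]
        exact Subsingleton.elim (α := Fin 1) _ _
    rw [e₆, ← hQ.relabel_trans]
    exact ProperadData.relabel_eq (fun _ => Subsingleton.elim (α := Fin 1) _ _)
      (fun _ => Subsingleton.elim (α := Fin 1) _ _) _
  · rintro ⟨a, b, hab⟩ - hne
    obtain rfl : b = 0 := by
      by_contra hb
      have hab' : a + b = 1 := hab
      obtain rfl : a = 0 := by omega
      obtain rfl : b = 1 := by omega
      exact hne rfl
    simp only [hξ, map_zero, smul_zero]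
  · simp
  · rintro ⟨a, b, hab⟩ - hne
    obtain rfl : a = 0 := by
      by_contra ha
      have hab' : a + b = 1 := hab
      obtain rfl : b = 0 := by omega
      obtain rfl : a = 1 := by omega
      exact hne rfl
    simp only [hη, map_zero, LinearMap.zero_apply, smul_zero, Finset.sum_const_zero]
  · simp

/-- Either the lower vertex has no inputs, or it carries the only input of the graph. -/
theorem star_one_one_zeroInp (h : k + l = t)
    (hj : deg c d k 1 1 + deg c d l 1 1 = deg c d t 1 1) {η : Fam Q c d k} (ξ : Fam Q c d l)
    (hη : ∀ n, η (0, n) = 0) :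
    star Q c d h η ξ (1, 1) =
      star Q c d h η ξ.zeroInp (1, 1) + oneComp hj (η (1, 1)) (ξ (1, 1)) := by
  have e := star_one_one hQ h hj (ξ := ξ - ξ.zeroInp) hη (fun m => sub_self _)
  rw [map_sub, Pi.sub_apply, sub_eq_iff_eq_add] at e
  rw [e, add_comm, Pi.sub_apply, show ξ.zeroInp (1, 1) = 0 from rfl, sub_zero]

omit hQ in
/-- The components without inputs of a bracket. -/
theorem brk_zeroInp (h : k + l = t) (h' : l + k = t) (η : Fam Q c d k) (ξ : Fam Q c d l) (m : ℕ) :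
    brk Q c d h η ξ (m, 0) = brk Q c d h η.zeroInp ξ (m, 0) -
      ksign K (k * l) • brk Q c d h' ξ.zeroInp η (m, 0) := by
  rw [brk_apply h h', brk_apply h h', brk_apply h' h, star_eq_zero_of_inp h η.zeroInp_inp,
    star_eq_zero_of_inp h' ξ.zeroInp_inp, sub_zero, sub_zero]
  simp only [Pi.sub_apply, Pi.smul_apply]
  rw [star_zeroInp h, star_zeroInp h', smul_smul, mul_comm l k, ksign_mul_self, one_smul]

/-- The component with one output and one input of a bracket. -/
theorem brk_one_one (h : k + l = t) (h' : l + k = t)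
    (hj : deg c d l 1 1 + deg c d k 1 1 = deg c d t 1 1) {η : Fam Q c d k} {ξ : Fam Q c d l}
    (hη : ∀ n, η (0, n) = 0) (hξ : ∀ n, ξ (0, n) = 0) :
    brk Q c d h η ξ (1, 1) = brk Q c d h η.zeroInp ξ (1, 1) -
      ksign K (k * l) • brk Q c d h' ξ.zeroInp η (1, 1) - innerMap (η (1, 1)) hj (ξ (1, 1)) := by
  rw [brk_apply h h', brk_apply h h', brk_apply h' h, star_eq_zero_of_inp h η.zeroInp_inp,
    star_eq_zero_of_inp h' ξ.zeroInp_inp, sub_zero, sub_zero]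
  simp only [Pi.sub_apply, Pi.smul_apply]
  rw [star_one_one_zeroInp hQ h (by omega) ξ hη, star_one_one_zeroInp hQ h' (by omega) η hξ,
    innerMap_one_one hQ hj (by omega), smul_smul, mul_comm l k, ksign_mul_self, one_smul,
    show deg c d k 1 1 * deg c d l 1 1 = k * l by simp [deg], smul_add]
  abel

end OneOne

/-! ### Derivations that move the Maurer-Cartan generators, and the extension of the differential of
`P`. -/

section OuterDerivations

variable {K : Type v} [Field K] [CharZero K] {P : DGProperad.{u} K} {c d k l t : ℤ}

omit [CharZero K] in
theorem attachMC_zero_out {η : Fam (tw P c d) c d k} (hη : ∀ n, η (0, n) = 0) (n : ℕ) :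
    attachMC η (0, n) = 0 := by
  rw [attachMC_apply]
  simp only [star, LinearMap.mk₂_apply]
  refine Finset.sum_eq_zero fun p _ => Finset.sum_eq_zero fun q _ => ?_
  obtain ⟨a, b, hab⟩ := p
  obtain rfl : a = 0 := by
    have : a + b = 0 := hab
    omega
  simp only [hη, map_zero, LinearMap.zero_apply, smul_zero]

omit [CharZero K] in
theorem expMC_zero_out {γ : Fam P.data c d k} (hγ : ∀ n, γ (0, n) = 0) (n : ℕ) :
    expMC γ (0, n) = 0 := by
  funext N
  have : ∀ n, attachMC^[N] (Fam.map (twOf P c d) γ) (0, n) = 0 := by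
    induction N with
    | zero => exact fun n => (congrArg (twOf P c d).app (hγ n)).trans (map_zero (twOf P c d).app)
    | succ N ih =>
      intro n
      rw [Function.iterate_succ_apply']
      exact attachMC_zero_out ih n
  exact (congrArg (((N ! : ℕ) : K)⁻¹ • ·) (congrFun (this n) N)).trans (smul_zero _)

omit [CharZero K] in
theorem expMC_weight_zero (γ : Fam P.data c d k) (s : ℕ × ℕ) (h : γ s = 0) : expMC γ s 0 = 0 := by
  have e : Fam.map (twOf P c d) γ s = 0 :=
    (congrArg (twOf P c d).app h).trans (map_zero (twOf P c d).app)
  exact (congrArg (((0 ! : ℕ) : K)⁻¹ • ·) (congrFun e 0)).trans (smul_zero _)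

omit [CharZero K] in
theorem exists_outerDer (γ : defSpace P.data c d k) : ∃ D ∈ ContDer (twFree P c d) k,
    (∀ {A B : Type} [Finite A] [Finite B] {i j : ℤ} (h : i + k = j) (a : P.data.obj A B i),
      D.app h ((twOf P c d).app a) = 0) ∧
    ∀ m : ℕ, D.app (deg_add c d (zero_add k) (m + 1) 0) (mcFam P c d (m + 1, 0)) =
      expMC γ.1 (m + 1, 0) := by
  obtain ⟨D, hD, h₁, h₂⟩ := tw_exists_der (P := P) (c := c) (d := d)
    (Submodule.zero_mem (Der P.data k))
    (β := fun m => expMC γ.1 (m + 1, 0))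
    (fun m σ => by
      have := expMC_mem γ.2.1 (m + 1, 0) σ (Equiv.refl (Fin 0))
      rwa [show psign K d (Equiv.refl (Fin 0)) = 1 by simp [psign], mul_one] at this)
    -- The values have no term of weight zero because `γ` vanishes on components without inputs.
    (fun m => expMC_weight_zero γ.1 _ (γ.2.2 _ (Or.inr rfl)))
  exact ⟨D, hD, fun h a => (h₁ h a).trans (map_zero (twOf P c d).app), h₂⟩

/-- The derivation that vanishes on `P` and maps the Maurer-Cartan generators to `γ` with all
inputs closed by Maurer-Cartan generators. -/
def outerDer (γ : defSpace P.data c d k) : Endo (tw P c d) k := Classical.choose (exists_outerDer γ)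

omit [CharZero K] in
theorem outerDer_mem (γ : defSpace P.data c d k) : outerDer γ ∈ ContDer (twFree P c d) k :=
  (Classical.choose_spec (exists_outerDer γ)).1

omit [CharZero K] in
theorem outerDer_of (γ : defSpace P.data c d k) {A B : Type} [Finite A] [Finite B] {i j : ℤ}
    (h : i + k = j) (a : P.data.obj A B i) : (outerDer γ).app h ((twOf P c d).app a) = 0 :=
  (Classical.choose_spec (exists_outerDer γ)).2.1 h a

omit [CharZero K] in
theorem outerDer_mc (γ : defSpace P.data c d k) (m : ℕ) :
    (outerDer γ).app (deg_add c d (zero_add k) (m + 1) 0) (mcFam P c d (m + 1, 0)) =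
      expMC γ.1 (m + 1, 0) :=
  (Classical.choose_spec (exists_outerDer γ)).2.2 m

omit [CharZero K] in
theorem outerDer_fam_mc (γ : defSpace P.data c d k) :
    (outerDer γ).fam (zero_add k) (mcFam P c d) = (expMC γ.1).zeroInp := by
  funext ⟨m, n⟩
  rw [Endo.fam_apply]
  rcases n with _ | n
  · rcases m with _ | m
    · rw [mcFam_zero, map_zero]
      exact (expMC_zero_out (fun n => γ.2.2 (0, n) (Or.inl rfl)) 0).symm
    · exact outerDer_mc γ m
  · rw [mcFam_inp, map_zero]
    rfl

omit [CharZero K] in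
theorem attachMC_zeroInp (η : Fam (tw P c d) c d k) : attachMC η.zeroInp = 0 := by
  rw [attachMC_apply, star_eq_zero_of_inp _ η.zeroInp_inp]

/-- The derivation commutes with `attachMC` up to the bracket with its value on the Maurer-Cartan
generators. That value has no inputs, so nothing can be attached to it and `attachMC` passes through
this bracket; differentiating a power then gives the exponent as a factor. -/
theorem outerDer_iterate (γ : defSpace P.data c d k) {ξ : Fam P.data c d l}
    (hξ : ξ ∈ symFam P.data c d l) (h : l + k = t) (h' : k + l = t) (N : ℕ) :
    (outerDer γ).fam h (attachMC^[N + 1] (Fam.map (twOf P c d) ξ)) = ((N + 1 : ℕ) : K) •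
      brk (tw P c d) c d h' (expMC γ.1).zeroInp (attachMC^[N] (Fam.map (twOf P c d) ξ)) := by
  have h0 : (outerDer γ).fam h (Fam.map (twOf P c d) ξ) = 0 := by
    funext s
    exact outerDer_of γ (deg_add c d h s.1 s.2) (ξ s)
  induction N with
  | zero =>
    rw [Function.iterate_succ_apply', Function.iterate_zero, id, der_attachMC (outerDer_mem γ).1 h h',
      h0, map_zero, zero_add, outerDer_fam_mc, zero_add, Nat.cast_one, one_smul]
  | succ N ih =>
    rw [Function.iterate_succ_apply', der_attachMC (outerDer_mem γ).1 h h', ih, map_smul,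
      attachMC_brk h' (Fam.zeroInp_mem (expMC_mem γ.2.1))
        (attachMC_iterate_mem (Fam.map_mem (twOf P c d) hξ) N), attachMC_zeroInp,
      LinearMap.map_zero₂, zero_add, outerDer_fam_mc,
      ← Function.iterate_succ_apply' attachMC]
    push_cast
    module

/-- The values of the derivation `outerDer γ` on `expMC ξ`. -/
theorem outerDer_expMC (γ : defSpace P.data c d k) {ξ : Fam P.data c d l}
    (hξ : ξ ∈ symFam P.data c d l) (h : l + k = t) (h' : k + l = t) :
    (outerDer γ).fam h (expMC ξ) = brk (tw P c d) c d h' (expMC γ.1).zeroInp (expMC ξ) := by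
  refine fam_expMC_eq (outerDer_mem γ) h ξ fun M => ?_
  -- As for the exponential series, (N+1)/(N+1)! = 1/N!, and the derivative of a partial sum is one
  -- term shorter.
  have e : (outerDer γ).fam h (expSum (M + 1) ξ) =
      brk (tw P c d) c d h' (expMC γ.1).zeroInp (expSum M ξ) := by
    induction M with
    | zero =>
      rw [expSum, expSum, Finset.sum_range_one, Finset.range_zero, Finset.sum_empty, map_zero,
        map_smul]
      have h0 : (outerDer γ).fam h (Fam.map (twOf P c d) ξ) = 0 := by
        funext s
        exact outerDer_of γ (deg_add c d h s.1 s.2) (ξ s)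
      rw [Function.iterate_zero, id, h0, smul_zero]
    | succ M ih =>
      have e₁ : expSum (M + 1 + 1) ξ = expSum (M + 1) ξ + (((M + 1)! : ℕ) : K)⁻¹ •
        attachMC^[M + 1] (Fam.map (twOf P c d) ξ) := Finset.sum_range_succ _ _
      have e₂ : expSum (M + 1) ξ = expSum M ξ + ((M ! : ℕ) : K)⁻¹ •
        attachMC^[M] (Fam.map (twOf P c d) ξ) := Finset.sum_range_succ _ _
      rw [e₁, map_add, ih, map_smul, outerDer_iterate γ hξ h h', e₂, map_add, map_smul, smul_smul]
      congr 2
      have h1 : ((M ! : ℕ) : K) ≠ 0 := Nat.cast_ne_zero.2 (Nat.factorial_ne_zero M)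
      have h2 : ((M + 1 : ℕ) : K) ≠ 0 := Nat.cast_ne_zero.2 (Nat.succ_ne_zero M)
      rw [Nat.factorial_succ, Nat.cast_mul]
      field_simp
  rw [e, ← map_sub]
  have := brk_mem_twGE h' (twGE_zero (expMC γ.1).zeroInp)
    (Submodule.neg_mem _ (expMC_sub_expSum M ξ))
  rwa [neg_sub, zero_add] at this

omit [CharZero K] in
theorem exists_baseDer (P : DGProperad.{u} K) (c d : ℤ) : ∃ D ∈ ContDer (twFree P c d) 1,
    (∀ {A B : Type} [Finite A] [Finite B] {i j : ℤ} (h : i + 1 = j) (a : P.data.obj A B i),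
      D.app h ((twOf P c d).app a) = (twOf P c d).app (P.d.app h a)) ∧
    ∀ m : ℕ, D.app (deg_add c d (zero_add 1) (m + 1) 0) (mcFam P c d (m + 1, 0)) = 0 :=
  tw_exists_der P.d_mem (β := fun m => 0) (fun m σ => by rw [map_zero, smul_zero]) (fun m => rfl)

/-- The derivation that extends the differential of `P` and vanishes on the Maurer-Cartan
generators. -/
def baseDer (P : DGProperad.{u} K) (c d : ℤ) : Endo (tw P c d) 1 :=
  Classical.choose (exists_baseDer P c d)

omit [CharZero K] in
theorem baseDer_mem : baseDer P c d ∈ ContDer (twFree P c d) 1 :=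
  (Classical.choose_spec (exists_baseDer P c d)).1

omit [CharZero K] in
theorem baseDer_of {A B : Type} [Finite A] [Finite B] {i j : ℤ} (h : i + 1 = j)
    (a : P.data.obj A B i) :
    (baseDer P c d).app h ((twOf P c d).app a) = (twOf P c d).app (P.d.app h a) :=
  (Classical.choose_spec (exists_baseDer P c d)).2.1 h a

omit [CharZero K] in
theorem baseDer_mc (m : ℕ) :
    (baseDer P c d).app (deg_add c d (zero_add 1) (m + 1) 0) (mcFam P c d (m + 1, 0)) = 0 :=
  (Classical.choose_spec (exists_baseDer P c d)).2.2 m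

omit [CharZero K] in
theorem baseDer_fam_mc : (baseDer P c d).fam (zero_add 1) (mcFam P c d) = 0 := by
  funext ⟨m, n⟩
  rw [Endo.fam_apply]
  rcases n with _ | n
  · rcases m with _ | m
    · rw [mcFam_zero, map_zero]
      rfl
    · exact baseDer_mc m
  · rw [mcFam_inp, map_zero]
    rfl

omit [CharZero K] in
-- The derivation kills the Maurer-Cartan generators, so it commutes with `attachMC`.
theorem baseDer_iterate (η : Fam P.data c d k) (h : k + 1 = l) (N : ℕ) :
    (baseDer P c d).fam h (attachMC^[N] (Fam.map (twOf P c d) η)) =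
      attachMC^[N] (Fam.map (twOf P c d) (Fam.diff P.d h η)) := by
  induction N with
  | zero =>
    funext s
    exact baseDer_of (deg_add c d h s.1 s.2) (η s)
  | succ N ih =>
    rw [Function.iterate_succ_apply', Function.iterate_succ_apply',
      der_attachMC baseDer_mem.1 h (by omega), ih, baseDer_fam_mc, LinearMap.map_zero₂, add_zero]

/-- The values of the derivation `baseDer` on `expMC η`. -/
theorem baseDer_expMC (η : Fam P.data c d k) (h : k + 1 = l) :
    (baseDer P c d).fam h (expMC η) = expMC (Fam.diff P.d h η) := by
  refine fam_expMC_eq baseDer_mem h η fun M => ?_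
  have e : (baseDer P c d).fam h (expSum (M + 1) η) = expSum (M + 1) (Fam.diff P.d h η) := by
    simp only [expSum, map_sum, map_smul, baseDer_iterate]
  rw [e]
  intro s N hN
  exact sub_eq_zero.2 (expSum_apply (by omega) _ s)

end OuterDerivations

/-! ### The graded commutator of families of maps. -/

section Commutators

variable {K : Type v} [Field K] {Q : ProperadData.{u} K ℤ} {r s t : ℤ}

theorem Endo.ext_app {D E : Endo Q r} (h : ∀ {A B : Type} [Finite A] [Finite B] {i j : ℤ}
    (h : i + r = j) (x : Q.obj A B i), D.app h x = E.app h x) : D = E :=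
  funext fun S => LinearMap.ext fun x => h S.add x

theorem Endo.comm_skew (h : r + s = t) (h' : s + r = t) (D : Endo Q r) (E : Endo Q s) :
    Endo.comm h D E = -(ksign K (r * s) • Endo.comm h' E D) := by
  refine Endo.ext_app fun {A B} _ _ {i j} hj x => ?_
  have e₁ : i + s + r = j := by omega
  have e₂ : i + r + s = j := by omega
  change _ = -(ksign K (r * s) • (Endo.comm h' E D).app hj x)
  rw [Endo.comm_app h D E hj rfl e₁ rfl e₂, Endo.comm_app h' E D hj rfl e₂ rfl e₁, smul_sub,
    smul_smul, mul_comm s r, ksign_mul_self, one_smul, neg_sub]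

theorem Endo.comm_jacobi {i j k ij jk ik t : ℤ} (h₁ : j + k = jk) (h₂ : i + jk = t)
    (h₃ : i + j = ij) (h₄ : ij + k = t) (h₅ : i + k = ik) (h₆ : j + ik = t) (x : Endo Q i)
    (y : Endo Q j) (z : Endo Q k) :
    Endo.comm h₂ x (Endo.comm h₁ y z) =
      Endo.comm h₄ (Endo.comm h₃ x y) z + ksign K (i * j) • Endo.comm h₆ y (Endo.comm h₅ x z) := by
  refine Endo.ext_app fun {A B} _ _ {p q} hq a => ?_
  change _ = (Endo.comm h₄ (Endo.comm h₃ x y) z).app hq a +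
    ksign K (i * j) • (Endo.comm h₆ y (Endo.comm h₅ x z)).app hq a
  -- Both sides expand into compositions of three maps; the intermediate degrees are chosen so that
  -- equal compositions match.
  rw [Endo.comm_app h₂ _ _ hq (m := p + jk) rfl (by omega) (n := p + i) rfl (by omega),
    Endo.comm_app h₄ _ _ hq (m := p + k) rfl (by omega) (n := p + ij) rfl (by omega),
    Endo.comm_app h₆ _ _ hq (m := p + ik) rfl (by omega) (n := p + j) rfl (by omega),
    Endo.comm_app h₁ _ _ (i := p) rfl (m := p + k) rfl (by omega) (n := p + j) rfl (by omega),
    Endo.comm_app h₁ _ _ (i := p + i) (j := q) (by omega) (m := p + ik) (by omega) (by omega)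
      (n := p + ij) (by omega) (by omega),
    Endo.comm_app h₃ _ _ (i := p + k) (j := q) (by omega) (m := p + jk) (by omega) (by omega)
      (n := p + ik) (by omega) (by omega),
    Endo.comm_app h₃ _ _ (i := p) (j := p + ij) rfl (m := p + j) rfl (by omega) (n := p + i) rfl
      (by omega),
    Endo.comm_app h₅ _ _ (i := p) (j := p + ik) rfl (m := p + k) rfl (by omega) (n := p + i) rfl
      (by omega),
    Endo.comm_app h₅ _ _ (i := p + j) (j := q) (by omega) (m := p + jk) (by omega) (by omega)
      (n := p + ij) (by omega) (by omega)]
  simp only [map_sub, map_smul, smul_sub, smul_smul]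
  subst h₁ h₃ h₅
  simp only [mul_add, add_mul, ksign_add, mul_comm j i]
  rcases ksign_cases K (i * j) with s₁ | s₁ <;> rcases ksign_cases K (i * k) with s₂ | s₂ <;>
    rcases ksign_cases K (j * k) with s₃ | s₃ <;> rw [s₁, s₂, s₃] <;> module

variable (hQ : Q.IsProperad (AddMonoidHom.id ℤ))

include hQ

theorem innerDer_add (g g' : Q.obj (Fin 1) (Fin 1) r) :
    innerDer (g + g') = innerDer g + innerDer g' := by
  refine Endo.ext_app fun h x => ?_
  change _ = (innerDer g).app h x + (innerDer g').app h x
  rw [innerDer_app hQ, innerDer_app hQ, innerDer_app hQ, innerMap_add hQ]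

theorem innerDer_smul (a : K) (g : Q.obj (Fin 1) (Fin 1) r) :
    innerDer (a • g) = a • innerDer g := by
  refine Endo.ext_app fun h x => ?_
  change _ = a • (innerDer g).app h x
  rw [innerDer_app hQ, innerDer_app hQ, innerMap_smul hQ]

theorem innerDer_sub (g g' : Q.obj (Fin 1) (Fin 1) r) :
    innerDer (g - g') = innerDer g - innerDer g' := by
  refine Endo.ext_app fun h x => ?_
  change _ = (innerDer g).app h x - (innerDer g').app h x
  rw [innerDer_app hQ, innerDer_app hQ, innerDer_app hQ, innerMap_sub hQ]

/-- The Leibniz rule `der_innerMap` has two terms, and the commutator removes the one in which `D`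
acts on the argument. -/
theorem comm_innerDer (h : s + r = t) (hr : r + s = t) {D : Endo Q s} (hD : D ∈ Der Q s)
    (g : Q.obj (Fin 1) (Fin 1) r) : Endo.comm h D (innerDer g) = innerDer (D.app hr g) := by
  refine Endo.ext_app fun {A B} _ _ {i j} hj x => ?_
  rw [Endo.comm_app h D _ hj (m := i + r) rfl (by omega) (n := i + s) rfl (by omega),
    innerDer_app hQ, innerDer_app hQ, innerDer_app hQ,
    der_innerMap hQ g hD hr rfl rfl (by omega), add_sub_cancel_right]

end Commutators

/-! ### The action of a family on the twisted properad, and its commutators. -/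

section ActionDerivation

variable {K : Type v} [Field K] {P : DGProperad.{u} K} {c d k l t : ℤ}

theorem expMC_add (η ξ : Fam P.data c d k) : expMC (η + ξ) = expMC η + expMC ξ := by
  funext s N
  have e : Fam.map (twOf P c d) (η + ξ) = Fam.map (twOf P c d) η + Fam.map (twOf P c d) ξ :=
    funext fun s => map_add (twOf P c d).app (η s) (ξ s)
  have e' := congrFun (congrFun (iterate_map_add attachMC N (Fam.map (twOf P c d) η)
    (Fam.map (twOf P c d) ξ)) s) N
  rw [← e] at e'
  exact (congrArg (((N ! : ℕ) : K)⁻¹ • ·) e').trans (smul_add ((N ! : ℕ) : K)⁻¹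
    (attachMC^[N] (Fam.map (twOf P c d) η) s N : (twFree P c d).obj _ _ _)
    (attachMC^[N] (Fam.map (twOf P c d) ξ) s N))

theorem attachMC_iterate_smul (a : K) (η : Fam (tw P c d) c d k) (N : ℕ) :
    attachMC^[N] (a • η) = a • attachMC^[N] η := by
  induction N with
  | zero => rfl
  | succ N ih => rw [Function.iterate_succ_apply', Function.iterate_succ_apply', ih, map_smul]

theorem expMC_smul (a : K) (η : Fam P.data c d k) : expMC (a • η) = a • expMC η := by
  funext s N
  have e : Fam.map (twOf P c d) (a • η) = a • Fam.map (twOf P c d) η :=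
    funext fun s => map_smul (twOf P c d).app a (η s)
  have e' := congrFun (congrFun (attachMC_iterate_smul a (Fam.map (twOf P c d) η) N) s) N
  rw [← e] at e'
  exact (congrArg (((N ! : ℕ) : K)⁻¹ • ·) e').trans (smul_comm ((N ! : ℕ) : K)⁻¹ a
    (attachMC^[N] (Fam.map (twOf P c d) η) s N : (twFree P c d).obj _ _ _))

/-- The component of `expMC γ` with one output and one input. -/
def expOne (γ : Fam P.data c d k) : (tw P c d).obj (Fin 1) (Fin 1) k :=
  castDeg (show deg c d k 1 1 = k by simp [deg]) (expMC γ (1, 1))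

theorem expOne_add (η ξ : Fam P.data c d k) : expOne (η + ξ) = expOne η + expOne ξ := by
  rw [expOne, expMC_add, Pi.add_apply, map_add]
  rfl

theorem expOne_smul (a : K) (η : Fam P.data c d k) : expOne (a • η) = a • expOne η := by
  rw [expOne, expMC_smul, Pi.smul_apply, map_smul]
  rfl

theorem innerMap_expOne (γ : Fam P.data c d k) {A B : Type} [Finite A] [Finite B] {i j : ℤ}
    (h : i + k = j) (x : (tw P c d).obj A B i) :
    innerMap (expOne γ) h x = innerMap (expMC γ (1, 1)) (deg_one_one c d h) x :=
  innerMap_castDeg _ _ _ _ _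

theorem outerDer_add (γ γ' : defSpace P.data c d k) :
    outerDer (γ + γ') = outerDer γ + outerDer γ' := by
  refine tw_der_ext (outerDer_mem _) (Submodule.add_mem _ (outerDer_mem _) (outerDer_mem _)) ?_ ?_
  · intro A B _ _ i j h a
    change _ = (outerDer γ).app h _ + (outerDer γ').app h _
    rw [outerDer_of, outerDer_of, outerDer_of, add_zero]
  · intro m
    change _ = (outerDer γ).app _ _ + (outerDer γ').app _ _
    rw [outerDer_mc, outerDer_mc, outerDer_mc, Submodule.coe_add, expMC_add, Pi.add_apply]

theorem outerDer_smul (a : K) (γ : defSpace P.data c d k) :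
    outerDer (a • γ) = a • outerDer γ := by
  refine tw_der_ext (outerDer_mem _) (Submodule.smul_mem _ _ (outerDer_mem _)) ?_ ?_
  · intro A B _ _ i j h b
    change _ = a • (outerDer γ).app h _
    rw [outerDer_of, outerDer_of, smul_zero]
  · intro m
    change _ = a • (outerDer γ).app _ _
    rw [outerDer_mc, outerDer_mc, Submodule.coe_smul, expMC_smul, Pi.smul_apply]

/-- The derivation of the twisted properad by which `γ` acts. -/
def actionDer (γ : defSpace P.data c d k) : Endo (tw P c d) k := outerDer γ - innerDer (expOne γ.1)

theorem innerDer_mem_tw (h : (tw P c d).obj (Fin 1) (Fin 1) k) :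
    innerDer h ∈ ContDer (twFree P c d) k :=
  innerDer_mem_contDer (W := twFree P c d) (tw_law P c d) h

theorem actionDer_mem (γ : defSpace P.data c d k) : actionDer γ ∈ ContDer (twFree P c d) k :=
  Submodule.sub_mem _ (outerDer_mem γ) (innerDer_mem_tw _)

theorem actionDer_app (γ : defSpace P.data c d k) {A B : Type} [Finite A] [Finite B] {i j : ℤ}
    (h : i + k = j) (x : (tw P c d).obj A B i) :
    (actionDer γ).app h x =
      (outerDer γ).app h x - innerMap (expMC γ.1 (1, 1)) (deg_one_one c d h) x := by
  change (outerDer γ).app h x - (innerDer (expOne γ.1)).app h x = _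
  rw [innerDer_app (tw_law P c d), innerMap_expOne]

theorem actionDer_isActionOf (γ : defSpace P.data c d k) : IsActionOf γ.1 (actionDer γ) where
  of h a := by
    rw [actionDer_app, outerDer_of, innerMap_neg (tw_law P c d), zero_sub]
  mc m := by
    rw [actionDer_app, outerDer_mc, innerMap_neg (tw_law P c d)]
    abel

theorem actionDer_add (γ γ' : defSpace P.data c d k) :
    actionDer (γ + γ') = actionDer γ + actionDer γ' := by
  rw [actionDer, outerDer_add, Submodule.coe_add, expOne_add, innerDer_add (tw_law P c d), actionDer,
    actionDer]
  abel

theorem actionDer_smul (a : K) (γ : defSpace P.data c d k) :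
    actionDer (a • γ) = a • actionDer γ := by
  rw [actionDer, outerDer_smul, Submodule.coe_smul, expOne_smul, innerDer_smul (tw_law P c d),
    actionDer, smul_sub]

/-- The bracket of the deformation complex. -/
theorem brk_mem_defSpace (h : k + l = t) {γ : Fam P.data c d k} {ξ : Fam P.data c d l}
    (hγ : γ ∈ defSpace P.data c d k) (hξ : ξ ∈ defSpace P.data c d l) :
    brk P.data c d h γ ξ ∈ defSpace P.data c d t :=
  Submodule.sub_mem _ (Submodule.smul_mem _ _ (star_mem P.law _ hξ hγ)) (star_mem P.law h hγ hξ)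

variable [CharZero K]

theorem outerDer_app_expMC (γ : defSpace P.data c d k) (ξ : defSpace P.data c d l) (h : l + k = t)
    (h' : k + l = t) (s : ℕ × ℕ) :
    (outerDer γ).app (deg_add c d h s.1 s.2) (expMC ξ.1 s) =
      brk (tw P c d) c d h' (expMC γ.1).zeroInp (expMC ξ.1) s :=
  congrFun (outerDer_expMC γ ξ.2.1 h h') s

/-- Both sides kill `P`. On a Maurer-Cartan generator the commutator is evaluated by
`outerDer_expMC`, and its two terms are those of `brk_zeroInp` for the bracket of the exponentials,
which is the exponential of the bracket by `expMC_brk`. -/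
theorem comm_outerDer (h : k + l = t) (γ : defSpace P.data c d k) (ξ : defSpace P.data c d l) :
    Endo.comm h (outerDer γ) (outerDer ξ) = outerDer ⟨_, brk_mem_defSpace h γ.2 ξ.2⟩ := by
  refine tw_der_ext (ContDer.comm_mem h (outerDer_mem γ) (outerDer_mem ξ)) (outerDer_mem _) ?_ ?_
  · intro A B _ _ i j hj a
    rw [Endo.comm_app h _ _ hj (m := i + l) rfl (by omega) (n := i + k) rfl (by omega), outerDer_of,
      outerDer_of, outerDer_of, map_zero, map_zero, smul_zero, sub_zero]
  · intro m
    have h' : l + k = t := by omega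
    rw [Endo.comm_app h _ _ _ (deg_add c d (zero_add l) (m + 1) 0) (deg_add c d h' (m + 1) 0)
      (deg_add c d (zero_add k) (m + 1) 0) (deg_add c d h (m + 1) 0), outerDer_mc, outerDer_mc,
      outerDer_mc, expMC_brk h γ.2.1 ξ.2.1, brk_zeroInp h h', outerDer_app_expMC γ ξ h' h,
      outerDer_app_expMC ξ γ h h']

/-- The first two terms are the graphs whose lower vertex has no inputs. In the remaining graphs the
two (1,1)-components are stacked; these form the inner term. -/
theorem expOne_brk (h : k + l = t) (h' : l + k = t) (γ : defSpace P.data c d k)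
    (ξ : defSpace P.data c d l) :
    expOne (brk P.data c d h γ.1 ξ.1) = (outerDer γ).app h' (expOne ξ.1) -
      ksign K (k * l) • (outerDer ξ).app h (expOne γ.1) - innerMap (expOne γ.1) h' (expOne ξ.1) := by
  have hk : deg c d k 1 1 = k := by simp [deg]
  have hl : deg c d l 1 1 = l := by simp [deg]
  have ht : deg c d t 1 1 = t := by simp [deg]
  have e := brk_one_one (tw_law P c d) h h' (by omega)
    (expMC_zero_out (fun n => γ.2.2 (0, n) (Or.inl rfl)))
    (expMC_zero_out (fun n => ξ.2.2 (0, n) (Or.inl rfl)))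
  rw [← outerDer_app_expMC γ ξ h' h, ← outerDer_app_expMC ξ γ h h', ← expMC_brk h γ.2.1 ξ.2.1] at e
  have e' := congrArg (castDeg ht) e
  rw [map_sub, map_sub, map_smul, ← Endo.app_castDeg (outerDer γ) hl ht _ h',
    ← Endo.app_castDeg (outerDer ξ) hk ht _ h] at e'
  refine e'.trans (congrArg₂ (· - ·) rfl ?_)
  rw [← innerDer_app (tw_law P c d), innerMap_expOne, ← innerDer_app (tw_law P c d), expOne,
    Endo.app_castDeg (innerDer (expMC γ.1 (1, 1))) hl ht]

/-- The outer parts commute to an outer part. The mixed commutators and the commutator of the inner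
parts are inner, and `expOne_brk` says that their elements add up to the (1,1)-component for the
bracket. -/
theorem comm_actionDer (h : k + l = t) (γ : defSpace P.data c d k) (ξ : defSpace P.data c d l) :
    Endo.comm h (actionDer γ) (actionDer ξ) = actionDer ⟨_, brk_mem_defSpace h γ.2 ξ.2⟩ := by
  have h' : l + k = t := by omega
  have law := tw_law P c d
  simp only [actionDer]
  rw [map_sub, LinearMap.map_sub₂, LinearMap.map_sub₂, comm_outerDer,
    comm_innerDer law h h' (outerDer_mem γ).1, comm_innerDer law h h' (innerDer_mem law _),
    Endo.comm_skew h h', comm_innerDer law h' h (outerDer_mem ξ).1, expOne_brk h h',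
    innerDer_sub law, innerDer_sub law, innerDer_smul law, innerDer_app law]
  abel

omit [CharZero K] in
theorem comm_baseDer_baseDer (h : (1 : ℤ) + 1 = t) :
    Endo.comm h (baseDer P c d) (baseDer P c d) = 0 := by
  have z : ∀ {A B : Type} [Finite A] [Finite B] {i j : ℤ} (h : i + t = j)
    (x : (tw P c d).obj A B i), (0 : Endo (tw P c d) t).app h x = 0 := fun _ _ => rfl
  refine tw_der_ext (ContDer.comm_mem h baseDer_mem baseDer_mem) (Submodule.zero_mem _) ?_ ?_
  · intro A B _ _ i j hj a
    rw [Endo.comm_app h _ _ hj (m := i + 1) rfl (by omega) (n := i + 1) rfl (by omega), baseDer_of,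
      baseDer_of, P.d_d, map_zero, smul_zero, sub_zero, z]
  · intro m
    rw [Endo.comm_app h _ _ _ (deg_add c d (zero_add 1) (m + 1) 0) (deg_add c d h (m + 1) 0)
      (deg_add c d (zero_add 1) (m + 1) 0) (deg_add c d h (m + 1) 0), baseDer_mc, map_zero,
      smul_zero, sub_zero, z]

/-- On Maurer-Cartan generators only the differential of the exponential is left, and this is the
exponential of the differential. -/
theorem comm_baseDer_outerDer (h : 1 + k = t) (h' : k + 1 = t) (γ : defSpace P.data c d k) :
    Endo.comm h (baseDer P c d) (outerDer γ) = outerDer ⟨_, Fam.diff_mem P.d_mem h' γ.2⟩ := by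
  refine tw_der_ext (ContDer.comm_mem h baseDer_mem (outerDer_mem γ)) (outerDer_mem _) ?_ ?_
  · intro A B _ _ i j hj a
    rw [Endo.comm_app h _ _ hj (m := i + k) rfl (by omega) (n := i + 1) rfl (by omega), baseDer_of,
      outerDer_of, outerDer_of, outerDer_of, map_zero, smul_zero, sub_zero]
  · intro m
    rw [Endo.comm_app h _ _ _ (deg_add c d (zero_add k) (m + 1) 0) (deg_add c d h' (m + 1) 0)
      (deg_add c d (zero_add 1) (m + 1) 0) (deg_add c d h (m + 1) 0), baseDer_mc, outerDer_mc,
      outerDer_mc, map_zero, smul_zero, sub_zero]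
    exact congrFun (baseDer_expMC γ.1 h') (m + 1, 0)

theorem expOne_diff (h : k + 1 = t) (γ : Fam P.data c d k) :
    expOne (Fam.diff P.d h γ) = (baseDer P c d).app h (expOne γ) := by
  have hk : deg c d k 1 1 = k := by simp [deg]
  have ht : deg c d t 1 1 = t := by simp [deg]
  rw [expOne, expOne, Endo.app_castDeg (baseDer P c d) hk ht (deg_add c d h 1 1)]
  exact congrArg (castDeg ht) (congrFun (baseDer_expMC γ h).symm (1, 1))

theorem comm_baseDer_actionDer (h : 1 + k = t) (h' : k + 1 = t) (γ : defSpace P.data c d k) :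
    Endo.comm h (baseDer P c d) (actionDer γ) = actionDer ⟨_, Fam.diff_mem P.d_mem h' γ.2⟩ := by
  simp only [actionDer]
  rw [map_sub, comm_baseDer_outerDer h h', comm_innerDer (tw_law P c d) h h' baseDer_mem.1,
    expOne_diff h']

end ActionDerivation

/-! ### Maurer-Cartan equation, twisted differential and morphism of dg Lie algebras. -/

section DGLie

variable {K : Type v} [Field K] {P : DGProperad.{u} K} {c d : ℤ}

/-- The linear map that sends a family to the derivation by which it acts. -/
def actionLin (P : DGProperad.{u} K) (c d k : ℤ) : defSpace P.data c d k →ₗ[K] Endo (tw P c d) k where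
  toFun := actionDer
  map_add' := actionDer_add
  map_smul' := actionDer_smul

variable (f : UnderHoLB P c d)

/-- The images of the generators satisfy the Maurer-Cartan equation. -/
theorem UnderHoLB.diff_pi (h : (1 : ℤ) + 1 = 2) :
    Fam.diff P.d h f.π = -star P.data c d h f.π f.π := by
  funext s
  by_cases hs : 1 ≤ s.1 ∧ 1 ≤ s.2 ∧ 3 ≤ s.1 + s.2
  · have e := f.map_d (deg_add c d h s.1 s.2) (HoLB.e K c d s)
    rw [HoLB.diff_e K c d s hs, map_neg] at e
    refine e.symm.trans (congrArg Neg.neg ?_)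
    exact congrFun (Fam.map_star f.hom h (HoLB.e K c d) (HoLB.e K c d)) s
  · have z : ∀ s : ℕ × ℕ, ¬(1 ≤ s.1 ∧ 1 ≤ s.2 ∧ 3 ≤ s.1 + s.2) → f.π s = 0 := by
      intro s hs
      rw [UnderHoLB.π, Fam.map, HoLB.e_neg K c d hs, map_zero]
    have e₁ : Fam.diff P.d h f.π s = 0 :=
      (congrArg (P.d.app (deg_add c d h s.1 s.2)) (z s hs)).trans (map_zero _)
    rw [e₁, Pi.neg_apply, eq_comm, neg_eq_zero]
    -- Outside the range of the generators the left-hand side is zero, so the square of π must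
    -- vanish there as well. Apart from components without outputs or without inputs only (1,1) is
    -- left, where the lower vertex would lack inputs or be the zero (1,1)-component of π.
    by_cases h0 : s.1 = 0 ∨ s.2 = 0
    · exact (star_mem P.law h f.π_mem f.π_mem).2 s h0
    · obtain ⟨m, n⟩ := s
      dsimp only at hs h0
      obtain rfl : m = 1 := by omega
      obtain rfl : n = 1 := by omega
      have hz : f.π.zeroInp = 0 := by
        funext ⟨m, n⟩
        rcases n with _ | n
        · exact z (m, 0) (by simp)
        · rfl
      rw [star_one_one_zeroInp P.law h (by simp [deg]) f.π (fun n => z (0, n) (by simp)), hz, map_zero,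
        z (1, 1) hs, oneComp]
      simp

/-- The degree one is odd, so the two terms of the bracket add up to minus twice the square of π. -/
theorem UnderHoLB.brk_pi_pi (h : (1 : ℤ) + 1 = 2) :
    brk P.data c d h f.π f.π = (2 : K) • Fam.diff P.d h f.π := by
  rw [brk_apply h h, f.diff_pi, show ksign K (1 * 1) = -1 by simp [ksign]]
  module

/-- The family given by an element of the deformation complex. -/
def UnderHoLB.val {k : ℤ} (x : f.defLie.obj k) : Fam P.data c d k :=
  (defSpace P.data c d k).subtype x

theorem UnderHoLB.val_mem {k : ℤ} (x : f.defLie.obj k) : f.val x ∈ symFam P.data c d k := x.2.1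

theorem UnderHoLB.val_d {i j : ℤ} (h : i + 1 = j) (η : f.defLie.obj i) :
    f.val (f.defLie.d h η) =
      Fam.diff P.d h (f.val η) - brk P.data c d (show 1 + i = j by omega) f.π (f.val η) := by
  rw [brk_apply _ h, one_mul]
  refine Eq.trans ?_ (sub_sub_eq_add_sub _ _ _).symm
  rfl

theorem UnderHoLB.val_bracket {i j k : ℤ} (h : i + j = k) (η : f.defLie.obj i)
    (ξ : f.defLie.obj j) :
    f.val (f.defLie.bracket h η ξ) = brk P.data c d h (f.val η) (f.val ξ) := rfl

theorem diff_brk {i j k i' j' k' : ℤ} (h : i + j = k) (hi : i + 1 = i') (hj : j + 1 = j')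
    (hk : k + 1 = k') (h' : i' + j = k') (h'' : i + j' = k') (η : Fam P.data c d i)
    (ξ : Fam P.data c d j) : Fam.diff P.d hk (brk P.data c d h η ξ) =
      brk P.data c d h' (Fam.diff P.d hi η) ξ +
        ksign K i • brk P.data c d h'' η (Fam.diff P.d hj ξ) := by
  have := der_brk P.d_mem h hi hj hk h' h'' η ξ
  rwa [one_mul] at this

variable [CharZero K]

/-- By the Jacobi identity the square of the adjoint action of the odd element π is half the adjoint
action of [π, π], and the Maurer-Cartan equation replaces this half by ∂π. -/
theorem UnderHoLB.brk_pi_brk_pi {i j k : ℤ} (h : 1 + i = j) (h' : 1 + j = k) (h'' : 2 + i = k)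
    {η : Fam P.data c d i} (hη : η ∈ symFam P.data c d i) :
    brk P.data c d h' f.π (brk P.data c d h f.π η) =
      brk P.data c d h'' (Fam.diff P.d (by norm_num) f.π) η := by
  have e := brk_jacobi P.law h h' (show (1 : ℤ) + 1 = 2 by norm_num) h'' h h' f.π_mem.1 f.π_mem.1 hη
  rw [f.brk_pi_pi, show ksign K (1 * 1) = -1 by simp [ksign], neg_one_smul, ← sub_eq_add_neg,
    eq_sub_iff_add_eq, ← two_smul K, LinearMap.map_smul₂] at e
  exact smul_right_injective _ (two_ne_zero (α := K)) e

/-- The differential is ∂ − [π, -], the twist of ∂ by a Maurer-Cartan element: the terms with ∂π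
cancel in its square, and [π, -] is a derivation of the bracket by the Jacobi identity. -/
theorem UnderHoLB.defLie_isDGLie : f.defLie.IsDGLie where
  skew {i j k} h h' x y := Subtype.ext (brk_skew h h' x.1 y.1)
  jacobi h₁ h₂ h₃ h₄ h₅ h₆ x y z :=
    Subtype.ext (brk_jacobi P.law h₁ h₂ h₃ h₄ h₅ h₆ x.2.1 y.2.1 z.2.1)
  d_d {i j k} h h' x := by
    have e := f.val_d h' (f.defLie.d h x)
    rw [f.val_d h x, map_sub, map_sub, f.brk_pi_brk_pi _ _ (by omega) (f.val_mem x),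
      diff_brk (show 1 + i = j by omega) (show (1 : ℤ) + 1 = 2 by norm_num) h h' (by omega) (by omega),
      show Fam.diff P.d h' (Fam.diff P.d h (f.val x)) = 0 from funext fun s => P.d_d _ _ _,
      show ksign K 1 = -1 by simp [ksign]] at e
    refine Subtype.ext (e.trans ?_)
    change _ = (0 : Fam P.data c d k)
    module
  d_bracket {i j k i' j' k'} h hi hj hk h' h'' x y := by
    have e₁ := f.val_d hk (f.defLie.bracket h x y)
    have e₂ := f.val_bracket h' (f.defLie.d hi x) y
    have e₃ := f.val_bracket h'' x (f.defLie.d hj y)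
    rw [f.val_d hi x, LinearMap.map_sub₂] at e₂
    rw [f.val_d hj y, map_sub] at e₃
    rw [f.val_bracket, diff_brk h hi hj hk h' h'',
      brk_jacobi P.law h (show 1 + k = k' by omega) (show 1 + i = i' by omega) h'
        (show 1 + j = j' by omega) h'' f.π_mem.1 (f.val_mem x) (f.val_mem y), one_mul] at e₁
    refine Subtype.ext (e₁.trans (Eq.trans ?_ (congrArg₂ (fun a b => a + ksign K i • b) e₂ e₃).symm))
    module

/-- The twisted differential. -/
def UnderHoLB.twDiff : Endo (tw P c d) 1 := baseDer P c d - actionDer ⟨f.π, f.π_mem⟩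

omit [CharZero K] in
theorem UnderHoLB.twDiff_mem : f.twDiff ∈ ContDer (twFree P c d) 1 :=
  Submodule.sub_mem _ baseDer_mem (actionDer_mem _)

omit [CharZero K] in
theorem UnderHoLB.twDiff_isTwistedDifferential : f.IsTwistedDifferential f.twDiff where
  of h a := by
    change (baseDer P c d).app h _ - (actionDer ⟨f.π, f.π_mem⟩).app h _ = _
    rw [baseDer_of, actionDer_app, outerDer_of, zero_sub, sub_neg_eq_add]
  mc m := by
    change (baseDer P c d).app _ _ - (actionDer ⟨f.π, f.π_mem⟩).app _ _ = _
    rw [baseDer_mc, actionDer_app, outerDer_mc, zero_sub, neg_sub]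

omit [CharZero K] in
theorem UnderHoLB.IsTwistedDifferential.unique {D D' : Endo (tw P c d) 1}
    (hD : D ∈ ContDer (twFree P c d) 1) (hD' : D' ∈ ContDer (twFree P c d) 1)
    (h : f.IsTwistedDifferential D) (h' : f.IsTwistedDifferential D') : D = D' :=
  tw_der_ext hD hD' (fun hj a => (h.of hj a).trans (h'.of hj a).symm)
    (fun m => (h.mc m).trans (h'.mc m).symm)

/-- The two mixed commutators contribute minus twice the action of ∂π, and the commutator of the
actions of π contributes the action of [π, π], which is twice that of ∂π. -/
theorem UnderHoLB.comm_twDiff_twDiff (h : (1 : ℤ) + 1 = 2) : Endo.comm h f.twDiff f.twDiff = 0 := by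
  have e : (⟨_, brk_mem_defSpace h f.π_mem f.π_mem⟩ : defSpace P.data c d 2) =
      (2 : K) • ⟨_, Fam.diff_mem P.d_mem h f.π_mem⟩ := Subtype.ext (f.brk_pi_pi h)
  rw [UnderHoLB.twDiff, map_sub, LinearMap.map_sub₂, LinearMap.map_sub₂, comm_baseDer_baseDer,
    comm_actionDer, Endo.comm_skew h h (actionDer _), comm_baseDer_actionDer h h, e, actionDer_smul,
    show ksign K (1 * 1) = -1 by simp [ksign]]
  module

/-- The graded commutator of an odd derivation with itself is twice its square. -/
theorem UnderHoLB.twDiff_twDiff {A B : Type} [Finite A] [Finite B] {i j k : ℤ} (h : i + 1 = j)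
    (h' : j + 1 = k) (x : (tw P c d).obj A B i) : f.twDiff.app h' (f.twDiff.app h x) = 0 := by
  have e := Endo.comm_app (show (1 : ℤ) + 1 = 2 by norm_num) f.twDiff f.twDiff
    (show i + 2 = k by omega) h h' h h' x
  rw [f.comm_twDiff_twDiff, show ksign K (1 * 1) = -1 by simp [ksign], neg_one_smul, sub_neg_eq_add,
    ← two_smul K] at e
  exact (smul_eq_zero.1 e.symm).resolve_left two_ne_zero

/-- Everything is the Jacobi identity for commutators; applied with `D` twice, it shows that twice
the square of the differential is the commutator with [D, D] = 0. -/
theorem derLie_isDGLie {W : ProperadData.{w} K (ℤ × ℕ)} {D : Endo W.completion 1}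
    (hD : D ∈ ContDer W 1) (h : Endo.comm (show (1 : ℤ) + 1 = 2 by norm_num) D D = 0) :
    (derLie W hD).IsDGLie where
  skew h h' x y := Subtype.ext (Endo.comm_skew h h' x.1 y.1)
  jacobi h₁ h₂ h₃ h₄ h₅ h₆ x y z :=
    Subtype.ext (Endo.comm_jacobi h₁ h₂ h₃ h₄ h₅ h₆ x.1 y.1 z.1)
  d_d {i j k} h₁ h₂ x := by
    have e := Endo.comm_jacobi (show 1 + i = j by omega) (show 1 + j = k by omega)
      (show (1 : ℤ) + 1 = 2 by norm_num) (show 2 + i = k by omega) (show 1 + i = j by omega)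
      (show 1 + j = k by omega) D D x.1
    rw [h, LinearMap.map_zero₂, zero_add, show ksign K (1 * 1) = -1 by simp [ksign], neg_one_smul,
      eq_neg_iff_add_eq_zero, ← two_smul K] at e
    exact Subtype.ext ((smul_eq_zero.1 e).resolve_left two_ne_zero)
  d_bracket {i j k i' j' k'} h hi hj hk h' h'' x y := by
    have e := Endo.comm_jacobi h (show 1 + k = k' by omega) (show 1 + i = i' by omega) h'
      (show 1 + j = j' by omega) h'' D x.1 y.1
    rw [one_mul] at e
    exact Subtype.ext e

/-- The untwisted part differentiates the family and the action of π contributes the bracket with π.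
Together these form the differential of the deformation complex. -/
theorem UnderHoLB.comm_twDiff_actionDer {i j : ℤ} (h : 1 + i = j) (h' : i + 1 = j)
    (x : defSpace P.data c d i) : Endo.comm h f.twDiff (actionDer x) =
      actionLin P c d j (⟨_, Fam.diff_mem P.d_mem h' x.2⟩ - ⟨_, brk_mem_defSpace h f.π_mem x.2⟩) := by
  rw [map_sub, UnderHoLB.twDiff, LinearMap.map_sub₂, comm_baseDer_actionDer h h', comm_actionDer]
  rfl

/-- The action of the deformation complex on the twisted properad. -/
def UnderHoLB.action : f.defLie.Hom (derLie (twFree P c d) f.twDiff_mem) where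
  app {k} := (actionLin P c d k).codRestrict _ actionDer_mem
  map_d {i j} h x := by
    have e : f.defLie.d h x =
        (⟨_, Fam.diff_mem P.d_mem h x.2⟩ : defSpace P.data c d j) -
          (⟨_, brk_mem_defSpace (show 1 + i = j by omega) f.π_mem x.2⟩ : defSpace P.data c d j) :=
      Subtype.ext (f.val_d h x)
    exact Subtype.ext ((congrArg (actionLin P c d j) e).trans
      (f.comm_twDiff_actionDer (by omega) h x).symm)
  map_bracket h x y := Subtype.ext (comm_actionDer h x y).symm

end DGLie

/-! ### Derivations induced on the cohomology properad. -/

section CohomologyAction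

variable {K : Type v} [Field K] {Q : ProperadData.{u} K ℤ} {r : ℤ}

/-- The derivations that commute with `D` in the graded sense. -/
def derCocycles (D : Endo Q 1) (r : ℤ) : Submodule K (Endo Q r) :=
  Der Q r ⊓ LinearMap.ker (Endo.comm (show 1 + r = r + 1 from add_comm 1 r) D)

theorem derCocycles.comm {D : Endo Q 1} (E : derCocycles D r) {A B : Type} [Finite A] [Finite B]
    {i i' j j' : ℤ} (h : i + r = j) (h₁ : i + 1 = i') (h₂ : j + 1 = j') (h₃ : i' + r = j')
    (x : Q.obj A B i) : D.app h₂ (E.1.app h x) = ksign K r • E.1.app h₃ (D.app h₁ x) := by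
  have e := Endo.comm_app (show 1 + r = r + 1 from add_comm 1 r) D E.1 (show i + (r + 1) = j' by omega)
    h h₂ h₁ h₃ x
  rw [LinearMap.mem_ker.1 E.2.2, one_mul] at e
  exact (sub_eq_zero.1 e.symm)

variable (hQ : Q.IsProperad (AddMonoidHom.id ℤ)) {D : Endo Q 1} (hD : D ∈ Der Q 1)

/-- The family of maps on the cohomology that is induced by a derivation commuting with `D`. -/
def cohEndo (E : derCocycles D r) : Endo (cohProperad hQ hD) r := fun S =>
  Coh.map (E.1.app S.add)
    (fun x hx => by rw [derCocycles.comm E S.add rfl rfl (by have := S.add; omega), hx, map_zero, smul_zero])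
    (fun x => by
      have := S.add
      refine ⟨ksign K r • E.1.app (show S.src - 1 + r = S.tgt - 1 by omega) x, ?_⟩
      rw [map_smul, derCocycles.comm E (i' := S.src) _ (by omega) _ S.add, smul_smul, ksign_mul_self, one_smul])

theorem cohEndo_mk (E : derCocycles D r) {A B : Type} [Finite A] [Finite B] {i j : ℤ}
    (h : i + r = j) (x : Q.obj A B i) (hx : D.app rfl x = 0) :
    ∃ hy : D.app rfl (E.1.app h x) = 0, (cohEndo hQ hD E).app h (Coh.mk _ x hx : cohObj D A B i) =
      (Coh.mk _ _ hy : cohObj D A B j) := ⟨_, rfl⟩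

theorem cohEndo_mem (E : derCocycles D r) : cohEndo hQ hD E ∈ Der (cohProperad hQ hD) r := by
  refine ⟨?_, ?_⟩
  · intro A A' B B' _ _ _ _ i j h e f x
    obtain ⟨x, rfl⟩ := Submodule.Quotient.mk_surjective _ x
    exact congrArg Submodule.Quotient.mk (Subtype.ext (E.2.1.1 h e f x.1))
  · intro A B C X E' _ _ _ _ _ _ i j k i' j' k' h hi hj hk x y
    obtain ⟨x, rfl⟩ := Submodule.Quotient.mk_surjective _ x
    obtain ⟨y, rfl⟩ := Submodule.Quotient.mk_surjective _ y
    exact congrArg Submodule.Quotient.mk (Subtype.ext (E.2.1.2 h hi hj hk x.1 y.1))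

/-- The derivation of the cohomology properad that is induced by a derivation commuting with `D`. -/
def cohDer : derCocycles D r →ₗ[K] Der (cohProperad hQ hD) r where
  toFun E := ⟨cohEndo hQ hD E, cohEndo_mem hQ hD E⟩
  map_add' E E' := by
    refine Subtype.ext (funext fun S => LinearMap.ext fun x => ?_)
    obtain ⟨x, rfl⟩ := Submodule.Quotient.mk_surjective _ x
    rfl
  map_smul' a E := by
    refine Subtype.ext (funext fun S => LinearMap.ext fun x => ?_)
    obtain ⟨x, rfl⟩ := Submodule.Quotient.mk_surjective _ x
    rfl

/-- On a cocycle the commutator reduces to `D` applied to the value of `F`, a coboundary. -/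
theorem cohDer_eq_zero {s : ℤ} (h : 1 + s = r) (E : derCocycles D r) (F : Endo Q s)
    (hF : E.1 = Endo.comm h D F) : cohDer hQ hD E = 0 := by
  refine Subtype.ext (funext fun S => LinearMap.ext fun x => ?_)
  obtain ⟨⟨x, hx⟩, rfl⟩ := Submodule.Quotient.mk_surjective _ x
  have := S.add
  refine (Submodule.Quotient.mk_eq_zero _).2 ⟨F.app (show S.src + s = S.tgt - 1 by omega) x, ?_⟩
  change _ = E.1.app S.add x
  rw [hF, Endo.comm_app h D F S.add (show S.src + s = S.tgt - 1 by omega) (by omega) rfl (by omega),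
    show D.app (rfl : S.src + 1 = S.src + 1) x = 0 from hx, map_zero, smul_zero, sub_zero]

theorem cohDer_comm {r s t : ℤ} (h : r + s = t) (E : derCocycles D r) (F : derCocycles D s)
    (G : derCocycles D t) (hG : G.1 = Endo.comm h E.1 F.1) :
    cohDer hQ hD G = Der.comm h (cohDer hQ hD E) (cohDer hQ hD F) := by
  refine Subtype.ext (funext fun S => LinearMap.ext fun x => ?_)
  obtain ⟨x, rfl⟩ := Submodule.Quotient.mk_surjective _ x
  refine congrArg Submodule.Quotient.mk (Subtype.ext ?_)
  change G.1.app S.add x.1 = _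
  rw [hG]
  rfl

end CohomologyAction

/-! ### The action of the cohomology of the deformation complex. -/

section InducedAction

variable {K : Type v} [Field K] [CharZero K] {P : DGProperad.{u} K} {c d : ℤ} (f : UnderHoLB P c d)

/-- The cocycles of the deformation complex act by derivations that commute with the
differential. -/
def UnderHoLB.cocycleAction (k : ℤ) :
    LinearMap.ker (f.defLie.d (show k + 1 = k + 1 from rfl)) →ₗ[K] derCocycles f.twDiff k :=
  LinearMap.codRestrict _ (actionLin P c d k ∘ₗ Submodule.subtype _) fun γ =>
    ⟨(actionDer_mem _).1, by
      -- The action intertwines the differentials, so a cocycle acts by a derivation that commutes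
      -- with the twisted differential.
      have e := congrArg Subtype.val (f.action.map_d (show k + 1 = k + 1 from rfl) γ.1)
      rw [γ.2, map_zero] at e
      exact LinearMap.mem_ker.2 e.symm⟩

/-- The action of the cohomology of the deformation complex on the cohomology of the twisted
properad. -/
def UnderHoLB.cohAction (k : ℤ) : f.defLie.cohomology k →ₗ[K]
    Der (cohProperad (tw_law P c d) f.twDiff_mem.1) k :=
  Submodule.liftQ _ (cohDer (tw_law P c d) f.twDiff_mem.1 ∘ₗ f.cocycleAction k) (by
    -- A coboundary acts as the commutator of the twisted differential with a derivation, hence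
    -- trivially on cohomology.
    rintro ⟨_, hx⟩ ⟨x, rfl⟩
    refine LinearMap.mem_ker.2 (cohDer_eq_zero _ _ (show 1 + (k - 1) = k by omega) _
      (f.action.app x : ContDer (twFree P c d) (k - 1)).1 ?_)
    exact congrArg Subtype.val (f.action.map_d (show k - 1 + 1 = k by omega) x))

theorem UnderHoLB.cohAction_bracket {i j k : ℤ} (h : i + j = k) (x : f.defLie.cohomology i)
    (y : f.defLie.cohomology j) :
    f.cohAction k (f.defLie_isDGLie.bracket h x y) = Der.comm h (f.cohAction i x) (f.cohAction j y) := by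
  obtain ⟨x, rfl⟩ := Submodule.Quotient.mk_surjective _ x
  obtain ⟨y, rfl⟩ := Submodule.Quotient.mk_surjective _ y
  exact cohDer_comm _ _ h (f.cocycleAction i x) (f.cocycleAction j y) (f.cocycleAction k _)
    (congrArg Subtype.val (f.action.map_bracket h x.1 y.1))

end InducedAction

end Twisting

end

theorem mainTheorem3 {K : Type v} [Field K] [CharZero K] (c d : ℤ) (P : DGProperad.{u} K)
    (f : UnderHoLB P c d) :
    -- the deformation complex is a dg Lie algebra
    ∃ hL : f.defLie.IsDGLie,
    -- the twisted differential exists on the completed properad, is unique, and squares to zero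
    ∃ (D : Endo (tw P c d) 1) (hD : D ∈ ContDer (twFree P c d) 1),
      f.IsTwistedDifferential D ∧
      (∀ D' ∈ ContDer (twFree P c d) 1, f.IsTwistedDifferential D' → D' = D) ∧
      (∀ {A B : Type} [Finite A] [Finite B] {i j k : ℤ} (h : i + 1 = j) (h' : j + 1 = k)
        (x : (tw P c d).obj A B i), D.app h' (D.app h x) = 0) ∧
      (derLie (twFree P c d) hD).IsDGLie ∧
      -- the morphism of dg Lie algebras, with its values on the generators
      ∃ Φ : f.defLie.Hom (derLie (twFree P c d) hD),
        (∀ (k : ℤ) (γ : defSpace P.data c d k),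
          IsActionOf (γ : Fam P.data c d k) (Φ.app γ : ContDer (twFree P c d) k).1) ∧
        -- the induced action on cohomology, by derivations
        ∃ Ψ : ∀ k : ℤ, f.defLie.cohomology k →ₗ[K] Der (cohProperad (tw_law P c d) hD.1) k,
          (∀ (k : ℤ) (γ : f.defLie.obj k) (hγ : f.defLie.d rfl γ = 0) {A B : Type} [Finite A]
            [Finite B] {i j : ℤ} (h : i + k = j) (x : (tw P c d).obj A B i)
            (hx : D.app rfl x = 0),
            ∃ hy : D.app rfl ((Φ.app γ : ContDer (twFree P c d) k).1.app h x) = 0,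
              (Ψ k (Coh.mk _ γ hγ)).1.app h (Coh.mk _ x hx : cohObj D A B i) =
                (Coh.mk _ _ hy : cohObj D A B j)) ∧
          ∀ {i j k : ℤ} (h : i + j = k) (x : f.defLie.cohomology i) (y : f.defLie.cohomology j),
            Ψ k (hL.bracket h x y) = Der.comm h (Ψ i x) (Ψ j y) := by
  refine ⟨f.defLie_isDGLie, f.twDiff, f.twDiff_mem, f.twDiff_isTwistedDifferential,
    fun D' hD' h => UnderHoLB.IsTwistedDifferential.unique f hD' f.twDiff_mem h
      f.twDiff_isTwistedDifferential,
    fun h h' x => f.twDiff_twDiff h h' x, derLie_isDGLie _ (f.comm_twDiff_twDiff (by norm_num)),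
    f.action, fun k γ => actionDer_isActionOf γ, f.cohAction, ?_,
    fun h x y => f.cohAction_bracket h x y⟩
  intro k γ hγ A B _ _ i j h x hx
  exact cohEndo_mk (tw_law P c d) f.twDiff_mem.1 (f.cocycleAction k ⟨γ, hγ⟩) h x hx
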